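/- **Conventions.** A *cartesian 2-category* is a (strict) 2-category $\mathcal K$ with finite products in the $\mathsf{Cat}$-enriched sense ($\mathcal K(Z,A\times B)\cong\mathcal K(Z,A)\times\mathcal K(Z,B)$ and $\mathcal K(Z,1)\cong 1$, isomorphisms of categories); a *cartesian 2-functor* preserves these, and a *cartesian pseudofunctor* preserves finite products up to equivalence. $\mathcal{D}\mathsf{bl}$ is the 2-category of small pseudo double categories, pseudo double functors and tight transformations, with terminal object $\bullet$. A *loose bimodule* $M:\mathbb D_0\nrightarrow\mathbb D_1$ is a double functor $\mathbb M\to\mathbb{L}\mathsf{oose}$ to the walking loose arrow, with source $\mathbb D_0$ and target $\mathbb D_1$ the fibres over its two objects; its *heteromorphisms* are the loose arrows from $\mathbb D_0$ to $\mathbb D_1$, and these with the squares between them form its *carrier*. $\ell\mathcal{B}\mathsf{imod}$ is the strict slice 2-category over $\mathbb{L}\mathsf{oose}$, and $\ell\mathcal{M}\mathsf{od}_r$ (loose right modules) its full sub-2-category on those with source $\bullet$. $\mathsf{Hom}^l(\mathbb D)$ is the projection $\mathbb D\times\mathbb{L}\mathsf{oose}\to\mathbb{L}\mathsf{oose}$,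 a loose bimodule $\mathbb D\nrightarrow\mathbb D$ whose heteromorphisms are the loose arrows of $\mathbb D$. A tight transformation is a *conjoint (companion) commuter* if its components have conjoints (companions) and the transposes of its naturality squares are invertible. A *niche* is a loose bimodule $M$ with double functors $F_i:\mathbb E_i\to\mathbb D_i$ into its ends ($i=0,1$). A 1-cell $(M,F_0,F_1)\to(M',F_0',F_1')$ consists of a bimodule map $a:M\to M'$, with action $a_i$ on ends, double functors $f_i:\mathbb E_i\to\mathbb E_i'$, a conjoint commuter $\bar f_0:a_0F_0\Rightarrow F_0'f_0$ and a companion commuter $\bar f_1:a_1F_1\Rightarrow F_1'f_1$; a 2-cell is a 2-cell of bimodules with tight transformations $f_i\Rightarrow g_i$ compatible with these. $\mathcal N\mathsf{iche}_r\subseteq\mathcal N\mathsf{iche}$ is the full sub-2-category of *right niches*, those with $\mathbb E_0=\bullet$. $\mathcal{D}\mathsf{bl}_\bullet$ is the 2-category of *pointed double categories* $d:\bullet\to\mathbb D$; a 1-cell $(\mathbb D,d)\to(\mathbb D',d')$ is a double functor $F:\mathbb D\to\mathbb D'$ with a conjoint commuter $\bar f: F d\Rightarrow d'$, and a 2-cell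 is a tight transformation compatible with the $\bar f$'s. The *restriction* of a niche is the loose bimodule $M(F_0,F_1):\mathbb E_0\nrightarrow\mathbb E_1$ whose heteromorphisms $e_0\nrightarrow e_1$ are the heteromorphisms $F_0e_0\nrightarrow F_1e_1$ of $M$. **Proposition.** 1. The 2-categories $\mathcal{D}\mathsf{bl}$, $\ell\mathcal{B}\mathsf{imod}$, $\ell\mathcal{M}\mathsf{od}_r$, $\mathcal N\mathsf{iche}$, $\mathcal N\mathsf{iche}_r$ and $\mathcal{D}\mathsf{bl}_\bullet$ are cartesian, and the inclusions $\mathcal N\mathsf{iche}_r\to\mathcal N\mathsf{iche}$, $\ell\mathcal{M}\mathsf{od}_r\to\ell\mathcal{B}\mathsf{imod}$ and the target 2-functor $(-)_1:\ell\mathcal{M}\mathsf{od}_r\to\mathcal{D}\mathsf{bl}$ are cartesian 2-functors. 2. There is a cartesian 2-functor $p:\mathcal{D}\mathsf{bl}_\bullet\to\mathcal N\mathsf{iche}_r$ sending $(\mathbb D,d)$ to the right niche $(\mathsf{Hom}^l(\mathbb D);\,d:\bullet\to\mathbb D,\ \mathrm{id}:\mathbb D\to\mathbb D)$, and a 1-cell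 $(F,\bar f)$ to $(\mathsf{Hom}^l(F);\mathrm{id}_\bullet,\bar f;F,\mathrm{id})$. 3. Restriction of niches extends to a cartesian pseudofunctor $\mathsf{Res}:\mathcal N\mathsf{iche}\to\ell\mathcal{B}\mathsf{imod}$. On a 1-cell as above, $\mathsf{Res}$ is $f_i$ on the ends and sends a heteromorphism $m:F_0e_0\nrightarrow F_1e_1$ to the composite $(\bar f_0e_0)^{<}\odot am\odot(\bar f_1e_1)^{>}$ of $am$ with a chosen conjoint of $\bar f_0e_0$ and a chosen companion of $\bar f_1e_1$; on 2-cells it is $f_i\Rightarrow g_i$ on the ends, its constraints are identities on the ends, and all of this structure is compatible with the canonical squares $am\to(\bar f_0e_0)^{<}\odot am\odot(\bar f_1e_1)^{>}$. For every choice of conjoints and companions: the source and target of $\mathsf{Res}$ are, strictly 2-naturally, $\mathbb E_0$ and $\mathbb E_1$; the restriction of a right niche is a loose right module; and $\mathsf{Res}$ restricts to a cartesian pseudofunctor $\mathsf{Res}_r:\mathcal N\mathsf{iche}_r\to\ell\mathcal{M}\mathsf{od}_r$ whose square with $\mathsf{Res}$ and the two inclusions commutes. 4. The forgetful 2-functor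 $\mathcal{D}\mathsf{bl}_\bullet\to\mathcal{D}\mathsf{bl}$ together with $\mathsf{Res}_r\circ p:\mathcal{D}\mathsf{bl}_\bullet\to\ell\mathcal{M}\mathsf{od}_r$ and $\mathrm{id}:\mathcal{D}\mathsf{bl}\to\mathcal{D}\mathsf{bl}$ is a doctrine of systems theories, the *doctrine of initial processes*: the forgetful 2-functor is a cartesian 2-functor, $\mathsf{Res}_r\circ p$ and $\mathrm{id}$ are cartesian pseudofunctors, and the target of $\mathsf{Res}_r(p(\mathbb D,d))$ is $\mathbb D$, strictly 2-naturally in $(\mathbb D,d)$. Its systems are the loose arrows out of the point: the carrier of $\mathsf{Res}_r(p(\mathbb D,d))$ is isomorphic to the category of loose arrows $d\nrightarrow x$ of $\mathbb D$, with the squares whose left side is $\mathrm{id}_d$ as morphisms, and loose arrows and squares of $\mathbb D$ act on it by composition in $\mathbb D$. -/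

import Mathlib

open CategoryTheory Bicategory

universe u
set_option linter.unusedVariables false
set_option linter.unusedSimpArgs false

/-- A loose arrow together with its endpoints. -/
structure LoArr {Obj : Type u} (Lo : Obj → Obj → Type u) : Type u where
  {src : Obj}
  {tgt : Obj}
  arr : Lo src tgt

/-- A (small, pseudo) double category. -/
structure DblCat : Type (u + 1) where
  Obj : Type u
  [tight : Category.{u} Obj]
  Lo : Obj → Obj → Type u
  [loose : Category.{u} (LoArr Lo)]
  dom {m n : LoArr Lo} (α : m ⟶ n) : m.src ⟶ n.src
  cod {m n : LoArr Lo} (α : m ⟶ n) : m.tgt ⟶ n.tgt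
  dom_id (m : LoArr Lo) : dom (𝟙 m) = 𝟙 m.src
  cod_id (m : LoArr Lo) : cod (𝟙 m) = 𝟙 m.tgt
  dom_comp {m n p : LoArr Lo} (α : m ⟶ n) (β : n ⟶ p) : dom (α ≫ β) = dom α ≫ dom β
  cod_comp {m n p : LoArr Lo} (α : m ⟶ n) (β : n ⟶ p) : cod (α ≫ β) = cod α ≫ cod β
  unit (x : Obj) : Lo x x
  unitSq {x y : Obj} (f : x ⟶ y) : LoArr.mk (unit x) ⟶ LoArr.mk (unit y)
  dom_unitSq {x y : Obj} (f : x ⟶ y) : dom (unitSq f) = f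
  cod_unitSq {x y : Obj} (f : x ⟶ y) : cod (unitSq f) = f
  unitSq_id (x : Obj) : unitSq (𝟙 x) = 𝟙 (LoArr.mk (unit x))
  unitSq_comp {x y z : Obj} (f : x ⟶ y) (g : y ⟶ z) : unitSq (f ≫ g) = unitSq f ≫ unitSq g
  comp {x y z : Obj} (m : Lo x y) (n : Lo y z) : Lo x z
  compSq {x y z x' y' z' : Obj} {m : Lo x y} {n : Lo y z} {m' : Lo x' y'} {n' : Lo y' z'}
    (α : LoArr.mk m ⟶ LoArr.mk m') (β : LoArr.mk n ⟶ LoArr.mk n') (h : cod α = dom β) :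
    LoArr.mk (comp m n) ⟶ LoArr.mk (comp m' n')
  dom_compSq {x y z x' y' z' : Obj} {m : Lo x y} {n : Lo y z} {m' : Lo x' y'} {n' : Lo y' z'}
    (α : LoArr.mk m ⟶ LoArr.mk m') (β : LoArr.mk n ⟶ LoArr.mk n') (h : cod α = dom β) :
    dom (compSq α β h) = dom α
  cod_compSq {x y z x' y' z' : Obj} {m : Lo x y} {n : Lo y z} {m' : Lo x' y'} {n' : Lo y' z'}
    (α : LoArr.mk m ⟶ LoArr.mk m') (β : LoArr.mk n ⟶ LoArr.mk n') (h : cod α = dom β) :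
    cod (compSq α β h) = cod β
  compSq_id {x y z : Obj} (m : Lo x y) (n : Lo y z)
    (h : cod (𝟙 (LoArr.mk m)) = dom (𝟙 (LoArr.mk n))) :
    compSq (𝟙 (LoArr.mk m)) (𝟙 (LoArr.mk n)) h = 𝟙 (LoArr.mk (comp m n))
  compSq_comp {x y z x' y' z' x'' y'' z'' : Obj}
    {m : Lo x y} {n : Lo y z} {m' : Lo x' y'} {n' : Lo y' z'} {m'' : Lo x'' y''} {n'' : Lo y'' z''}
    (α : LoArr.mk m ⟶ LoArr.mk m') (β : LoArr.mk n ⟶ LoArr.mk n') (h : cod α = dom β)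
    (α' : LoArr.mk m' ⟶ LoArr.mk m'') (β' : LoArr.mk n' ⟶ LoArr.mk n'') (h' : cod α' = dom β')
    (h'' : cod (α ≫ α') = dom (β ≫ β')) :
    compSq (α ≫ α') (β ≫ β') h'' = compSq α β h ≫ compSq α' β' h'
  assoc {x y z w : Obj} (m : Lo x y) (n : Lo y z) (p : Lo z w) :
    LoArr.mk (comp (comp m n) p) ≅ LoArr.mk (comp m (comp n p))
  dom_assoc {x y z w : Obj} (m : Lo x y) (n : Lo y z) (p : Lo z w) :
    dom (assoc m n p).hom = 𝟙 x
  cod_assoc {x y z w : Obj} (m : Lo x y) (n : Lo y z) (p : Lo z w) :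
    cod (assoc m n p).hom = 𝟙 w
  assoc_naturality {x y z w x' y' z' w' : Obj} {m : Lo x y} {n : Lo y z} {p : Lo z w}
    {m' : Lo x' y'} {n' : Lo y' z'} {p' : Lo z' w'}
    (α : LoArr.mk m ⟶ LoArr.mk m') (β : LoArr.mk n ⟶ LoArr.mk n') (γ : LoArr.mk p ⟶ LoArr.mk p')
    (h : cod α = dom β) (k : cod β = dom γ) :
    compSq (compSq α β h) γ ((cod_compSq α β h).trans k) ≫ (assoc m' n' p').hom =
      (assoc m n p).hom ≫ compSq α (compSq β γ k) (h.trans (dom_compSq β γ k).symm)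
  leftUnitor {x y : Obj} (m : Lo x y) : LoArr.mk (comp (unit x) m) ≅ LoArr.mk m
  dom_leftUnitor {x y : Obj} (m : Lo x y) : dom (leftUnitor m).hom = 𝟙 x
  cod_leftUnitor {x y : Obj} (m : Lo x y) : cod (leftUnitor m).hom = 𝟙 y
  leftUnitor_naturality {x y x' y' : Obj} {m : Lo x y} {m' : Lo x' y'}
    (α : LoArr.mk m ⟶ LoArr.mk m') :
    compSq (unitSq (dom α)) α (cod_unitSq (dom α)) ≫ (leftUnitor m').hom = (leftUnitor m).hom ≫ α
  rightUnitor {x y : Obj} (m : Lo x y) : LoArr.mk (comp m (unit y)) ≅ LoArr.mk m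
  dom_rightUnitor {x y : Obj} (m : Lo x y) : dom (rightUnitor m).hom = 𝟙 x
  cod_rightUnitor {x y : Obj} (m : Lo x y) : cod (rightUnitor m).hom = 𝟙 y
  rightUnitor_naturality {x y x' y' : Obj} {m : Lo x y} {m' : Lo x' y'}
    (α : LoArr.mk m ⟶ LoArr.mk m') :
    compSq α (unitSq (cod α)) (dom_unitSq (cod α)).symm ≫ (rightUnitor m').hom =
      (rightUnitor m).hom ≫ α
  pentagon {x y z w v : Obj} (m : Lo x y) (n : Lo y z) (p : Lo z w) (q : Lo w v) :
    compSq (assoc m n p).hom (𝟙 (LoArr.mk q)) ((cod_assoc m n p).trans (dom_id (LoArr.mk q)).symm) ≫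
        (assoc m (comp n p) q).hom ≫
        compSq (𝟙 (LoArr.mk m)) (assoc n p q).hom ((cod_id (LoArr.mk m)).trans (dom_assoc n p q).symm) =
      (assoc (comp m n) p q).hom ≫ (assoc m n (comp p q)).hom
  triangle {x y z : Obj} (m : Lo x y) (n : Lo y z) :
    (assoc m (unit y) n).hom ≫
        compSq (𝟙 (LoArr.mk m)) (leftUnitor n).hom ((cod_id (LoArr.mk m)).trans (dom_leftUnitor n).symm) =
      compSq (rightUnitor m).hom (𝟙 (LoArr.mk n)) ((cod_rightUnitor m).trans (dom_id (LoArr.mk n)).symm)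

namespace DblCat

attribute [instance] tight loose
attribute [simp] dom_id cod_id dom_comp cod_comp dom_unitSq cod_unitSq unitSq_id dom_compSq
  cod_compSq compSq_id dom_assoc cod_assoc dom_leftUnitor cod_leftUnitor dom_rightUnitor
  cod_rightUnitor

variable (D : DblCat.{u})

variable {D}

theorem dom_inv {m n : LoArr D.Lo} (e : m ≅ n) (f : n.src ⟶ m.src)
    (h : f ≫ D.dom e.hom = 𝟙 _) : D.dom e.inv = f := by
  have h1 : D.dom e.hom ≫ D.dom e.inv = 𝟙 _ := by rw [← D.dom_comp]; simp
  calc D.dom e.inv = (f ≫ D.dom e.hom) ≫ D.dom e.inv := by rw [h, Category.id_comp]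
    _ = f := by rw [Category.assoc, h1, Category.comp_id]

theorem cod_inv {m n : LoArr D.Lo} (e : m ≅ n) (f : n.tgt ⟶ m.tgt)
    (h : f ≫ D.cod e.hom = 𝟙 _) : D.cod e.inv = f := by
  have h1 : D.cod e.hom ≫ D.cod e.inv = 𝟙 _ := by rw [← D.cod_comp]; simp
  calc D.cod e.inv = (f ≫ D.cod e.hom) ≫ D.cod e.inv := by rw [h, Category.id_comp]
    _ = f := by rw [Category.assoc, h1, Category.comp_id]

@[simp] theorem dom_assoc_inv {x y z w : D.Obj} (m : D.Lo x y) (n : D.Lo y z) (p : D.Lo z w) :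
    D.dom (D.assoc m n p).inv = 𝟙 x := dom_inv _ _ (by simp)

@[simp] theorem cod_assoc_inv {x y z w : D.Obj} (m : D.Lo x y) (n : D.Lo y z) (p : D.Lo z w) :
    D.cod (D.assoc m n p).inv = 𝟙 w := cod_inv _ _ (by simp)

@[simp] theorem dom_leftUnitor_inv {x y : D.Obj} (m : D.Lo x y) :
    D.dom (D.leftUnitor m).inv = 𝟙 x := dom_inv _ _ (by simp)

@[simp] theorem cod_leftUnitor_inv {x y : D.Obj} (m : D.Lo x y) :
    D.cod (D.leftUnitor m).inv = 𝟙 y := cod_inv _ _ (by simp)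

@[simp] theorem dom_rightUnitor_inv {x y : D.Obj} (m : D.Lo x y) :
    D.dom (D.rightUnitor m).inv = 𝟙 x := dom_inv _ _ (by simp)

@[simp] theorem cod_rightUnitor_inv {x y : D.Obj} (m : D.Lo x y) :
    D.cod (D.rightUnitor m).inv = 𝟙 y := cod_inv _ _ (by simp)

theorem compSq_compSq {x y z x' y' x'' y'' : D.Obj} {m : D.Lo x y} {n : D.Lo y z}
    {m' : D.Lo x' y'} {m'' : D.Lo x'' y''} {z' z'' : D.Obj} {n' : D.Lo y' z'} {n'' : D.Lo y'' z''}
    (α : LoArr.mk m ⟶ LoArr.mk m') (α' : LoArr.mk m' ⟶ LoArr.mk m'')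
    (β : LoArr.mk n ⟶ LoArr.mk n') (β' : LoArr.mk n' ⟶ LoArr.mk n'')
    (h : D.cod α = D.dom β) (h' : D.cod α' = D.dom β') :
    D.compSq α β h ≫ D.compSq α' β' h' =
      D.compSq (α ≫ α') (β ≫ β') (by rw [D.cod_comp, D.dom_comp, h, h']) :=
  (D.compSq_comp α β h α' β' h' _).symm

end DblCat

/-- A pseudo double functor. -/
structure DblFunctor (D E : DblCat.{u}) : Type u where
  tight : D.Obj ⥤ E.Obj
  lo {x y : D.Obj} (m : D.Lo x y) : E.Lo (tight.obj x) (tight.obj y)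
  sq {x y x' y' : D.Obj} {m : D.Lo x y} {n : D.Lo x' y'} (α : LoArr.mk m ⟶ LoArr.mk n) :
    LoArr.mk (lo m) ⟶ LoArr.mk (lo n)
  sq_id {x y : D.Obj} (m : D.Lo x y) : sq (𝟙 (LoArr.mk m)) = 𝟙 (LoArr.mk (lo m))
  sq_comp {x y x' y' x'' y'' : D.Obj} {m : D.Lo x y} {n : D.Lo x' y'} {p : D.Lo x'' y''}
    (α : LoArr.mk m ⟶ LoArr.mk n) (β : LoArr.mk n ⟶ LoArr.mk p) : sq (α ≫ β) = sq α ≫ sq β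
  dom_sq {x y x' y' : D.Obj} {m : D.Lo x y} {n : D.Lo x' y'} (α : LoArr.mk m ⟶ LoArr.mk n) :
    E.dom (sq α) = tight.map (D.dom α)
  cod_sq {x y x' y' : D.Obj} {m : D.Lo x y} {n : D.Lo x' y'} (α : LoArr.mk m ⟶ LoArr.mk n) :
    E.cod (sq α) = tight.map (D.cod α)
  unitIso (x : D.Obj) : LoArr.mk (E.unit (tight.obj x)) ≅ LoArr.mk (lo (D.unit x))
  dom_unitIso (x : D.Obj) : E.dom (unitIso x).hom = 𝟙 (tight.obj x)
  cod_unitIso (x : D.Obj) : E.cod (unitIso x).hom = 𝟙 (tight.obj x)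
  unitIso_naturality {x y : D.Obj} (f : x ⟶ y) :
    E.unitSq (tight.map f) ≫ (unitIso y).hom = (unitIso x).hom ≫ sq (D.unitSq f)
  compIso {x y z : D.Obj} (m : D.Lo x y) (n : D.Lo y z) :
    LoArr.mk (E.comp (lo m) (lo n)) ≅ LoArr.mk (lo (D.comp m n))
  dom_compIso {x y z : D.Obj} (m : D.Lo x y) (n : D.Lo y z) :
    E.dom (compIso m n).hom = 𝟙 (tight.obj x)
  cod_compIso {x y z : D.Obj} (m : D.Lo x y) (n : D.Lo y z) :
    E.cod (compIso m n).hom = 𝟙 (tight.obj z)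
  compIso_naturality {x y z x' y' z' : D.Obj} {m : D.Lo x y} {n : D.Lo y z}
    {m' : D.Lo x' y'} {n' : D.Lo y' z'}
    (α : LoArr.mk m ⟶ LoArr.mk m') (β : LoArr.mk n ⟶ LoArr.mk n') (h : D.cod α = D.dom β) :
    E.compSq (sq α) (sq β) (by rw [cod_sq, dom_sq, h]) ≫ (compIso m' n').hom =
      (compIso m n).hom ≫ sq (D.compSq α β h)
  map_assoc {x y z w : D.Obj} (m : D.Lo x y) (n : D.Lo y z) (p : D.Lo z w) :
    E.compSq (compIso m n).hom (𝟙 (LoArr.mk (lo p))) (by rw [cod_compIso, E.dom_id]) ≫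
        (compIso (D.comp m n) p).hom ≫ sq (D.assoc m n p).hom =
      (E.assoc (lo m) (lo n) (lo p)).hom ≫
        E.compSq (𝟙 (LoArr.mk (lo m))) (compIso n p).hom (by rw [dom_compIso, E.cod_id]) ≫
        (compIso m (D.comp n p)).hom
  map_leftUnitor {x y : D.Obj} (m : D.Lo x y) :
    E.compSq (unitIso x).hom (𝟙 (LoArr.mk (lo m))) (by rw [cod_unitIso, E.dom_id]) ≫
        (compIso (D.unit x) m).hom ≫ sq (D.leftUnitor m).hom = (E.leftUnitor (lo m)).hom
  map_rightUnitor {x y : D.Obj} (m : D.Lo x y) :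
    E.compSq (𝟙 (LoArr.mk (lo m))) (unitIso y).hom (by rw [dom_unitIso, E.cod_id]) ≫
        (compIso m (D.unit y)).hom ≫ sq (D.rightUnitor m).hom = (E.rightUnitor (lo m)).hom

namespace DblFunctor

attribute [simp] sq_id sq_comp dom_sq cod_sq dom_unitIso cod_unitIso dom_compIso cod_compIso

variable {A B C D E : DblCat.{u}}

/-- The image of an isomorphism of loose arrows. -/
def sqIso (F : DblFunctor D E) {x y x' y' : D.Obj} {m : D.Lo x y} {n : D.Lo x' y'}
    (e : LoArr.mk m ≅ LoArr.mk n) : LoArr.mk (F.lo m) ≅ LoArr.mk (F.lo n) where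
  hom := F.sq e.hom
  inv := F.sq e.inv
  hom_inv_id := by rw [← F.sq_comp, e.hom_inv_id, F.sq_id]
  inv_hom_id := by rw [← F.sq_comp, e.inv_hom_id, F.sq_id]

/-- The identity double functor. -/
def id (D : DblCat.{u}) : DblFunctor D D where
  tight := 𝟭 D.Obj
  lo m := m
  sq α := α
  sq_id _ := rfl
  sq_comp _ _ := rfl
  dom_sq _ := rfl
  cod_sq _ := rfl
  unitIso _ := Iso.refl _
  dom_unitIso _ := D.dom_id _
  cod_unitIso _ := D.cod_id _
  unitIso_naturality f := by simp
  compIso _ _ := Iso.refl _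
  dom_compIso _ _ := D.dom_id _
  cod_compIso _ _ := D.cod_id _
  compIso_naturality α β h := by simp
  map_assoc m n p := by simp
  map_leftUnitor m := by simp
  map_rightUnitor m := by simp

/-- Composition of double functors. -/
def comp (F : DblFunctor C D) (G : DblFunctor D E) : DblFunctor C E where
  tight := F.tight ⋙ G.tight
  lo m := G.lo (F.lo m)
  sq α := G.sq (F.sq α)
  sq_id _ := by simp
  sq_comp _ _ := by simp
  dom_sq _ := by simp
  cod_sq _ := by simp
  unitIso x := G.unitIso (F.tight.obj x) ≪≫ G.sqIso (F.unitIso x)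
  dom_unitIso _ := by simp [sqIso]
  cod_unitIso _ := by simp [sqIso]
  unitIso_naturality f := by
    simp only [sqIso, Functor.comp_map, Iso.trans_hom, Category.assoc]
    rw [← Category.assoc, G.unitIso_naturality, Category.assoc, ← G.sq_comp,
      F.unitIso_naturality, G.sq_comp]
  compIso m n := G.compIso (F.lo m) (F.lo n) ≪≫ G.sqIso (F.compIso m n)
  dom_compIso _ _ := by simp [sqIso]
  cod_compIso _ _ := by simp [sqIso]
  compIso_naturality α β h := by
    simp only [sqIso, Iso.trans_hom, Category.assoc]
    rw [← Category.assoc, G.compIso_naturality (F.sq α) (F.sq β) (by rw [F.cod_sq, F.dom_sq, h]),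
      Category.assoc, ← G.sq_comp, F.compIso_naturality α β h, G.sq_comp]
  map_assoc m n p := by
    have h1 := G.compIso_naturality (F.compIso m n).hom (𝟙 (LoArr.mk (F.lo p)))
      (by rw [F.cod_compIso, D.dom_id])
    have h2 := G.compIso_naturality (𝟙 (LoArr.mk (F.lo m))) (F.compIso n p).hom
      (by rw [F.dom_compIso, D.cod_id])
    have h3 := congrArg G.sq (F.map_assoc m n p)
    have h4 := G.map_assoc (F.lo m) (F.lo n) (F.lo p)
    simp only [G.sq_comp, G.sq_id] at h1 h2 h3
    have e1 : E.compSq ((G.compIso (F.lo m) (F.lo n)).hom ≫ G.sq (F.compIso m n).hom)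
        (𝟙 (LoArr.mk (G.lo (F.lo p)))) (by simp) =
        E.compSq (G.compIso (F.lo m) (F.lo n)).hom (𝟙 _) (by simp) ≫
          E.compSq (G.sq (F.compIso m n).hom) (𝟙 (LoArr.mk (G.lo (F.lo p)))) (by simp) := by
      rw [DblCat.compSq_compSq]; simp
    have e2 : E.compSq (𝟙 (LoArr.mk (G.lo (F.lo m))))
        ((G.compIso (F.lo n) (F.lo p)).hom ≫ G.sq (F.compIso n p).hom) (by simp) =
        E.compSq (𝟙 (LoArr.mk (G.lo (F.lo m)))) (G.compIso (F.lo n) (F.lo p)).hom (by simp) ≫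
          E.compSq (𝟙 (LoArr.mk (G.lo (F.lo m)))) (G.sq (F.compIso n p).hom) (by simp) := by
      rw [DblCat.compSq_compSq]; simp
    simp only [sqIso, Iso.trans_hom, e1, e2, Category.assoc]
    rw [reassoc_of% h1, h3, reassoc_of% h4, reassoc_of% h2]
  map_leftUnitor {x _} m := by
    have h1 := G.compIso_naturality (F.unitIso x).hom (𝟙 (LoArr.mk (F.lo m)))
      (by rw [F.cod_unitIso, D.dom_id])
    have h3 := congrArg G.sq (F.map_leftUnitor m)
    have h4 := G.map_leftUnitor (F.lo m)
    simp only [G.sq_comp, G.sq_id] at h1 h3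
    have e1 : E.compSq ((G.unitIso (F.tight.obj x)).hom ≫ G.sq (F.unitIso x).hom)
        (𝟙 (LoArr.mk (G.lo (F.lo m)))) (by simp) =
        E.compSq (G.unitIso (F.tight.obj x)).hom (𝟙 _) (by simp) ≫
          E.compSq (G.sq (F.unitIso x).hom) (𝟙 (LoArr.mk (G.lo (F.lo m)))) (by simp) := by
      rw [DblCat.compSq_compSq]; simp
    simp only [sqIso, Iso.trans_hom, e1, Category.assoc]
    rw [reassoc_of% h1, h3, h4]
  map_rightUnitor {_ y} m := by
    have h1 := G.compIso_naturality (𝟙 (LoArr.mk (F.lo m))) (F.unitIso y).hom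
      (by rw [F.dom_unitIso, D.cod_id])
    have h3 := congrArg G.sq (F.map_rightUnitor m)
    have h4 := G.map_rightUnitor (F.lo m)
    simp only [G.sq_comp, G.sq_id] at h1 h3
    have e1 : E.compSq (𝟙 (LoArr.mk (G.lo (F.lo m))))
        ((G.unitIso (F.tight.obj y)).hom ≫ G.sq (F.unitIso y).hom) (by simp) =
        E.compSq (𝟙 _) (G.unitIso (F.tight.obj y)).hom (by simp) ≫
          E.compSq (𝟙 (LoArr.mk (G.lo (F.lo m)))) (G.sq (F.unitIso y).hom) (by simp) := by
      rw [DblCat.compSq_compSq]; simp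
    simp only [sqIso, Iso.trans_hom, e1, Category.assoc]
    rw [reassoc_of% h1, h3, h4]

end DblFunctor

/-- A tight transformation between double functors. -/
@[ext]
structure DblTrans {D E : DblCat.{u}} (F G : DblFunctor D E) : Type u where
  app (x : D.Obj) : F.tight.obj x ⟶ G.tight.obj x
  sq {x y : D.Obj} (m : D.Lo x y) : LoArr.mk (F.lo m) ⟶ LoArr.mk (G.lo m)
  naturality {x y : D.Obj} (f : x ⟶ y) : F.tight.map f ≫ app y = app x ≫ G.tight.map f
  dom_sq {x y : D.Obj} (m : D.Lo x y) : E.dom (sq m) = app x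
  cod_sq {x y : D.Obj} (m : D.Lo x y) : E.cod (sq m) = app y
  sq_naturality {x y x' y' : D.Obj} {m : D.Lo x y} {n : D.Lo x' y'}
    (α : LoArr.mk m ⟶ LoArr.mk n) : F.sq α ≫ sq n = sq m ≫ G.sq α
  unit (x : D.Obj) : (F.unitIso x).hom ≫ sq (D.unit x) = E.unitSq (app x) ≫ (G.unitIso x).hom
  comp {x y z : D.Obj} (m : D.Lo x y) (n : D.Lo y z) :
    (F.compIso m n).hom ≫ sq (D.comp m n) =
      E.compSq (sq m) (sq n) ((cod_sq m).trans (dom_sq n).symm) ≫ (G.compIso m n).hom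

namespace DblTrans
attribute [simp] dom_sq cod_sq

variable {A B C D E : DblCat.{u}}

/-- The identity tight transformation. -/
def id (F : DblFunctor D E) : DblTrans F F where
  app _ := 𝟙 _
  sq _ := 𝟙 _
  naturality _ := by simp
  dom_sq _ := by simp
  cod_sq _ := by simp
  sq_naturality _ := by simp
  unit _ := by simp
  comp _ _ := by simp

/-- Vertical composition. -/
def vcomp {F G H : DblFunctor D E} (α : DblTrans F G) (β : DblTrans G H) : DblTrans F H where
  app x := α.app x ≫ β.app x
  sq m := α.sq m ≫ β.sq m
  naturality f := by
    rw [← Category.assoc, α.naturality, Category.assoc, β.naturality, Category.assoc]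
  dom_sq _ := by simp
  cod_sq _ := by simp
  sq_naturality f := by
    rw [← Category.assoc, α.sq_naturality, Category.assoc, β.sq_naturality, Category.assoc]
  unit x := by
    rw [← Category.assoc, α.unit, Category.assoc, β.unit, E.unitSq_comp, Category.assoc]
  comp m n := by
    rw [← Category.assoc, α.comp, Category.assoc, β.comp, ← Category.assoc, ← E.compSq_comp]

/-- Whiskering `F ≫ α`. -/
def whiskerLeft (F : DblFunctor C D) {G H : DblFunctor D E} (α : DblTrans G H) :
    DblTrans (F.comp G) (F.comp H) where
  app x := α.app (F.tight.obj x)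
  sq m := α.sq (F.lo m)
  naturality _ := α.naturality _
  dom_sq _ := α.dom_sq _
  cod_sq _ := α.cod_sq _
  sq_naturality _ := α.sq_naturality _
  unit x := by
    simp only [DblFunctor.comp, DblFunctor.sqIso, Iso.trans_hom, Category.assoc]
    rw [α.sq_naturality, reassoc_of% (α.unit (F.tight.obj x))]
  comp m n := by
    simp only [DblFunctor.comp, DblFunctor.sqIso, Iso.trans_hom, Category.assoc]
    rw [α.sq_naturality, reassoc_of% (α.comp (F.lo m) (F.lo n))]

/-- Whiskering `α ≫ G`. -/
def whiskerRight {F H : DblFunctor C D} (α : DblTrans F H) (G : DblFunctor D E) :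
    DblTrans (F.comp G) (H.comp G) where
  app x := G.tight.map (α.app x)
  sq m := G.sq (α.sq m)
  naturality f := by
    simp only [DblFunctor.comp, Functor.comp_map, ← Functor.map_comp, α.naturality]
  dom_sq _ := (G.dom_sq _).trans (congrArg G.tight.map (α.dom_sq _))
  cod_sq _ := (G.cod_sq _).trans (congrArg G.tight.map (α.cod_sq _))
  sq_naturality f := by
    simp only [DblFunctor.comp, ← G.sq_comp, α.sq_naturality]
  unit x := by
    simp only [DblFunctor.comp, DblFunctor.sqIso, Iso.trans_hom, Category.assoc]
    rw [← G.sq_comp, α.unit, G.sq_comp, reassoc_of% (G.unitIso_naturality (α.app x))]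
  comp m n := by
    simp only [DblFunctor.comp, DblFunctor.sqIso, Iso.trans_hom, Category.assoc]
    rw [← G.sq_comp, α.comp, G.sq_comp,
      reassoc_of% (G.compIso_naturality (α.sq m) (α.sq n) (by simp))]

end DblTrans

instance (D E : DblCat.{u}) : Category.{u} (DblFunctor D E) where
  Hom F G := DblTrans F G
  id F := DblTrans.id F
  comp α β := DblTrans.vcomp α β
  id_comp α := by apply DblTrans.ext <;> simp [DblTrans.vcomp, DblTrans.id]
  comp_id α := by apply DblTrans.ext <;> simp [DblTrans.vcomp, DblTrans.id]
  assoc α β γ := by apply DblTrans.ext <;> simp [DblTrans.vcomp]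

namespace DblFunctor
variable {A B C D E : DblCat.{u}}

theorem comp_assoc (F : DblFunctor A B) (G : DblFunctor B C) (H : DblFunctor C D) :
    (F.comp G).comp H = F.comp (G.comp H) := by
  simp only [comp, sqIso, mk.injEq]
  refine ⟨rfl, HEq.rfl, HEq.rfl, ?_, ?_⟩ <;> apply heq_of_eq <;> ext <;> simp

theorem comp_id (F : DblFunctor A B)  :
    F.comp (DblFunctor.id B) = F := by
  cases F
  simp only [comp, sqIso, mk.injEq]
  refine ⟨rfl, HEq.rfl, HEq.rfl, ?_, ?_⟩ <;> apply heq_of_eq <;> ext <;> simp [DblFunctor.id]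

theorem id_comp (F : DblFunctor A B)  :
    (DblFunctor.id A).comp F = F := by
  cases F
  simp only [comp, sqIso, mk.injEq]
  refine ⟨rfl, HEq.rfl, HEq.rfl, ?_, ?_⟩ <;> apply heq_of_eq <;> ext <;> simp [DblFunctor.id, *]

end DblFunctor

namespace DblTrans
variable {A B C D E : DblCat.{u}}

@[ext]
theorem hom_ext {F G : DblFunctor D E} {α β : F ⟶ G} (h : ∀ x, DblTrans.app α x = DblTrans.app β x)
    (h' : ∀ {x y : D.Obj} (m : D.Lo x y), DblTrans.sq α m = DblTrans.sq β m) : α = β := by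
  apply DblTrans.ext
  · funext x; exact h x
  · funext x y m; exact h' m

@[simp] theorem id_app (F : DblFunctor D E) (x : D.Obj) : DblTrans.app (𝟙 F) x = 𝟙 _ := rfl
@[simp] theorem id_sq (F : DblFunctor D E) {x y : D.Obj} (m : D.Lo x y) :
    DblTrans.sq (𝟙 F) m = 𝟙 _ := rfl
@[simp] theorem comp_app {F G H : DblFunctor D E} (α : F ⟶ G) (β : G ⟶ H) (x : D.Obj) :
    DblTrans.app (α ≫ β) x = DblTrans.app α x ≫ DblTrans.app β x := rfl
@[simp] theorem comp_sq {F G H : DblFunctor D E} (α : F ⟶ G) (β : G ⟶ H) {x y : D.Obj}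
    (m : D.Lo x y) : DblTrans.sq (α ≫ β) m = DblTrans.sq α m ≫ DblTrans.sq β m := rfl

theorem eqToHom_app {F G : DblFunctor D E} (h : F = G) (x : D.Obj) :
    DblTrans.app (eqToHom h) x = eqToHom (congrArg (fun K => K.tight.obj x) h) := by
  subst h; rfl

theorem eqToHom_sq {F G : DblFunctor D E} (h : F = G) {x y : D.Obj} (m : D.Lo x y) :
    DblTrans.sq (eqToHom h) m = eqToHom (congrArg (fun K => LoArr.mk (K.lo m)) h) := by
  subst h; rfl

theorem whiskerLeft_eqToHom (F : DblFunctor C D) {G H : DblFunctor D E} (h : G = H) :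
    DblTrans.whiskerLeft F (eqToHom h : G ⟶ H) =
      (eqToHom (congrArg F.comp h) : F.comp G ⟶ F.comp H) := by
  subst h; rfl

theorem whiskerRight_eqToHom {F H : DblFunctor C D} (h : F = H) (G : DblFunctor D E) :
    DblTrans.whiskerRight (eqToHom h : F ⟶ H) G =
      (eqToHom (congrArg (fun K => K.comp G) h) : F.comp G ⟶ H.comp G) := by
  subst h
  apply DblTrans.hom_ext
  · intro x
    exact G.tight.map_id _
  · intro x y m
    exact G.sq_id _

end DblTrans

instance : CategoryStruct.{u} DblCat.{u} where
  Hom D E := DblFunctor D E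
  id D := DblFunctor.id D
  comp F G := DblFunctor.comp F G

instance (D E : DblCat.{u}) : Category.{u} (D ⟶ E) := inferInstanceAs (Category.{u} (DblFunctor D E))

namespace DblCat
variable {A B C D : DblCat.{u}}

/-- The associativity constraint of double functors; all its components are identities. -/
def assocIso (F : A ⟶ B) (G : B ⟶ C) (H : C ⟶ D) : (F ≫ G) ≫ H ≅ F ≫ (G ≫ H) :=
  eqToIso (DblFunctor.comp_assoc F G H)

/-- The left unit constraint of double functors; all its components are identities. -/
def leftUnitIso (F : A ⟶ B) : 𝟙 A ≫ F ≅ F := eqToIso (DblFunctor.id_comp F)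

/-- The right unit constraint of double functors; all its components are identities. -/
def rightUnitIso (F : A ⟶ B) : F ≫ 𝟙 B ≅ F := eqToIso (DblFunctor.comp_id F)

theorem assocIso_hom_app (F : A ⟶ B) (G : B ⟶ C) (H : C ⟶ D) (x : A.Obj) :
    DblTrans.app (assocIso F G H).hom x =
      𝟙 (H.tight.obj (G.tight.obj (F.tight.obj x))) :=
  DblTrans.eqToHom_app (DblFunctor.comp_assoc F G H) x
theorem assocIso_hom_sq (F : A ⟶ B) (G : B ⟶ C) (H : C ⟶ D) {x y : A.Obj} (m : A.Lo x y) :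
    DblTrans.sq (assocIso F G H).hom m = 𝟙 (LoArr.mk (H.lo (G.lo (F.lo m)))) :=
  DblTrans.eqToHom_sq (DblFunctor.comp_assoc F G H) m
theorem assocIso_inv_app (F : A ⟶ B) (G : B ⟶ C) (H : C ⟶ D) (x : A.Obj) :
    DblTrans.app (assocIso F G H).inv x =
      𝟙 (H.tight.obj (G.tight.obj (F.tight.obj x))) :=
  DblTrans.eqToHom_app (DblFunctor.comp_assoc F G H).symm x
theorem assocIso_inv_sq (F : A ⟶ B) (G : B ⟶ C) (H : C ⟶ D) {x y : A.Obj} (m : A.Lo x y) :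
    DblTrans.sq (assocIso F G H).inv m = 𝟙 (LoArr.mk (H.lo (G.lo (F.lo m)))) :=
  DblTrans.eqToHom_sq (DblFunctor.comp_assoc F G H).symm m
theorem leftUnitIso_hom_app (F : A ⟶ B) (x : A.Obj) :
    DblTrans.app (leftUnitIso F).hom x = 𝟙 (F.tight.obj x) :=
  DblTrans.eqToHom_app (DblFunctor.id_comp F) x
theorem leftUnitIso_hom_sq (F : A ⟶ B) {x y : A.Obj} (m : A.Lo x y) :
    DblTrans.sq (leftUnitIso F).hom m = 𝟙 (LoArr.mk (F.lo m)) :=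
  DblTrans.eqToHom_sq (DblFunctor.id_comp F) m
theorem leftUnitIso_inv_app (F : A ⟶ B) (x : A.Obj) :
    DblTrans.app (leftUnitIso F).inv x = 𝟙 (F.tight.obj x) :=
  DblTrans.eqToHom_app (DblFunctor.id_comp F).symm x
theorem leftUnitIso_inv_sq (F : A ⟶ B) {x y : A.Obj} (m : A.Lo x y) :
    DblTrans.sq (leftUnitIso F).inv m = 𝟙 (LoArr.mk (F.lo m)) :=
  DblTrans.eqToHom_sq (DblFunctor.id_comp F).symm m
theorem rightUnitIso_hom_app (F : A ⟶ B) (x : A.Obj) :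
    DblTrans.app (rightUnitIso F).hom x = 𝟙 (F.tight.obj x) :=
  DblTrans.eqToHom_app (DblFunctor.comp_id F) x
theorem rightUnitIso_hom_sq (F : A ⟶ B) {x y : A.Obj} (m : A.Lo x y) :
    DblTrans.sq (rightUnitIso F).hom m = 𝟙 (LoArr.mk (F.lo m)) :=
  DblTrans.eqToHom_sq (DblFunctor.comp_id F) m
theorem rightUnitIso_inv_app (F : A ⟶ B) (x : A.Obj) :
    DblTrans.app (rightUnitIso F).inv x = 𝟙 (F.tight.obj x) :=
  DblTrans.eqToHom_app (DblFunctor.comp_id F).symm x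
theorem rightUnitIso_inv_sq (F : A ⟶ B) {x y : A.Obj} (m : A.Lo x y) :
    DblTrans.sq (rightUnitIso F).inv m = 𝟙 (LoArr.mk (F.lo m)) :=
  DblTrans.eqToHom_sq (DblFunctor.comp_id F).symm m

end DblCat

instance : Bicategory.{u, u} DblCat.{u} where
  homCategory D E := inferInstance
  whiskerLeft F _ _ α := DblTrans.whiskerLeft F α
  whiskerRight α G := DblTrans.whiskerRight α G
  associator F G H := DblCat.assocIso F G H
  leftUnitor F := DblCat.leftUnitIso F
  rightUnitor F := DblCat.rightUnitIso F
  whiskerLeft_id _ _ := rfl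
  whiskerLeft_comp _ _ _ _ _ _ := rfl
  id_whiskerLeft α := by
    apply DblTrans.hom_ext
    · intro x
      erw [DblTrans.comp_app, DblTrans.comp_app, DblCat.leftUnitIso_hom_app,
        DblCat.leftUnitIso_inv_app, Category.comp_id, Category.id_comp]
      rfl
    · intro x y m
      erw [DblTrans.comp_sq, DblTrans.comp_sq, DblCat.leftUnitIso_hom_sq,
        DblCat.leftUnitIso_inv_sq, Category.comp_id, Category.id_comp]
      rfl
  comp_whiskerLeft F G _ _ α := by
    apply DblTrans.hom_ext
    · intro x
      erw [DblTrans.comp_app, DblTrans.comp_app, DblCat.assocIso_hom_app,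
        DblCat.assocIso_inv_app, Category.comp_id, Category.id_comp]
      rfl
    · intro x y m
      erw [DblTrans.comp_sq, DblTrans.comp_sq, DblCat.assocIso_hom_sq,
        DblCat.assocIso_inv_sq, Category.comp_id, Category.id_comp]
      rfl
  id_whiskerRight F G := by
    apply DblTrans.hom_ext
    · intro x
      exact G.tight.map_id _
    · intro x y m
      exact G.sq_id _
  comp_whiskerRight α β G := by
    apply DblTrans.hom_ext
    · intro x
      exact G.tight.map_comp _ _
    · intro x y m
      exact G.sq_comp _ _
  whiskerRight_id α := by
    apply DblTrans.hom_ext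
    · intro x
      erw [DblTrans.comp_app, DblTrans.comp_app, DblCat.rightUnitIso_hom_app,
        DblCat.rightUnitIso_inv_app, Category.comp_id, Category.id_comp]
      rfl
    · intro x y m
      erw [DblTrans.comp_sq, DblTrans.comp_sq, DblCat.rightUnitIso_hom_sq,
        DblCat.rightUnitIso_inv_sq, Category.comp_id, Category.id_comp]
      rfl
  whiskerRight_comp α G H := by
    apply DblTrans.hom_ext
    · intro x
      erw [DblTrans.comp_app, DblTrans.comp_app, DblCat.assocIso_hom_app,
        DblCat.assocIso_inv_app, Category.comp_id, Category.id_comp]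
      rfl
    · intro x y m
      erw [DblTrans.comp_sq, DblTrans.comp_sq, DblCat.assocIso_hom_sq,
        DblCat.assocIso_inv_sq, Category.comp_id, Category.id_comp]
      rfl
  whisker_assoc F _ _ α H := by
    apply DblTrans.hom_ext
    · intro x
      erw [DblTrans.comp_app, DblTrans.comp_app, DblCat.assocIso_hom_app,
        DblCat.assocIso_inv_app, Category.comp_id, Category.id_comp]
      rfl
    · intro x y m
      erw [DblTrans.comp_sq, DblTrans.comp_sq, DblCat.assocIso_hom_sq,
        DblCat.assocIso_inv_sq, Category.comp_id, Category.id_comp]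
      rfl
  whisker_exchange α β := by
    apply DblTrans.hom_ext
    · intro x
      exact (DblTrans.naturality β _).symm
    · intro x y m
      exact (DblTrans.sq_naturality β _).symm
  pentagon F G H K := by
    simp only [DblCat.assocIso, eqToIso.hom]
    erw [DblTrans.whiskerRight_eqToHom, DblTrans.whiskerLeft_eqToHom]
    simp only [eqToHom_trans]
  triangle F G := by
    simp only [DblCat.assocIso, DblCat.leftUnitIso, DblCat.rightUnitIso, eqToIso.hom]
    erw [DblTrans.whiskerRight_eqToHom, DblTrans.whiskerLeft_eqToHom]
    erw [eqToHom_trans]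

theorem DblCat.strict : Bicategory.Strict DblCat.{u} where
  id_comp F := DblFunctor.id_comp F
  comp_id F := DblFunctor.comp_id F
  assoc F G H := DblFunctor.comp_assoc F G H

namespace DblCat

variable {D : DblCat.{u}}

theorem compSq_congr {x y z x' y' z' : D.Obj} {m : D.Lo x y} {n : D.Lo y z}
    {m' : D.Lo x' y'} {n' : D.Lo y' z'}
    {α α' : LoArr.mk m ⟶ LoArr.mk m'} {β β' : LoArr.mk n ⟶ LoArr.mk n'} (h : D.cod α = D.dom β)
    (h₁ : α = α') (h₂ : β = β') :
    D.compSq α β h = D.compSq α' β' (by rw [← h₁, ← h₂, h]) := by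
  subst h₁ h₂; rfl

/-- A globular square, i.e. one whose two tight sides are identities. -/
structure Glob {x y : D.Obj} (m n : D.Lo x y) : Type u where
  sq : LoArr.mk m ⟶ LoArr.mk n
  dom : D.dom sq = 𝟙 x
  cod : D.cod sq = 𝟙 y

namespace Glob

theorem ext' {x y : D.Obj} {m n : D.Lo x y} {α β : Glob m n} (h : α.sq = β.sq) : α = β := by
  cases α; cases β; cases h; rfl

/-- A globular isomorphism. -/
def ofIso {x y : D.Obj} {m n : D.Lo x y} (e : LoArr.mk m ≅ LoArr.mk n)
    (h : D.dom e.hom = 𝟙 x) (k : D.cod e.hom = 𝟙 y) : Glob m n × Glob n m :=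
  (⟨e.hom, h, k⟩, ⟨e.inv, dom_inv e _ (by simp [h]), cod_inv e _ (by simp [k])⟩)

variable {x y z w v : D.Obj}

/-- Left whiskering of globular squares. -/
def wl (m : D.Lo x y) {n n' : D.Lo y z} (β : Glob n n') : Glob (D.comp m n) (D.comp m n') :=
  ⟨D.compSq (𝟙 (LoArr.mk m)) β.sq (by rw [D.cod_id, β.dom]), by simp, by simp [β.cod]⟩

/-- Right whiskering of globular squares. -/
def wr {m m' : D.Lo x y} (α : Glob m m') (n : D.Lo y z) : Glob (D.comp m n) (D.comp m' n) :=
  ⟨D.compSq α.sq (𝟙 (LoArr.mk n)) (by rw [D.dom_id, α.cod]), by simp [α.dom], by simp⟩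

/-- Vertical composition of globular squares. -/
def vc {m n p : D.Lo x y} (α : Glob m n) (β : Glob n p) : Glob m p :=
  ⟨α.sq ≫ β.sq, by simp [α.dom, β.dom], by simp [α.cod, β.cod]⟩

theorem wl_vc (m : D.Lo x y) {n n' n'' : D.Lo y z} (β : Glob n n') (γ : Glob n' n'') :
    (wl m (vc β γ)).sq = (wl m β).sq ≫ (wl m γ).sq := by
  refine Eq.trans ?_ (compSq_compSq (𝟙 (LoArr.mk m)) (𝟙 (LoArr.mk m)) β.sq γ.sq
    (by rw [D.cod_id, β.dom]) (by rw [D.cod_id, γ.dom])).symm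
  exact compSq_congr _ (Category.id_comp _).symm rfl

theorem vc_wr {m m' m'' : D.Lo x y} (α : Glob m m') (β : Glob m' m'') (n : D.Lo y z) :
    (wr (vc α β) n).sq = (wr α n).sq ≫ (wr β n).sq := by
  refine Eq.trans ?_ (compSq_compSq α.sq β.sq (𝟙 (LoArr.mk n)) (𝟙 (LoArr.mk n))
    (by rw [D.dom_id, α.cod]) (by rw [D.dom_id, β.cod])).symm
  exact compSq_congr _ rfl (Category.id_comp _).symm

theorem unit_wl {m n : D.Lo x y} (α : Glob m n) :
    (wl (D.unit x) α).sq = (D.leftUnitor m).hom ≫ α.sq ≫ (D.leftUnitor n).inv := by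
  rw [← Category.assoc, ← D.leftUnitor_naturality, Category.assoc, Iso.hom_inv_id,
    Category.comp_id]
  refine compSq_congr _ ?_ rfl
  rw [α.dom, D.unitSq_id]

theorem wr_unit {m n : D.Lo x y} (α : Glob m n) :
    (wr α (D.unit y)).sq = (D.rightUnitor m).hom ≫ α.sq ≫ (D.rightUnitor n).inv := by
  rw [← Category.assoc, ← D.rightUnitor_naturality, Category.assoc, Iso.hom_inv_id,
    Category.comp_id]
  refine compSq_congr _ rfl ?_
  rw [α.cod, D.unitSq_id]

theorem comp_wl (m : D.Lo x y) (n : D.Lo y z) {p p' : D.Lo z w} (α : Glob p p') :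
    (wl (D.comp m n) α).sq =
      (D.assoc m n p).hom ≫ (wl m (wl n α)).sq ≫ (D.assoc m n p').inv := by
  have h := D.assoc_naturality (𝟙 (LoArr.mk m)) (𝟙 (LoArr.mk n)) α.sq (by simp) (by simp [α.dom])
  dsimp only [wl]
  rw [← Category.assoc, ← h, Category.assoc, Iso.hom_inv_id, Category.comp_id]
  exact compSq_congr _ (D.compSq_id _ _ _).symm rfl

theorem wr_comp {m m' : D.Lo x y} (α : Glob m m') (n : D.Lo y z) (p : D.Lo z w) :
    (wr α (D.comp n p)).sq =
      (D.assoc m n p).inv ≫ (wr (wr α n) p).sq ≫ (D.assoc m' n p).hom := by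
  have h := D.assoc_naturality α.sq (𝟙 (LoArr.mk n)) (𝟙 (LoArr.mk p)) (by simp [α.cod]) (by simp)
  dsimp only [wr]
  rw [h, Iso.inv_hom_id_assoc]
  exact compSq_congr _ rfl (D.compSq_id _ _ _).symm

theorem wl_wr (m : D.Lo x y) {n n' : D.Lo y z} (α : Glob n n') (p : D.Lo z w) :
    (wr (wl m α) p).sq =
      (D.assoc m n p).hom ≫ (wl m (wr α p)).sq ≫ (D.assoc m n' p).inv := by
  have h := D.assoc_naturality (𝟙 (LoArr.mk m)) α.sq (𝟙 (LoArr.mk p)) (by simp [α.dom])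
    (by simp [α.cod])
  dsimp only [wl, wr]
  rw [← Category.assoc, ← h, Category.assoc, Iso.hom_inv_id, Category.comp_id]

theorem exchange {m m' : D.Lo x y} {n n' : D.Lo y z} (α : Glob m m') (β : Glob n n') :
    (wl m β).sq ≫ (wr α n').sq = (wr α n).sq ≫ (wl m' β).sq := by
  dsimp only [wl, wr]
  rw [compSq_compSq, compSq_compSq]
  exact compSq_congr _ ((Category.id_comp _).trans (Category.comp_id _).symm)
    ((Category.comp_id _).trans (Category.id_comp _).symm)

end Glob

/-- The bicategory of objects, loose arrows and globular squares. -/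
structure Horiz (D : DblCat.{u}) : Type u where
  of : D.Obj

instance : CategoryStruct.{u} (Horiz D) where
  Hom x y := D.Lo x.of y.of
  id x := D.unit x.of
  comp m n := D.comp m n

instance (x y : Horiz D) : Category.{u} (x ⟶ y) where
  Hom m n := Glob (D := D) (x := x.of) (y := y.of) m n
  id m := ⟨𝟙 _, D.dom_id _, D.cod_id _⟩
  comp α β := Glob.vc α β
  id_comp _ := Glob.ext' (Category.id_comp _)
  comp_id _ := Glob.ext' (Category.comp_id _)
  assoc _ _ _ := Glob.ext' (Category.assoc _ _ _)

/-- A globular isomorphism. -/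
def Horiz.iso {x y : Horiz D} (m n : x ⟶ y) (e : @LoArr.mk _ D.Lo x.of y.of m ≅ LoArr.mk n)
    (h : D.dom e.hom = 𝟙 x.of) (k : D.cod e.hom = 𝟙 y.of) : m ≅ n where
  hom := (⟨e.hom, h, k⟩ : Glob (D := D) (x := x.of) (y := y.of) m n)
  inv := (⟨e.inv, dom_inv e _ (by simp [h]), cod_inv e _ (by simp [k])⟩ :
    Glob (D := D) (x := x.of) (y := y.of) n m)
  hom_inv_id := Glob.ext' e.hom_inv_id
  inv_hom_id := Glob.ext' e.inv_hom_id

instance : Bicategory.{u, u} (Horiz D) where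
  whiskerLeft m _ _ β := Glob.wl m β
  whiskerRight α n := Glob.wr α n
  associator m n p := Horiz.iso _ _ (D.assoc m n p) (by simp) (by simp)
  leftUnitor m := Horiz.iso _ _ (D.leftUnitor m) (by simp) (by simp)
  rightUnitor m := Horiz.iso _ _ (D.rightUnitor m) (by simp) (by simp)
  whiskerLeft_id _ _ := Glob.ext' (D.compSq_id _ _ _)
  whiskerLeft_comp m _ _ _ β γ := Glob.ext' (Glob.wl_vc _ _ _)
  id_whiskerLeft α := Glob.ext' (Glob.unit_wl α)
  comp_whiskerLeft m n _ _ α := Glob.ext' (Glob.comp_wl m n α)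
  id_whiskerRight _ _ := Glob.ext' (D.compSq_id _ _ _)
  comp_whiskerRight α β n := Glob.ext' (Glob.vc_wr _ _ _)
  whiskerRight_id α := Glob.ext' (Glob.wr_unit α)
  whiskerRight_comp α n p := Glob.ext' (Glob.wr_comp α n p)
  whisker_assoc m _ _ α p := Glob.ext' (Glob.wl_wr m α p)
  whisker_exchange α β := Glob.ext' (Glob.exchange _ _)
  pentagon m n p q := Glob.ext' (D.pentagon _ _ _ _)
  triangle m n := Glob.ext' (D.triangle _ _)

theorem leftUnitor_comp {x y z : D.Obj} (m : D.Lo x y) (n : D.Lo y z) :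
    (D.leftUnitor (D.comp m n)).hom =
      (D.assoc (D.unit x) m n).inv ≫
        D.compSq (D.leftUnitor m).hom (𝟙 (LoArr.mk n)) (by simp) :=
  congrArg Glob.sq (Bicategory.leftUnitor_comp (B := Horiz D) (a := ⟨x⟩) (b := ⟨y⟩) (c := ⟨z⟩) m n)

theorem rightUnitor_comp {x y z : D.Obj} (m : D.Lo x y) (n : D.Lo y z) :
    (D.rightUnitor (D.comp m n)).hom =
      (D.assoc m n (D.unit z)).hom ≫
        D.compSq (𝟙 (LoArr.mk m)) (D.rightUnitor n).hom (by simp) :=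
  congrArg Glob.sq (Bicategory.rightUnitor_comp (B := Horiz D) (a := ⟨x⟩) (b := ⟨y⟩) (c := ⟨z⟩) m n)

theorem unitors_equal (x : D.Obj) :
    (D.leftUnitor (D.unit x)).hom = (D.rightUnitor (D.unit x)).hom :=
  congrArg Glob.sq (Bicategory.unitors_equal (B := Horiz D) (a := ⟨x⟩))

end DblCat

namespace DblCat

variable {D E : DblCat.{u}}

/-- A companion of the tight arrow `f`. -/
structure Companion {x y : D.Obj} (f : x ⟶ y) : Type u where
  lo : D.Lo x y
  eta : LoArr.mk (D.unit x) ⟶ LoArr.mk lo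
  eps : LoArr.mk lo ⟶ LoArr.mk (D.unit y)
  dom_eta : D.dom eta = 𝟙 x
  cod_eta : D.cod eta = f
  dom_eps : D.dom eps = f
  cod_eps : D.cod eps = 𝟙 y
  eta_eps : eta ≫ eps = D.unitSq f
  zigzag : (D.leftUnitor lo).inv ≫ D.compSq eta eps (cod_eta.trans dom_eps.symm) ≫
    (D.rightUnitor lo).hom = 𝟙 (LoArr.mk lo)

/-- A conjoint of the tight arrow `f`. -/
structure Conjoint {x y : D.Obj} (f : x ⟶ y) : Type u where
  lo : D.Lo y x
  eta : LoArr.mk (D.unit x) ⟶ LoArr.mk lo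
  eps : LoArr.mk lo ⟶ LoArr.mk (D.unit y)
  dom_eta : D.dom eta = f
  cod_eta : D.cod eta = 𝟙 x
  dom_eps : D.dom eps = 𝟙 y
  cod_eps : D.cod eps = f
  eta_eps : eta ≫ eps = D.unitSq f
  zigzag : (D.rightUnitor lo).inv ≫ D.compSq eps eta (cod_eps.trans dom_eta.symm) ≫
    (D.leftUnitor lo).hom = 𝟙 (LoArr.mk lo)

attribute [simp] Companion.dom_eta Companion.cod_eta Companion.dom_eps Companion.cod_eps
  Conjoint.dom_eta Conjoint.cod_eta Conjoint.dom_eps Conjoint.cod_eps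

/-- The globular square obtained from `α` by bending its tight sides down to companions. -/
def Companion.transpose {x y x' y' : D.Obj} {m : D.Lo x y} {n : D.Lo x' y'}
    (α : LoArr.mk m ⟶ LoArr.mk n) {f : x ⟶ x'} {g : y ⟶ y'} (C₀ : Companion f) (C₁ : Companion g)
    (hf : D.dom α = f) (hg : D.cod α = g) :
    LoArr.mk (D.comp m C₁.lo) ⟶ LoArr.mk (D.comp C₀.lo n) :=
  (D.leftUnitor (D.comp m C₁.lo)).inv ≫
    D.compSq C₀.eta (D.compSq α C₁.eps (by simp [hg]) ≫ (D.rightUnitor n).hom) (by simp [hf])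

/-- The globular square obtained from `α` by bending its tight sides up to conjoints. -/
def Conjoint.transpose {x y x' y' : D.Obj} {m : D.Lo x y} {n : D.Lo x' y'}
    (α : LoArr.mk m ⟶ LoArr.mk n) {f : x ⟶ x'} {g : y ⟶ y'} (C₀ : Conjoint f) (C₁ : Conjoint g)
    (hf : D.dom α = f) (hg : D.cod α = g) :
    LoArr.mk (D.comp C₀.lo m) ⟶ LoArr.mk (D.comp n C₁.lo) :=
  (D.rightUnitor (D.comp C₀.lo m)).inv ≫
    D.compSq (D.compSq C₀.eps α (by simp [hf]) ≫ (D.leftUnitor n).hom) C₁.eta (by simp [hg])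

/-- The sides of `α` have companions, and the resulting globular square is invertible. -/
def IsCompanionCommuter {x y x' y' : D.Obj} {m : D.Lo x y} {n : D.Lo x' y'}
    (α : LoArr.mk m ⟶ LoArr.mk n) : Prop :=
  ∃ (C₀ : Companion (D.dom α)) (C₁ : Companion (D.cod α)),
    IsIso (Companion.transpose α C₀ C₁ rfl rfl)

/-- The sides of `α` have conjoints, and the resulting globular square is invertible. -/
def IsConjointCommuter {x y x' y' : D.Obj} {m : D.Lo x y} {n : D.Lo x' y'}
    (α : LoArr.mk m ⟶ LoArr.mk n) : Prop :=
  ∃ (C₀ : Conjoint (D.dom α)) (C₁ : Conjoint (D.cod α)),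
    IsIso (Conjoint.transpose α C₀ C₁ rfl rfl)

/-- Whiskering on the left by an identity square. -/
def lw {x y z z' : D.Obj} (m : D.Lo x y) {n : D.Lo y z} {n' : D.Lo y z'}
    (β : LoArr.mk n ⟶ LoArr.mk n') (h : D.dom β = 𝟙 y) :
    LoArr.mk (D.comp m n) ⟶ LoArr.mk (D.comp m n') :=
  D.compSq (𝟙 (LoArr.mk m)) β (by rw [h, D.cod_id])

/-- Whiskering on the right by an identity square. -/
def rw' {x x' y z : D.Obj} {m : D.Lo x y} {m' : D.Lo x' y} (α : LoArr.mk m ⟶ LoArr.mk m')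
    (n : D.Lo y z) (h : D.cod α = 𝟙 y) :
    LoArr.mk (D.comp m n) ⟶ LoArr.mk (D.comp m' n) :=
  D.compSq α (𝟙 (LoArr.mk n)) (by rw [h, D.dom_id])

@[simp] theorem dom_lw {x y z z' : D.Obj} (m : D.Lo x y) {n : D.Lo y z} {n' : D.Lo y z'}
    (β : LoArr.mk n ⟶ LoArr.mk n') (h : D.dom β = 𝟙 y) : D.dom (lw m β h) = 𝟙 x := by simp [lw]
@[simp] theorem cod_lw {x y z z' : D.Obj} (m : D.Lo x y) {n : D.Lo y z} {n' : D.Lo y z'}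
    (β : LoArr.mk n ⟶ LoArr.mk n') (h : D.dom β = 𝟙 y) : D.cod (lw m β h) = D.cod β := by simp [lw]
@[simp] theorem dom_rw' {x x' y z : D.Obj} {m : D.Lo x y} {m' : D.Lo x' y}
    (α : LoArr.mk m ⟶ LoArr.mk m') (n : D.Lo y z) (h : D.cod α = 𝟙 y) :
    D.dom (rw' α n h) = D.dom α := by simp [rw']
@[simp] theorem cod_rw' {x x' y z : D.Obj} {m : D.Lo x y} {m' : D.Lo x' y}
    (α : LoArr.mk m ⟶ LoArr.mk m') (n : D.Lo y z) (h : D.cod α = 𝟙 y) :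
    D.cod (rw' α n h) = 𝟙 z := by simp [rw']

theorem lw_comp {x y z z' z'' : D.Obj} (m : D.Lo x y) {n : D.Lo y z} {n' : D.Lo y z'}
    {n'' : D.Lo y z''} (β : LoArr.mk n ⟶ LoArr.mk n') (γ : LoArr.mk n' ⟶ LoArr.mk n'')
    (h : D.dom β = 𝟙 y) (k : D.dom γ = 𝟙 y) :
    lw m (β ≫ γ) (by simp [h, k]) = lw m β h ≫ lw m γ k := by
  unfold lw
  rw [compSq_compSq]
  exact compSq_congr _ (Category.id_comp _).symm rfl

theorem comp_rw' {x x' x'' y z : D.Obj} {m : D.Lo x y} {m' : D.Lo x' y} {m'' : D.Lo x'' y}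
    (α : LoArr.mk m ⟶ LoArr.mk m') (β : LoArr.mk m' ⟶ LoArr.mk m'') (n : D.Lo y z)
    (h : D.cod α = 𝟙 y) (k : D.cod β = 𝟙 y) :
    rw' (α ≫ β) n (by simp [h, k]) = rw' α n h ≫ rw' β n k := by
  unfold rw'
  rw [compSq_compSq]
  exact compSq_congr _ rfl (Category.id_comp _).symm

theorem lw_id {x y z : D.Obj} (m : D.Lo x y) (n : D.Lo y z) :
    lw m (𝟙 (LoArr.mk n)) (D.dom_id _) = 𝟙 (LoArr.mk (D.comp m n)) := D.compSq_id _ _ _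

theorem id_rw' {x y z : D.Obj} (m : D.Lo x y) (n : D.Lo y z) :
    rw' (𝟙 (LoArr.mk m)) n (D.cod_id _) = 𝟙 (LoArr.mk (D.comp m n)) := D.compSq_id _ _ _

theorem unit_lw {x y y' : D.Obj} {m : D.Lo x y} {n : D.Lo x y'} (α : LoArr.mk m ⟶ LoArr.mk n)
    (h : D.dom α = 𝟙 x) :
    lw (D.unit x) α h ≫ (D.leftUnitor n).hom = (D.leftUnitor m).hom ≫ α := by
  rw [← D.leftUnitor_naturality α]
  congr 1
  exact compSq_congr _ (by rw [h, D.unitSq_id]) rfl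

theorem rw'_unit {x x' y : D.Obj} {m : D.Lo x y} {n : D.Lo x' y} (α : LoArr.mk m ⟶ LoArr.mk n)
    (h : D.cod α = 𝟙 y) :
    rw' α (D.unit y) h ≫ (D.rightUnitor n).hom = (D.rightUnitor m).hom ≫ α := by
  rw [← D.rightUnitor_naturality α]
  congr 1
  exact compSq_congr _ rfl (by rw [h, D.unitSq_id])

theorem unit_lw_inv {x y y' : D.Obj} {m : D.Lo x y} {n : D.Lo x y'} (α : LoArr.mk m ⟶ LoArr.mk n)
    (h : D.dom α = 𝟙 x) :
    (D.leftUnitor m).inv ≫ lw (D.unit x) α h = α ≫ (D.leftUnitor n).inv := by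
  rw [Iso.inv_comp_eq, ← Category.assoc, ← unit_lw α h, Category.assoc, Iso.hom_inv_id,
    Category.comp_id]

theorem rw'_unit_inv {x x' y : D.Obj} {m : D.Lo x y} {n : D.Lo x' y} (α : LoArr.mk m ⟶ LoArr.mk n)
    (h : D.cod α = 𝟙 y) :
    (D.rightUnitor m).inv ≫ rw' α (D.unit y) h = α ≫ (D.rightUnitor n).inv := by
  rw [Iso.inv_comp_eq, ← Category.assoc, ← rw'_unit α h, Category.assoc, Iso.hom_inv_id,
    Category.comp_id]

theorem lw_lw {x y z w w' : D.Obj} (m : D.Lo x y) (n : D.Lo y z) {p : D.Lo z w} {p' : D.Lo z w'}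
    (α : LoArr.mk p ⟶ LoArr.mk p') (h : D.dom α = 𝟙 z) :
    lw (D.comp m n) α h ≫ (D.assoc m n p').hom =
      (D.assoc m n p).hom ≫ lw m (lw n α h) (by simp) := by
  have h := D.assoc_naturality (𝟙 (LoArr.mk m)) (𝟙 (LoArr.mk n)) α (by simp) (by simp [h])
  unfold lw
  rw [← h]
  congr 1
  exact compSq_congr _ (D.compSq_id _ _ _).symm rfl

theorem rw'_rw' {x x' y z w : D.Obj} {m : D.Lo x y} {m' : D.Lo x' y}
    (α : LoArr.mk m ⟶ LoArr.mk m') (n : D.Lo y z) (p : D.Lo z w) (h : D.cod α = 𝟙 y) :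
    rw' (rw' α n h) p (by simp) ≫ (D.assoc m' n p).hom =
      (D.assoc m n p).hom ≫ rw' α (D.comp n p) h := by
  have h := D.assoc_naturality α (𝟙 (LoArr.mk n)) (𝟙 (LoArr.mk p)) (by simp [h]) (by simp)
  unfold rw'
  rw [h]
  congr 1
  exact compSq_congr _ rfl (D.compSq_id _ _ _)

theorem rw'_lw {x x' y z z' : D.Obj} {m : D.Lo x y} {m' : D.Lo x' y} {n : D.Lo y z} {n' : D.Lo y z'}
    (α : LoArr.mk m ⟶ LoArr.mk m') (β : LoArr.mk n ⟶ LoArr.mk n') (h : D.cod α = 𝟙 y)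
    (k : D.dom β = 𝟙 y) :
    rw' α n h ≫ lw m' β k = lw m β k ≫ rw' α n' h := by
  unfold lw rw'
  rw [compSq_compSq, compSq_compSq]
  exact compSq_congr _ ((Category.comp_id _).trans (Category.id_comp _).symm)
    ((Category.id_comp _).trans (Category.comp_id _).symm)

theorem rightUnitor_inv_assoc {x y z : D.Obj} (m : D.Lo x y) (n : D.Lo y z) :
    (D.rightUnitor (D.comp m n)).inv ≫ (D.assoc m n (D.unit z)).hom =
      lw m (D.rightUnitor n).inv (by simp) := by
  have h1 : lw m (D.rightUnitor n).inv (by simp) ≫ lw m (D.rightUnitor n).hom (by simp) = 𝟙 _ := by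
    rw [← lw_comp, ← lw_id]; unfold lw; exact compSq_congr _ rfl (Iso.inv_hom_id _)
  have h3 : lw m (D.rightUnitor n).hom (by simp) ≫ lw m (D.rightUnitor n).inv (by simp) = 𝟙 _ := by
    rw [← lw_comp, ← lw_id]; unfold lw; exact compSq_congr _ rfl (Iso.hom_inv_id _)
  have h2 := rightUnitor_comp m n
  change _ = _ ≫ lw m (D.rightUnitor n).hom (by simp) at h2
  rw [Iso.inv_comp_eq, h2, Category.assoc, h3, Category.comp_id]

/-- The square from `m` to its composite with a companion of a tight arrow out of its target. -/
def Companion.χ {x y z : D.Obj} {g : y ⟶ z} (C : Companion g) (m : D.Lo x y) :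
    LoArr.mk m ⟶ LoArr.mk (D.comp m C.lo) :=
  (D.rightUnitor m).inv ≫ lw m C.eta C.dom_eta

/-- The square to `n` from its composite with a companion of a tight arrow into its source. -/
def Companion.κ {x y z : D.Obj} {f : x ⟶ y} (C : Companion f) (n : D.Lo y z) :
    LoArr.mk (D.comp C.lo n) ⟶ LoArr.mk n :=
  rw' C.eps n C.cod_eps ≫ (D.leftUnitor n).hom

namespace Companion

variable {x y z w : D.Obj}

@[simp] theorem dom_χ {g : y ⟶ z} (C : Companion g) (m : D.Lo x y) : D.dom (C.χ m) = 𝟙 x := by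
  simp [χ]
@[simp] theorem cod_χ {g : y ⟶ z} (C : Companion g) (m : D.Lo x y) : D.cod (C.χ m) = g := by
  simp [χ]
@[simp] theorem dom_κ {f : x ⟶ y} (C : Companion f) (n : D.Lo y z) : D.dom (C.κ n) = f := by
  simp [κ]
@[simp] theorem cod_κ {f : x ⟶ y} (C : Companion f) (n : D.Lo y z) : D.cod (C.κ n) = 𝟙 z := by
  simp [κ]

theorem zigzag_right {f : x ⟶ y} (C : Companion f) :
    D.compSq C.eta C.eps (by simp) ≫ (D.rightUnitor C.lo).hom = (D.leftUnitor C.lo).hom := by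
  have h := C.zigzag
  rw [Iso.inv_comp_eq, Category.comp_id] at h
  exact h

theorem zigzag_left {f : x ⟶ y} (C : Companion f) :
    (D.leftUnitor C.lo).inv ≫ D.compSq C.eta C.eps (by simp) = (D.rightUnitor C.lo).inv := by
  rw [← cancel_mono (D.rightUnitor C.lo).hom, Category.assoc, C.zigzag, Iso.inv_hom_id]

theorem χ_eps {g : y ⟶ z} (C : Companion g) (m : D.Lo x y) :
    D.compSq (C.χ m) C.eps (by simp) ≫ (D.rightUnitor (D.comp m C.lo)).hom = 𝟙 _ := by
  have e1 : D.compSq (C.χ m) C.eps (by simp) =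
      rw' (D.rightUnitor m).inv C.lo (by simp) ≫ D.compSq (lw m C.eta C.dom_eta) C.eps (by simp) := by
    unfold χ rw'
    rw [compSq_compSq]
    exact compSq_congr _ rfl (Category.id_comp _).symm
  have e2 := D.assoc_naturality (𝟙 (LoArr.mk m)) C.eta C.eps (by simp) (by simp)
  have e3 : D.compSq (𝟙 (LoArr.mk m)) (D.compSq C.eta C.eps (by simp)) (by simp) ≫
      D.compSq (𝟙 (LoArr.mk m)) (D.rightUnitor C.lo).hom (by simp) =
      D.compSq (𝟙 (LoArr.mk m)) (D.leftUnitor C.lo).hom (by simp) := by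
    rw [compSq_compSq]
    exact compSq_congr _ (Category.id_comp _) C.zigzag_right
  rw [e1, rightUnitor_comp, Category.assoc]
  unfold lw
  rw [reassoc_of% e2, e3, D.triangle]
  unfold rw'
  rw [compSq_compSq, ← D.compSq_id _ _ (by simp)]
  exact compSq_congr _ (Iso.inv_hom_id _) (Category.id_comp _)

theorem eta_κ {f : x ⟶ y} (C : Companion f) (n : D.Lo y z) :
    (D.leftUnitor (D.comp C.lo n)).inv ≫ D.compSq C.eta (C.κ n) (by simp) = 𝟙 _ := by
  rw [Iso.inv_comp_eq, Category.comp_id, leftUnitor_comp, Iso.eq_inv_comp]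
  have e1 : D.compSq C.eta (C.κ n) (by simp) =
      D.compSq C.eta (rw' C.eps n C.cod_eps) (by simp) ≫ lw C.lo (D.leftUnitor n).hom (by simp) := by
    unfold κ lw
    rw [compSq_compSq]
    exact compSq_congr _ (Category.comp_id _).symm rfl
  have e2 := D.assoc_naturality C.eta C.eps (𝟙 (LoArr.mk n)) (by simp) (by simp)
  have e4 := D.triangle C.lo n
  rw [e1]
  unfold rw' lw
  rw [← reassoc_of% e2, e4, compSq_compSq]
  exact compSq_congr _ C.zigzag_right (Category.comp_id _)

theorem eq_of_χ {g : y ⟶ z} (C : Companion g) (m : D.Lo x y) {x' z' : D.Obj} {p : D.Lo x' z'}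
    (δ : LoArr.mk (D.comp m C.lo) ⟶ LoArr.mk p) :
    δ = D.compSq (C.χ m ≫ δ) (C.eps ≫ D.unitSq (D.cod δ)) (by simp) ≫ (D.rightUnitor p).hom := by
  rw [← compSq_compSq _ _ _ _ (by simp) (by simp), Category.assoc, D.rightUnitor_naturality,
    ← Category.assoc, χ_eps, Category.id_comp]

theorem χ_epi {g : y ⟶ z} (C : Companion g) (m : D.Lo x y) {x' z' : D.Obj} {p : D.Lo x' z'}
    (δ δ' : LoArr.mk (D.comp m C.lo) ⟶ LoArr.mk p) (h : D.cod δ = D.cod δ')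
    (e : C.χ m ≫ δ = C.χ m ≫ δ') : δ = δ' := by
  rw [C.eq_of_χ m δ, C.eq_of_χ m δ']
  congr 1
  exact compSq_congr _ e (by rw [h])

theorem eq_of_κ {f : x ⟶ y} (C : Companion f) (n : D.Lo y z) {x' z' : D.Obj} {p : D.Lo x' z'}
    (δ : LoArr.mk p ⟶ LoArr.mk (D.comp C.lo n)) :
    δ = (D.leftUnitor p).inv ≫ D.compSq (D.unitSq (D.dom δ) ≫ C.eta) (δ ≫ C.κ n) (by simp) := by
  rw [← compSq_compSq _ _ _ _ (by simp) (by simp), ← Category.assoc]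
  have h : (D.leftUnitor p).inv ≫ D.compSq (D.unitSq (D.dom δ)) δ (by simp) =
      δ ≫ (D.leftUnitor _).inv := by
    rw [Iso.inv_comp_eq, ← Category.assoc, ← D.leftUnitor_naturality, Category.assoc,
      Iso.hom_inv_id, Category.comp_id]
  rw [h, Category.assoc, eta_κ, Category.comp_id]

section
variable {x' y' : D.Obj} {m : D.Lo x y} {n : D.Lo x' y'}
    (α : LoArr.mk m ⟶ LoArr.mk n) {f : x ⟶ x'} {g : y ⟶ y'} (C₀ : Companion f) (C₁ : Companion g)
    (hf : D.dom α = f) (hg : D.cod α = g)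

theorem χ_transpose_κ : C₁.χ m ≫ transpose α C₀ C₁ hf hg ≫ C₀.κ n = α := by
  have h1 : transpose α C₀ C₁ hf hg ≫ C₀.κ n =
      D.compSq α C₁.eps (by simp [hg]) ≫ (D.rightUnitor n).hom := by
    have h := D.leftUnitor_naturality (D.compSq α C₁.eps (by simp [hg]) ≫ (D.rightUnitor n).hom)
    unfold transpose κ rw'
    rw [Category.assoc, Iso.inv_comp_eq, ← h, ← Category.assoc, compSq_compSq]
    congr 1
    refine compSq_congr _ (C₀.eta_eps.trans ?_) (Category.comp_id _)
    congr 1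
    simp [hf]
  rw [h1]
  unfold χ lw
  rw [Category.assoc, Iso.inv_comp_eq, ← D.rightUnitor_naturality, ← Category.assoc, compSq_compSq]
  congr 1
  exact compSq_congr _ (Category.id_comp _) (C₁.eta_eps.trans (by rw [hg]))

theorem transpose_unique (t : LoArr.mk (D.comp m C₁.lo) ⟶ LoArr.mk (D.comp C₀.lo n))
    (hd : D.dom t = 𝟙 x) (hc : D.cod t = 𝟙 y') (ht : C₁.χ m ≫ t ≫ C₀.κ n = α) :
    transpose α C₀ C₁ hf hg = t := by
  have h1 := C₁.eq_of_χ m (t ≫ C₀.κ n)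
  rw [C₀.eq_of_κ n t]
  unfold transpose
  congr 1
  refine compSq_congr _ (by simp [hd]) ?_
  rw [h1]
  congr 1
  exact compSq_congr _ ht.symm (by simp [hc])

end

/-- The companion of an identity. -/
def id (x : D.Obj) : Companion (𝟙 x) where
  lo := D.unit x
  eta := 𝟙 _
  eps := 𝟙 _
  dom_eta := by simp
  cod_eta := by simp
  dom_eps := by simp
  cod_eps := by simp
  eta_eps := by simp
  zigzag := by
    rw [D.compSq_id, Category.id_comp, ← unitors_equal, Iso.inv_hom_id]

theorem χ_κ {f : x ⟶ y} {g : y ⟶ z} (C : Companion f) (C' : Companion g) :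
    C'.χ C.lo ≫ C.κ C'.lo = C.eps ≫ C'.eta := by
  unfold χ κ
  rw [Category.assoc, ← Category.assoc (lw _ _ _), ← rw'_lw, Category.assoc, unit_lw,
    ← Category.assoc, rw'_unit_inv, Category.assoc, unitors_equal, Iso.inv_hom_id_assoc]

theorem eta_epi {f : x ⟶ y} (C : Companion f) {x' y' : D.Obj} {p : D.Lo x' y'}
    (δ δ' : LoArr.mk C.lo ⟶ LoArr.mk p) (h : D.cod δ = D.cod δ') (e : C.eta ≫ δ = C.eta ≫ δ') :
    δ = δ' := by
  have h1 : C.χ (D.unit x) = C.eta ≫ (D.leftUnitor _).inv := by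
    unfold χ
    rw [Iso.inv_comp_eq, ← unitors_equal, ← Category.assoc, ← unit_lw, Category.assoc,
      Iso.hom_inv_id, Category.comp_id]
  have h2 := C.χ_epi (D.unit x) ((D.leftUnitor _).hom ≫ δ) ((D.leftUnitor _).hom ≫ δ')
    (by simp [h]) (by rw [h1]; simpa using e)
  exact (cancel_epi _).1 h2

/-- The composite of companions. -/
def comp {f : x ⟶ y} {g : y ⟶ z} (C : Companion f) (C' : Companion g) : Companion (f ≫ g) where
  lo := D.comp C.lo C'.lo
  eta := C.eta ≫ C'.χ C.lo
  eps := C.κ C'.lo ≫ C'.eps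
  dom_eta := by simp
  cod_eta := by simp
  dom_eps := by simp
  cod_eps := by simp
  eta_eps := by
    have h := C.χ_κ C'
    rw [Category.assoc, reassoc_of% h, C'.eta_eps, ← Category.assoc, C.eta_eps, D.unitSq_comp]
  zigzag := by
    have h := C.χ_κ C'
    have h' : (C.eta ≫ C'.χ C.lo) ≫ (C.κ C'.lo ≫ C'.eps) = D.unitSq (f ≫ g) := by
      rw [Category.assoc, reassoc_of% h, C'.eta_eps, ← Category.assoc, C.eta_eps, D.unitSq_comp]
    refine C'.χ_epi C.lo _ _ (by simp) ?_
    refine C.eta_epi _ _ (by simp) ?_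
    have hl := unit_lw_inv (C.eta ≫ C'.χ C.lo) (by simp)
    rw [← Category.assoc, ← Category.assoc C.eta, Category.assoc, ← reassoc_of% hl]
    refine Eq.trans ?_ (Category.comp_id _).symm
    unfold lw
    rw [← Category.assoc (D.compSq _ _ _), compSq_compSq, Iso.inv_comp_eq, unitors_equal,
      ← D.rightUnitor_naturality]
    congr 1
    refine compSq_congr _ (Category.id_comp _) (h'.trans ?_)
    simp

theorem comp_χ {f : y ⟶ z} {g : z ⟶ w} (C : Companion f) (C' : Companion g) (m : D.Lo x y) :
    (C.comp C').χ m = C.χ m ≫ C'.χ (D.comp m C.lo) ≫ (D.assoc m C.lo C'.lo).hom := by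
  have h := rightUnitor_inv_assoc m C.lo
  unfold χ
  rw [Category.assoc, Category.assoc, lw_lw, reassoc_of% h, ← lw_comp, ← lw_comp]
  rfl

theorem comp_κ {f : x ⟶ y} {g : y ⟶ z} (C : Companion f) (C' : Companion g) (p : D.Lo z w) :
    (C.comp C').κ p = (D.assoc C.lo C'.lo p).hom ≫ C.κ (D.comp C'.lo p) ≫ C'.κ p := by
  have h := leftUnitor_comp C'.lo p
  change _ = _ ≫ rw' (D.leftUnitor C'.lo).hom p (by simp) at h
  have h2 := rw'_rw' C.eps C'.lo p C.cod_eps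
  unfold κ
  rw [Category.assoc, ← reassoc_of% h2, h, Category.assoc, Iso.hom_inv_id_assoc,
    ← Category.assoc, ← Category.assoc, ← comp_rw', ← comp_rw']
  congr 1

theorem χ_assoc_κ {x' y' : D.Obj} {f : x ⟶ y} {g : x' ⟶ y'} (C : Companion f) (C' : Companion g)
    (n : D.Lo y x') :
    C'.χ (D.comp C.lo n) ≫ (D.assoc C.lo n C'.lo).hom ≫ C.κ (D.comp n C'.lo) =
      C.κ n ≫ C'.χ n := by
  have h := rightUnitor_inv_assoc C.lo n
  have h2 := lw_lw C.lo n C'.eta C'.dom_eta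
  unfold χ κ
  rw [Category.assoc, reassoc_of% h2, reassoc_of% h]
  rw [← Category.assoc (lw _ _ _), ← lw_comp, ← Category.assoc, ← rw'_lw _ _ C.cod_eps,
    Category.assoc, unit_lw, Category.assoc]

theorem isIso_rw' {x y z : D.Obj} {m m' : D.Lo x y} (α : LoArr.mk m ⟶ LoArr.mk m') [IsIso α]
    (n : D.Lo y z) (h : D.cod α = 𝟙 y) : IsIso (rw' α n h) := by
  have h' : D.cod (inv α) = 𝟙 y := cod_inv (asIso α) _ (by simp [h])
  refine ⟨rw' (inv α) n h', ?_, ?_⟩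
  · rw [← comp_rw', ← id_rw']; unfold rw'; exact compSq_congr _ (by simp) rfl
  · rw [← comp_rw', ← id_rw']; unfold rw'; exact compSq_congr _ (by simp) rfl

theorem isIso_lw {x y z : D.Obj} (m : D.Lo x y) {n n' : D.Lo y z} (α : LoArr.mk n ⟶ LoArr.mk n')
    [IsIso α] (h : D.dom α = 𝟙 y) : IsIso (lw m α h) := by
  have h' : D.dom (inv α) = 𝟙 y := dom_inv (asIso α) _ (by simp [h])
  refine ⟨lw m (inv α) h', ?_, ?_⟩
  · rw [← lw_comp, ← lw_id]; unfold lw; exact compSq_congr _ rfl (by simp)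
  · rw [← lw_comp, ← lw_id]; unfold lw; exact compSq_congr _ rfl (by simp)

@[simp] theorem dom_transpose {x' y' : D.Obj} {m : D.Lo x y} {n : D.Lo x' y'}
    (α : LoArr.mk m ⟶ LoArr.mk n) {f : x ⟶ x'} {g : y ⟶ y'} (C₀ : Companion f) (C₁ : Companion g)
    (hf : D.dom α = f) (hg : D.cod α = g) : D.dom (transpose α C₀ C₁ hf hg) = 𝟙 x := by
  simp [transpose]

@[simp] theorem cod_transpose {x' y' : D.Obj} {m : D.Lo x y} {n : D.Lo x' y'}
    (α : LoArr.mk m ⟶ LoArr.mk n) {f : x ⟶ x'} {g : y ⟶ y'} (C₀ : Companion f) (C₁ : Companion g)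
    (hf : D.dom α = f) (hg : D.cod α = g) : D.cod (transpose α C₀ C₁ hf hg) = 𝟙 y' := by
  simp [transpose]

/-- The image of a companion under a double functor. -/
def map (F : DblFunctor D E) {f : x ⟶ y} (C : Companion f) : Companion (F.tight.map f) where
  lo := F.lo C.lo
  eta := (F.unitIso x).hom ≫ F.sq C.eta
  eps := F.sq C.eps ≫ (F.unitIso y).inv
  dom_eta := by simp
  cod_eta := by simp
  dom_eps := by
    have h : E.dom (F.unitIso y).inv = 𝟙 _ := dom_inv _ _ (by simp)
    simp [h]
  cod_eps := by
    have h : E.cod (F.unitIso y).inv = 𝟙 _ := cod_inv _ _ (by simp)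
    simp [h]
  eta_eps := by
    have h := F.unitIso_naturality f
    rw [Category.assoc, ← Category.assoc (F.sq _), ← F.sq_comp, C.eta_eps, ← Category.assoc, ← h,
      Category.assoc, Iso.hom_inv_id, Category.comp_id]
  zigzag := by
    have hd : E.dom (F.unitIso y).inv = 𝟙 _ := dom_inv _ _ (by simp)
    have hc : E.cod (F.unitIso y).inv = 𝟙 _ := cod_inv _ _ (by simp)
    have e : E.compSq ((F.unitIso x).hom ≫ F.sq C.eta) (F.sq C.eps ≫ (F.unitIso y).inv) (by simp [hd]) =
        rw' (F.unitIso x).hom (F.lo C.lo) (by simp) ≫ E.compSq (F.sq C.eta) (F.sq C.eps) (by simp) ≫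
          lw (F.lo C.lo) (F.unitIso y).inv hd := by
      unfold lw rw'
      rw [compSq_compSq, compSq_compSq]
      exact compSq_congr _ (by simp) (by simp)
    have h1 := F.map_leftUnitor C.lo
    have h2 := F.map_rightUnitor C.lo
    have h3 := F.compIso_naturality C.eta C.eps (by simp)
    have h4 := congrArg F.sq C.zigzag_right
    have h5 : lw (F.lo C.lo) (F.unitIso y).hom (by simp) ≫ lw (F.lo C.lo) (F.unitIso y).inv hd =
        𝟙 _ := by
      rw [← lw_comp, ← lw_id]; unfold lw; exact compSq_congr _ rfl (Iso.hom_inv_id _)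
    have h6 : lw (F.lo C.lo) (F.unitIso y).inv hd ≫ lw (F.lo C.lo) (F.unitIso y).hom (by simp) =
        𝟙 _ := by
      rw [← lw_comp, ← lw_id]; unfold lw; exact compSq_congr _ rfl (Iso.inv_hom_id _)
    change rw' (F.unitIso x).hom (F.lo C.lo) (by simp) ≫ _ = _ at h1
    change lw (F.lo C.lo) (F.unitIso y).hom (by simp) ≫ _ = _ at h2
    rw [F.sq_comp] at h4
    rw [e, ← h2, Iso.inv_comp_eq, Category.comp_id, Category.assoc, Category.assoc,
      reassoc_of% h6, reassoc_of% h3, h4, h1]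

theorem map_χ (F : DblFunctor D E) {g : y ⟶ z} (C : Companion g) (m : D.Lo x y) :
    (C.map F).χ (F.lo m) ≫ (F.compIso m C.lo).hom = F.sq (C.χ m) := by
  have h2 := F.map_rightUnitor m
  have h3 := F.compIso_naturality (𝟙 (LoArr.mk m)) C.eta (by simp)
  simp only [F.sq_id] at h3
  change lw (F.lo m) (F.unitIso y).hom (by simp) ≫ _ = _ at h2
  change lw (F.lo m) (F.sq C.eta) (by simp) ≫ _ = _ ≫ F.sq (lw m C.eta C.dom_eta) at h3
  unfold χ
  change (_ ≫ lw (F.lo m) ((F.unitIso y).hom ≫ F.sq C.eta) _) ≫ _ = _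
  rw [lw_comp _ _ _ (by simp) (by simp), Category.assoc, Category.assoc, h3, Iso.inv_comp_eq, ← h2,
    Category.assoc, Category.assoc, F.sq_comp, ← Category.assoc (F.sq _), ← F.sq_comp,
    Iso.hom_inv_id, F.sq_id, Category.id_comp]

theorem map_κ (F : DblFunctor D E) {f : x ⟶ y} (C : Companion f) (n : D.Lo y z) :
    (F.compIso C.lo n).inv ≫ (C.map F).κ (F.lo n) = F.sq (C.κ n) := by
  have hc : E.cod (F.unitIso y).inv = 𝟙 _ := cod_inv _ _ (by simp)
  have h2 := F.map_leftUnitor n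
  have h3 := F.compIso_naturality C.eps (𝟙 (LoArr.mk n)) (by simp)
  simp only [F.sq_id] at h3
  change rw' (F.unitIso y).hom (F.lo n) (by simp) ≫ _ = _ at h2
  change rw' (F.sq C.eps) (F.lo n) (by simp) ≫ _ = _ ≫ F.sq (rw' C.eps n C.cod_eps) at h3
  have h6 : rw' (F.unitIso y).inv (F.lo n) hc ≫ rw' (F.unitIso y).hom (F.lo n) (by simp) =
      𝟙 _ := by
    rw [← comp_rw', ← id_rw']; unfold rw'; exact compSq_congr _ (Iso.inv_hom_id _) rfl
  unfold κ
  change _ ≫ rw' (F.sq C.eps ≫ (F.unitIso y).inv) (F.lo n) _ ≫ _ = _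
  rw [comp_rw' _ _ _ (by simp) hc, Iso.inv_comp_eq, ← h2, Category.assoc, reassoc_of% h6,
    reassoc_of% h3, F.sq_comp]

end Companion

theorem isCompanionCommuter_of {x y x' y' : D.Obj} {m : D.Lo x y} {n : D.Lo x' y'}
    (α : LoArr.mk m ⟶ LoArr.mk n) {f : x ⟶ x'} {g : y ⟶ y'} (C₀ : Companion f) (C₁ : Companion g)
    (hf : D.dom α = f) (hg : D.cod α = g)
    (t : LoArr.mk (D.comp m C₁.lo) ⟶ LoArr.mk (D.comp C₀.lo n)) (ht : IsIso t)
    (hd : D.dom t = 𝟙 x) (hc : D.cod t = 𝟙 y') (e : C₁.χ m ≫ t ≫ C₀.κ n = α) :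
    IsCompanionCommuter α := by
  subst hf hg
  exact ⟨C₀, C₁, by rw [Companion.transpose_unique α C₀ C₁ rfl rfl t hd hc e]; exact ht⟩

theorem IsCompanionCommuter.id {x y : D.Obj} (m : D.Lo x y) :
    IsCompanionCommuter (𝟙 (LoArr.mk m)) := by
  have h1 : (Companion.id y).χ m = (D.rightUnitor m).inv := by
    unfold Companion.χ Companion.id
    rw [lw_id, Category.comp_id]
  have h2 : (Companion.id x).κ m = (D.leftUnitor m).hom := by
    unfold Companion.κ Companion.id
    rw [id_rw', Category.id_comp]
  have hi : IsIso ((D.rightUnitor m).hom ≫ (D.leftUnitor m).inv) := inferInstance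
  have hd : D.dom ((D.rightUnitor m).hom ≫ (D.leftUnitor m).inv) = 𝟙 x := by simp
  have hc : D.cod ((D.rightUnitor m).hom ≫ (D.leftUnitor m).inv) = 𝟙 y := by simp
  have e : (D.rightUnitor m).inv ≫ ((D.rightUnitor m).hom ≫ (D.leftUnitor m).inv) ≫
      (D.leftUnitor m).hom = 𝟙 _ := by simp
  refine isCompanionCommuter_of _ (Companion.id x) (Companion.id y) (by simp) (by simp)
    ((D.rightUnitor m).hom ≫ (D.leftUnitor m).inv) hi hd hc ?_
  rw [h1, h2]
  exact e

theorem IsCompanionCommuter.comp {x y x' y' x'' y'' : D.Obj} {m : D.Lo x y} {n : D.Lo x' y'}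
    {p : D.Lo x'' y''} {α : LoArr.mk m ⟶ LoArr.mk n} {β : LoArr.mk n ⟶ LoArr.mk p}
    (hα : IsCompanionCommuter α) (hβ : IsCompanionCommuter β) : IsCompanionCommuter (α ≫ β) := by
  obtain ⟨C₀, C₁, h⟩ := hα
  obtain ⟨C₀', C₁', h'⟩ := hβ
  have e := Companion.χ_transpose_κ α C₀ C₁ rfl rfl
  have e' := Companion.χ_transpose_κ β C₀' C₁' rfl rfl
  have hd := Companion.dom_transpose α C₀ C₁ rfl rfl
  have hc := Companion.cod_transpose α C₀ C₁ rfl rfl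
  have hd' := Companion.dom_transpose β C₀' C₁' rfl rfl
  have hc' := Companion.cod_transpose β C₀' C₁' rfl rfl
  generalize Companion.transpose α C₀ C₁ rfl rfl = s at h e hd hc
  generalize Companion.transpose β C₀' C₁' rfl rfl = t at h' e' hd' hc'
  have i1 := Companion.isIso_rw' s C₁'.lo hc
  have i2 := Companion.isIso_lw C₀.lo t hd'
  have k1 : C₁'.χ (D.comp m C₁.lo) ≫ rw' s C₁'.lo hc = s ≫ C₁'.χ (D.comp C₀.lo n) := by
    unfold Companion.χ
    rw [Category.assoc, ← rw'_lw, ← Category.assoc, rw'_unit_inv, Category.assoc]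
  have k2 : lw C₀.lo t hd' ≫ C₀.κ (D.comp C₀'.lo p) = C₀.κ (D.comp n C₁'.lo) ≫ t := by
    unfold Companion.κ
    rw [← Category.assoc, ← rw'_lw, Category.assoc, unit_lw, Category.assoc]
  have k3 := C₀.χ_assoc_κ C₁' n
  obtain ⟨v, hv⟩ : ∃ v, v = (D.assoc m C₁.lo C₁'.lo).inv ≫ rw' s C₁'.lo hc ≫
    (D.assoc C₀.lo n C₁'.lo).hom ≫ lw C₀.lo t hd' ≫ (D.assoc C₀.lo C₀'.lo p).inv := ⟨_, rfl⟩
  have vi : IsIso v := by rw [hv]; infer_instance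
  have vd : D.dom v = 𝟙 x := by simp [hv, hd]
  have vc : D.cod v = 𝟙 y'' := by simp [hv, hc']
  have ve : (C₁.χ m ≫ C₁'.χ (D.comp m C₁.lo) ≫ (D.assoc m C₁.lo C₁'.lo).hom) ≫ v ≫
      (D.assoc C₀.lo C₀'.lo p).hom ≫ C₀.κ (D.comp C₀'.lo p) ≫ C₀'.κ p = α ≫ β := by
    simp only [hv, Category.assoc, Iso.hom_inv_id_assoc, Iso.inv_hom_id_assoc]
    rw [reassoc_of% k1, reassoc_of% k2, reassoc_of% k3, e', reassoc_of% e]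
  refine isCompanionCommuter_of _ (C₀.comp C₀') (C₁.comp C₁') (by simp) (by simp) v vi vd vc ?_
  rw [Companion.comp_χ, Companion.comp_κ]
  exact ve

theorem IsCompanionCommuter.map (F : DblFunctor D E) {x y x' y' : D.Obj} {m : D.Lo x y}
    {n : D.Lo x' y'} {α : LoArr.mk m ⟶ LoArr.mk n} (hα : IsCompanionCommuter α) :
    IsCompanionCommuter (F.sq α) := by
  obtain ⟨C₀, C₁, h⟩ := hα
  have e := Companion.χ_transpose_κ α C₀ C₁ rfl rfl
  have hd := Companion.dom_transpose α C₀ C₁ rfl rfl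
  have hc := Companion.cod_transpose α C₀ C₁ rfl rfl
  generalize Companion.transpose α C₀ C₁ rfl rfl = s at h e hd hc
  have i : IsIso (F.sq s) := (F.sqIso (asIso s)).isIso_hom
  have hd1 : E.dom (F.compIso C₀.lo n).inv = 𝟙 _ := dom_inv _ _ (by simp)
  have hc1 : E.cod (F.compIso C₀.lo n).inv = 𝟙 _ := cod_inv _ _ (by simp)
  have k1 := C₁.map_χ F m
  have k2 := C₀.map_κ F n
  obtain ⟨v, hv⟩ : ∃ v, v = (F.compIso m C₁.lo).hom ≫ F.sq s ≫ (F.compIso C₀.lo n).inv := ⟨_, rfl⟩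
  have vi : IsIso v := by rw [hv]; infer_instance
  have vd : E.dom v = 𝟙 _ := by simp [hv, hd, hd1]
  have vc : E.cod v = 𝟙 _ := by simp [hv, hc, hc1]
  refine isCompanionCommuter_of _ (C₀.map F) (C₁.map F) (by simp) (by simp) v vi vd vc ?_
  refine Eq.trans ?_ (congrArg F.sq e)
  rw [F.sq_comp, F.sq_comp, ← k1, ← k2, hv]
  generalize (Companion.map F C₁).χ (F.lo m) = a
  generalize (Companion.map F C₀).κ (F.lo n) = b
  change LoArr.mk (E.comp (F.lo C₀.lo) (F.lo n)) ⟶ _ at b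
  change _ ⟶ LoArr.mk (E.comp (F.lo m) (F.lo C₁.lo)) at a
  exact (congrArg (a ≫ ·) ((Category.assoc _ _ _).trans
    (congrArg _ (Category.assoc _ _ _)))).trans (Category.assoc _ _ _).symm

end DblCat

namespace DblCat

/-- The category of loose arrows of the horizontal opposite. -/
@[reducible] def hopLoose (D : DblCat.{u}) : Category.{u} (LoArr fun x y : D.Obj => D.Lo y x) where
  Hom m n := LoArr.mk m.arr ⟶ LoArr.mk n.arr
  id m := 𝟙 (LoArr.mk m.arr)
  comp α β := α ≫ β
  id_comp _ := Category.id_comp _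
  comp_id _ := Category.comp_id _
  assoc _ _ _ := Category.assoc _ _ _

/-- A square isomorphism seen in the horizontal opposite. -/
@[reducible] def hopIso {D : DblCat.{u}} {x y x' y' : D.Obj} {m : D.Lo x y} {n : D.Lo x' y'}
    (e : LoArr.mk m ≅ LoArr.mk n) :
    @Iso _ D.hopLoose (@LoArr.mk D.Obj (fun x y => D.Lo y x) y x m)
      (@LoArr.mk D.Obj (fun x y => D.Lo y x) y' x' n) :=
  @Iso.mk _ D.hopLoose _ _ e.hom e.inv e.hom_inv_id e.inv_hom_id

/-- The horizontal opposite, in which loose arrows are reversed. -/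
def hop (D : DblCat.{u}) : DblCat.{u} where
  Obj := D.Obj
  Lo x y := D.Lo y x
  loose := D.hopLoose
  dom α := D.cod α
  cod α := D.dom α
  dom_id _ := D.cod_id _
  cod_id _ := D.dom_id _
  dom_comp _ _ := D.cod_comp _ _
  cod_comp _ _ := D.dom_comp _ _
  unit x := D.unit x
  unitSq f := D.unitSq f
  dom_unitSq f := D.cod_unitSq f
  cod_unitSq f := D.dom_unitSq f
  unitSq_id x := D.unitSq_id x
  unitSq_comp f g := D.unitSq_comp f g
  comp m n := D.comp n m
  compSq α β h := D.compSq β α h.symm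
  dom_compSq α β h := D.cod_compSq _ _ _
  cod_compSq α β h := D.dom_compSq _ _ _
  compSq_id m n h := D.compSq_id _ _ _
  compSq_comp α β h α' β' h' h'' := D.compSq_comp _ _ _ _ _ _ _
  assoc m n p := hopIso (D.assoc p n m).symm
  dom_assoc m n p := D.cod_assoc_inv p n m
  cod_assoc m n p := D.dom_assoc_inv p n m
  assoc_naturality {_ _ _ _ _ _ _ _ m n p m' n' p'} α β γ h k := by
    have e := D.assoc_naturality (m := p) (n := n) (p := m) (m' := p') (n' := n') (p' := m')
      γ β α k.symm h.symm
    have e' := (Iso.eq_comp_inv (D.assoc p' n' m')).2 e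
    exact ((Iso.inv_comp_eq _).2 (e'.trans (Category.assoc _ _ _))).symm
  leftUnitor m := hopIso (D.rightUnitor m)
  dom_leftUnitor m := D.cod_rightUnitor m
  cod_leftUnitor m := D.dom_rightUnitor m
  leftUnitor_naturality α := D.rightUnitor_naturality α
  rightUnitor m := hopIso (D.leftUnitor m)
  dom_rightUnitor m := D.cod_leftUnitor m
  cod_rightUnitor m := D.dom_leftUnitor m
  rightUnitor_naturality α := D.leftUnitor_naturality α
  pentagon m n p q := congrArg Glob.sq (Bicategory.pentagon_inv (B := Horiz D)
    (a := ⟨_⟩) (b := ⟨_⟩) (c := ⟨_⟩) (d := ⟨_⟩) (e := ⟨_⟩) q p n m)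
  triangle m n := congrArg Glob.sq (Bicategory.triangle_assoc_comp_right (B := Horiz D)
    (a := ⟨_⟩) (b := ⟨_⟩) (c := ⟨_⟩) n m)

variable {D E : DblCat.{u}}

/-- The double functor between horizontal opposites. -/
def hopFunctor (F : DblFunctor D E) : DblFunctor D.hop E.hop where
  tight := F.tight
  lo m := F.lo m
  sq α := F.sq α
  sq_id _ := F.sq_id _
  sq_comp _ _ := F.sq_comp _ _
  dom_sq _ := F.cod_sq _
  cod_sq _ := F.dom_sq _
  unitIso x := hopIso (F.unitIso x)
  dom_unitIso x := F.cod_unitIso x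
  cod_unitIso x := F.dom_unitIso x
  unitIso_naturality f := F.unitIso_naturality f
  compIso m n := hopIso (F.compIso n m)
  dom_compIso m n := F.cod_compIso n m
  cod_compIso m n := F.dom_compIso n m
  compIso_naturality α β h := F.compIso_naturality _ _ _
  map_assoc m n p := by
    have h := F.map_assoc p n m
    have e : (E.assoc (F.lo p) (F.lo n) (F.lo m)).inv ≫
        E.compSq (F.compIso p n).hom (𝟙 (LoArr.mk (F.lo m)))
          ((F.cod_compIso p n).trans (E.dom_id (LoArr.mk (F.lo m))).symm) ≫
          (F.compIso (D.comp p n) m).hom =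
        E.compSq (𝟙 (LoArr.mk (F.lo p))) (F.compIso n m).hom
          ((E.cod_id (LoArr.mk (F.lo p))).trans (F.dom_compIso n m).symm) ≫
          (F.compIso p (D.comp n m)).hom ≫ F.sq (D.assoc p n m).inv := by
      rw [Iso.inv_comp_eq, ← cancel_mono (F.sqIso (D.assoc p n m)).hom]
      simp only [Category.assoc]
      refine h.trans ?_
      have : F.sq (D.assoc p n m).inv ≫ (F.sqIso (D.assoc p n m)).hom = 𝟙 _ :=
        (F.sqIso (D.assoc p n m)).inv_hom_id
      rw [this, Category.comp_id]
    exact e.symm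
  map_leftUnitor m := F.map_rightUnitor m
  map_rightUnitor m := F.map_leftUnitor m

/-- A conjoint is a companion in the horizontal opposite. -/
def Conjoint.toHop {x y : D.Obj} {f : x ⟶ y} (C : Conjoint f) : Companion (D := D.hop) f :=
  ⟨C.lo, C.eta, C.eps, C.cod_eta, C.dom_eta, C.cod_eps, C.dom_eps, C.eta_eps, C.zigzag⟩

/-- A companion in the horizontal opposite is a conjoint. -/
def Conjoint.ofHop {x y : D.Obj} {f : x ⟶ y} (C : Companion (D := D.hop) f) : Conjoint (D := D) f :=
  ⟨C.lo, C.eta, C.eps, C.cod_eta, C.dom_eta, C.cod_eps, C.dom_eps, C.eta_eps, C.zigzag⟩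

/-- A square of the horizontal opposite. -/
def hopSq {x y x' y' : D.Obj} {m : D.Lo x y} {n : D.Lo x' y'} (α : LoArr.mk m ⟶ LoArr.mk n) :
    @LoArr.mk D.hop.Obj D.hop.Lo y x m ⟶ @LoArr.mk D.hop.Obj D.hop.Lo y' x' n := α

theorem isIso_hopSq {x y x' y' : D.Obj} {m : D.Lo x y} {n : D.Lo x' y'}
    (α : LoArr.mk m ⟶ LoArr.mk n) : IsIso (hopSq α) ↔ IsIso α :=
  ⟨fun ⟨b, h⟩ => ⟨b, h⟩, fun ⟨b, h⟩ => ⟨b, h⟩⟩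

theorem isConjointCommuter_iff {x y x' y' : D.Obj} {m : D.Lo x y} {n : D.Lo x' y'}
    (α : LoArr.mk m ⟶ LoArr.mk n) : IsConjointCommuter α ↔
      IsCompanionCommuter (D := D.hop) (x := y) (y := x) (x' := y') (y' := x') (hopSq α) := by
  constructor
  · rintro ⟨C₀, C₁, h⟩
    exact ⟨C₁.toHop, C₀.toHop, (isIso_hopSq _).2 h⟩
  · rintro ⟨C₁, C₀, h⟩
    exact ⟨Conjoint.ofHop C₀, Conjoint.ofHop C₁, (isIso_hopSq _).1 h⟩

theorem IsConjointCommuter.id {x y : D.Obj} (m : D.Lo x y) :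
    IsConjointCommuter (𝟙 (LoArr.mk m)) :=
  (isConjointCommuter_iff _).2 (IsCompanionCommuter.id (D := D.hop) (x := y) (y := x) m)

theorem IsConjointCommuter.comp {x y x' y' x'' y'' : D.Obj} {m : D.Lo x y} {n : D.Lo x' y'}
    {p : D.Lo x'' y''} {α : LoArr.mk m ⟶ LoArr.mk n} {β : LoArr.mk n ⟶ LoArr.mk p}
    (hα : IsConjointCommuter α) (hβ : IsConjointCommuter β) : IsConjointCommuter (α ≫ β) :=
  (isConjointCommuter_iff _).2
    (IsCompanionCommuter.comp (D := D.hop) ((isConjointCommuter_iff _).1 hα)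
      ((isConjointCommuter_iff _).1 hβ))

theorem IsConjointCommuter.map (F : DblFunctor D E) {x y x' y' : D.Obj} {m : D.Lo x y}
    {n : D.Lo x' y'} {α : LoArr.mk m ⟶ LoArr.mk n} (hα : IsConjointCommuter α) :
    IsConjointCommuter (F.sq α) :=
  (isConjointCommuter_iff _).2 (((isConjointCommuter_iff _).1 hα).map (hopFunctor F))

end DblCat

/-- A tight transformation is a companion commuter if its components at loose arrows are. -/
def DblTrans.IsCompanionCommuter {D E : DblCat.{u}} {F G : DblFunctor D E} (α : DblTrans F G) :
    Prop :=
  (∀ x, Nonempty (DblCat.Companion (α.app x))) ∧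
    ∀ {x y : D.Obj} (m : D.Lo x y), DblCat.IsCompanionCommuter (α.sq m)

/-- A tight transformation is a conjoint commuter if its components at loose arrows are. -/
def DblTrans.IsConjointCommuter {D E : DblCat.{u}} {F G : DblFunctor D E} (α : DblTrans F G) :
    Prop :=
  (∀ x, Nonempty (DblCat.Conjoint (α.app x))) ∧
    ∀ {x y : D.Obj} (m : D.Lo x y), DblCat.IsConjointCommuter (α.sq m)

namespace DblCat

/-- The squares of `DblCat.ofRel`. -/
@[reducible] def relLoose {X : Type u} (R : X → X → Prop) :
    Category.{u} (LoArr fun x y : X => ULift.{u} (PLift (R x y))) where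
  Hom m n := ULift.{u} (PLift (m.src = n.src ∧ m.tgt = n.tgt))
  id _ := ⟨⟨rfl, rfl⟩⟩
  comp α β := ⟨⟨α.down.down.1.trans β.down.down.1, α.down.down.2.trans β.down.down.2⟩⟩

/-- A square isomorphism of `DblCat.ofRel`. -/
@[reducible] def relIso {X : Type u} {R : X → X → Prop} {x y : X}
    (m n : ULift.{u} (PLift (R x y))) :
    @Iso _ (relLoose R) (@LoArr.mk _ (fun x y => ULift.{u} (PLift (R x y))) x y m)
      (@LoArr.mk _ (fun x y => ULift.{u} (PLift (R x y))) x y n) :=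
  @Iso.mk _ (relLoose R) _ _ ⟨⟨rfl, rfl⟩⟩ ⟨⟨rfl, rfl⟩⟩ rfl rfl

/-- The double category of a preorder relation: the tight category is discrete, there is a loose
arrow from `x` to `y` exactly when `R x y`, and the only squares are identities. -/
def ofRel {X : Type u} (R : X → X → Prop) (hr : ∀ x, R x x) (ht : ∀ {x y z}, R x y → R y z → R x z) :
    DblCat.{u} where
  Obj := X
  tight :=
    { Hom := fun x y => ULift.{u} (PLift (x = y))
      id := fun x => ⟨⟨rfl⟩⟩
      comp := fun f g => ⟨⟨f.down.down.trans g.down.down⟩⟩ }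
  Lo x y := ULift.{u} (PLift (R x y))
  loose := relLoose R
  dom α := ⟨⟨α.down.down.1⟩⟩
  cod α := ⟨⟨α.down.down.2⟩⟩
  dom_id _ := rfl
  cod_id _ := rfl
  dom_comp _ _ := rfl
  cod_comp _ _ := rfl
  unit x := ⟨⟨hr x⟩⟩
  unitSq f := ⟨⟨f.down.down, f.down.down⟩⟩
  dom_unitSq _ := rfl
  cod_unitSq _ := rfl
  unitSq_id _ := rfl
  unitSq_comp _ _ := rfl
  comp m n := ⟨⟨ht m.down.down n.down.down⟩⟩
  compSq α β _ := ⟨⟨α.down.down.1, β.down.down.2⟩⟩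
  dom_compSq _ _ _ := rfl
  cod_compSq _ _ _ := rfl
  compSq_id _ _ _ := rfl
  compSq_comp _ _ _ _ _ _ _ := rfl
  assoc _ _ _ := relIso _ _
  dom_assoc _ _ _ := rfl
  cod_assoc _ _ _ := rfl
  assoc_naturality _ _ _ _ _ := rfl
  leftUnitor _ := relIso _ _
  dom_leftUnitor _ := rfl
  cod_leftUnitor _ := rfl
  leftUnitor_naturality _ := rfl
  rightUnitor _ := relIso _ _
  dom_rightUnitor _ := rfl
  cod_rightUnitor _ := rfl
  rightUnitor_naturality _ := rfl
  pentagon _ _ _ _ := rfl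
  triangle _ _ := rfl

/-- The terminal double category, the point. -/
def Pt : DblCat.{u} := ofRel (X := PUnit.{u + 1}) (fun _ _ => True) (fun _ => trivial)
  (fun _ _ => trivial)

end DblCat

/-- The two ends of a loose bimodule. -/
inductive Side : Type u
  | zero
  | one

namespace DblCat

/-- The walking loose arrow, from `Side.zero` to `Side.one`. -/
def Loose : DblCat.{u} := ofRel (X := Side.{u}) (fun i j => i = j ∨ i = .zero ∧ j = .one)
  (fun _ => Or.inl rfl) (by rintro _ _ _ (rfl | ⟨rfl, rfl⟩) (rfl | ⟨h, rfl⟩) <;> simp_all)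

instance (x y : Loose.{u}.Obj) : Subsingleton (x ⟶ y) :=
  ⟨fun ⟨⟨_⟩⟩ ⟨⟨_⟩⟩ => rfl⟩
instance (x y : LoArr Loose.{u}.Lo) : Subsingleton (x ⟶ y) :=
  ⟨fun ⟨⟨_⟩⟩ ⟨⟨_⟩⟩ => rfl⟩

instance {D : DblCat.{u}} (F G : D ⟶ Loose.{u}) : Subsingleton (F ⟶ G) :=
  ⟨fun _ _ => DblTrans.hom_ext (fun _ => Subsingleton.elim _ _) (fun _ => Subsingleton.elim _ _)⟩

section full

variable (D : DblCat.{u}) (P : D.Obj → Prop)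

/-- Loose arrows and squares between objects satisfying `P`. -/
@[reducible] def fullLoose : Category.{u} (LoArr fun x y : {x // P x} => D.Lo x.1 y.1) where
  Hom m n := LoArr.mk m.arr ⟶ LoArr.mk n.arr
  id m := 𝟙 (LoArr.mk m.arr)
  comp α β := α ≫ β
  id_comp _ := Category.id_comp _
  comp_id _ := Category.comp_id _
  assoc _ _ _ := Category.assoc _ _ _

/-- Tight arrows between objects satisfying `P`. -/
@[reducible] def fullTight : Category.{u} {x // P x} where
  Hom x y := x.1 ⟶ y.1
  id x := 𝟙 x.1
  comp f g := f ≫ g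
  id_comp _ := Category.id_comp _
  comp_id _ := Category.comp_id _
  assoc _ _ _ := Category.assoc _ _ _

variable {D P} in
/-- A square isomorphism between objects satisfying `P`. -/
@[reducible] def fullIso {x y x' y' : {x // P x}} {m : D.Lo x.1 y.1} {n : D.Lo x'.1 y'.1}
    (e : LoArr.mk m ≅ LoArr.mk n) :
    @Iso _ (D.fullLoose P) (@LoArr.mk _ (fun x y : {x // P x} => D.Lo x.1 y.1) x y m)
      (@LoArr.mk _ (fun x y : {x // P x} => D.Lo x.1 y.1) x' y' n) :=
  @Iso.mk _ (D.fullLoose P) _ _ e.hom e.inv e.hom_inv_id e.inv_hom_id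

/-- The full sub double category on the objects satisfying `P`. -/
def full : DblCat.{u} where
  Obj := {x // P x}
  tight := D.fullTight P
  Lo x y := D.Lo x.1 y.1
  loose := D.fullLoose P
  dom α := D.dom α
  cod α := D.cod α
  dom_id _ := D.dom_id _
  cod_id _ := D.cod_id _
  dom_comp _ _ := D.dom_comp _ _
  cod_comp _ _ := D.cod_comp _ _
  unit x := D.unit x.1
  unitSq f := D.unitSq f
  dom_unitSq _ := D.dom_unitSq _
  cod_unitSq _ := D.cod_unitSq _
  unitSq_id _ := D.unitSq_id _
  unitSq_comp _ _ := D.unitSq_comp _ _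
  comp m n := D.comp m n
  compSq α β h := D.compSq α β h
  dom_compSq _ _ _ := D.dom_compSq _ _ _
  cod_compSq _ _ _ := D.cod_compSq _ _ _
  compSq_id _ _ _ := D.compSq_id _ _ _
  compSq_comp _ _ _ _ _ _ _ := D.compSq_comp _ _ _ _ _ _ _
  assoc m n p := fullIso (D.assoc m n p)
  dom_assoc _ _ _ := D.dom_assoc _ _ _
  cod_assoc _ _ _ := D.cod_assoc _ _ _
  assoc_naturality _ _ _ h k := D.assoc_naturality _ _ _ h k
  leftUnitor m := fullIso (D.leftUnitor m)
  dom_leftUnitor _ := D.dom_leftUnitor _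
  cod_leftUnitor _ := D.cod_leftUnitor _
  leftUnitor_naturality _ := D.leftUnitor_naturality _
  rightUnitor m := fullIso (D.rightUnitor m)
  dom_rightUnitor _ := D.dom_rightUnitor _
  cod_rightUnitor _ := D.cod_rightUnitor _
  rightUnitor_naturality _ := D.rightUnitor_naturality _
  pentagon _ _ _ _ := D.pentagon _ _ _ _
  triangle _ _ := D.triangle _ _

variable {D P} {E : DblCat.{u}} {Q : E.Obj → Prop}

/-- A double functor restricts to full sub double categories. -/
def fullMap (F : DblFunctor D E) (h : ∀ x, P x → Q (F.tight.obj x)) :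
    DblFunctor (D.full P) (E.full Q) where
  tight :=
    { obj := fun x => ⟨F.tight.obj x.1, h x.1 x.2⟩
      map := fun f => F.tight.map f
      map_id := fun _ => F.tight.map_id _
      map_comp := fun _ _ => F.tight.map_comp _ _ }
  lo m := F.lo m
  sq α := F.sq α
  sq_id _ := F.sq_id _
  sq_comp _ _ := F.sq_comp _ _
  dom_sq _ := F.dom_sq _
  cod_sq _ := F.cod_sq _
  unitIso x := fullIso (F.unitIso x.1)
  dom_unitIso _ := F.dom_unitIso _
  cod_unitIso _ := F.cod_unitIso _
  unitIso_naturality _ := F.unitIso_naturality _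
  compIso m n := fullIso (F.compIso m n)
  dom_compIso _ _ := F.dom_compIso _ _
  cod_compIso _ _ := F.cod_compIso _ _
  compIso_naturality _ _ h := F.compIso_naturality _ _ h
  map_assoc _ _ _ := F.map_assoc _ _ _
  map_leftUnitor _ := F.map_leftUnitor _
  map_rightUnitor _ := F.map_rightUnitor _

/-- A tight transformation restricts to full sub double categories. -/
def fullTrans {F G : DblFunctor D E} (α : DblTrans F G) (h : ∀ x, P x → Q (F.tight.obj x))
    (k : ∀ x, P x → Q (G.tight.obj x)) :
    DblTrans (fullMap (P := P) (Q := Q) F h) (fullMap G k) where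
  app x := α.app x.1
  sq m := α.sq m
  naturality _ := α.naturality _
  dom_sq _ := α.dom_sq _
  cod_sq _ := α.cod_sq _
  sq_naturality _ := α.sq_naturality _
  unit _ := α.unit _
  comp _ _ := α.comp _ _

end full

section prod

variable (D E : DblCat.{u})

/-- Squares of a product. -/
@[reducible] def prodLoose :
    Category.{u} (LoArr fun x y : D.Obj × E.Obj => D.Lo x.1 y.1 × E.Lo x.2 y.2) where
  Hom m n := (LoArr.mk m.arr.1 ⟶ LoArr.mk n.arr.1) × (LoArr.mk m.arr.2 ⟶ LoArr.mk n.arr.2)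
  id m := (𝟙 _, 𝟙 _)
  comp α β := (α.1 ≫ β.1, α.2 ≫ β.2)
  id_comp _ := Prod.ext (Category.id_comp _) (Category.id_comp _)
  comp_id _ := Prod.ext (Category.comp_id _) (Category.comp_id _)
  assoc _ _ _ := Prod.ext (Category.assoc _ _ _) (Category.assoc _ _ _)

/-- Tight arrows of a product. -/
@[reducible] def prodTight : Category.{u} (D.Obj × E.Obj) where
  Hom x y := (x.1 ⟶ y.1) × (x.2 ⟶ y.2)
  id x := (𝟙 _, 𝟙 _)
  comp f g := (f.1 ≫ g.1, f.2 ≫ g.2)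
  id_comp _ := Prod.ext (Category.id_comp _) (Category.id_comp _)
  comp_id _ := Prod.ext (Category.comp_id _) (Category.comp_id _)
  assoc _ _ _ := Prod.ext (Category.assoc _ _ _) (Category.assoc _ _ _)

variable {D E} in
/-- A pair of square isomorphisms. -/
@[reducible] def prodIso {x y x' y' : D.Obj × E.Obj} {m : D.Lo x.1 y.1} {m' : D.Lo x'.1 y'.1}
    {n : E.Lo x.2 y.2} {n' : E.Lo x'.2 y'.2}
    (e : LoArr.mk m ≅ LoArr.mk m') (e' : LoArr.mk n ≅ LoArr.mk n') :
    @Iso _ (D.prodLoose E)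
      (@LoArr.mk _ (fun x y : D.Obj × E.Obj => D.Lo x.1 y.1 × E.Lo x.2 y.2) x y (m, n))
      (@LoArr.mk _ (fun x y : D.Obj × E.Obj => D.Lo x.1 y.1 × E.Lo x.2 y.2) x' y' (m', n')) :=
  @Iso.mk _ (D.prodLoose E) _ _ (e.hom, e'.hom) (e.inv, e'.inv)
    (Prod.ext e.hom_inv_id e'.hom_inv_id) (Prod.ext e.inv_hom_id e'.inv_hom_id)

/-- The product of two double categories. -/
def prod : DblCat.{u} where
  Obj := D.Obj × E.Obj
  tight := D.prodTight E
  Lo x y := D.Lo x.1 y.1 × E.Lo x.2 y.2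
  loose := D.prodLoose E
  dom α := (D.dom α.1, E.dom α.2)
  cod α := (D.cod α.1, E.cod α.2)
  dom_id _ := Prod.ext (D.dom_id _) (E.dom_id _)
  cod_id _ := Prod.ext (D.cod_id _) (E.cod_id _)
  dom_comp _ _ := Prod.ext (D.dom_comp _ _) (E.dom_comp _ _)
  cod_comp _ _ := Prod.ext (D.cod_comp _ _) (E.cod_comp _ _)
  unit x := (D.unit x.1, E.unit x.2)
  unitSq f := (D.unitSq f.1, E.unitSq f.2)
  dom_unitSq _ := Prod.ext (D.dom_unitSq _) (E.dom_unitSq _)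
  cod_unitSq _ := Prod.ext (D.cod_unitSq _) (E.cod_unitSq _)
  unitSq_id _ := Prod.ext (D.unitSq_id _) (E.unitSq_id _)
  unitSq_comp _ _ := Prod.ext (D.unitSq_comp _ _) (E.unitSq_comp _ _)
  comp m n := (D.comp m.1 n.1, E.comp m.2 n.2)
  compSq α β h :=
    (D.compSq α.1 β.1 (congrArg Prod.fst h), E.compSq α.2 β.2 (congrArg Prod.snd h))
  dom_compSq _ _ _ := Prod.ext (D.dom_compSq _ _ _) (E.dom_compSq _ _ _)
  cod_compSq _ _ _ := Prod.ext (D.cod_compSq _ _ _) (E.cod_compSq _ _ _)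
  compSq_id _ _ _ := Prod.ext (D.compSq_id _ _ _) (E.compSq_id _ _ _)
  compSq_comp _ _ _ _ _ _ _ :=
    Prod.ext (D.compSq_comp _ _ _ _ _ _ _) (E.compSq_comp _ _ _ _ _ _ _)
  assoc m n p := prodIso (D.assoc m.1 n.1 p.1) (E.assoc m.2 n.2 p.2)
  dom_assoc _ _ _ := Prod.ext (D.dom_assoc _ _ _) (E.dom_assoc _ _ _)
  cod_assoc _ _ _ := Prod.ext (D.cod_assoc _ _ _) (E.cod_assoc _ _ _)
  assoc_naturality α β γ h k := Prod.ext
    (D.assoc_naturality α.1 β.1 γ.1 (congrArg Prod.fst h) (congrArg Prod.fst k))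
    (E.assoc_naturality α.2 β.2 γ.2 (congrArg Prod.snd h) (congrArg Prod.snd k))
  leftUnitor m := prodIso (D.leftUnitor m.1) (E.leftUnitor m.2)
  dom_leftUnitor _ := Prod.ext (D.dom_leftUnitor _) (E.dom_leftUnitor _)
  cod_leftUnitor _ := Prod.ext (D.cod_leftUnitor _) (E.cod_leftUnitor _)
  leftUnitor_naturality _ := Prod.ext (D.leftUnitor_naturality _) (E.leftUnitor_naturality _)
  rightUnitor m := prodIso (D.rightUnitor m.1) (E.rightUnitor m.2)
  dom_rightUnitor _ := Prod.ext (D.dom_rightUnitor _) (E.dom_rightUnitor _)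
  cod_rightUnitor _ := Prod.ext (D.cod_rightUnitor _) (E.cod_rightUnitor _)
  rightUnitor_naturality _ := Prod.ext (D.rightUnitor_naturality _) (E.rightUnitor_naturality _)
  pentagon _ _ _ _ := Prod.ext (D.pentagon _ _ _ _) (E.pentagon _ _ _ _)
  triangle _ _ := Prod.ext (D.triangle _ _) (E.triangle _ _)

/-- The second projection. -/
def prodSnd : DblFunctor (D.prod E) E where
  tight :=
    { obj := fun x => x.2
      map := fun f => f.2
      map_id := fun _ => rfl
      map_comp := fun _ _ => rfl }
  lo m := m.2
  sq α := α.2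
  sq_id _ := rfl
  sq_comp _ _ := rfl
  dom_sq _ := rfl
  cod_sq _ := rfl
  unitIso _ := Iso.refl _
  dom_unitIso _ := E.dom_id _
  cod_unitIso _ := E.cod_id _
  unitIso_naturality f := (Category.comp_id _).trans (Category.id_comp _).symm
  compIso _ _ := Iso.refl _
  dom_compIso _ _ := E.dom_id _
  cod_compIso _ _ := E.cod_id _
  compIso_naturality α β h := (Category.comp_id _).trans (Category.id_comp _).symm
  map_assoc m n p := (DblFunctor.id E).map_assoc m.2 n.2 p.2
  map_leftUnitor m := (DblFunctor.id E).map_leftUnitor m.2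
  map_rightUnitor m := (DblFunctor.id E).map_rightUnitor m.2

variable {D E} {D' E' : DblCat.{u}}

/-- The product of two double functors. -/
def prodMap (F : DblFunctor D D') (G : DblFunctor E E') :
    DblFunctor (D.prod E) (D'.prod E') where
  tight :=
    { obj := fun x => (F.tight.obj x.1, G.tight.obj x.2)
      map := fun f => (F.tight.map f.1, G.tight.map f.2)
      map_id := fun _ => Prod.ext (F.tight.map_id _) (G.tight.map_id _)
      map_comp := fun _ _ => Prod.ext (F.tight.map_comp _ _) (G.tight.map_comp _ _) }
  lo m := (F.lo m.1, G.lo m.2)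
  sq α := (F.sq α.1, G.sq α.2)
  sq_id _ := Prod.ext (F.sq_id _) (G.sq_id _)
  sq_comp _ _ := Prod.ext (F.sq_comp _ _) (G.sq_comp _ _)
  dom_sq _ := Prod.ext (F.dom_sq _) (G.dom_sq _)
  cod_sq _ := Prod.ext (F.cod_sq _) (G.cod_sq _)
  unitIso x := prodIso (F.unitIso x.1) (G.unitIso x.2)
  dom_unitIso _ := Prod.ext (F.dom_unitIso _) (G.dom_unitIso _)
  cod_unitIso _ := Prod.ext (F.cod_unitIso _) (G.cod_unitIso _)
  unitIso_naturality _ := Prod.ext (F.unitIso_naturality _) (G.unitIso_naturality _)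
  compIso m n := prodIso (F.compIso m.1 n.1) (G.compIso m.2 n.2)
  dom_compIso _ _ := Prod.ext (F.dom_compIso _ _) (G.dom_compIso _ _)
  cod_compIso _ _ := Prod.ext (F.cod_compIso _ _) (G.cod_compIso _ _)
  compIso_naturality α β h := Prod.ext
    (F.compIso_naturality α.1 β.1 (congrArg Prod.fst h))
    (G.compIso_naturality α.2 β.2 (congrArg Prod.snd h))
  map_assoc _ _ _ := Prod.ext (F.map_assoc _ _ _) (G.map_assoc _ _ _)
  map_leftUnitor _ := Prod.ext (F.map_leftUnitor _) (G.map_leftUnitor _)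
  map_rightUnitor _ := Prod.ext (F.map_rightUnitor _) (G.map_rightUnitor _)

/-- The product of two tight transformations. -/
def prodTrans {F F' : DblFunctor D D'} {G G' : DblFunctor E E'} (α : DblTrans F F')
    (β : DblTrans G G') : DblTrans (prodMap F G) (prodMap F' G') where
  app x := (α.app x.1, β.app x.2)
  sq m := (α.sq m.1, β.sq m.2)
  naturality _ := Prod.ext (α.naturality _) (β.naturality _)
  dom_sq _ := Prod.ext (α.dom_sq _) (β.dom_sq _)
  cod_sq _ := Prod.ext (α.cod_sq _) (β.cod_sq _)
  sq_naturality _ := Prod.ext (α.sq_naturality _) (β.sq_naturality _)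
  unit _ := Prod.ext (α.unit _) (β.unit _)
  comp _ _ := Prod.ext (α.comp _ _) (β.comp _ _)

/-- The inclusion of the end `i` of a product with the walking loose arrow. -/
def inEnd (D : DblCat.{u}) (i : Side.{u}) :
    DblFunctor D ((D.prod Loose).full fun x => x.2 = i) where
  tight :=
    { obj := fun x => ⟨(x, i), rfl⟩
      map := fun f => (f, ⟨⟨rfl⟩⟩)
      map_id := fun _ => rfl
      map_comp := fun _ _ => rfl }
  lo m := (m, ⟨⟨Or.inl rfl⟩⟩)
  sq α := (α, ⟨⟨rfl, rfl⟩⟩)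
  sq_id _ := rfl
  sq_comp _ _ := rfl
  dom_sq _ := rfl
  cod_sq _ := rfl
  unitIso _ := Iso.refl _
  dom_unitIso _ := DblCat.dom_id _ _
  cod_unitIso _ := DblCat.cod_id _ _
  unitIso_naturality f := (Category.comp_id _).trans (Category.id_comp _).symm
  compIso _ _ := Iso.refl _
  dom_compIso _ _ := DblCat.dom_id _ _
  cod_compIso _ _ := DblCat.cod_id _ _
  compIso_naturality α β h := (Category.comp_id _).trans (Category.id_comp _).symm
  map_assoc m n p := Prod.ext ((DblFunctor.id D).map_assoc m n p) rfl
  map_leftUnitor m := Prod.ext ((DblFunctor.id D).map_leftUnitor m) rfl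
  map_rightUnitor m := Prod.ext ((DblFunctor.id D).map_rightUnitor m) rfl

end prod

end DblCat

theorem eq_conj_eqToHom {C : Type*} [Category* C] {X X' Y Y' : C} {f : X ⟶ Y} {g : X' ⟶ Y'}
    (h : X = X') (k : Y' = Y) (e : HEq f g) : f = eqToHom h ≫ g ≫ eqToHom k := by
  subst h k
  cases e
  simp

/-- A loose bimodule, presented by its collage with its labelling in the walking loose arrow. -/
structure LooseBimod : Type (u + 1) where
  collage : DblCat.{u}
  label : collage ⟶ DblCat.Loose.{u}

namespace LooseBimod

/-- A map of loose bimodules: a double functor between collages that respects the labels. -/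
structure Hom (M N : LooseBimod.{u}) : Type u where
  functor : M.collage ⟶ N.collage
  w : functor ≫ N.label = M.label

instance : CategoryStruct.{u} LooseBimod.{u} where
  Hom M N := Hom M N
  id M := ⟨𝟙 M.collage, DblCat.strict.id_comp _⟩
  comp F G := ⟨F.functor ≫ G.functor, by rw [DblCat.strict.assoc, G.w, F.w]⟩

/-- A 2-cell of loose bimodules: a tight transformation over the identity of labels. -/
structure Hom₂ {M N : LooseBimod.{u}} (F G : M ⟶ N) : Type u where
  trans : F.functor ⟶ G.functor
  w : trans ▷ N.label = eqToHom (F.w.trans G.w.symm)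

theorem Hom₂.ext' {M N : LooseBimod.{u}} {F G : M ⟶ N} {α β : Hom₂ F G}
    (h : α.trans = β.trans) : α = β := by
  cases α; cases β; cases h; rfl

theorem hom_ext {M N : LooseBimod.{u}} {F G : M ⟶ N} (h : F.functor = G.functor) : F = G := by
  rcases F with ⟨f, hf⟩
  rcases G with ⟨g, hg⟩
  change f = g at h
  subst h; rfl

instance (M N : LooseBimod.{u}) : Category.{u} (M ⟶ N) where
  Hom F G := Hom₂ F G
  id F := ⟨𝟙 F.functor, Subsingleton.elim _ _⟩
  comp α β := ⟨Hom₂.trans α ≫ Hom₂.trans β, Subsingleton.elim _ _⟩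
  id_comp _ := Hom₂.ext' (Category.id_comp _)
  comp_id _ := Hom₂.ext' (Category.comp_id _)
  assoc _ _ _ := Hom₂.ext' (Category.assoc _ _ _)

/-- The 2-cell given by a tight transformation. -/
def mkHom₂ {M N : LooseBimod.{u}} {F G : M ⟶ N} (α : F.functor ⟶ G.functor) : F ⟶ G :=
  (⟨α, Subsingleton.elim _ _⟩ : Hom₂ F G)

/-- The invertible 2-cell given by an invertible tight transformation. -/
def isoMk {M N : LooseBimod.{u}} {F G : M ⟶ N} (e : F.functor ≅ G.functor) : F ≅ G where
  hom := mkHom₂ e.hom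
  inv := mkHom₂ e.inv
  hom_inv_id := Hom₂.ext' e.hom_inv_id
  inv_hom_id := Hom₂.ext' e.inv_hom_id

instance : Bicategory.{u, u} LooseBimod.{u} where
  whiskerLeft F _ _ α := mkHom₂ (F.functor ◁ Hom₂.trans α)
  whiskerRight α G := mkHom₂ (Hom₂.trans α ▷ G.functor)
  associator F G H := isoMk (α_ F.functor G.functor H.functor)
  leftUnitor F := isoMk (λ_ F.functor)
  rightUnitor F := isoMk (ρ_ F.functor)
  whiskerLeft_id _ _ := Hom₂.ext' (whiskerLeft_id _ _)
  whiskerLeft_comp _ _ _ _ _ _ := Hom₂.ext' (whiskerLeft_comp _ _ _)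
  id_whiskerLeft _ := Hom₂.ext' (id_whiskerLeft _)
  comp_whiskerLeft _ _ _ _ _ := Hom₂.ext' (comp_whiskerLeft _ _ _)
  id_whiskerRight _ _ := Hom₂.ext' (id_whiskerRight _ _)
  comp_whiskerRight _ _ _ := Hom₂.ext' (comp_whiskerRight _ _ _)
  whiskerRight_id _ := Hom₂.ext' (whiskerRight_id _)
  whiskerRight_comp _ _ _ := Hom₂.ext' (whiskerRight_comp _ _ _)
  whisker_assoc _ _ _ _ _ := Hom₂.ext' (whisker_assoc _ _ _)
  whisker_exchange _ _ := Hom₂.ext' (whisker_exchange _ _)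
  pentagon _ _ _ _ := Hom₂.ext' (pentagon _ _ _ _)
  triangle _ _ := Hom₂.ext' (triangle _ _)

theorem eqToHom_trans' {M N : LooseBimod.{u}} {F G : M ⟶ N} (h : F = G) :
    Hom₂.trans (eqToHom h) = eqToHom (congrArg Hom.functor h) := by
  subst h; rfl

theorem strict : Bicategory.Strict LooseBimod.{u} where
  id_comp F := hom_ext (DblCat.strict.id_comp _)
  comp_id F := hom_ext (DblCat.strict.comp_id _)
  assoc F G H := hom_ext (DblCat.strict.assoc _ _ _)
  leftUnitor_eqToIso F := by
    refine Iso.ext (Hom₂.ext' ?_)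
    refine Eq.trans ?_ (eqToHom_trans' (hom_ext (DblCat.strict.id_comp _))).symm
    exact congrArg Iso.hom (DblCat.strict.leftUnitor_eqToIso F.functor)
  rightUnitor_eqToIso F := by
    refine Iso.ext (Hom₂.ext' ?_)
    refine Eq.trans ?_ (eqToHom_trans' (hom_ext (DblCat.strict.comp_id _))).symm
    exact congrArg Iso.hom (DblCat.strict.rightUnitor_eqToIso F.functor)
  associator_eqToIso F G H := by
    refine Iso.ext (Hom₂.ext' ?_)
    refine Eq.trans ?_ (eqToHom_trans' (hom_ext (DblCat.strict.assoc _ _ _))).symm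
    exact congrArg Iso.hom (DblCat.strict.associator_eqToIso F.functor G.functor H.functor)

theorem Hom.label_obj {M N : LooseBimod.{u}} (F : M ⟶ N) (x : M.collage.Obj) :
    N.label.tight.obj (F.functor.tight.obj x) = M.label.tight.obj x :=
  congrArg (fun K => DblFunctor.tight K |>.obj x) F.w

/-- The objects of the collage over the end `i`. -/
def Over (M : LooseBimod.{u}) (i : Side.{u}) (x : M.collage.Obj) : Prop :=
  M.label.tight.obj x = i

/-- The source (`i = .zero`) or target (`i = .one`) of a loose bimodule. -/
def fiberObj (M : LooseBimod.{u}) (i : Side.{u}) : DblCat.{u} := M.collage.full (M.Over i)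

/-- The action of a map of loose bimodules on an end. -/
def fiberMap {M N : LooseBimod.{u}} (F : M ⟶ N) (i : Side.{u}) : M.fiberObj i ⟶ N.fiberObj i :=
  DblCat.fullMap F.functor fun x h => (F.label_obj x).trans h

/-- The action of a 2-cell of loose bimodules on an end. -/
def fiberMap₂ {M N : LooseBimod.{u}} {F G : M ⟶ N} (α : F ⟶ G) (i : Side.{u}) :
    fiberMap F i ⟶ fiberMap G i :=
  DblCat.fullTrans (Hom₂.trans α) (fun x h => (F.label_obj x).trans h)
    (fun x h => (G.label_obj x).trans h)

/-- The 2-functor sending a loose bimodule to its source (`i = .zero`) or target (`i = .one`). -/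
def fiber (i : Side.{u}) : StrictPseudofunctor LooseBimod.{u} DblCat.{u} :=
  letI := strict
  letI := DblCat.strict
  StrictPseudofunctor.mk''
    { obj := fun M => M.fiberObj i
      map := fun F => fiberMap F i
      map₂ := fun α => fiberMap₂ α i
      map₂_id := fun _ => rfl
      map₂_comp := fun _ _ => rfl
      map_id := fun _ => rfl
      map_comp := fun _ _ => rfl
      map₂_whisker_left := fun _ _ _ _ => eq_conj_eqToHom _ _ HEq.rfl
      map₂_whisker_right := fun _ _ => eq_conj_eqToHom _ _ HEq.rfl }

/-- The loose Hom bimodule of a double category, the projection `D × Loose ⟶ Loose`. -/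
def homBimod (D : DblCat.{u}) : LooseBimod.{u} := ⟨D.prod DblCat.Loose, D.prodSnd DblCat.Loose⟩

/-- The map between loose Hom bimodules induced by a double functor. -/
def homMap {D E : DblCat.{u}} (F : D ⟶ E) : homBimod D ⟶ homBimod E :=
  (⟨DblCat.prodMap F (𝟙 DblCat.Loose), rfl⟩ : Hom (homBimod D) (homBimod E))

/-- The 2-cell between loose Hom bimodules induced by a tight transformation. -/
def homMap₂ {D E : DblCat.{u}} {F G : D ⟶ E} (α : F ⟶ G) : homMap F ⟶ homMap G :=
  mkHom₂ (DblCat.prodTrans α (DblTrans.id (𝟙 DblCat.Loose)))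

/-- The identification of a double category with an end of its loose Hom bimodule. -/
def homEnd (D : DblCat.{u}) (i : Side.{u}) : D ⟶ (homBimod D).fiberObj i := D.inEnd i

end LooseBimod

namespace DblTrans

theorem hom_ext_sq {D E : DblCat.{u}} {F G : DblFunctor D E} {α β : F ⟶ G}
    (h : ∀ {x y : D.Obj} (m : D.Lo x y), DblTrans.sq α m = DblTrans.sq β m) : α = β := by
  refine hom_ext (fun x => ?_) h
  rw [← DblTrans.dom_sq α (D.unit x), ← DblTrans.dom_sq β (D.unit x), h]

variable {A B C D E G : DblCat.{u}}

theorem comp_sq' {F G H : D ⟶ E} (α : F ⟶ G) (β : G ⟶ H) {x y : D.Obj} (m : D.Lo x y) :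
    DblTrans.sq (α ≫ β) m = DblTrans.sq α m ≫ DblTrans.sq β m := rfl

/-- The identity colaxator. -/
def idColax (F : D ⟶ E) : F ≫ 𝟙 E ⟶ 𝟙 D ≫ F :=
  (DblCat.rightUnitIso F).hom ≫ (DblCat.leftUnitIso F).inv

theorem idColax_sq (F : D ⟶ E) {x y : D.Obj} (m : D.Lo x y) :
    DblTrans.sq (idColax F) m = 𝟙 (LoArr.mk (DblFunctor.lo F m)) := by
  unfold idColax
  rw [comp_sq', DblCat.rightUnitIso_hom_sq, DblCat.leftUnitIso_inv_sq]
  exact Category.comp_id _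

/-- Pasting of colaxators. -/
def paste {F : A ⟶ B} {a : B ⟶ D} {f : A ⟶ C} {F' : C ⟶ D} {b : D ⟶ E} {g : C ⟶ G} {F'' : G ⟶ E}
    (s : F ≫ a ⟶ f ≫ F') (t : F' ≫ b ⟶ g ≫ F'') : F ≫ (a ≫ b) ⟶ (f ≫ g) ≫ F'' :=
  (DblCat.assocIso F a b).inv ≫ s ▷ b ≫ (DblCat.assocIso f F' b).hom ≫ f ◁ t ≫
    (DblCat.assocIso f g F'').inv

theorem paste_sq {F : A ⟶ B} {a : B ⟶ D} {f : A ⟶ C} {F' : C ⟶ D} {b : D ⟶ E} {g : C ⟶ G}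
    {F'' : G ⟶ E} (s : F ≫ a ⟶ f ≫ F') (t : F' ≫ b ⟶ g ≫ F'') {x y : A.Obj} (m : A.Lo x y) :
    DblTrans.sq (paste s t) m =
      DblFunctor.sq b (DblTrans.sq s m) ≫ DblTrans.sq t (DblFunctor.lo f m) := by
  unfold paste
  rw [comp_sq', comp_sq', comp_sq', comp_sq', DblCat.assocIso_inv_sq, DblCat.assocIso_hom_sq,
    DblCat.assocIso_inv_sq]
  exact (Category.id_comp _).trans (congrArg (_ ≫ ·) ((Category.id_comp _).trans
    (Category.comp_id _)))

theorem isCompanionCommuter_of_sq {F G : DblFunctor D E} (α : DblTrans F G)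
    (h : ∀ {x y : D.Obj} (m : D.Lo x y), DblCat.IsCompanionCommuter (α.sq m)) :
    α.IsCompanionCommuter := by
  refine ⟨fun x => ?_, h⟩
  obtain ⟨C, _⟩ := h (D.unit x)
  exact ⟨cast (by rw [α.dom_sq]) C⟩

theorem isConjointCommuter_of_sq {F G : DblFunctor D E} (α : DblTrans F G)
    (h : ∀ {x y : D.Obj} (m : D.Lo x y), DblCat.IsConjointCommuter (α.sq m)) :
    α.IsConjointCommuter := by
  refine ⟨fun x => ?_, h⟩
  obtain ⟨C, _⟩ := h (D.unit x)
  exact ⟨cast (by rw [α.dom_sq]) C⟩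

theorem idColax_isCompanionCommuter (F : D ⟶ E) : (idColax F).IsCompanionCommuter :=
  isCompanionCommuter_of_sq _ fun m => by
    rw [idColax_sq]; exact DblCat.IsCompanionCommuter.id _

theorem idColax_isConjointCommuter (F : D ⟶ E) : (idColax F).IsConjointCommuter :=
  isConjointCommuter_of_sq _ fun m => by
    rw [idColax_sq]; exact DblCat.IsConjointCommuter.id _

theorem paste_isCompanionCommuter {F : A ⟶ B} {a : B ⟶ D} {f : A ⟶ C} {F' : C ⟶ D} {b : D ⟶ E}
    {g : C ⟶ G} {F'' : G ⟶ E} {s : F ≫ a ⟶ f ≫ F'} {t : F' ≫ b ⟶ g ≫ F''}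
    (hs : DblTrans.IsCompanionCommuter s) (ht : DblTrans.IsCompanionCommuter t) :
    (paste s t).IsCompanionCommuter :=
  isCompanionCommuter_of_sq _ fun m => by
    rw [paste_sq]; exact (DblCat.IsCompanionCommuter.map b (hs.2 m)).comp (ht.2 _)

theorem paste_isConjointCommuter {F : A ⟶ B} {a : B ⟶ D} {f : A ⟶ C} {F' : C ⟶ D} {b : D ⟶ E}
    {g : C ⟶ G} {F'' : G ⟶ E} {s : F ≫ a ⟶ f ≫ F'} {t : F' ≫ b ⟶ g ≫ F''}
    (hs : DblTrans.IsConjointCommuter s) (ht : DblTrans.IsConjointCommuter t) :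
    (paste s t).IsConjointCommuter :=
  isConjointCommuter_of_sq _ fun m => by
    rw [paste_sq]; exact (DblCat.IsConjointCommuter.map b (hs.2 m)).comp (ht.2 _)

theorem heq_of_sq {F F' G G' : D ⟶ E} {α : F ⟶ G} {β : F' ⟶ G'} (h : F = F') (k : G = G')
    (e : ∀ {x y : D.Obj} (m : D.Lo x y), HEq (DblTrans.sq α m) (DblTrans.sq β m)) : HEq α β := by
  subst h k
  exact heq_of_eq (hom_ext_sq fun m => eq_of_heq (e m))

/-- The compatibility of colaxators `s` and `s'` with 2-cells `α` and `φ`. -/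
def Compat {F : A ⟶ B} {a a' : B ⟶ D} {f f' : A ⟶ C} {F' : C ⟶ D} (s : F ≫ a ⟶ f ≫ F')
    (s' : F ≫ a' ⟶ f' ≫ F') (α : a ⟶ a') (φ : f ⟶ f') : Prop :=
  F ◁ α ≫ s' = s ≫ φ ▷ F'

theorem compat_iff {F : A ⟶ B} {a a' : B ⟶ D} {f f' : A ⟶ C} {F' : C ⟶ D} {s : F ≫ a ⟶ f ≫ F'}
    {s' : F ≫ a' ⟶ f' ≫ F'} {α : a ⟶ a'} {φ : f ⟶ f'} :
    Compat s s' α φ ↔ ∀ {x y : A.Obj} (m : A.Lo x y),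
      DblTrans.sq α (DblFunctor.lo F m) ≫ DblTrans.sq s' m =
        DblTrans.sq s m ≫ DblFunctor.sq F' (DblTrans.sq φ m) := by
  constructor
  · intro h x y m
    exact congrArg (fun t : F ≫ a ⟶ f' ≫ F' => DblTrans.sq t m) h
  · intro h
    exact hom_ext_sq fun m => h m

section
variable {F : A ⟶ B} {a a' a'' : B ⟶ D} {f f' f'' : A ⟶ C} {F' : C ⟶ D} {b b' : D ⟶ E}
    {g g' : C ⟶ G} {F'' : G ⟶ E} {s : F ≫ a ⟶ f ≫ F'} {s' : F ≫ a' ⟶ f' ≫ F'}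
    {s'' : F ≫ a'' ⟶ f'' ≫ F'} {t : F' ≫ b ⟶ g ≫ F''} {t' : F' ≫ b' ⟶ g' ≫ F''}

theorem Compat.id : Compat s s (𝟙 a) (𝟙 f) := compat_iff.2 fun m => by
  refine (Category.id_comp _).trans ?_
  exact ((congrArg (_ ≫ ·) (DblFunctor.sq_id F' _)).trans (Category.comp_id _)).symm

theorem Compat.comp {α : a ⟶ a'} {φ : f ⟶ f'} {β : a' ⟶ a''} {ψ : f' ⟶ f''}
    (h : Compat s s' α φ) (k : Compat s' s'' β ψ) : Compat s s'' (α ≫ β) (φ ≫ ψ) :=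
  compat_iff.2 fun m => by
    have h := compat_iff.1 h m
    have k := compat_iff.1 k m
    rw [comp_sq', comp_sq', DblFunctor.sq_comp]
    refine (Category.assoc _ _ _).trans ?_
    refine (congrArg (_ ≫ ·) k).trans ?_
    refine (Category.assoc _ _ _).symm.trans ?_
    exact (congrArg (· ≫ _) h).trans (Category.assoc _ _ _)

theorem Compat.whiskerLeft {β : b ⟶ b'} {ψ : g ⟶ g'} (h : Compat t t' β ψ)
    (s : F ≫ a ⟶ f ≫ F') : Compat (paste s t) (paste s t') (a ◁ β) (f ◁ ψ) :=
  compat_iff.2 fun m => by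
    have h := compat_iff.1 h (DblFunctor.lo f m)
    rw [paste_sq, paste_sq]
    have n := DblTrans.sq_naturality β (DblTrans.sq s m)
    refine (Category.assoc _ _ _).symm.trans ?_
    refine (congrArg (· ≫ _) n.symm).trans ?_
    refine (Category.assoc _ _ _).trans ?_
    exact (congrArg (_ ≫ ·) h).trans (Category.assoc _ _ _).symm

theorem Compat.whiskerRight {α : a ⟶ a'} {φ : f ⟶ f'} (h : Compat s s' α φ)
    (t : F' ≫ b ⟶ g ≫ F'') : Compat (paste s t) (paste s' t) (α ▷ b) (φ ▷ g) :=
  compat_iff.2 fun m => by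
    have h := compat_iff.1 h m
    rw [paste_sq, paste_sq]
    have n := DblTrans.sq_naturality t (DblTrans.sq φ m)
    refine (Category.assoc _ _ _).symm.trans ?_
    refine (congrArg (· ≫ _) ((DblFunctor.sq_comp b _ _).symm.trans
      ((congrArg (DblFunctor.sq b) h).trans (DblFunctor.sq_comp b _ _)))).trans ?_
    refine (Category.assoc _ _ _).trans ?_
    exact (congrArg (_ ≫ ·) n).trans (Category.assoc _ _ _).symm

/-- 2-cells with identity components are compatible with colaxators having equal components. -/
theorem Compat.of_id {α : a ⟶ a'} {φ : f ⟶ f'} (h : a = a') (k : f = f') (hα : α = eqToHom h)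
    (hφ : φ = eqToHom k)
    (e : ∀ {x y : A.Obj} (m : A.Lo x y), HEq (DblTrans.sq s m) (DblTrans.sq s' m)) :
    Compat s s' α φ := by
  subst h k hα hφ
  have : s = s' := hom_ext_sq fun m => eq_of_heq (e m)
  subst this
  exact Compat.id

theorem paste_assoc_heq {H I : DblCat.{u}} {c : E ⟶ H} {k : G ⟶ I} {F''' : I ⟶ H}
    (s : F ≫ a ⟶ f ≫ F') (t : F' ≫ b ⟶ g ≫ F'') (r : F'' ≫ c ⟶ k ≫ F''') {x y : A.Obj}
    (m : A.Lo x y) :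
    HEq (DblTrans.sq (paste (paste s t) r) m) (DblTrans.sq (paste s (paste t r)) m) := by
  rw [paste_sq, paste_sq, paste_sq, paste_sq]
  exact heq_of_eq ((congrArg (· ≫ _) (DblFunctor.sq_comp c _ _)).trans (Category.assoc _ _ _))

theorem paste_id_heq (s : F ≫ a ⟶ f ≫ F') {x y : A.Obj} (m : A.Lo x y) :
    HEq (DblTrans.sq (paste s (idColax F')) m) (DblTrans.sq s m) := by
  rw [paste_sq, idColax_sq]
  exact heq_of_eq (Category.comp_id _)

theorem id_paste_heq (s : F ≫ a ⟶ f ≫ F') {x y : A.Obj} (m : A.Lo x y) :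
    HEq (DblTrans.sq (paste (idColax F) s) m) (DblTrans.sq s m) := by
  rw [paste_sq, idColax_sq]
  exact heq_of_eq ((congrArg (· ≫ _) (DblFunctor.sq_id a _)).trans (Category.id_comp _))

end

end DblTrans

/-- A niche: a loose bimodule with double functors into its source and its target. -/
structure Niche : Type (u + 1) where
  bimod : LooseBimod.{u}
  E (i : Side.{u}) : DblCat.{u}
  F (i : Side.{u}) : E i ⟶ bimod.fiberObj i

namespace Niche

/-- A map of niches: the source part is colax along a conjoint commuter transformation, the target
part is colax along a companion commuter transformation. -/
structure Hom (M N : Niche.{u}) : Type u where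
  bimod : M.bimod ⟶ N.bimod
  f (i : Side.{u}) : M.E i ⟶ N.E i
  colax (i : Side.{u}) : M.F i ≫ LooseBimod.fiberMap bimod i ⟶ f i ≫ N.F i
  conj : DblTrans.IsConjointCommuter (colax .zero)
  comp : DblTrans.IsCompanionCommuter (colax .one)

instance : CategoryStruct.{u} Niche.{u} where
  Hom M N := Hom M N
  id M := ⟨𝟙 M.bimod, fun i => 𝟙 (M.E i), fun i => DblTrans.idColax (M.F i),
    DblTrans.idColax_isConjointCommuter _, DblTrans.idColax_isCompanionCommuter _⟩
  comp F G := ⟨F.bimod ≫ G.bimod, fun i => F.f i ≫ G.f i,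
    fun i => DblTrans.paste (F.colax i) (G.colax i),
    DblTrans.paste_isConjointCommuter F.conj G.conj,
    DblTrans.paste_isCompanionCommuter F.comp G.comp⟩

/-- A 2-cell of niches. -/
structure Hom₂ {M N : Niche.{u}} (F G : M ⟶ N) : Type u where
  bimod : F.bimod ⟶ G.bimod
  f (i : Side.{u}) : F.f i ⟶ G.f i
  w (i : Side.{u}) : M.F i ◁ LooseBimod.fiberMap₂ bimod i ≫ G.colax i = F.colax i ≫ f i ▷ N.F i

theorem Hom₂.ext' {M N : Niche.{u}} {F G : M ⟶ N} {α β : Hom₂ F G}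
    (h : α.bimod = β.bimod) (k : ∀ i, α.f i = β.f i) : α = β := by
  cases α; cases β; cases h; cases funext k; rfl

theorem Hom.ext' {M N : Niche.{u}} {F G : Hom M N} (h : F.bimod = G.bimod)
    (k : ∀ i, F.f i = G.f i)
    (e : ∀ i {x y : (M.E i).Obj} (m : (M.E i).Lo x y),
      HEq (DblTrans.sq (F.colax i) m) (DblTrans.sq (G.colax i) m)) : F = G := by
  rcases F with ⟨a, f, c, h1, h2⟩
  rcases G with ⟨a', f', c', h1', h2'⟩
  cases h
  cases funext k
  have : c = c' := funext fun i => DblTrans.hom_ext_sq fun m => eq_of_heq (e i m)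
  subst this
  rfl

instance (M N : Niche.{u}) : Category.{u} (M ⟶ N) where
  Hom F G := Hom₂ F G
  id F := ⟨𝟙 F.bimod, fun i => 𝟙 (F.f i), fun i => DblTrans.Compat.id (s := F.colax i)⟩
  comp α β := ⟨α.bimod ≫ β.bimod, fun i => α.f i ≫ β.f i,
    fun i => DblTrans.Compat.comp (α.w i) (β.w i)⟩
  id_comp _ := Hom₂.ext' (Category.id_comp _) fun _ => Category.id_comp _
  comp_id _ := Hom₂.ext' (Category.comp_id _) fun _ => Category.comp_id _
  assoc _ _ _ := Hom₂.ext' (Category.assoc _ _ _) fun _ => Category.assoc _ _ _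

theorem eqToHom_bimod {M N : Niche.{u}} {F G : M ⟶ N} (h : F = G) :
    Hom₂.bimod (eqToHom h) = eqToHom (congrArg Hom.bimod h) := by
  subst h; rfl

theorem eqToHom_f {M N : Niche.{u}} {F G : M ⟶ N} (h : F = G) (i : Side.{u}) :
    Hom₂.f (eqToHom h) i = eqToHom (congrArg (fun K => Hom.f K i) h) := by
  subst h; rfl

theorem assoc' {A B C D : Niche.{u}} (F : A ⟶ B) (G : B ⟶ C) (H : C ⟶ D) :
    (F ≫ G) ≫ H = F ≫ G ≫ H :=
  Hom.ext' (LooseBimod.strict.assoc _ _ _) (fun i => DblCat.strict.assoc _ _ _)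
    fun i _ _ m => DblTrans.paste_assoc_heq (F.colax i) (G.colax i) (H.colax i) m

theorem id_comp' {A B : Niche.{u}} (F : A ⟶ B) : 𝟙 A ≫ F = F :=
  Hom.ext' (LooseBimod.strict.id_comp _) (fun i => DblCat.strict.id_comp _)
    fun i _ _ m => DblTrans.id_paste_heq (F.colax i) m

theorem comp_id' {A B : Niche.{u}} (F : A ⟶ B) : F ≫ 𝟙 B = F :=
  Hom.ext' (LooseBimod.strict.comp_id _) (fun i => DblCat.strict.comp_id _)
    fun i _ _ m => DblTrans.paste_id_heq (F.colax i) m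

/-- An invertible 2-cell between equal maps of niches. -/
def isoOfEq {M N : Niche.{u}} {F G : M ⟶ N} (h : F = G) (e : F.bimod ≅ G.bimod)
    (e' : ∀ i, F.f i ≅ G.f i) (he : e = eqToIso (congrArg Hom.bimod h))
    (he' : ∀ i, e' i = eqToIso (congrArg (fun K => Hom.f K i) h)) : F ≅ G where
  hom := ⟨e.hom, fun i => (e' i).hom, fun i => by
    subst h; rw [he, he']; exact DblTrans.Compat.id (s := F.colax i)⟩
  inv := ⟨e.inv, fun i => (e' i).inv, fun i => by
    subst h; rw [he, he']; exact DblTrans.Compat.id (s := F.colax i)⟩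
  hom_inv_id := Hom₂.ext' e.hom_inv_id fun i => (e' i).hom_inv_id
  inv_hom_id := Hom₂.ext' e.inv_hom_id fun i => (e' i).inv_hom_id

theorem isoOfEq_eq {M N : Niche.{u}} {F G : M ⟶ N} (h : F = G) (e : F.bimod ≅ G.bimod)
    (e' : ∀ i, F.f i ≅ G.f i) (he : e = eqToIso (congrArg Hom.bimod h))
    (he' : ∀ i, e' i = eqToIso (congrArg (fun K => Hom.f K i) h)) :
    isoOfEq h e e' he he' = eqToIso h := by
  refine Iso.ext (Hom₂.ext' ?_ fun i => ?_)
  · exact (congrArg Iso.hom he).trans (eqToHom_bimod h).symm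
  · exact (congrArg Iso.hom (he' i)).trans (eqToHom_f h i).symm

/-- Left whiskering. -/
def wl {A B C : Niche.{u}} (F : A ⟶ B) {G H : B ⟶ C} (α : G ⟶ H) : F ≫ G ⟶ F ≫ H :=
  Hom₂.mk (F := F ≫ G) (G := F ≫ H) (F.bimod ◁ Hom₂.bimod α) (fun i => F.f i ◁ Hom₂.f α i)
    (fun i => DblTrans.Compat.whiskerLeft (Hom₂.w α i) (F.colax i))

/-- Right whiskering. -/
def wr {A B C : Niche.{u}} {F G : A ⟶ B} (α : F ⟶ G) (H : B ⟶ C) : F ≫ H ⟶ G ≫ H :=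
  Hom₂.mk (F := F ≫ H) (G := G ≫ H) (Hom₂.bimod α ▷ H.bimod) (fun i => Hom₂.f α i ▷ H.f i)
    (fun i => DblTrans.Compat.whiskerRight (Hom₂.w α i) (H.colax i))

instance : Bicategory.{u, u} Niche.{u} where
  whiskerLeft F _ _ α := wl F α
  whiskerRight α G := wr α G
  associator F G H := isoOfEq (assoc' F G H) (α_ F.bimod G.bimod H.bimod)
    (fun i => α_ (F.f i) (G.f i) (H.f i)) (LooseBimod.strict.associator_eqToIso _ _ _)
    (fun i => DblCat.strict.associator_eqToIso _ _ _)
  leftUnitor F := isoOfEq (id_comp' F) (λ_ F.bimod) (fun i => λ_ (F.f i))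
    (LooseBimod.strict.leftUnitor_eqToIso _) (fun i => DblCat.strict.leftUnitor_eqToIso _)
  rightUnitor F := isoOfEq (comp_id' F) (ρ_ F.bimod) (fun i => ρ_ (F.f i))
    (LooseBimod.strict.rightUnitor_eqToIso _) (fun i => DblCat.strict.rightUnitor_eqToIso _)
  whiskerLeft_id _ _ := Hom₂.ext' (whiskerLeft_id _ _) fun _ => whiskerLeft_id _ _
  whiskerLeft_comp _ _ _ _ _ _ :=
    Hom₂.ext' (whiskerLeft_comp _ _ _) fun _ => whiskerLeft_comp _ _ _
  id_whiskerLeft _ := Hom₂.ext' (id_whiskerLeft _) fun _ => id_whiskerLeft _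
  comp_whiskerLeft _ _ _ _ _ :=
    Hom₂.ext' (comp_whiskerLeft _ _ _) fun _ => comp_whiskerLeft _ _ _
  id_whiskerRight _ _ := Hom₂.ext' (id_whiskerRight _ _) fun _ => id_whiskerRight _ _
  comp_whiskerRight _ _ _ :=
    Hom₂.ext' (comp_whiskerRight _ _ _) fun _ => comp_whiskerRight _ _ _
  whiskerRight_id _ := Hom₂.ext' (whiskerRight_id _) fun _ => whiskerRight_id _
  whiskerRight_comp _ _ _ :=
    Hom₂.ext' (whiskerRight_comp _ _ _) fun _ => whiskerRight_comp _ _ _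
  whisker_assoc _ _ _ _ _ := Hom₂.ext' (whisker_assoc _ _ _) fun _ => whisker_assoc _ _ _
  whisker_exchange _ _ := Hom₂.ext' (whisker_exchange _ _) fun _ => whisker_exchange _ _
  pentagon _ _ _ _ := Hom₂.ext' (pentagon _ _ _ _) fun _ => pentagon _ _ _ _
  triangle _ _ := Hom₂.ext' (triangle _ _) fun _ => triangle _ _

theorem strict : Bicategory.Strict Niche.{u} where
  id_comp F := id_comp' F
  comp_id F := comp_id' F
  assoc F G H := assoc' F G H
  leftUnitor_eqToIso F := isoOfEq_eq _ _ _ _ _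
  rightUnitor_eqToIso F := isoOfEq_eq _ _ _ _ _
  associator_eqToIso F G H := isoOfEq_eq _ _ _ _ _

/-- The 2-functor sending a niche to its loose bimodule. -/
def toBimod : StrictPseudofunctor Niche.{u} LooseBimod.{u} :=
  letI := strict
  letI := LooseBimod.strict
  StrictPseudofunctor.mk''
    { obj := fun M => M.bimod
      map := fun F => F.bimod
      map₂ := fun α => Hom₂.bimod α
      map₂_id := fun _ => rfl
      map₂_comp := fun _ _ => rfl
      map_id := fun _ => rfl
      map_comp := fun _ _ => rfl
      map₂_whisker_left := fun _ _ _ _ => eq_conj_eqToHom _ _ HEq.rfl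
      map₂_whisker_right := fun _ _ => eq_conj_eqToHom _ _ HEq.rfl }

/-- The 2-functor sending a niche to the domain of its source (`i = .zero`) or target
(`i = .one`) double functor. -/
def endpoint (i : Side.{u}) : StrictPseudofunctor Niche.{u} DblCat.{u} :=
  letI := strict
  letI := DblCat.strict
  StrictPseudofunctor.mk''
    { obj := fun M => M.E i
      map := fun F => F.f i
      map₂ := fun α => Hom₂.f α i
      map₂_id := fun _ => rfl
      map₂_comp := fun _ _ => rfl
      map_id := fun _ => rfl
      map_comp := fun _ _ => rfl
      map₂_whisker_left := fun _ _ _ _ => eq_conj_eqToHom _ _ HEq.rfl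
      map₂_whisker_right := fun _ _ => eq_conj_eqToHom _ _ HEq.rfl }

end Niche

namespace DblCat

section coherence
variable {B : Type*} [Bicategory B] {a b c d e : B}

theorem pentagon_llh {m : a ⟶ b} {n : b ⟶ c} {p : c ⟶ d} {q : d ⟶ e} {mn : a ⟶ c} {np : b ⟶ d}
    {mnp mnp' : a ⟶ d} (φ : m ≫ n ≅ mn) (ψ : n ≫ p ≅ np) (χ : mn ≫ p ≅ mnp) (ω : m ≫ np ≅ mnp')
    (A : mnp ⟶ mnp') (h : φ.hom ▷ p ≫ χ.hom ≫ A = (α_ m n p).hom ≫ m ◁ ψ.hom ≫ ω.hom) :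
    A ▷ q ≫ (ω.inv ▷ q ≫ (α_ m np q).hom) ≫ m ◁ (ψ.inv ▷ q ≫ (α_ n p q).hom) =
      (χ.inv ▷ q ≫ (α_ mn p q).hom) ≫ φ.inv ▷ (p ≫ q) ≫ (α_ m n (p ≫ q)).hom := by
  have h' : A = χ.inv ≫ φ.inv ▷ p ≫ (α_ m n p).hom ≫ m ◁ ψ.hom ≫ ω.hom := by
    rw [← h]; simp
  rw [h']
  simp only [comp_whiskerRight, Category.assoc, hom_inv_whiskerRight_assoc]
  simp

theorem pentagon_hrr {m : a ⟶ b} {n : b ⟶ c} {p : c ⟶ d} {q : d ⟶ e} {np : b ⟶ d} {pq : c ⟶ e}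
    {npq npq' : b ⟶ e} (φ : n ≫ p ≅ np) (ψ : p ≫ q ≅ pq) (χ : np ≫ q ≅ npq) (ω : n ≫ pq ≅ npq')
    (A : npq ⟶ npq') (h : φ.hom ▷ q ≫ χ.hom ≫ A = (α_ n p q).hom ≫ n ◁ ψ.hom ≫ ω.hom) :
    ((α_ m n p).hom ≫ m ◁ φ.hom) ▷ q ≫ ((α_ m np q).hom ≫ m ◁ χ.hom) ≫ m ◁ A =
      ((α_ (m ≫ n) p q).hom ≫ (m ≫ n) ◁ ψ.hom) ≫ (α_ m n pq).hom ≫ m ◁ ω.hom := by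
  have h2 : m ◁ (φ.hom ▷ q) ≫ m ◁ χ.hom ≫ m ◁ A =
      m ◁ (α_ n p q).hom ≫ m ◁ n ◁ ψ.hom ≫ m ◁ ω.hom := by
    simp only [← Bicategory.whiskerLeft_comp, h]
  simp only [comp_whiskerRight, Category.assoc, whisker_assoc, Iso.inv_hom_id_assoc]
  rw [h2]
  simp

theorem pentagon_lhr {m : a ⟶ b} {n : b ⟶ c} {p : c ⟶ d} {q : d ⟶ e} {mn : a ⟶ c}
    (φ : m ≫ n ≅ mn) :
    (φ.inv ▷ p ≫ (α_ m n p).hom) ▷ q ≫ (α_ m (n ≫ p) q).hom ≫ m ◁ (α_ n p q).hom =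
      (α_ mn p q).hom ≫ φ.inv ▷ (p ≫ q) ≫ (α_ m n (p ≫ q)).hom := by
  simp

theorem pentagon_lhr' {m : a ⟶ b} {n : b ⟶ c} {p : c ⟶ d} {q : d ⟶ e} {pq : c ⟶ e}
    (φ : p ≫ q ≅ pq) :
    (α_ m n p).hom ▷ q ≫ (α_ m (n ≫ p) q).hom ≫ m ◁ ((α_ n p q).hom ≫ n ◁ φ.hom) =
      ((α_ (m ≫ n) p q).hom ≫ (m ≫ n) ◁ φ.hom) ≫ (α_ m n pq).hom := by
  simp

theorem triangle_lh {m : a ⟶ b} {n : b ⟶ c} {u : b ⟶ b} {mu : a ⟶ b} (φ : m ≫ u ≅ mu)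
    (ψ : 𝟙 b ≅ u) (R : mu ⟶ m) (h : m ◁ ψ.hom ≫ φ.hom ≫ R = (ρ_ m).hom) :
    (φ.inv ▷ n ≫ (α_ m u n).hom) ≫ m ◁ (ψ.inv ▷ n ≫ (λ_ n).hom) = R ▷ n := by
  have h' : R = φ.inv ≫ m ◁ ψ.inv ≫ (ρ_ m).hom := by
    rw [← h]; simp
  rw [h']
  simp

theorem triangle_hr {m : a ⟶ b} {n : b ⟶ c} {u : b ⟶ b} {un : b ⟶ c} (φ : u ≫ n ≅ un)
    (ψ : 𝟙 b ≅ u) (L : un ⟶ n) (h : ψ.hom ▷ n ≫ φ.hom ≫ L = (λ_ n).hom) :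
    ((α_ m u n).hom ≫ m ◁ φ.hom) ≫ m ◁ L = (m ◁ ψ.inv ≫ (ρ_ m).hom) ▷ n := by
  have h' : L = φ.inv ≫ ψ.inv ▷ n ≫ (λ_ n).hom := by
    rw [← h]; simp
  rw [h']
  simp

end coherence

/-- Whiskering of an isomorphism on the left. -/
def lwIso {D : DblCat.{u}} {x y z : D.Obj} (m : D.Lo x y) {n n' : D.Lo y z}
    (e : LoArr.mk n ≅ LoArr.mk n') (h : D.dom e.hom = 𝟙 y) :
    LoArr.mk (D.comp m n) ≅ LoArr.mk (D.comp m n') where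
  hom := lw m e.hom h
  inv := lw m e.inv (dom_inv e _ (by simp [h]))
  hom_inv_id := by rw [← lw_comp, ← lw_id]; unfold lw; exact compSq_congr _ rfl (by simp)
  inv_hom_id := by rw [← lw_comp, ← lw_id]; unfold lw; exact compSq_congr _ rfl (by simp)

/-- Whiskering of an isomorphism on the right. -/
def rwIso {D : DblCat.{u}} {x y z : D.Obj} {m m' : D.Lo x y} (e : LoArr.mk m ≅ LoArr.mk m')
    (n : D.Lo y z) (h : D.cod e.hom = 𝟙 y) :
    LoArr.mk (D.comp m n) ≅ LoArr.mk (D.comp m' n) where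
  hom := rw' e.hom n h
  inv := rw' e.inv n (cod_inv e _ (by simp [h]))
  hom_inv_id := by rw [← comp_rw', ← id_rw']; unfold rw'; exact compSq_congr _ (by simp) rfl
  inv_hom_id := by rw [← comp_rw', ← id_rw']; unfold rw'; exact compSq_congr _ (by simp) rfl

end DblCat

namespace Cograph

variable {A B M : DblCat.{u}} (P : DblFunctor A M) (Q : DblFunctor B M)

/-- Tight arrows of the restriction. -/
inductive Ti : A.Obj ⊕ B.Obj → A.Obj ⊕ B.Obj → Type u
  | left {a a' : A.Obj} (f : a ⟶ a') : Ti (.inl a) (.inl a')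
  | right {b b' : B.Obj} (f : b ⟶ b') : Ti (.inr b) (.inr b')

/-- The identity of an object. -/
def Ti.id : ∀ x : A.Obj ⊕ B.Obj, Ti x x
  | .inl a => .left (𝟙 a)
  | .inr b => .right (𝟙 b)

/-- Composition of tight arrows. -/
def Ti.comp : ∀ {x y z : A.Obj ⊕ B.Obj}, Ti x y → Ti y z → Ti x z
  | _, _, _, .left f, .left g => .left (f ≫ g)
  | _, _, _, .right f, .right g => .right (f ≫ g)

/-- Tight arrows of the restriction form a category. -/
@[reducible] def tiCat : Category.{u} (A.Obj ⊕ B.Obj) where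
  Hom := Ti
  id := Ti.id
  comp := Ti.comp
  id_comp f := by cases f <;> simp [Ti.id, Ti.comp]
  comp_id f := by cases f <;> simp [Ti.id, Ti.comp]
  assoc f g h := by cases f <;> cases g <;> cases h <;> simp [Ti.comp]

/-- Loose arrows of the restriction: those of `A`, those of `B`, and loose arrows of `M` from the
image of an object of `A` to the image of an object of `B`. -/
inductive Lo : A.Obj ⊕ B.Obj → A.Obj ⊕ B.Obj → Type u
  | left {a a' : A.Obj} (m : A.Lo a a') : Lo (.inl a) (.inl a')
  | het {a : A.Obj} {b : B.Obj} (m : M.Lo (P.tight.obj a) (Q.tight.obj b)) : Lo (.inl a) (.inr b)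
  | right {b b' : B.Obj} (m : B.Lo b b') : Lo (.inr b) (.inr b')

/-- A square between loose arrows of `M` whose sides are images of tight arrows. -/
structure Het {a a' : A.Obj} {b b' : B.Obj} (m : M.Lo (P.tight.obj a) (Q.tight.obj b))
    (n : M.Lo (P.tight.obj a') (Q.tight.obj b')) : Type u where
  f : a ⟶ a'
  g : b ⟶ b'
  sq : LoArr.mk m ⟶ LoArr.mk n
  dom : M.dom sq = P.tight.map f
  cod : M.cod sq = Q.tight.map g

theorem Het.ext' {P : DblFunctor A M} {Q : DblFunctor B M} {a a' : A.Obj} {b b' : B.Obj}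
    {m : M.Lo (P.tight.obj a) (Q.tight.obj b)} {n : M.Lo (P.tight.obj a') (Q.tight.obj b')}
    {α β : Het P Q m n} (h : α.f = β.f) (k : α.g = β.g) (e : α.sq = β.sq) : α = β := by
  cases α; cases β; cases h; cases k; cases e; rfl

/-- Squares of the restriction. -/
inductive Sq : LoArr (Lo P Q) → LoArr (Lo P Q) → Type u
  | left {a b a' b' : A.Obj} {m : A.Lo a b} {n : A.Lo a' b'} (α : LoArr.mk m ⟶ LoArr.mk n) :
    Sq ⟨.left m⟩ ⟨.left n⟩
  | het {a a' : A.Obj} {b b' : B.Obj} {m : M.Lo (P.tight.obj a) (Q.tight.obj b)}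
    {n : M.Lo (P.tight.obj a') (Q.tight.obj b')} (α : Het P Q m n) : Sq ⟨.het m⟩ ⟨.het n⟩
  | right {a b a' b' : B.Obj} {m : B.Lo a b} {n : B.Lo a' b'} (α : LoArr.mk m ⟶ LoArr.mk n) :
    Sq ⟨.right m⟩ ⟨.right n⟩

/-- The identity square. -/
def Sq.id : ∀ m : LoArr (Lo P Q), Sq P Q m m
  | ⟨.left m⟩ => .left (𝟙 (LoArr.mk m))
  | ⟨.het m⟩ => .het ⟨𝟙 _, 𝟙 _, 𝟙 (LoArr.mk m), by simp, by simp⟩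
  | ⟨.right m⟩ => .right (𝟙 (LoArr.mk m))

variable {P Q}

/-- Vertical composition of heteromorphic squares. -/
def Het.comp {a a' a'' : A.Obj} {b b' b'' : B.Obj} {m : M.Lo (P.tight.obj a) (Q.tight.obj b)}
    {n : M.Lo (P.tight.obj a') (Q.tight.obj b')} {p : M.Lo (P.tight.obj a'') (Q.tight.obj b'')}
    (α : Het P Q m n) (β : Het P Q n p) : Het P Q m p :=
  ⟨α.f ≫ β.f, α.g ≫ β.g, α.sq ≫ β.sq, by simp [α.dom, β.dom], by simp [α.cod, β.cod]⟩

/-- Vertical composition of squares. -/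
def Sq.comp : ∀ {m n p : LoArr (Lo P Q)}, Sq P Q m n → Sq P Q n p → Sq P Q m p
  | _, _, _, .left α, .left β => .left (α ≫ β)
  | _, _, _, .het α, .het β => .het (α.comp β)
  | _, _, _, .right α, .right β => .right (α ≫ β)

/-- The source of a square. -/
def Sq.dom : ∀ {m n : LoArr (Lo P Q)}, Sq P Q m n → Ti m.src n.src
  | _, _, .left α => .left (A.dom α)
  | _, _, .het α => .left α.f
  | _, _, .right α => .right (B.dom α)

/-- The target of a square. -/
def Sq.cod : ∀ {m n : LoArr (Lo P Q)}, Sq P Q m n → Ti m.tgt n.tgt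
  | _, _, .left α => .left (A.cod α)
  | _, _, .het α => .right α.g
  | _, _, .right α => .right (B.cod α)

theorem Sq.left_congr {a b a' b' : A.Obj} {m : A.Lo a b} {n : A.Lo a' b'}
    {α β : LoArr.mk m ⟶ LoArr.mk n} (h : α = β) : Sq.left (P := P) (Q := Q) α = .left β :=
  congrArg _ h

theorem Sq.right_congr {a b a' b' : B.Obj} {m : B.Lo a b} {n : B.Lo a' b'}
    {α β : LoArr.mk m ⟶ LoArr.mk n} (h : α = β) : Sq.right (P := P) (Q := Q) α = .right β :=
  congrArg _ h

theorem Sq.het_congr {a a' : A.Obj} {b b' : B.Obj} {m : M.Lo (P.tight.obj a) (Q.tight.obj b)}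
    {n : M.Lo (P.tight.obj a') (Q.tight.obj b')} {α β : Het P Q m n} (h : α.f = β.f)
    (k : α.g = β.g) (e : α.sq = β.sq) : Sq.het α = Sq.het β :=
  congrArg _ (Het.ext' h k e)

variable (P Q) in
/-- Squares of the restriction form a category. -/
@[reducible] def sqCat : Category.{u} (LoArr (Lo P Q)) where
  Hom := Sq P Q
  id := Sq.id P Q
  comp := Sq.comp
  id_comp α := by
    cases α
    · exact Sq.left_congr (Category.id_comp _)
    · exact Sq.het_congr (Category.id_comp _) (Category.id_comp _) (Category.id_comp _)
    · exact Sq.right_congr (Category.id_comp _)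
  comp_id α := by
    cases α
    · exact Sq.left_congr (Category.comp_id _)
    · exact Sq.het_congr (Category.comp_id _) (Category.comp_id _) (Category.comp_id _)
    · exact Sq.right_congr (Category.comp_id _)
  assoc α β γ := by
    cases α <;> cases β <;> cases γ
    · exact Sq.left_congr (Category.assoc _ _ _)
    · exact Sq.het_congr (Category.assoc _ _ _) (Category.assoc _ _ _) (Category.assoc _ _ _)
    · exact Sq.right_congr (Category.assoc _ _ _)

variable (P Q) in
/-- Unit loose arrows. -/
def unit : ∀ x : A.Obj ⊕ B.Obj, Lo P Q x x
  | .inl a => .left (A.unit a)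
  | .inr b => .right (B.unit b)

variable (P Q) in
/-- Unit squares. -/
def unitSq : ∀ {x y : A.Obj ⊕ B.Obj}, Ti x y → Sq P Q ⟨unit P Q x⟩ ⟨unit P Q y⟩
  | _, _, .left f => .left (A.unitSq f)
  | _, _, .right f => .right (B.unitSq f)

/-- Composition of loose arrows; loose arrows of `A` and `B` act through their images in `M`. -/
def comp : ∀ {x y z : A.Obj ⊕ B.Obj}, Lo P Q x y → Lo P Q y z → Lo P Q x z
  | _, _, _, .left m, .left n => .left (A.comp m n)
  | _, _, _, .left m, .het n => .het (M.comp (P.lo m) n)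
  | _, _, _, .het m, .right n => .het (M.comp m (Q.lo n))
  | _, _, _, .right m, .right n => .right (B.comp m n)

theorem Ti.left_inj {a a' : A.Obj} {f g : a ⟶ a'} (h : Ti.left (B := B) f = Ti.left g) : f = g := by
  cases h; rfl

theorem Ti.right_inj {b b' : B.Obj} {f g : b ⟶ b'} (h : Ti.right (A := A) f = Ti.right g) :
    f = g := by
  cases h; rfl

/-- Horizontal composition of a square of `A` with a heteromorphic one. -/
def leftHet {a a' c c' : A.Obj} {b b' : B.Obj} {m : A.Lo a c} {m' : A.Lo a' c'}
    {n : M.Lo (P.tight.obj c) (Q.tight.obj b)} {n' : M.Lo (P.tight.obj c') (Q.tight.obj b')}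
    (α : LoArr.mk m ⟶ LoArr.mk m') (β : Het P Q n n') (h : A.cod α = β.f) :
    Het P Q (M.comp (P.lo m) n) (M.comp (P.lo m') n') where
  f := A.dom α
  g := β.g
  sq := M.compSq (P.sq α) β.sq (by rw [P.cod_sq, β.dom, h])
  dom := by simp
  cod := by simp [β.cod]

/-- Horizontal composition of a heteromorphic square with a square of `B`. -/
def hetRight {a a' : A.Obj} {b b' c c' : B.Obj} {m : M.Lo (P.tight.obj a) (Q.tight.obj b)}
    {m' : M.Lo (P.tight.obj a') (Q.tight.obj b')} {n : B.Lo b c} {n' : B.Lo b' c'}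
    (α : Het P Q m m') (β : LoArr.mk n ⟶ LoArr.mk n') (h : α.g = B.dom β) :
    Het P Q (M.comp m (Q.lo n)) (M.comp m' (Q.lo n')) where
  f := α.f
  g := B.cod β
  sq := M.compSq α.sq (Q.sq β) (by rw [Q.dom_sq, α.cod, h])
  dom := by simp [α.dom]
  cod := by simp

/-- Horizontal composition of squares. -/
def compSq : ∀ {x y z x' y' z' : A.Obj ⊕ B.Obj} {m : Lo P Q x y} {n : Lo P Q y z}
    {m' : Lo P Q x' y'} {n' : Lo P Q y' z'} (α : Sq P Q ⟨m⟩ ⟨m'⟩) (β : Sq P Q ⟨n⟩ ⟨n'⟩)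
    (h : Sq.cod α = Sq.dom β), Sq P Q ⟨comp m n⟩ ⟨comp m' n'⟩
  | _, _, _, _, _, _, _, _, _, _, .left α, .left β, h => .left (A.compSq α β (Ti.left_inj h))
  | _, _, _, _, _, _, _, _, _, _, .left α, .het β, h => .het (leftHet α β (Ti.left_inj h))
  | _, _, _, _, _, _, _, _, _, _, .het α, .right β, h => .het (hetRight α β (Ti.right_inj h))
  | _, _, _, _, _, _, _, _, _, _, .right α, .right β, h => .right (B.compSq α β (Ti.right_inj h))

variable (P Q) in
/-- An isomorphism of squares of `A`. -/
@[reducible] def leftIso {a b a' b' : A.Obj} {m : A.Lo a b} {n : A.Lo a' b'}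
    (e : LoArr.mk m ≅ LoArr.mk n) :
    @Iso _ (sqCat P Q) ⟨Lo.left m⟩ ⟨Lo.left n⟩ :=
  @Iso.mk _ (sqCat P Q) ⟨Lo.left m⟩ ⟨Lo.left n⟩ (.left e.hom) (.left e.inv)
    (Sq.left_congr e.hom_inv_id) (Sq.left_congr e.inv_hom_id)

variable (P Q) in
/-- An isomorphism of squares of `B`. -/
@[reducible] def rightIso {a b a' b' : B.Obj} {m : B.Lo a b} {n : B.Lo a' b'}
    (e : LoArr.mk m ≅ LoArr.mk n) :
    @Iso _ (sqCat P Q) ⟨Lo.right m⟩ ⟨Lo.right n⟩ :=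
  @Iso.mk _ (sqCat P Q) ⟨Lo.right m⟩ ⟨Lo.right n⟩ (.right e.hom) (.right e.inv)
    (Sq.right_congr e.hom_inv_id) (Sq.right_congr e.inv_hom_id)

/-- A globular square of `M`. -/
def Het.glob {a : A.Obj} {b : B.Obj} {m n : M.Lo (P.tight.obj a) (Q.tight.obj b)}
    (e : LoArr.mk m ⟶ LoArr.mk n) (h : M.dom e = 𝟙 _) (k : M.cod e = 𝟙 _) : Het P Q m n :=
  ⟨𝟙 _, 𝟙 _, e, h.trans (P.tight.map_id a).symm, k.trans (Q.tight.map_id b).symm⟩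

theorem Het.glob_comp {a : A.Obj} {b : B.Obj} {m n : M.Lo (P.tight.obj a) (Q.tight.obj b)}
    (e : LoArr.mk m ⟶ LoArr.mk n) (h : M.dom e = 𝟙 _) (k : M.cod e = 𝟙 _)
    (e' : LoArr.mk n ⟶ LoArr.mk m) (h' : M.dom e' = 𝟙 _) (k' : M.cod e' = 𝟙 _)
    (w : e ≫ e' = 𝟙 _) :
    Sq.comp (.het (Het.glob e h k)) (.het (Het.glob e' h' k')) = Sq.id P Q ⟨.het m⟩ :=
  Sq.het_congr (Category.id_comp _) (Category.id_comp _) w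

/-- A globular isomorphism of `M`. -/
@[reducible] def hetIso {a : A.Obj} {b : B.Obj} {m n : M.Lo (P.tight.obj a) (Q.tight.obj b)}
    (e : LoArr.mk m ≅ LoArr.mk n) (h : M.dom e.hom = 𝟙 _) (k : M.cod e.hom = 𝟙 _) :
    @Iso _ (sqCat P Q) ⟨Lo.het m⟩ ⟨Lo.het n⟩ :=
  @Iso.mk _ (sqCat P Q) ⟨Lo.het m⟩ ⟨Lo.het n⟩ (.het (Het.glob e.hom h k))
    (.het (Het.glob e.inv (DblCat.dom_inv e (𝟙 _) (by rw [h]; exact Category.id_comp _))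
      (DblCat.cod_inv e (𝟙 _) (by rw [k]; exact Category.id_comp _))))
    (Het.glob_comp _ _ _ _ _ _ e.hom_inv_id) (Het.glob_comp _ _ _ _ _ _ e.inv_hom_id)

theorem cod_compIso_inv {D E : DblCat.{u}} (F : DblFunctor D E) {x y z : D.Obj} (m : D.Lo x y)
    (n : D.Lo y z) : E.cod (F.compIso m n).inv = 𝟙 _ := DblCat.cod_inv _ _ (by simp)
theorem dom_compIso_inv {D E : DblCat.{u}} (F : DblFunctor D E) {x y z : D.Obj} (m : D.Lo x y)
    (n : D.Lo y z) : E.dom (F.compIso m n).inv = 𝟙 _ := DblCat.dom_inv _ _ (by simp)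
theorem cod_unitIso_inv {D E : DblCat.{u}} (F : DblFunctor D E) (x : D.Obj) :
    E.cod (F.unitIso x).inv = 𝟙 _ := DblCat.cod_inv _ _ (by simp)
theorem dom_unitIso_inv {D E : DblCat.{u}} (F : DblFunctor D E) (x : D.Obj) :
    E.dom (F.unitIso x).inv = 𝟙 _ := DblCat.dom_inv _ _ (by simp)

attribute [simp] cod_compIso_inv dom_compIso_inv cod_unitIso_inv dom_unitIso_inv

/-- The associativity constraint. -/
def assoc : ∀ {x y z w : A.Obj ⊕ B.Obj} (m : Lo P Q x y) (n : Lo P Q y z) (p : Lo P Q z w),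
    @Iso _ (sqCat P Q) ⟨comp (comp m n) p⟩ ⟨comp m (comp n p)⟩
  | _, _, _, _, .left m, .left n, .left p => leftIso P Q (A.assoc m n p)
  | _, _, _, _, .left m, .left n, .het p => hetIso
      (DblCat.rwIso (P.compIso m n).symm p (by simp) ≪≫ M.assoc (P.lo m) (P.lo n) p)
      (by simp [DblCat.rwIso]) (by simp [DblCat.rwIso])
  | _, _, _, _, .left m, .het n, .right p => hetIso (M.assoc (P.lo m) n (Q.lo p))
      (by simp) (by simp)
  | _, _, _, _, .het m, .right n, .right p => hetIso
      (M.assoc m (Q.lo n) (Q.lo p) ≪≫ DblCat.lwIso m (Q.compIso n p) (by simp))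
      (by simp [DblCat.lwIso]) (by simp [DblCat.lwIso])
  | _, _, _, _, .right m, .right n, .right p => rightIso P Q (B.assoc m n p)

/-- The left unit constraint. -/
def leftUnitor : ∀ {x y : A.Obj ⊕ B.Obj} (m : Lo P Q x y),
    @Iso _ (sqCat P Q) ⟨comp (unit P Q x) m⟩ ⟨m⟩
  | _, _, .left m => leftIso P Q (A.leftUnitor m)
  | _, _, .het m => hetIso
      (DblCat.rwIso (P.unitIso _).symm m (by simp) ≪≫ M.leftUnitor m)
      (by simp [DblCat.rwIso]) (by simp [DblCat.rwIso])
  | _, _, .right m => rightIso P Q (B.leftUnitor m)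

/-- The right unit constraint. -/
def rightUnitor : ∀ {x y : A.Obj ⊕ B.Obj} (m : Lo P Q x y),
    @Iso _ (sqCat P Q) ⟨comp m (unit P Q y)⟩ ⟨m⟩
  | _, _, .left m => leftIso P Q (A.rightUnitor m)
  | _, _, .het m => hetIso
      (DblCat.lwIso m (Q.unitIso _).symm (by simp) ≪≫ M.rightUnitor m)
      (by simp [DblCat.lwIso]) (by simp [DblCat.lwIso])
  | _, _, .right m => rightIso P Q (B.rightUnitor m)

end Cograph

namespace Cograph

variable {A B M : DblCat.{u}} {P : DblFunctor A M} {Q : DblFunctor B M}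

theorem compSq_comp_left {a a' a'' c c' c'' : A.Obj} {b b' b'' : B.Obj} {m : A.Lo a c}
    {m' : A.Lo a' c'} {m'' : A.Lo a'' c''} {n : M.Lo (P.tight.obj c) (Q.tight.obj b)}
    {n' : M.Lo (P.tight.obj c') (Q.tight.obj b')} {n'' : M.Lo (P.tight.obj c'') (Q.tight.obj b'')}
    (α : LoArr.mk m ⟶ LoArr.mk m') (β : Het P Q n n') (h : A.cod α = β.f)
    (α' : LoArr.mk m' ⟶ LoArr.mk m'') (β' : Het P Q n' n'') (h' : A.cod α' = β'.f)
    (e : M.cod (P.sq (α ≫ α')) = M.dom (β.sq ≫ β'.sq)) :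
    M.compSq (P.sq (α ≫ α')) (β.sq ≫ β'.sq) e = (leftHet α β h).sq ≫ (leftHet α' β' h').sq :=
  (DblCat.compSq_congr _ (P.sq_comp _ _) rfl).trans (M.compSq_comp _ _ _ _ _ _ _)

theorem compSq_comp_right {a a' a'' : A.Obj} {b b' b'' c c' c'' : B.Obj}
    {m : M.Lo (P.tight.obj a) (Q.tight.obj b)} {m' : M.Lo (P.tight.obj a') (Q.tight.obj b')}
    {m'' : M.Lo (P.tight.obj a'') (Q.tight.obj b'')} {n : B.Lo b c} {n' : B.Lo b' c'}
    {n'' : B.Lo b'' c''} (α : Het P Q m m') (β : LoArr.mk n ⟶ LoArr.mk n') (h : α.g = B.dom β)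
    (α' : Het P Q m' m'') (β' : LoArr.mk n' ⟶ LoArr.mk n'') (h' : α'.g = B.dom β')
    (e : M.cod (α.sq ≫ α'.sq) = M.dom (Q.sq (β ≫ β'))) :
    M.compSq (α.sq ≫ α'.sq) (Q.sq (β ≫ β')) e = (hetRight α β h).sq ≫ (hetRight α' β' h').sq :=
  (DblCat.compSq_congr _ rfl (Q.sq_comp _ _)).trans (M.compSq_comp _ _ _ _ _ _ _)

theorem rw_exchange {D : DblCat.{u}} {x y z x' y' z' : D.Obj} {m k : D.Lo x y} {m' k' : D.Lo x' y'}
    {n : D.Lo y z} {n' : D.Lo y' z'} (e : LoArr.mk k ⟶ LoArr.mk m) (he : D.cod e = 𝟙 y)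
    (e' : LoArr.mk k' ⟶ LoArr.mk m') (he' : D.cod e' = 𝟙 y') (α : LoArr.mk m ⟶ LoArr.mk m')
    (α' : LoArr.mk k ⟶ LoArr.mk k') (β : LoArr.mk n ⟶ LoArr.mk n') (h : D.cod α = D.dom β)
    (h' : D.cod α' = D.dom β) (w : α' ≫ e' = e ≫ α) :
    D.compSq α' β h' ≫ DblCat.rw' e' n' he' = DblCat.rw' e n he ≫ D.compSq α β h := by
  unfold DblCat.rw'
  refine (DblCat.compSq_compSq _ _ _ _ _ _).trans ?_
  refine Eq.trans ?_ (DblCat.compSq_compSq _ _ _ _ _ _).symm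
  exact DblCat.compSq_congr _ w ((Category.comp_id _).trans (Category.id_comp _).symm)

theorem lw_exchange {D : DblCat.{u}} {x y z x' y' z' : D.Obj} {m : D.Lo x y} {m' : D.Lo x' y'}
    {n k : D.Lo y z} {n' k' : D.Lo y' z'} (e : LoArr.mk n ⟶ LoArr.mk k) (he : D.dom e = 𝟙 y)
    (e' : LoArr.mk n' ⟶ LoArr.mk k') (he' : D.dom e' = 𝟙 y') (α : LoArr.mk m ⟶ LoArr.mk m')
    (β : LoArr.mk n ⟶ LoArr.mk n') (β' : LoArr.mk k ⟶ LoArr.mk k') (h : D.cod α = D.dom β)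
    (h' : D.cod α = D.dom β') (w : β ≫ e' = e ≫ β') :
    D.compSq α β h ≫ DblCat.lw m' e' he' = DblCat.lw m e he ≫ D.compSq α β' h' := by
  unfold DblCat.lw
  refine (DblCat.compSq_compSq _ _ _ _ _ _).trans ?_
  refine Eq.trans ?_ (DblCat.compSq_compSq _ _ _ _ _ _).symm
  exact DblCat.compSq_congr _ ((Category.comp_id _).trans (Category.id_comp _).symm) w

theorem compIso_inv_naturality {D E : DblCat.{u}} (F : DblFunctor D E) {x y z x' y' z' : D.Obj}
    {m : D.Lo x y} {n : D.Lo y z} {m' : D.Lo x' y'} {n' : D.Lo y' z'}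
    (α : LoArr.mk m ⟶ LoArr.mk m') (β : LoArr.mk n ⟶ LoArr.mk n') (h : D.cod α = D.dom β) :
    F.sq (D.compSq α β h) ≫ (F.compIso m' n').inv =
      (F.compIso m n).inv ≫ E.compSq (F.sq α) (F.sq β) (by rw [F.cod_sq, F.dom_sq, h]) := by
  rw [Iso.eq_inv_comp, ← Category.assoc, ← F.compIso_naturality, Category.assoc, Iso.hom_inv_id,
    Category.comp_id]

theorem unitIso_inv_naturality {D E : DblCat.{u}} (F : DblFunctor D E) {x y : D.Obj} (f : x ⟶ y) :
    F.sq (D.unitSq f) ≫ (F.unitIso y).inv = (F.unitIso x).inv ≫ E.unitSq (F.tight.map f) := by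
  rw [Iso.eq_inv_comp, ← Category.assoc, ← F.unitIso_naturality, Category.assoc, Iso.hom_inv_id,
    Category.comp_id]

theorem assoc_nat_llh {a₀ a₁ a₂ c₀ c₁ c₂ : A.Obj} {b b' : B.Obj} {m : A.Lo a₀ a₁} {n : A.Lo a₁ a₂}
    {p : M.Lo (P.tight.obj a₂) (Q.tight.obj b)} {m' : A.Lo c₀ c₁} {n' : A.Lo c₁ c₂}
    {p' : M.Lo (P.tight.obj c₂) (Q.tight.obj b')} (α : LoArr.mk m ⟶ LoArr.mk m')
    (β : LoArr.mk n ⟶ LoArr.mk n') (γ : Het P Q p p') (h : A.cod α = A.dom β) (k : A.cod β = γ.f) :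
    (leftHet (A.compSq α β h) γ ((A.cod_compSq α β h).trans k)).sq ≫
        DblCat.rw' (P.compIso m' n').inv p' (by simp) ≫ (M.assoc (P.lo m') (P.lo n') p').hom =
      (DblCat.rw' (P.compIso m n).inv p (by simp) ≫ (M.assoc (P.lo m) (P.lo n) p).hom) ≫
        (leftHet α (leftHet β γ k) h).sq := by
  have hγ : M.cod (P.sq β) = M.dom γ.sq := by rw [P.cod_sq, γ.dom, k]
  have hαβ : M.cod (P.sq α) = M.dom (P.sq β) := by rw [P.cod_sq, P.dom_sq, h]
  have h1 := M.assoc_naturality (P.sq α) (P.sq β) γ.sq hαβ hγ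
  refine (Category.assoc _ _ _).symm.trans ?_
  refine Eq.trans (congrArg (· ≫ _) (rw_exchange _ (cod_compIso_inv P m n) _ (cod_compIso_inv P m' n') (M.compSq (P.sq α) (P.sq β) hαβ)
    (P.sq (A.compSq α β h)) γ.sq ((M.cod_compSq _ _ _).trans hγ) _
    (compIso_inv_naturality P α β h))) ?_
  refine (Category.assoc _ _ _).trans ?_
  refine (congrArg (_ ≫ ·) h1).trans ?_
  exact (Category.assoc _ _ _).symm

theorem assoc_nat_hrr {a a' : A.Obj} {b₀ b₁ b₂ c₀ c₁ c₂ : B.Obj}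
    {m : M.Lo (P.tight.obj a) (Q.tight.obj b₀)} {n : B.Lo b₀ b₁} {p : B.Lo b₁ b₂}
    {m' : M.Lo (P.tight.obj a') (Q.tight.obj c₀)} {n' : B.Lo c₀ c₁} {p' : B.Lo c₁ c₂}
    (α : Het P Q m m') (β : LoArr.mk n ⟶ LoArr.mk n') (γ : LoArr.mk p ⟶ LoArr.mk p')
    (h : α.g = B.dom β) (k : B.cod β = B.dom γ) :
    (hetRight (hetRight α β h) γ k).sq ≫
        (M.assoc m' (Q.lo n') (Q.lo p')).hom ≫ DblCat.lw m' (Q.compIso n' p').hom (by simp) =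
      ((M.assoc m (Q.lo n) (Q.lo p)).hom ≫ DblCat.lw m (Q.compIso n p).hom (by simp)) ≫
        (hetRight α (B.compSq β γ k) (h.trans (B.dom_compSq β γ k).symm)).sq := by
  have hα : M.cod α.sq = M.dom (Q.sq β) := by rw [Q.dom_sq, α.cod, h]
  have hβγ : M.cod (Q.sq β) = M.dom (Q.sq γ) := by rw [Q.cod_sq, Q.dom_sq, k]
  have h1 := M.assoc_naturality α.sq (Q.sq β) (Q.sq γ) hα hβγ
  refine (Category.assoc _ _ _).symm.trans ?_
  refine (congrArg (· ≫ _) h1).trans ?_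
  refine (Category.assoc _ _ _).trans ?_
  refine Eq.trans ?_ (Category.assoc _ _ _).symm
  refine congrArg (_ ≫ ·) ?_
  exact lw_exchange _ (Q.dom_compIso n p) _ (Q.dom_compIso n' p') α.sq (M.compSq (Q.sq β) (Q.sq γ) hβγ) (Q.sq (B.compSq β γ k))
    (hα.trans (M.dom_compSq _ _ _).symm) _ (Q.compIso_naturality β γ k)

theorem leftUnitor_nat {a a' : A.Obj} {b b' : B.Obj} {m : M.Lo (P.tight.obj a) (Q.tight.obj b)}
    {m' : M.Lo (P.tight.obj a') (Q.tight.obj b')} (α : Het P Q m m')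
    (h : A.cod (A.unitSq α.f) = α.f) :
    (leftHet (A.unitSq α.f) α h).sq ≫
        DblCat.rw' (P.unitIso a').inv m' (by simp) ≫ (M.leftUnitor m').hom =
      (DblCat.rw' (P.unitIso a).inv m (by simp) ≫ (M.leftUnitor m).hom) ≫ α.sq := by
  have h1 := M.leftUnitor_naturality α.sq
  have h2 : M.compSq (M.unitSq (M.dom α.sq)) α.sq (M.cod_unitSq _) =
      M.compSq (M.unitSq (P.tight.map α.f)) α.sq (by rw [M.cod_unitSq, α.dom]) :=
    DblCat.compSq_congr _ (congrArg _ α.dom) rfl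
  refine (Category.assoc _ _ _).symm.trans ?_
  refine Eq.trans (congrArg (· ≫ _) (rw_exchange _ (cod_unitIso_inv P a) _ (cod_unitIso_inv P a') (M.unitSq (P.tight.map α.f))
    (P.sq (A.unitSq α.f)) α.sq (by rw [M.cod_unitSq, α.dom]) _
    (unitIso_inv_naturality P α.f))) ?_
  refine (Category.assoc _ _ _).trans ?_
  rw [← h2, h1]
  exact (Category.assoc _ _ _).symm

theorem rightUnitor_nat {a a' : A.Obj} {b b' : B.Obj} {m : M.Lo (P.tight.obj a) (Q.tight.obj b)}
    {m' : M.Lo (P.tight.obj a') (Q.tight.obj b')} (α : Het P Q m m')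
    (h : α.g = B.dom (B.unitSq α.g)) :
    (hetRight α (B.unitSq α.g) h).sq ≫
        DblCat.lw m' (Q.unitIso b').inv (by simp) ≫ (M.rightUnitor m').hom =
      (DblCat.lw m (Q.unitIso b).inv (by simp) ≫ (M.rightUnitor m).hom) ≫ α.sq := by
  have h1 := M.rightUnitor_naturality α.sq
  have h2 : M.compSq α.sq (M.unitSq (M.cod α.sq)) (M.dom_unitSq _).symm =
      M.compSq α.sq (M.unitSq (Q.tight.map α.g)) (by rw [M.dom_unitSq, α.cod]) :=
    DblCat.compSq_congr _ rfl (congrArg _ α.cod)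
  refine (Category.assoc _ _ _).symm.trans ?_
  refine Eq.trans (congrArg (· ≫ _) (lw_exchange _ (dom_unitIso_inv Q b) _ (dom_unitIso_inv Q b') α.sq (Q.sq (B.unitSq α.g))
    (M.unitSq (Q.tight.map α.g)) _ (by rw [M.dom_unitSq, α.cod])
    (unitIso_inv_naturality Q α.g))) ?_
  refine (Category.assoc _ _ _).trans ?_
  rw [← h2, h1]
  exact (Category.assoc _ _ _).symm

end Cograph

namespace Cograph

variable {A B M : DblCat.{u}} {P : DblFunctor A M} {Q : DblFunctor B M}

theorem dom_comp {m n p : LoArr (Lo P Q)} (α : Sq P Q m n) (β : Sq P Q n p) :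
    Sq.dom (α.comp β) = Ti.comp (Sq.dom α) (Sq.dom β) := by
  rcases α with α | α | α <;> rcases β with β | β | β
  · exact congrArg Ti.left (A.dom_comp _ _)
  · rfl
  · exact congrArg Ti.right (B.dom_comp _ _)

theorem cod_comp {m n p : LoArr (Lo P Q)} (α : Sq P Q m n) (β : Sq P Q n p) :
    Sq.cod (α.comp β) = Ti.comp (Sq.cod α) (Sq.cod β) := by
  rcases α with α | α | α <;> rcases β with β | β | β
  · exact congrArg Ti.left (A.cod_comp _ _)
  · rfl
  · exact congrArg Ti.right (B.cod_comp _ _)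

theorem dom_compSq {x y z x' y' z' : A.Obj ⊕ B.Obj} {m : Lo P Q x y} {n : Lo P Q y z}
    {m' : Lo P Q x' y'} {n' : Lo P Q y' z'} (α : Sq P Q ⟨m⟩ ⟨m'⟩) (β : Sq P Q ⟨n⟩ ⟨n'⟩)
    (h : Sq.cod α = Sq.dom β) : Sq.dom (compSq α β h) = Sq.dom α := by
  rcases α with α | α | α <;> rcases β with β | β | β
  · exact congrArg Ti.left (A.dom_compSq _ _ _)
  · rfl
  · rfl
  · exact congrArg Ti.right (B.dom_compSq _ _ _)

theorem cod_compSq {x y z x' y' z' : A.Obj ⊕ B.Obj} {m : Lo P Q x y} {n : Lo P Q y z}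
    {m' : Lo P Q x' y'} {n' : Lo P Q y' z'} (α : Sq P Q ⟨m⟩ ⟨m'⟩) (β : Sq P Q ⟨n⟩ ⟨n'⟩)
    (h : Sq.cod α = Sq.dom β) : Sq.cod (compSq α β h) = Sq.cod β := by
  rcases α with α | α | α <;> rcases β with β | β | β
  · exact congrArg Ti.left (A.cod_compSq _ _ _)
  · rfl
  · rfl
  · exact congrArg Ti.right (B.cod_compSq _ _ _)

theorem compSq_comp {x y z x' y' z' x'' y'' z'' : A.Obj ⊕ B.Obj} {m : Lo P Q x y} {n : Lo P Q y z}
    {m' : Lo P Q x' y'} {n' : Lo P Q y' z'} {m'' : Lo P Q x'' y''} {n'' : Lo P Q y'' z''}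
    (α : Sq P Q ⟨m⟩ ⟨m'⟩) (β : Sq P Q ⟨n⟩ ⟨n'⟩) (h : Sq.cod α = Sq.dom β)
    (α' : Sq P Q ⟨m'⟩ ⟨m''⟩) (β' : Sq P Q ⟨n'⟩ ⟨n''⟩) (h' : Sq.cod α' = Sq.dom β')
    (h'' : Sq.cod (α.comp α') = Sq.dom (β.comp β')) :
    compSq (α.comp α') (β.comp β') h'' = (compSq α β h).comp (compSq α' β' h') := by
  rcases α with α | α | α <;> rcases β with β | β | β <;> rcases α' with α' | α' | α' <;> rcases β' with β' | β' | β'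
  · exact Sq.left_congr (A.compSq_comp _ _ _ _ _ _ _)
  · exact Sq.het_congr (A.dom_comp _ _) rfl (compSq_comp_left _ _ _ _ _ _ _)
  · exact Sq.het_congr rfl (B.cod_comp _ _) (compSq_comp_right _ _ _ _ _ _ _)
  · exact Sq.right_congr (B.compSq_comp _ _ _ _ _ _ _)

theorem assoc_naturality {x y z w x' y' z' w' : A.Obj ⊕ B.Obj} {m : Lo P Q x y} {n : Lo P Q y z}
    {p : Lo P Q z w} {m' : Lo P Q x' y'} {n' : Lo P Q y' z'} {p' : Lo P Q z' w'}
    (α : Sq P Q ⟨m⟩ ⟨m'⟩) (β : Sq P Q ⟨n⟩ ⟨n'⟩) (γ : Sq P Q ⟨p⟩ ⟨p'⟩)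
    (h : Sq.cod α = Sq.dom β) (k : Sq.cod β = Sq.dom γ) :
    Sq.comp (compSq (compSq α β h) γ ((cod_compSq α β h).trans k))
        (@Iso.hom _ (sqCat P Q) _ _ (assoc m' n' p')) =
      Sq.comp (@Iso.hom _ (sqCat P Q) _ _ (assoc m n p)) (compSq α (compSq β γ k) (h.trans (dom_compSq β γ k).symm)) := by
  rcases α with α | α | α <;> rcases β with β | β | β <;> rcases γ with γ | γ | γ
  · exact Sq.left_congr (A.assoc_naturality _ _ _ (Ti.left_inj h) (Ti.left_inj k))
  · refine Sq.het_congr ?_ ?_ (assoc_nat_llh _ _ _ (Ti.left_inj h) (Ti.left_inj k))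
    · exact (congrArg (· ≫ _) (A.dom_compSq _ _ _)).trans
        ((Category.comp_id _).trans (Category.id_comp _).symm)
    · exact (Category.comp_id _).trans (Category.id_comp _).symm
  · refine Sq.het_congr ?_ ?_ (M.assoc_naturality _ _ _ _ _)
    · exact (Category.comp_id _).trans (Category.id_comp _).symm
    · exact (Category.comp_id _).trans (Category.id_comp _).symm
  · refine Sq.het_congr ?_ ?_ (assoc_nat_hrr _ _ _ (Ti.right_inj h) (Ti.right_inj k))
    · exact (Category.comp_id _).trans (Category.id_comp _).symm
    · exact (Category.comp_id _).trans ((Category.id_comp _).trans (B.cod_compSq _ _ _)).symm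
  · exact Sq.right_congr (B.assoc_naturality _ _ _ (Ti.right_inj h) (Ti.right_inj k))

section coherence
open DblCat

variable (P Q) in
/-- The comparison of composites as an isomorphism of globular squares. -/
def compGlob {x y z : A.Obj} (m : A.Lo x y) (n : A.Lo y z) :
    @Iso ((⟨P.tight.obj x⟩ : Horiz M) ⟶ ⟨P.tight.obj z⟩) _
      (CategoryStruct.comp (obj := Horiz M) (Y := ⟨P.tight.obj y⟩) (P.lo m) (P.lo n))
      (P.lo (A.comp m n)) :=
  Horiz.iso _ _ (P.compIso m n) (P.dom_compIso m n) (P.cod_compIso m n)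

/-- The comparison of units as an isomorphism of globular squares. -/
def unitGlob (P : DblFunctor A M) (x : A.Obj) :
    @Iso ((⟨P.tight.obj x⟩ : Horiz M) ⟶ ⟨P.tight.obj x⟩) _ (𝟙 (⟨P.tight.obj x⟩ : Horiz M))
      (P.lo (A.unit x)) :=
  Horiz.iso _ _ (P.unitIso x) (P.dom_unitIso x) (P.cod_unitIso x)

theorem pentagon_sq_llh {x y z w : A.Obj} {v : B.Obj} (m : A.Lo x y) (n : A.Lo y z) (p : A.Lo z w)
    (q : M.Lo (P.tight.obj w) (Q.tight.obj v))
    (h : M.cod (P.sq (A.assoc m n p).hom) = M.dom (𝟙 (LoArr.mk q)))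
    (k : M.cod (P.sq (𝟙 (LoArr.mk m))) =
      M.dom (rw' (P.compIso n p).inv q (by simp) ≫ (M.assoc (P.lo n) (P.lo p) q).hom)) :
    M.compSq (P.sq (A.assoc m n p).hom) (𝟙 (LoArr.mk q)) h ≫
        (rw' (P.compIso m (A.comp n p)).inv q (by simp) ≫
          (M.assoc (P.lo m) (P.lo (A.comp n p)) q).hom) ≫
        M.compSq (P.sq (𝟙 (LoArr.mk m)))
          (rw' (P.compIso n p).inv q (by simp) ≫ (M.assoc (P.lo n) (P.lo p) q).hom) k =
      (rw' (P.compIso (A.comp m n) p).inv q (by simp) ≫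
        (M.assoc (P.lo (A.comp m n)) (P.lo p) q).hom) ≫
        rw' (P.compIso m n).inv (M.comp (P.lo p) q) (by simp) ≫
          (M.assoc (P.lo m) (P.lo n) (M.comp (P.lo p) q)).hom := by
  have key := congrArg Glob.sq (DblCat.pentagon_llh (B := Horiz M) (a := ⟨_⟩) (b := ⟨_⟩)
    (c := ⟨_⟩) (d := ⟨_⟩) (e := ⟨_⟩) (q := q) (compGlob P m n) (compGlob P n p)
    (compGlob P (A.comp m n) p) (compGlob P m (A.comp n p))
    ⟨P.sq (A.assoc m n p).hom, by simp, by simp⟩ (Glob.ext' (P.map_assoc m n p)))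
  refine Eq.trans ?_ key
  exact congrArg (_ ≫ ·) (congrArg (_ ≫ ·) (compSq_congr k (P.sq_id m) rfl))

theorem pentagon_sq_lhr {x y z : A.Obj} {w v : B.Obj} (m : A.Lo x y) (n : A.Lo y z)
    (p : M.Lo (P.tight.obj z) (Q.tight.obj w)) (q : B.Lo w v)
    (h : M.cod (rw' (P.compIso m n).inv p (by simp) ≫ (M.assoc (P.lo m) (P.lo n) p).hom) =
      M.dom (Q.sq (𝟙 (LoArr.mk q))))
    (k : M.cod (P.sq (𝟙 (LoArr.mk m))) = M.dom (M.assoc (P.lo n) p (Q.lo q)).hom) :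
    M.compSq (rw' (P.compIso m n).inv p (by simp) ≫ (M.assoc (P.lo m) (P.lo n) p).hom)
        (Q.sq (𝟙 (LoArr.mk q))) h ≫ (M.assoc (P.lo m) (M.comp (P.lo n) p) (Q.lo q)).hom ≫
        M.compSq (P.sq (𝟙 (LoArr.mk m))) (M.assoc (P.lo n) p (Q.lo q)).hom k =
      (M.assoc (P.lo (A.comp m n)) p (Q.lo q)).hom ≫
        rw' (P.compIso m n).inv (M.comp p (Q.lo q)) (by simp) ≫
          (M.assoc (P.lo m) (P.lo n) (M.comp p (Q.lo q))).hom := by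
  have key := congrArg Glob.sq (DblCat.pentagon_lhr (B := Horiz M) (a := ⟨_⟩) (b := ⟨_⟩)
    (c := ⟨_⟩) (d := ⟨_⟩) (e := ⟨_⟩) (p := p) (q := Q.lo q) (compGlob P m n))
  refine Eq.trans ?_ key
  exact congrArg₂ (· ≫ ·) (compSq_congr h rfl (Q.sq_id q))
    (congrArg (_ ≫ ·) (compSq_congr k (P.sq_id m) rfl))

theorem pentagon_sq_lhr' {x y : A.Obj} {z w v : B.Obj} (m : A.Lo x y)
    (n : M.Lo (P.tight.obj y) (Q.tight.obj z)) (p : B.Lo z w) (q : B.Lo w v)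
    (h : M.cod (M.assoc (P.lo m) n (Q.lo p)).hom = M.dom (Q.sq (𝟙 (LoArr.mk q))))
    (k : M.cod (P.sq (𝟙 (LoArr.mk m))) =
      M.dom ((M.assoc n (Q.lo p) (Q.lo q)).hom ≫ lw n (Q.compIso p q).hom (by simp))) :
    M.compSq (M.assoc (P.lo m) n (Q.lo p)).hom (Q.sq (𝟙 (LoArr.mk q))) h ≫
        (M.assoc (P.lo m) (M.comp n (Q.lo p)) (Q.lo q)).hom ≫
        M.compSq (P.sq (𝟙 (LoArr.mk m)))
          ((M.assoc n (Q.lo p) (Q.lo q)).hom ≫ lw n (Q.compIso p q).hom (by simp)) k =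
      ((M.assoc (M.comp (P.lo m) n) (Q.lo p) (Q.lo q)).hom ≫
        lw (M.comp (P.lo m) n) (Q.compIso p q).hom (by simp)) ≫
          (M.assoc (P.lo m) n (Q.lo (B.comp p q))).hom := by
  have key := congrArg Glob.sq (DblCat.pentagon_lhr' (B := Horiz M) (a := ⟨_⟩) (b := ⟨_⟩)
    (c := ⟨_⟩) (d := ⟨_⟩) (e := ⟨_⟩) (m := P.lo m) (n := n) (compGlob Q p q))
  refine Eq.trans ?_ key
  exact congrArg₂ (· ≫ ·) (compSq_congr h rfl (Q.sq_id q))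
    (congrArg (_ ≫ ·) (compSq_congr k (P.sq_id m) rfl))

theorem pentagon_sq_hrr {x : A.Obj} {y z w v : B.Obj} (m : M.Lo (P.tight.obj x) (Q.tight.obj y))
    (n : B.Lo y z) (p : B.Lo z w) (q : B.Lo w v)
    (h : M.cod ((M.assoc m (Q.lo n) (Q.lo p)).hom ≫ lw m (Q.compIso n p).hom (by simp)) =
      M.dom (Q.sq (𝟙 (LoArr.mk q))))
    (k : M.cod (𝟙 (LoArr.mk m)) = M.dom (Q.sq (B.assoc n p q).hom)) :
    M.compSq ((M.assoc m (Q.lo n) (Q.lo p)).hom ≫ lw m (Q.compIso n p).hom (by simp))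
        (Q.sq (𝟙 (LoArr.mk q))) h ≫
        ((M.assoc m (Q.lo (B.comp n p)) (Q.lo q)).hom ≫
          lw m (Q.compIso (B.comp n p) q).hom (by simp)) ≫
        M.compSq (𝟙 (LoArr.mk m)) (Q.sq (B.assoc n p q).hom) k =
      ((M.assoc (M.comp m (Q.lo n)) (Q.lo p) (Q.lo q)).hom ≫
        lw (M.comp m (Q.lo n)) (Q.compIso p q).hom (by simp)) ≫
        (M.assoc m (Q.lo n) (Q.lo (B.comp p q))).hom ≫
          lw m (Q.compIso n (B.comp p q)).hom (by simp) := by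
  have key := congrArg Glob.sq (DblCat.pentagon_hrr (B := Horiz M) (a := ⟨_⟩) (b := ⟨_⟩)
    (c := ⟨_⟩) (d := ⟨_⟩) (e := ⟨_⟩) (m := m) (compGlob Q n p) (compGlob Q p q)
    (compGlob Q (B.comp n p) q) (compGlob Q n (B.comp p q))
    ⟨Q.sq (B.assoc n p q).hom, by simp, by simp⟩ (Glob.ext' (Q.map_assoc n p q)))
  refine Eq.trans ?_ key
  exact congrArg (· ≫ _) (compSq_congr h rfl (Q.sq_id q))

theorem triangle_sq_lh {x y : A.Obj} {z : B.Obj} (m : A.Lo x y)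
    (n : M.Lo (P.tight.obj y) (Q.tight.obj z))
    (h : M.cod (P.sq (𝟙 (LoArr.mk m))) =
      M.dom (rw' (P.unitIso y).inv n (by simp) ≫ (M.leftUnitor n).hom))
    (k : M.cod (P.sq (A.rightUnitor m).hom) = M.dom (𝟙 (LoArr.mk n))) :
    (rw' (P.compIso m (A.unit y)).inv n (by simp) ≫ (M.assoc (P.lo m) (P.lo (A.unit y)) n).hom) ≫
        M.compSq (P.sq (𝟙 (LoArr.mk m)))
          (rw' (P.unitIso y).inv n (by simp) ≫ (M.leftUnitor n).hom) h =
      M.compSq (P.sq (A.rightUnitor m).hom) (𝟙 (LoArr.mk n)) k := by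
  have key := congrArg Glob.sq (DblCat.triangle_lh (B := Horiz M) (a := ⟨_⟩) (b := ⟨_⟩)
    (c := ⟨_⟩) (n := n) (compGlob P m (A.unit y)) (unitGlob P y)
    ⟨P.sq (A.rightUnitor m).hom, by simp, by simp⟩ (Glob.ext' (P.map_rightUnitor m)))
  refine Eq.trans ?_ key
  exact congrArg (_ ≫ ·) (compSq_congr h (P.sq_id m) rfl)

theorem triangle_sq_hr {x : A.Obj} {y z : B.Obj} (m : M.Lo (P.tight.obj x) (Q.tight.obj y))
    (n : B.Lo y z) (h : M.cod (𝟙 (LoArr.mk m)) = M.dom (Q.sq (B.leftUnitor n).hom))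
    (k : M.cod (lw m (Q.unitIso y).inv (by simp) ≫ (M.rightUnitor m).hom) =
      M.dom (Q.sq (𝟙 (LoArr.mk n)))) :
    ((M.assoc m (Q.lo (B.unit y)) (Q.lo n)).hom ≫
        lw m (Q.compIso (B.unit y) n).hom (by simp)) ≫
        M.compSq (𝟙 (LoArr.mk m)) (Q.sq (B.leftUnitor n).hom) h =
      M.compSq (lw m (Q.unitIso y).inv (by simp) ≫ (M.rightUnitor m).hom)
        (Q.sq (𝟙 (LoArr.mk n))) k := by
  have key := congrArg Glob.sq (DblCat.triangle_hr (B := Horiz M) (a := ⟨_⟩) (b := ⟨_⟩)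
    (c := ⟨_⟩) (m := m) (n := Q.lo n) (compGlob Q (B.unit y) n) (unitGlob Q y)
    ⟨Q.sq (B.leftUnitor n).hom, by simp, by simp⟩ (Glob.ext' (Q.map_leftUnitor n)))
  refine key.trans ?_
  exact compSq_congr _ rfl (Q.sq_id n).symm

end coherence

theorem pentagon {x y z w v : A.Obj ⊕ B.Obj} (m : Lo P Q x y) (n : Lo P Q y z) (p : Lo P Q z w)
    (q : Lo P Q w v)
    (h : Sq.cod (@Iso.hom _ (sqCat P Q) _ _ (assoc m n p)) = Sq.dom (Sq.id P Q ⟨q⟩))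
    (k : Sq.cod (Sq.id P Q ⟨m⟩) = Sq.dom (@Iso.hom _ (sqCat P Q) _ _ (assoc n p q))) :
    Sq.comp (compSq (@Iso.hom _ (sqCat P Q) _ _ (assoc m n p)) (Sq.id P Q ⟨q⟩) h)
        (Sq.comp (@Iso.hom _ (sqCat P Q) _ _ (assoc m (comp n p) q))
          (compSq (Sq.id P Q ⟨m⟩) (@Iso.hom _ (sqCat P Q) _ _ (assoc n p q)) k)) =
      Sq.comp (@Iso.hom _ (sqCat P Q) _ _ (assoc (comp m n) p q))
        (@Iso.hom _ (sqCat P Q) _ _ (assoc m n (comp p q))) := by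
  rcases m with m | m | m <;> rcases n with n | n | n <;> rcases p with p | p | p <;>
    rcases q with q | q | q
  · exact Sq.left_congr (A.pentagon m n p q)
  · refine Sq.het_congr ?_ ?_ ?_
    · simp [leftHet, hetRight, Het.comp, Het.glob]
    · simp [leftHet, hetRight, Het.comp, Het.glob]
    · exact pentagon_sq_llh m n p q _ _
  · refine Sq.het_congr ?_ ?_ ?_
    · simp [leftHet, hetRight, Het.comp, Het.glob]
    · simp [leftHet, hetRight, Het.comp, Het.glob]
    · exact pentagon_sq_lhr m n p q _ _
  · refine Sq.het_congr ?_ ?_ ?_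
    · simp [leftHet, hetRight, Het.comp, Het.glob]
    · simp [leftHet, hetRight, Het.comp, Het.glob]
    · exact pentagon_sq_lhr' m n p q _ _
  · refine Sq.het_congr ?_ ?_ ?_
    · simp [leftHet, hetRight, Het.comp, Het.glob]
    · simp [leftHet, hetRight, Het.comp, Het.glob]
    · exact pentagon_sq_hrr m n p q _ _
  · exact Sq.right_congr (B.pentagon m n p q)

theorem triangle {x y z : A.Obj ⊕ B.Obj} (m : Lo P Q x y) (n : Lo P Q y z)
    (h : Sq.cod (Sq.id P Q ⟨m⟩) = Sq.dom (@Iso.hom _ (sqCat P Q) _ _ (leftUnitor n)))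
    (k : Sq.cod (@Iso.hom _ (sqCat P Q) _ _ (rightUnitor m)) = Sq.dom (Sq.id P Q ⟨n⟩)) :
    Sq.comp (@Iso.hom _ (sqCat P Q) _ _ (assoc m (unit P Q y) n))
        (compSq (Sq.id P Q ⟨m⟩) (@Iso.hom _ (sqCat P Q) _ _ (leftUnitor n)) h) =
      compSq (@Iso.hom _ (sqCat P Q) _ _ (rightUnitor m)) (Sq.id P Q ⟨n⟩) k := by
  rcases m with m | m | m <;> rcases n with n | n | n
  · exact Sq.left_congr (A.triangle m n)
  · refine Sq.het_congr ?_ ?_ ?_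
    · simp [leftHet, hetRight, Het.comp, Het.glob]
    · simp [leftHet, hetRight, Het.comp, Het.glob]
    · exact triangle_sq_lh m n _ _
  · refine Sq.het_congr ?_ ?_ ?_
    · simp [leftHet, hetRight, Het.comp, Het.glob]
    · simp [leftHet, hetRight, Het.comp, Het.glob]
    · exact triangle_sq_hr m n _ _
  · exact Sq.right_congr (B.triangle m n)

variable (P Q) in
/-- The restriction of `M` along `P` and `Q`: the disjoint union of `A` and `B` together with the
loose arrows of `M` from the image of `A` to the image of `B`. -/
def cograph : DblCat.{u} where
  Obj := A.Obj ⊕ B.Obj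
  tight := tiCat
  Lo := Lo P Q
  loose := sqCat P Q
  dom := Sq.dom
  cod := Sq.cod
  dom_id := by
    rintro ⟨m | m | m⟩
    · exact congrArg Ti.left (A.dom_id _)
    · rfl
    · exact congrArg Ti.right (B.dom_id _)
  cod_id := by
    rintro ⟨m | m | m⟩
    · exact congrArg Ti.left (A.cod_id _)
    · rfl
    · exact congrArg Ti.right (B.cod_id _)
  dom_comp := dom_comp
  cod_comp := cod_comp
  unit := unit P Q
  unitSq := unitSq P Q
  dom_unitSq f := by
    rcases f with f | f
    · exact congrArg Ti.left (A.dom_unitSq _)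
    · exact congrArg Ti.right (B.dom_unitSq _)
  cod_unitSq f := by
    rcases f with f | f
    · exact congrArg Ti.left (A.cod_unitSq _)
    · exact congrArg Ti.right (B.cod_unitSq _)
  unitSq_id := by
    rintro (x | x)
    · exact Sq.left_congr (A.unitSq_id x)
    · exact Sq.right_congr (B.unitSq_id x)
  unitSq_comp f g := by
    rcases f with f | f <;> rcases g with g | g
    · exact Sq.left_congr (A.unitSq_comp _ _)
    · exact Sq.right_congr (B.unitSq_comp _ _)
  comp := comp
  compSq := compSq
  dom_compSq := dom_compSq
  cod_compSq := cod_compSq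
  compSq_id := by
    rintro _ _ _ (m | m | m) (n | n | n) h
    · exact Sq.left_congr (A.compSq_id m n _)
    · refine Sq.het_congr (A.dom_id _) rfl ?_
      exact (DblCat.compSq_congr _ (P.sq_id m) rfl).trans (M.compSq_id _ _ _)
    · refine Sq.het_congr rfl (B.cod_id _) ?_
      exact (DblCat.compSq_congr _ rfl (Q.sq_id n)).trans (M.compSq_id _ _ _)
    · exact Sq.right_congr (B.compSq_id m n _)
  compSq_comp := compSq_comp
  assoc := assoc
  dom_assoc := by
    rintro _ _ _ _ (m | m | m) (n | n | n) (p | p | p)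
    · exact congrArg Ti.left (A.dom_assoc _ _ _)
    · rfl
    · rfl
    · rfl
    · exact congrArg Ti.right (B.dom_assoc _ _ _)
  cod_assoc := by
    rintro _ _ _ _ (m | m | m) (n | n | n) (p | p | p)
    · exact congrArg Ti.left (A.cod_assoc _ _ _)
    · rfl
    · rfl
    · rfl
    · exact congrArg Ti.right (B.cod_assoc _ _ _)
  assoc_naturality := assoc_naturality
  leftUnitor := leftUnitor
  dom_leftUnitor := by
    rintro _ _ (m | m | m)
    · exact congrArg Ti.left (A.dom_leftUnitor _)
    · rfl
    · exact congrArg Ti.right (B.dom_leftUnitor _)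
  cod_leftUnitor := by
    rintro _ _ (m | m | m)
    · exact congrArg Ti.left (A.cod_leftUnitor _)
    · rfl
    · exact congrArg Ti.right (B.cod_leftUnitor _)
  leftUnitor_naturality α := by
    rcases α with α | α | α
    · exact Sq.left_congr (A.leftUnitor_naturality _)
    · refine Sq.het_congr ?_ ?_ (leftUnitor_nat _ (A.cod_unitSq _))
      · exact (congrArg (· ≫ _) (A.dom_unitSq _)).trans
          ((Category.comp_id _).trans (Category.id_comp _).symm)
      · exact (Category.comp_id _).trans (Category.id_comp _).symm
    · exact Sq.right_congr (B.leftUnitor_naturality _)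
  rightUnitor := rightUnitor
  dom_rightUnitor := by
    rintro _ _ (m | m | m)
    · exact congrArg Ti.left (A.dom_rightUnitor _)
    · rfl
    · exact congrArg Ti.right (B.dom_rightUnitor _)
  cod_rightUnitor := by
    rintro _ _ (m | m | m)
    · exact congrArg Ti.left (A.cod_rightUnitor _)
    · rfl
    · exact congrArg Ti.right (B.cod_rightUnitor _)
  rightUnitor_naturality α := by
    rcases α with α | α | α
    · exact Sq.left_congr (A.rightUnitor_naturality _)
    · refine Sq.het_congr ?_ ?_ (rightUnitor_nat _ (B.dom_unitSq _).symm)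
      · exact (Category.comp_id _).trans (Category.id_comp _).symm
      · exact (congrArg (· ≫ _) (B.cod_unitSq _)).trans
          ((Category.comp_id _).trans (Category.id_comp _).symm)
    · exact Sq.right_congr (B.rightUnitor_naturality _)
  pentagon m n p q := pentagon m n p q _ _
  triangle m n := triangle m n _ _

end Cograph

namespace DblCat

instance (x y : Loose.{u}.Obj) : Subsingleton (Loose.{u}.Lo x y) :=
  ⟨fun ⟨⟨_⟩⟩ ⟨⟨_⟩⟩ => rfl⟩

/-- A square isomorphism of the walking loose arrow. -/
def looseIso {x y : Loose.{u}.Obj} (m n : Loose.{u}.Lo x y) : LoArr.mk m ≅ LoArr.mk n where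
  hom := ⟨⟨rfl, rfl⟩⟩
  inv := ⟨⟨rfl, rfl⟩⟩

/-- The double functor to the walking loose arrow given by a labelling of objects. -/
def toLoose (D : DblCat.{u}) (o : D.Obj → Loose.{u}.Obj)
    (h : ∀ {x y : D.Obj}, (x ⟶ y) → o x = o y)
    (k : ∀ {x y : D.Obj}, D.Lo x y → Loose.{u}.Lo (o x) (o y)) :
    DblFunctor D Loose where
  tight :=
    { obj := o
      map := fun f => ⟨⟨h f⟩⟩
      map_id := fun _ => Subsingleton.elim _ _
      map_comp := fun _ _ => Subsingleton.elim _ _ }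
  lo m := k m
  sq α := ⟨⟨h (D.dom α), h (D.cod α)⟩⟩
  sq_id _ := Subsingleton.elim _ _
  sq_comp _ _ := Subsingleton.elim _ _
  dom_sq _ := Subsingleton.elim _ _
  cod_sq _ := Subsingleton.elim _ _
  unitIso _ := looseIso _ _
  dom_unitIso _ := Subsingleton.elim _ _
  cod_unitIso _ := Subsingleton.elim _ _
  unitIso_naturality _ := Subsingleton.elim _ _
  compIso _ _ := looseIso _ _
  dom_compIso _ _ := Subsingleton.elim _ _
  cod_compIso _ _ := Subsingleton.elim _ _
  compIso_naturality _ _ _ := Subsingleton.elim _ _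
  map_assoc _ _ _ := Subsingleton.elim _ _
  map_leftUnitor _ := Subsingleton.elim _ _
  map_rightUnitor _ := Subsingleton.elim _ _

theorem eq_toLoose {D : DblCat.{u}} (F : DblFunctor D Loose) (o : D.Obj → Loose.{u}.Obj)
    (h : ∀ {x y : D.Obj}, (x ⟶ y) → o x = o y)
    (k : ∀ {x y : D.Obj}, D.Lo x y → Loose.{u}.Lo (o x) (o y))
    (e : ∀ x, F.tight.obj x = o x) : F = D.toLoose o h k := by
  obtain rfl : F.tight.obj = o := funext e
  obtain ⟨t, lo, sq, _, _, _, _, ui, _, _, _, ci⟩ := F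
  rcases t with @⟨o', f, _, _⟩
  dsimp only at h k
  have h1 : @f = fun _ _ f => ⟨⟨h f⟩⟩ := by
    funext x y f; exact Subsingleton.elim _ _
  subst h1
  have h2 : @lo = fun x y m => k m := by
    funext x y f; exact Subsingleton.elim _ _
  subst h2
  have h3 : @sq = fun _ _ _ _ _ _ α => ⟨⟨h (D.dom α), h (D.cod α)⟩⟩ := by
    funext x y x' y' m n α; exact Subsingleton.elim _ _
  subst h3
  have h4 : @ui = fun _ => looseIso _ _ := by
    funext x; exact Iso.ext (Subsingleton.elim _ _)
  subst h4
  have h5 : @ci = fun _ _ _ _ _ => looseIso _ _ := by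
    funext x y z m n; exact Iso.ext (Subsingleton.elim _ _)
  subst h5
  rfl

variable {D X : DblCat.{u}} {R : D.Obj → Prop}

/-- The composite of a double functor with the inclusion of a full sub double category. -/
def fullOut (F : DblFunctor X (D.full R)) : DblFunctor X D where
  tight :=
    { obj := fun x => (F.tight.obj x).1
      map := fun f => F.tight.map f
      map_id := fun _ => F.tight.map_id _
      map_comp := fun _ _ => F.tight.map_comp _ _ }
  lo m := F.lo m
  sq α := F.sq α
  sq_id _ := F.sq_id _
  sq_comp _ _ := F.sq_comp _ _
  dom_sq _ := F.dom_sq _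
  cod_sq _ := F.cod_sq _
  unitIso x := ⟨(F.unitIso x).hom, (F.unitIso x).inv, (F.unitIso x).hom_inv_id,
    (F.unitIso x).inv_hom_id⟩
  dom_unitIso _ := F.dom_unitIso _
  cod_unitIso _ := F.cod_unitIso _
  unitIso_naturality _ := F.unitIso_naturality _
  compIso m n := ⟨(F.compIso m n).hom, (F.compIso m n).inv, (F.compIso m n).hom_inv_id,
    (F.compIso m n).inv_hom_id⟩
  dom_compIso _ _ := F.dom_compIso _ _
  cod_compIso _ _ := F.cod_compIso _ _
  compIso_naturality _ _ h := F.compIso_naturality _ _ h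
  map_assoc _ _ _ := F.map_assoc _ _ _
  map_leftUnitor _ := F.map_leftUnitor _
  map_rightUnitor _ := F.map_rightUnitor _

/-- A double functor landing in a full sub double category. -/
def fullIn (F : DblFunctor X D) (h : ∀ x, R (F.tight.obj x)) : DblFunctor X (D.full R) where
  tight :=
    { obj := fun x => ⟨F.tight.obj x, h x⟩
      map := fun f => F.tight.map f
      map_id := fun _ => F.tight.map_id _
      map_comp := fun _ _ => F.tight.map_comp _ _ }
  lo m := F.lo m
  sq α := F.sq α
  sq_id _ := F.sq_id _
  sq_comp _ _ := F.sq_comp _ _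
  dom_sq _ := F.dom_sq _
  cod_sq _ := F.cod_sq _
  unitIso x := fullIso (F.unitIso x)
  dom_unitIso _ := F.dom_unitIso _
  cod_unitIso _ := F.cod_unitIso _
  unitIso_naturality _ := F.unitIso_naturality _
  compIso m n := fullIso (F.compIso m n)
  dom_compIso _ _ := F.dom_compIso _ _
  cod_compIso _ _ := F.cod_compIso _ _
  compIso_naturality _ _ h := F.compIso_naturality _ _ h
  map_assoc _ _ _ := F.map_assoc _ _ _
  map_leftUnitor _ := F.map_leftUnitor _
  map_rightUnitor _ := F.map_rightUnitor _

end DblCat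

namespace Cograph

variable {A B M : DblCat.{u}} (P : DblFunctor A M) (Q : DblFunctor B M)

/-- The label of an object of the restriction. -/
def side : A.Obj ⊕ B.Obj → DblCat.Loose.{u}.Obj
  | .inl _ => Side.zero
  | .inr _ => Side.one

/-- The labelling of the restriction. -/
def label : DblFunctor (cograph P Q) DblCat.Loose.{u} :=
  (cograph P Q).toLoose side (fun f => by rcases f with f | f <;> rfl)
    (fun m => by
      rcases m with m | m | m
      · exact ⟨⟨Or.inl rfl⟩⟩
      · exact ⟨⟨Or.inr ⟨rfl, rfl⟩⟩⟩
      · exact ⟨⟨Or.inl rfl⟩⟩)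

/-- The inclusion of `A`. -/
def inl : DblFunctor A (cograph P Q) where
  tight :=
    { obj := fun x => Sum.inl x
      map := fun f => Ti.left f
      map_id := fun _ => rfl
      map_comp := fun _ _ => rfl }
  lo m := .left m
  sq α := .left α
  sq_id _ := rfl
  sq_comp _ _ := rfl
  dom_sq _ := rfl
  cod_sq _ := rfl
  unitIso _ := Iso.refl _
  dom_unitIso _ := DblCat.dom_id _ _
  cod_unitIso _ := DblCat.cod_id _ _
  unitIso_naturality f := (Category.comp_id _).trans (Category.id_comp _).symm
  compIso _ _ := Iso.refl _
  dom_compIso _ _ := DblCat.dom_id _ _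
  cod_compIso _ _ := DblCat.cod_id _ _
  compIso_naturality α β h := (Category.comp_id _).trans (Category.id_comp _).symm
  map_assoc m n p := Sq.left_congr ((DblFunctor.id A).map_assoc m n p)
  map_leftUnitor m := Sq.left_congr ((DblFunctor.id A).map_leftUnitor m)
  map_rightUnitor m := Sq.left_congr ((DblFunctor.id A).map_rightUnitor m)

/-- The inclusion of `B`. -/
def inr : DblFunctor B (cograph P Q) where
  tight :=
    { obj := fun x => Sum.inr x
      map := fun f => Ti.right f
      map_id := fun _ => rfl
      map_comp := fun _ _ => rfl }
  lo m := .right m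
  sq α := .right α
  sq_id _ := rfl
  sq_comp _ _ := rfl
  dom_sq _ := rfl
  cod_sq _ := rfl
  unitIso _ := Iso.refl _
  dom_unitIso _ := DblCat.dom_id _ _
  cod_unitIso _ := DblCat.cod_id _ _
  unitIso_naturality f := (Category.comp_id _).trans (Category.id_comp _).symm
  compIso _ _ := Iso.refl _
  dom_compIso _ _ := DblCat.dom_id _ _
  cod_compIso _ _ := DblCat.cod_id _ _
  compIso_naturality α β h := (Category.comp_id _).trans (Category.id_comp _).symm
  map_assoc m n p := Sq.right_congr ((DblFunctor.id B).map_assoc m n p)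
  map_leftUnitor m := Sq.right_congr ((DblFunctor.id B).map_leftUnitor m)
  map_rightUnitor m := Sq.right_congr ((DblFunctor.id B).map_rightUnitor m)

/-- The image of an object in `M`. -/
def projObj : A.Obj ⊕ B.Obj → M.Obj
  | .inl x => P.tight.obj x
  | .inr x => Q.tight.obj x

variable {P Q}

/-- The image of a tight arrow in `M`. -/
def projTi : ∀ {x y : A.Obj ⊕ B.Obj}, Ti x y → (projObj P Q x ⟶ projObj P Q y)
  | _, _, .left f => P.tight.map f
  | _, _, .right f => Q.tight.map f

/-- The image of a loose arrow in `M`. -/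
def projLo : ∀ {x y : A.Obj ⊕ B.Obj}, Lo P Q x y → M.Lo (projObj P Q x) (projObj P Q y)
  | _, _, .left m => P.lo m
  | _, _, .het m => m
  | _, _, .right m => Q.lo m

/-- The image of a square in `M`. -/
def projSq : ∀ {m n : LoArr (Lo P Q)}, Sq P Q m n →
    (LoArr.mk (projLo m.arr) ⟶ LoArr.mk (projLo n.arr))
  | _, _, .left α => P.sq α
  | _, _, .het α => α.sq
  | _, _, .right α => Q.sq α

/-- The comparison of units. -/
def projUnit : ∀ x : A.Obj ⊕ B.Obj,
    LoArr.mk (M.unit (projObj P Q x)) ≅ LoArr.mk (projLo (unit P Q x))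
  | .inl x => P.unitIso x
  | .inr x => Q.unitIso x

/-- The comparison of composites. -/
def projComp : ∀ {x y z : A.Obj ⊕ B.Obj} (m : Lo P Q x y) (n : Lo P Q y z),
    LoArr.mk (M.comp (projLo m) (projLo n)) ≅ LoArr.mk (projLo (comp m n))
  | _, _, _, .left m, .left n => P.compIso m n
  | _, _, _, .left m, .het n => Iso.refl _
  | _, _, _, .het m, .right n => Iso.refl _
  | _, _, _, .right m, .right n => Q.compIso m n

section
open DblCat

theorem map_assoc_llh {x y z : A.Obj} {w : B.Obj} (m : A.Lo x y) (n : A.Lo y z)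
    (p : M.Lo (P.tight.obj z) (Q.tight.obj w))
    (h : M.cod (P.compIso m n).hom = M.dom (𝟙 (LoArr.mk p)))
    (k : M.cod (𝟙 (LoArr.mk (P.lo m))) = M.dom (𝟙 (LoArr.mk (M.comp (P.lo n) p)))) :
    M.compSq (P.compIso m n).hom (𝟙 (LoArr.mk p)) h ≫ 𝟙 (LoArr.mk (M.comp (P.lo (A.comp m n)) p)) ≫
        rw' (P.compIso m n).inv p (by simp) ≫ (M.assoc (P.lo m) (P.lo n) p).hom =
      (M.assoc (P.lo m) (P.lo n) p).hom ≫
        M.compSq (𝟙 (LoArr.mk (P.lo m))) (𝟙 (LoArr.mk (M.comp (P.lo n) p))) k ≫ 𝟙 _ := by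
  have e : M.compSq (P.compIso m n).hom (𝟙 (LoArr.mk p)) h ≫
      rw' (P.compIso m n).inv p (by simp) = 𝟙 _ :=
    (rwIso (P.compIso m n) p (P.cod_compIso m n)).hom_inv_id
  rw [M.compSq_id, Category.id_comp, reassoc_of% e, Category.id_comp, Category.comp_id]

theorem map_assoc_lhr {x y : A.Obj} {z w : B.Obj} (m : A.Lo x y)
    (n : M.Lo (P.tight.obj y) (Q.tight.obj z)) (p : B.Lo z w)
    (h : M.cod (𝟙 (LoArr.mk (M.comp (P.lo m) n))) = M.dom (𝟙 (LoArr.mk (Q.lo p))))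
    (k : M.cod (𝟙 (LoArr.mk (P.lo m))) = M.dom (𝟙 (LoArr.mk (M.comp n (Q.lo p))))) :
    M.compSq (𝟙 (LoArr.mk (M.comp (P.lo m) n))) (𝟙 (LoArr.mk (Q.lo p))) h ≫ 𝟙 _ ≫
        (M.assoc (P.lo m) n (Q.lo p)).hom =
      (M.assoc (P.lo m) n (Q.lo p)).hom ≫
        M.compSq (𝟙 (LoArr.mk (P.lo m))) (𝟙 (LoArr.mk (M.comp n (Q.lo p)))) k ≫ 𝟙 _ := by
  rw [M.compSq_id, M.compSq_id]
  simp

theorem map_assoc_hrr {x : A.Obj} {y z w : B.Obj} (m : M.Lo (P.tight.obj x) (Q.tight.obj y))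
    (n : B.Lo y z) (p : B.Lo z w)
    (h : M.cod (𝟙 (LoArr.mk (M.comp m (Q.lo n)))) = M.dom (𝟙 (LoArr.mk (Q.lo p))))
    (k : M.cod (𝟙 (LoArr.mk m)) = M.dom (Q.compIso n p).hom) :
    M.compSq (𝟙 (LoArr.mk (M.comp m (Q.lo n)))) (𝟙 (LoArr.mk (Q.lo p))) h ≫ 𝟙 _ ≫
        (M.assoc m (Q.lo n) (Q.lo p)).hom ≫ lw m (Q.compIso n p).hom (by simp) =
      (M.assoc m (Q.lo n) (Q.lo p)).hom ≫
        M.compSq (𝟙 (LoArr.mk m)) (Q.compIso n p).hom k ≫ 𝟙 _ := by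
  rw [M.compSq_id, Category.id_comp, Category.id_comp, Category.comp_id]
  rfl

theorem map_leftUnitor_het {x : A.Obj} {y : B.Obj} (m : M.Lo (P.tight.obj x) (Q.tight.obj y))
    (h : M.cod (P.unitIso x).hom = M.dom (𝟙 (LoArr.mk m))) :
    M.compSq (P.unitIso x).hom (𝟙 (LoArr.mk m)) h ≫ 𝟙 _ ≫
        rw' (P.unitIso x).inv m (by simp) ≫ (M.leftUnitor m).hom = (M.leftUnitor m).hom := by
  have e : M.compSq (P.unitIso x).hom (𝟙 (LoArr.mk m)) h ≫
      rw' (P.unitIso x).inv m (by simp) = 𝟙 _ :=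
    (rwIso (P.unitIso x) m (P.cod_unitIso x)).hom_inv_id
  rw [Category.id_comp, reassoc_of% e]

theorem map_rightUnitor_het {x : A.Obj} {y : B.Obj} (m : M.Lo (P.tight.obj x) (Q.tight.obj y))
    (h : M.cod (𝟙 (LoArr.mk m)) = M.dom (Q.unitIso y).hom) :
    M.compSq (𝟙 (LoArr.mk m)) (Q.unitIso y).hom h ≫ 𝟙 _ ≫
        lw m (Q.unitIso y).inv (by simp) ≫ (M.rightUnitor m).hom = (M.rightUnitor m).hom := by
  have e : M.compSq (𝟙 (LoArr.mk m)) (Q.unitIso y).hom h ≫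
      lw m (Q.unitIso y).inv (by simp) = 𝟙 _ :=
    (lwIso m (Q.unitIso y) (Q.dom_unitIso y)).hom_inv_id
  rw [Category.id_comp, reassoc_of% e]

end

variable (P Q)

/-- The projection of the restriction to `M`. -/
def proj : DblFunctor (cograph P Q) M where
  tight :=
    { obj := projObj P Q
      map := projTi
      map_id := by
        rintro (x | x)
        · exact P.tight.map_id x
        · exact Q.tight.map_id x
      map_comp := fun f g => by
        rcases f with f | f <;> rcases g with g | g
        · exact P.tight.map_comp f g
        · exact Q.tight.map_comp f g }
  lo m := projLo m
  sq α := projSq α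
  sq_id {x y} m := by
    rcases m with m | m | m
    · exact P.sq_id m
    · rfl
    · exact Q.sq_id m
  sq_comp α β := by
    rcases α with α | α | α <;> rcases β with β | β | β
    · exact P.sq_comp α β
    · rfl
    · exact Q.sq_comp α β
  dom_sq α := by
    rcases α with α | α | α
    · exact P.dom_sq α
    · exact α.dom
    · exact Q.dom_sq α
  cod_sq α := by
    rcases α with α | α | α
    · exact P.cod_sq α
    · exact α.cod
    · exact Q.cod_sq α
  unitIso := projUnit
  dom_unitIso := by
    rintro (x | x)
    · exact P.dom_unitIso x
    · exact Q.dom_unitIso x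
  cod_unitIso := by
    rintro (x | x)
    · exact P.cod_unitIso x
    · exact Q.cod_unitIso x
  unitIso_naturality f := by
    rcases f with f | f
    · exact P.unitIso_naturality f
    · exact Q.unitIso_naturality f
  compIso m n := projComp m n
  dom_compIso m n := by
    rcases m with m | m | m <;> rcases n with n | n | n
    · exact P.dom_compIso m n
    · exact M.dom_id _
    · exact M.dom_id _
    · exact Q.dom_compIso m n
  cod_compIso m n := by
    rcases m with m | m | m <;> rcases n with n | n | n
    · exact P.cod_compIso m n
    · exact M.cod_id _
    · exact M.cod_id _
    · exact Q.cod_compIso m n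
  compIso_naturality α β h := by
    rcases α with α | α | α <;> rcases β with β | β | β
    · exact P.compIso_naturality α β (Ti.left_inj h)
    · exact (Category.comp_id _).trans (Category.id_comp _).symm
    · exact (Category.comp_id _).trans (Category.id_comp _).symm
    · exact Q.compIso_naturality α β (Ti.right_inj h)
  map_assoc m n p := by
    rcases m with m | m | m <;> rcases n with n | n | n <;> rcases p with p | p | p
    · exact P.map_assoc m n p
    · exact map_assoc_llh m n p _ _
    · exact map_assoc_lhr m n p _ _
    · exact map_assoc_hrr m n p _ _
    · exact Q.map_assoc m n p
  map_leftUnitor m := by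
    rcases m with m | m | m
    · exact P.map_leftUnitor m
    · exact map_leftUnitor_het m _
    · exact Q.map_leftUnitor m
  map_rightUnitor m := by
    rcases m with m | m | m
    · exact P.map_rightUnitor m
    · exact map_rightUnitor_het m _
    · exact Q.map_rightUnitor m

end Cograph

theorem DblCat.loose_ext {D : DblCat.{u}} {F G : DblFunctor D DblCat.Loose.{u}}
    (e : ∀ x, F.tight.obj x = G.tight.obj x) : F = G :=
  (DblCat.eq_toLoose F G.tight.obj (fun f => (G.tight.map f).down.down) (fun m => G.lo m) e).trans
    (DblCat.eq_toLoose G G.tight.obj _ _ fun _ => rfl).symm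

namespace Niche

/-- The source (`i = .zero`) or target (`i = .one`) double functor of a niche, with values in the
collage. -/
def leg (N : Niche.{u}) (i : Side.{u}) : DblFunctor (N.E i) N.bimod.collage :=
  DblCat.fullOut (N.F i)

/-- The restriction of a niche: its heteromorphisms from `e₀` to `e₁` are those of the given bimodule
from `F₀ e₀` to `F₁ e₁`. -/
def restrict (N : Niche.{u}) : LooseBimod.{u} :=
  ⟨Cograph.cograph (N.leg .zero) (N.leg .one), Cograph.label (N.leg .zero) (N.leg .one)⟩

/-- The canonical map from the restriction of a niche to its bimodule. -/
def proj (N : Niche.{u}) : N.restrict ⟶ N.bimod :=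
  LooseBimod.Hom.mk (M := N.restrict) (N := N.bimod) (Cograph.proj (N.leg .zero) (N.leg .one)) (by
    refine DblCat.loose_ext ?_
    rintro (x | x)
    · exact (N.F .zero).tight.obj x |>.2
    · exact (N.F .one).tight.obj x |>.2)

/-- The identification of the ends of the restriction with the given double categories. -/
def inc (N : Niche.{u}) : ∀ i : Side.{u}, N.E i ⟶ N.restrict.fiberObj i
  | .zero => DblCat.fullIn (D := N.restrict.collage) (R := N.restrict.Over .zero)
      (Cograph.inl (N.leg .zero) (N.leg .one)) (fun _ => rfl)
  | .one => DblCat.fullIn (D := N.restrict.collage) (R := N.restrict.Over .one)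
      (Cograph.inr (N.leg .zero) (N.leg .one)) (fun _ => rfl)

end Niche

namespace DblTrans
variable {A B C D : DblCat.{u}}

/-- Pasting of 2-cells under `A`. -/
def under {p : A ⟶ B} {q : A ⟶ C} {r : A ⟶ D} {F : B ⟶ C} {G : C ⟶ D} (s : p ≫ F ⟶ q)
    (t : q ≫ G ⟶ r) : p ≫ F ≫ G ⟶ r :=
  (DblCat.assocIso p F G).inv ≫ s ▷ G ≫ t

theorem under_sq {p : A ⟶ B} {q : A ⟶ C} {r : A ⟶ D} {F : B ⟶ C} {G : C ⟶ D} (s : p ≫ F ⟶ q)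
    (t : q ≫ G ⟶ r) {x y : A.Obj} (m : A.Lo x y) :
    DblTrans.sq (under s t) m = DblFunctor.sq G (DblTrans.sq s m) ≫ DblTrans.sq t m := by
  unfold under
  rw [comp_sq', comp_sq', DblCat.assocIso_inv_sq]
  exact Category.id_comp _

theorem under_isConjointCommuter {p : A ⟶ B} {q : A ⟶ C} {r : A ⟶ D} {F : B ⟶ C} {G : C ⟶ D}
    {s : p ≫ F ⟶ q} {t : q ≫ G ⟶ r} (hs : DblTrans.IsConjointCommuter s)
    (ht : DblTrans.IsConjointCommuter t) : (under s t).IsConjointCommuter :=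
  isConjointCommuter_of_sq _ fun m => by
    rw [under_sq]; exact (DblCat.IsConjointCommuter.map G (hs.2 m)).comp (ht.2 _)

theorem rightUnit_sq (p : A ⟶ B) {x y : A.Obj} (m : A.Lo x y) :
    DblTrans.sq (DblCat.rightUnitIso p).hom m = 𝟙 (LoArr.mk (DblFunctor.lo p m)) :=
  DblCat.rightUnitIso_hom_sq p m

theorem rightUnit_isConjointCommuter (p : A ⟶ B) :
    DblTrans.IsConjointCommuter (DblCat.rightUnitIso p).hom :=
  isConjointCommuter_of_sq _ fun m => by
    rw [rightUnit_sq]; exact DblCat.IsConjointCommuter.id _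

end DblTrans

/-- A pointed double category. -/
structure PtdDbl : Type (u + 1) where
  dbl : DblCat.{u}
  pt : DblCat.Pt.{u} ⟶ dbl

namespace PtdDbl

/-- A map of pointed double categories: a double functor preserving the point up to a transformation
that is a conjoint commuter. -/
structure Hom (X Y : PtdDbl.{u}) : Type u where
  functor : X.dbl ⟶ Y.dbl
  colax : X.pt ≫ functor ⟶ Y.pt
  conj : DblTrans.IsConjointCommuter colax

instance : CategoryStruct.{u} PtdDbl.{u} where
  Hom X Y := Hom X Y
  id X := ⟨𝟙 X.dbl, (DblCat.rightUnitIso X.pt).hom, DblTrans.rightUnit_isConjointCommuter _⟩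
  comp F G := ⟨F.functor ≫ G.functor, DblTrans.under F.colax G.colax,
    DblTrans.under_isConjointCommuter F.conj G.conj⟩

/-- A 2-cell of pointed double categories. -/
structure Hom₂ {X Y : PtdDbl.{u}} (F G : X ⟶ Y) : Type u where
  trans : F.functor ⟶ G.functor
  w : X.pt ◁ trans ≫ G.colax = F.colax

theorem Hom₂.ext' {X Y : PtdDbl.{u}} {F G : X ⟶ Y} {α β : Hom₂ F G}
    (h : α.trans = β.trans) : α = β := by
  cases α; cases β; cases h; rfl

theorem Hom.ext' {X Y : PtdDbl.{u}} {F G : Hom X Y} (h : F.functor = G.functor)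
    (e : ∀ {x y : DblCat.Pt.{u}.Obj} (m : DblCat.Pt.{u}.Lo x y),
      HEq (DblTrans.sq F.colax m) (DblTrans.sq G.colax m)) : F = G := by
  rcases F with ⟨f, c, h1⟩
  rcases G with ⟨f', c', h2⟩
  cases h
  have : c = c' := DblTrans.hom_ext_sq fun m => eq_of_heq (e m)
  subst this
  rfl

instance (X Y : PtdDbl.{u}) : Category.{u} (X ⟶ Y) where
  Hom F G := Hom₂ F G
  id F := ⟨𝟙 F.functor, by rw [whiskerLeft_id]; exact Category.id_comp _⟩
  comp {F G H} α β := ⟨Hom₂.trans α ≫ Hom₂.trans β, by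
    rw [whiskerLeft_comp, Category.assoc, Hom₂.w β, Hom₂.w α]⟩
  id_comp _ := Hom₂.ext' (Category.id_comp _)
  comp_id _ := Hom₂.ext' (Category.comp_id _)
  assoc _ _ _ := Hom₂.ext' (Category.assoc _ _ _)

theorem eqToHom_trans' {X Y : PtdDbl.{u}} {F G : X ⟶ Y} (h : F = G) :
    Hom₂.trans (eqToHom h) = eqToHom (congrArg Hom.functor h) := by
  subst h; rfl

theorem assoc' {A B C D : PtdDbl.{u}} (F : A ⟶ B) (G : B ⟶ C) (H : C ⟶ D) :
    (F ≫ G) ≫ H = F ≫ G ≫ H :=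
  Hom.ext' (DblCat.strict.assoc _ _ _) fun m => by
    change HEq (DblTrans.sq (DblTrans.under (DblTrans.under F.colax G.colax) H.colax) m)
      (DblTrans.sq (DblTrans.under F.colax (DblTrans.under G.colax H.colax)) m)
    rw [DblTrans.under_sq, DblTrans.under_sq, DblTrans.under_sq, DblTrans.under_sq]
    exact heq_of_eq ((congrArg (· ≫ _) (DblFunctor.sq_comp H.functor _ _)).trans
      (Category.assoc _ _ _))

theorem id_comp' {A B : PtdDbl.{u}} (F : A ⟶ B) : 𝟙 A ≫ F = F :=
  Hom.ext' (DblCat.strict.id_comp _) fun m => by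
    change HEq (DblTrans.sq (DblTrans.under (DblCat.rightUnitIso A.pt).hom F.colax) m) _
    rw [DblTrans.under_sq, DblTrans.rightUnit_sq]
    exact heq_of_eq ((congrArg (· ≫ _) (DblFunctor.sq_id F.functor _)).trans
      (Category.id_comp _))

theorem comp_id' {A B : PtdDbl.{u}} (F : A ⟶ B) : F ≫ 𝟙 B = F :=
  Hom.ext' (DblCat.strict.comp_id _) fun m => by
    change HEq (DblTrans.sq (DblTrans.under F.colax (DblCat.rightUnitIso B.pt).hom) m) _
    rw [DblTrans.under_sq, DblTrans.rightUnit_sq]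
    exact heq_of_eq (Category.comp_id _)

/-- An invertible 2-cell between equal maps. -/
def isoOfEq {X Y : PtdDbl.{u}} {F G : X ⟶ Y} (h : F = G) (e : F.functor ≅ G.functor)
    (he : e = eqToIso (congrArg Hom.functor h)) : F ≅ G where
  hom := ⟨e.hom, by
    subst h; rw [he]; exact (congrArg (· ≫ _) (whiskerLeft_id _ _)).trans (Category.id_comp _)⟩
  inv := ⟨e.inv, by
    subst h; rw [he]; exact (congrArg (· ≫ _) (whiskerLeft_id _ _)).trans (Category.id_comp _)⟩
  hom_inv_id := Hom₂.ext' e.hom_inv_id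
  inv_hom_id := Hom₂.ext' e.inv_hom_id

theorem isoOfEq_eq {X Y : PtdDbl.{u}} {F G : X ⟶ Y} (h : F = G) (e : F.functor ≅ G.functor)
    (he : e = eqToIso (congrArg Hom.functor h)) : isoOfEq h e he = eqToIso h :=
  Iso.ext (Hom₂.ext' ((congrArg Iso.hom he).trans (eqToHom_trans' h).symm))

/-- Left whiskering. -/
def wl {A B C : PtdDbl.{u}} (F : A ⟶ B) {G H : B ⟶ C} (α : G ⟶ H) : F ≫ G ⟶ F ≫ H :=
  Hom₂.mk (F := F ≫ G) (G := F ≫ H) (F.functor ◁ Hom₂.trans α) (DblTrans.hom_ext_sq fun m => by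
    have h := congrArg (fun t : B.pt ≫ G.functor ⟶ C.pt => DblTrans.sq t m) (Hom₂.w α)
    have n := DblTrans.sq_naturality (Hom₂.trans α) (DblTrans.sq F.colax m)
    change DblTrans.sq (Hom₂.trans α) _ ≫ DblTrans.sq (DblTrans.under F.colax H.colax) m =
      DblTrans.sq (DblTrans.under F.colax G.colax) m
    rw [DblTrans.under_sq, DblTrans.under_sq]
    refine (Category.assoc _ _ _).symm.trans ?_
    refine (congrArg (· ≫ _) n.symm).trans ?_
    exact (Category.assoc _ _ _).trans (congrArg (_ ≫ ·) h))

/-- Right whiskering. -/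
def wr {A B C : PtdDbl.{u}} {F G : A ⟶ B} (α : F ⟶ G) (H : B ⟶ C) : F ≫ H ⟶ G ≫ H :=
  Hom₂.mk (F := F ≫ H) (G := G ≫ H) (Hom₂.trans α ▷ H.functor) (DblTrans.hom_ext_sq fun m => by
    have h := congrArg (fun t : A.pt ≫ F.functor ⟶ B.pt => DblTrans.sq t m) (Hom₂.w α)
    change DblFunctor.sq H.functor (DblTrans.sq (Hom₂.trans α) _) ≫
      DblTrans.sq (DblTrans.under G.colax H.colax) m =
      DblTrans.sq (DblTrans.under F.colax H.colax) m
    rw [DblTrans.under_sq, DblTrans.under_sq]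
    refine (Category.assoc _ _ _).symm.trans ?_
    refine (congrArg (· ≫ _) ((DblFunctor.sq_comp H.functor _ _).symm.trans
      (congrArg (DblFunctor.sq H.functor) h))).trans rfl)

instance : Bicategory.{u, u} PtdDbl.{u} where
  whiskerLeft F _ _ α := wl F α
  whiskerRight α G := wr α G
  associator F G H := isoOfEq (assoc' F G H) (α_ F.functor G.functor H.functor)
    (DblCat.strict.associator_eqToIso _ _ _)
  leftUnitor F := isoOfEq (id_comp' F) (λ_ F.functor) (DblCat.strict.leftUnitor_eqToIso _)
  rightUnitor F := isoOfEq (comp_id' F) (ρ_ F.functor) (DblCat.strict.rightUnitor_eqToIso _)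
  whiskerLeft_id _ _ := Hom₂.ext' (whiskerLeft_id _ _)
  whiskerLeft_comp _ _ _ _ _ _ := Hom₂.ext' (whiskerLeft_comp _ _ _)
  id_whiskerLeft _ := Hom₂.ext' (id_whiskerLeft _)
  comp_whiskerLeft _ _ _ _ _ := Hom₂.ext' (comp_whiskerLeft _ _ _)
  id_whiskerRight _ _ := Hom₂.ext' (id_whiskerRight _ _)
  comp_whiskerRight _ _ _ := Hom₂.ext' (comp_whiskerRight _ _ _)
  whiskerRight_id _ := Hom₂.ext' (whiskerRight_id _)
  whiskerRight_comp _ _ _ := Hom₂.ext' (whiskerRight_comp _ _ _)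
  whisker_assoc _ _ _ _ _ := Hom₂.ext' (whisker_assoc _ _ _)
  whisker_exchange _ _ := Hom₂.ext' (whisker_exchange _ _)
  pentagon _ _ _ _ := Hom₂.ext' (pentagon _ _ _ _)
  triangle _ _ := Hom₂.ext' (triangle _ _)

theorem strict : Bicategory.Strict PtdDbl.{u} where
  id_comp F := id_comp' F
  comp_id F := comp_id' F
  assoc F G H := assoc' F G H
  leftUnitor_eqToIso F := isoOfEq_eq _ _ _
  rightUnitor_eqToIso F := isoOfEq_eq _ _ _
  associator_eqToIso F G H := isoOfEq_eq _ _ _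

/-- The 2-functor forgetting points. -/
def forget : StrictPseudofunctor PtdDbl.{u} DblCat.{u} :=
  letI := strict
  letI := DblCat.strict
  StrictPseudofunctor.mk''
    { obj := fun X => X.dbl
      map := fun F => F.functor
      map₂ := fun α => Hom₂.trans α
      map₂_id := fun _ => rfl
      map₂_comp := fun _ _ => rfl
      map_id := fun _ => rfl
      map_comp := fun _ _ => rfl
      map₂_whisker_left := fun _ _ _ _ => eq_conj_eqToHom _ _ HEq.rfl
      map₂_whisker_right := fun _ _ => eq_conj_eqToHom _ _ HEq.rfl }

end PtdDbl

namespace LooseBimod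

theorem homNat_unit {D E : DblCat.{u}} (F : DblFunctor D E) (x : D.Obj) :
    ((F.unitIso x).hom ≫ F.sq (𝟙 (LoArr.mk (D.unit x)))) ≫ 𝟙 (LoArr.mk (F.lo (D.unit x))) =
      E.unitSq (𝟙 (F.tight.obj x)) ≫
        𝟙 (LoArr.mk (E.unit (F.tight.obj x))) ≫ (F.unitIso x).hom := by
  rw [F.sq_id, E.unitSq_id]
  simp

theorem homNat_comp {D E : DblCat.{u}} (F : DblFunctor D E) {x y z : D.Obj} (m : D.Lo x y)
    (n : D.Lo y z) (h : E.cod (𝟙 (LoArr.mk (F.lo m))) = E.dom (𝟙 (LoArr.mk (F.lo n)))) :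
    ((F.compIso m n).hom ≫ F.sq (𝟙 (LoArr.mk (D.comp m n)))) ≫
        𝟙 (LoArr.mk (F.lo (D.comp m n))) =
      E.compSq (𝟙 (LoArr.mk (F.lo m))) (𝟙 (LoArr.mk (F.lo n))) h ≫
        𝟙 (LoArr.mk (E.comp (F.lo m) (F.lo n))) ≫ (F.compIso m n).hom := by
  rw [F.sq_id, E.compSq_id]
  simp

/-- The naturality of the identification of a double category with an end of its loose Hom
bimodule; all components are identities. -/
def homNat {D E : DblCat.{u}} (F : D ⟶ E) (i : Side.{u}) :
    homEnd D i ≫ fiberMap (homMap F) i ⟶ F ≫ homEnd E i :=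
  DblTrans.mk (F := DblFunctor.comp (homEnd D i) (fiberMap (homMap F) i))
    (G := DblFunctor.comp F (homEnd E i))
    (fun x => 𝟙 (DblFunctor.tight (homEnd E i) |>.obj (DblFunctor.tight F |>.obj x)))
    (fun {x y} m => 𝟙 (LoArr.mk (DblFunctor.lo (homEnd E i) (DblFunctor.lo F m))))
    (fun f => (Category.comp_id _).trans (Category.id_comp _).symm)
    (fun m => DblCat.dom_id _ _)
    (fun m => DblCat.cod_id _ _)
    (fun α => (Category.comp_id _).trans (Category.id_comp _).symm)
    (fun x => Prod.ext (homNat_unit F x) (Subsingleton.elim (α := LoArr.mk _ ⟶ LoArr.mk _) _ _))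
    (fun m n => Prod.ext (homNat_comp F m n _)
      (Subsingleton.elim (α := LoArr.mk _ ⟶ LoArr.mk _) _ _))

end LooseBimod

/-- A double category with a single object, tight arrow, loose arrow and square. -/
def DblCat.IsPoint (D : DblCat.{u}) : Prop :=
  Nonempty (Unique D.Obj) ∧ (∀ x y : D.Obj, Nonempty (Unique (x ⟶ y))) ∧
    (∀ x y : D.Obj, Nonempty (Unique (D.Lo x y))) ∧
    ∀ m n : LoArr D.Lo, Nonempty (Unique (m ⟶ n))

/-- A loose right module: a loose bimodule whose source is the point. -/
structure RightModule : Type (u + 1) where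
  bimod : LooseBimod.{u}
  isPoint : (bimod.fiberObj .zero).IsPoint

/-- The 2-category of loose right modules, full in that of loose bimodules. -/
abbrev LooseRightMod : Type (u + 1) := InducedBicategory LooseBimod.{u} RightModule.bimod.{u}

/-- The inclusion of loose right modules in loose bimodules. -/
def LooseRightMod.incl : StrictPseudofunctor LooseRightMod.{u} LooseBimod.{u} :=
  InducedBicategory.forget

/-- The target of a loose right module. -/
def LooseRightMod.target : StrictPseudofunctor LooseRightMod.{u} DblCat.{u} :=
  LooseRightMod.incl.comp (LooseBimod.fiber .one)

/-- A right niche: a niche whose source double category is the point. -/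
structure RightNicheData : Type (u + 1) where
  bimod : LooseBimod.{u}
  dbl : DblCat.{u}
  F₀ : DblCat.Pt.{u} ⟶ bimod.fiberObj .zero
  F₁ : dbl ⟶ bimod.fiberObj .one

/-- The niche underlying a right niche. -/
def RightNicheData.toNiche (N : RightNicheData.{u}) : Niche.{u} where
  bimod := N.bimod
  E
    | .zero => DblCat.Pt
    | .one => N.dbl
  F
    | .zero => N.F₀
    | .one => N.F₁

/-- The 2-category of right niches, full in that of niches. -/
abbrev RightNiche : Type (u + 1) := InducedBicategory Niche.{u} RightNicheData.toNiche.{u}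

/-- The inclusion of right niches in niches. -/
def RightNiche.incl : StrictPseudofunctor RightNiche.{u} Niche.{u} := InducedBicategory.forget

namespace RightNicheData

theorem not_over {N : RightNicheData.{u}} {y : N.dbl.Obj}
    (h : N.toNiche.restrict.Over .zero (Sum.inr y)) : False := nomatch (show Side.one = Side.zero from h)

theorem restrict_isPoint (N : RightNicheData.{u}) :
    (N.toNiche.restrict.fiberObj .zero).IsPoint := by
  refine ⟨⟨⟨⟨⟨Sum.inl PUnit.unit, rfl⟩⟩, ?_⟩⟩, ?_, ?_, ?_⟩
  · rintro ⟨x | x, h⟩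
    · rfl
    · exact (not_over h).elim
  · rintro ⟨x | x, h⟩ ⟨y | y, k⟩
    · refine ⟨⟨⟨Cograph.Ti.left ⟨⟨rfl⟩⟩⟩, ?_⟩⟩
      rintro (⟨⟨⟨f⟩⟩⟩ | f)
      rfl
    all_goals first | exact (not_over h).elim | exact (not_over k).elim
  · rintro ⟨x | x, h⟩ ⟨y | y, k⟩
    · refine ⟨⟨⟨Cograph.Lo.left ⟨⟨trivial⟩⟩⟩, ?_⟩⟩
      rintro (⟨⟨⟨f⟩⟩⟩ | f | f)
      rfl
    all_goals first | exact (not_over h).elim | exact (not_over k).elim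
  · rintro @⟨⟨x | x, h⟩, ⟨y | y, k⟩, m⟩ @⟨⟨x' | x', h'⟩, ⟨y' | y', k'⟩, n⟩
    · rcases m with m | m | m
      rcases n with n | n | n
      refine ⟨⟨⟨Cograph.Sq.left ⟨⟨rfl, rfl⟩⟩⟩, ?_⟩⟩
      intro α
      rcases α with α | α | α
      rfl
    all_goals first | exact (not_over h).elim | exact (not_over k).elim |
        exact (not_over h').elim | exact (not_over k').elim

/-- The restriction of a right niche. -/
def restrict (N : RightNicheData.{u}) : RightModule.{u} := ⟨N.toNiche.restrict, N.restrict_isPoint⟩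

end RightNicheData

namespace LooseBimod

theorem homNat_sq {D E : DblCat.{u}} (F : D ⟶ E) (i : Side.{u}) {x y : D.Obj} (m : D.Lo x y) :
    DblTrans.sq (homNat F i) m =
      𝟙 (LoArr.mk (DblFunctor.lo (homEnd E i) (DblFunctor.lo F m))) := rfl

theorem homNat_isCompanionCommuter {D E : DblCat.{u}} (F : D ⟶ E) (i : Side.{u}) :
    DblTrans.IsCompanionCommuter (homNat F i) :=
  DblTrans.isCompanionCommuter_of_sq _ fun m => by
    rw [homNat_sq]; exact DblCat.IsCompanionCommuter.id _

end LooseBimod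

namespace PtdDbl

/-- The right niche over the loose Hom bimodule of a pointed double category, given by the point and
the identity. -/
def niche (X : PtdDbl.{u}) : RightNicheData.{u} where
  bimod := LooseBimod.homBimod X.dbl
  dbl := X.dbl
  F₀ := X.pt ≫ LooseBimod.homEnd X.dbl .zero
  F₁ := LooseBimod.homEnd X.dbl .one

/-- The source colaxator of the map of right niches induced by a map of pointed double
categories. -/
def nicheColax {X Y : PtdDbl.{u}} (F : X ⟶ Y) :
    (X.pt ≫ LooseBimod.homEnd X.dbl .zero) ≫
        LooseBimod.fiberMap (LooseBimod.homMap F.functor) .zero ⟶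
      𝟙 DblCat.Pt.{u} ≫ (Y.pt ≫ LooseBimod.homEnd Y.dbl .zero) :=
  (DblCat.assocIso _ _ _).hom ≫ X.pt ◁ LooseBimod.homNat F.functor .zero ≫
    (DblCat.assocIso _ _ _).inv ≫ F.colax ▷ LooseBimod.homEnd Y.dbl .zero ≫
      (DblCat.leftUnitIso _).inv

theorem nicheColax_sq {X Y : PtdDbl.{u}} (F : X ⟶ Y) {x y : DblCat.Pt.{u}.Obj}
    (m : DblCat.Pt.{u}.Lo x y) :
    DblTrans.sq (nicheColax F) m =
      DblFunctor.sq (LooseBimod.homEnd Y.dbl .zero) (DblTrans.sq F.colax m) := by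
  unfold nicheColax
  rw [DblTrans.comp_sq', DblTrans.comp_sq', DblTrans.comp_sq', DblTrans.comp_sq',
    DblCat.assocIso_hom_sq, DblCat.assocIso_inv_sq, DblCat.leftUnitIso_inv_sq]
  refine (Category.id_comp _).trans ?_
  refine (Category.id_comp _).trans ?_
  refine (Category.id_comp _).trans ?_
  exact Category.comp_id _

/-- The map of niches induced by a map of pointed double categories. -/
def nicheMap {X Y : PtdDbl.{u}} (F : X ⟶ Y) : X.niche.toNiche ⟶ Y.niche.toNiche :=
  Niche.Hom.mk (M := X.niche.toNiche) (N := Y.niche.toNiche) (LooseBimod.homMap F.functor)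
    (fun
      | .zero => 𝟙 DblCat.Pt
      | .one => F.functor)
    (fun
      | .zero => nicheColax F
      | .one => LooseBimod.homNat F.functor .one)
    (DblTrans.isConjointCommuter_of_sq (nicheColax F) fun m => by
      rw [nicheColax_sq]; exact DblCat.IsConjointCommuter.map _ (F.conj.2 m))
    (LooseBimod.homNat_isCompanionCommuter F.functor .one)

/-- The 2-cell of niches induced by a 2-cell of pointed double categories. -/
def nicheMap₂ {X Y : PtdDbl.{u}} {F G : X ⟶ Y} (α : F ⟶ G) : nicheMap F ⟶ nicheMap G :=
  Niche.Hom₂.mk (F := nicheMap F) (G := nicheMap G) (LooseBimod.homMap₂ (Hom₂.trans α))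
    (fun
      | .zero => 𝟙 (𝟙 DblCat.Pt)
      | .one => Hom₂.trans α)
    (fun
      | .zero => DblTrans.compat_iff.2 fun m => by
          have h := congrArg (fun t : X.pt ≫ F.functor ⟶ Y.pt => DblTrans.sq t m) (Hom₂.w α)
          refine (congrArg (_ ≫ ·) (nicheColax_sq G m)).trans ?_
          refine Eq.trans ?_ ((congrArg (DblTrans.sq (nicheColax F) m ≫ ·)
            (DblFunctor.sq_id (Y.niche.toNiche.F .zero) m)).trans (Category.comp_id _)).symm
          refine Eq.trans ?_ (nicheColax_sq F m).symm
          exact Prod.ext h rfl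
      | .one => DblTrans.compat_iff.2 fun m =>
          (Category.comp_id _).trans (Category.id_comp _).symm)

theorem nicheMap_id (X : PtdDbl.{u}) : nicheMap (𝟙 X) = 𝟙 X.niche.toNiche := by
  refine Niche.Hom.ext' (LooseBimod.hom_ext rfl) (by rintro (_ | _) <;> rfl) ?_
  rintro (_ | _) x y m
  · refine heq_of_eq ?_
    refine Eq.trans (nicheColax_sq (𝟙 X) m) ?_
    refine Eq.trans ?_ (DblTrans.idColax_sq (X.niche.toNiche.F .zero) m).symm
    exact congrArg (DblFunctor.sq (LooseBimod.homEnd X.dbl .zero)) (DblTrans.rightUnit_sq X.pt m)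
  · exact heq_of_eq (DblTrans.idColax_sq (X.niche.toNiche.F .one) m).symm

theorem nicheMap_comp {X Y Z : PtdDbl.{u}} (F : X ⟶ Y) (G : Y ⟶ Z) :
    nicheMap (F ≫ G) = nicheMap F ≫ nicheMap G := by
  refine Niche.Hom.ext' (LooseBimod.hom_ext rfl) (by rintro (_ | _) <;> rfl) ?_
  rintro (_ | _) x y m
  · refine heq_of_eq ?_
    refine Eq.trans (nicheColax_sq (F ≫ G) m) ?_
    refine Eq.trans ?_ (DblTrans.paste_sq ((nicheMap F).colax .zero) ((nicheMap G).colax .zero)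
      m).symm
    refine Eq.trans ?_ (congrArg₂ (· ≫ ·)
      (congrArg (DblFunctor.sq (LooseBimod.fiberMap (LooseBimod.homMap G.functor) .zero))
        (nicheColax_sq F m)) (nicheColax_sq G m)).symm
    exact Prod.ext (DblTrans.under_sq F.colax G.colax m) rfl
  · refine heq_of_eq ?_
    refine Eq.trans ?_ (DblTrans.paste_sq ((nicheMap F).colax .one) ((nicheMap G).colax .one)
      m).symm
    exact ((Category.comp_id _).trans
      (DblFunctor.sq_id (LooseBimod.fiberMap (LooseBimod.homMap G.functor) .one)
        (DblFunctor.lo (LooseBimod.homEnd Y.dbl .one) (DblFunctor.lo F.functor m)))).symm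

theorem heq_hom₂ {M N : Niche.{u}} {F F' G G' : M ⟶ N} (h : F = F') (k : G = G') (α : F ⟶ G)
    (β : F' ⟶ G') (e : HEq (LooseBimod.Hom₂.trans (Niche.Hom₂.bimod α))
      (LooseBimod.Hom₂.trans (Niche.Hom₂.bimod β)))
    (e₀ : HEq (Niche.Hom₂.f α .zero) (Niche.Hom₂.f β .zero))
    (e₁ : HEq (Niche.Hom₂.f α .one) (Niche.Hom₂.f β .one)) : HEq α β := by
  subst h k
  refine heq_of_eq (Niche.Hom₂.ext' (LooseBimod.Hom₂.ext' (eq_of_heq e)) ?_)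
  rintro (_ | _)
  · exact eq_of_heq e₀
  · exact eq_of_heq e₁

theorem heq_induced {M N : RightNiche.{u}} {F F' G G' : M ⟶ N} (h : F = F') (k : G = G') (α : F ⟶ G)
    (β : F' ⟶ G') (e : HEq α.hom β.hom) : HEq α β := by
  subst h k
  exact heq_of_eq (InducedBicategory.hom₂_ext (eq_of_heq e))

theorem nicheMap₂_whiskerLeft {X Y Z : PtdDbl.{u}} (F : X ⟶ Y) {G H : Y ⟶ Z} (α : G ⟶ H) :
    HEq (nicheMap₂ (F ◁ α)) (nicheMap F ◁ nicheMap₂ α) :=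
  heq_hom₂ (nicheMap_comp F G) (nicheMap_comp F H) (nicheMap₂ (F ◁ α)) (nicheMap F ◁ nicheMap₂ α)
    HEq.rfl HEq.rfl HEq.rfl

theorem nicheMap₂_whiskerRight {X Y Z : PtdDbl.{u}} {F G : X ⟶ Y} (α : F ⟶ G) (H : Y ⟶ Z) :
    HEq (nicheMap₂ (α ▷ H)) (nicheMap₂ α ▷ nicheMap H) :=
  heq_hom₂ (nicheMap_comp F H) (nicheMap_comp G H) (nicheMap₂ (α ▷ H)) (nicheMap₂ α ▷ nicheMap H)
    HEq.rfl HEq.rfl HEq.rfl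

/-- The right niche of a pointed double category. -/
def rightNiche (X : PtdDbl.{u}) : RightNiche.{u} := X.niche

/-- The map of right niches induced by a map of pointed double categories. -/
def rightNicheMap {X Y : PtdDbl.{u}} (F : X ⟶ Y) : rightNiche X ⟶ rightNiche Y :=
  InducedBicategory.mkHom (nicheMap F)

/-- The 2-functor sending a pointed double category to the right niche over its loose Hom
bimodule. -/
def toRightNiche : StrictPseudofunctor PtdDbl.{u} RightNiche.{u} :=
  letI := strict
  letI := Niche.strict
  StrictPseudofunctor.mk''
    { obj := rightNiche
      map := rightNicheMap
      map₂ := fun {X Y F G} α =>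
        (⟨nicheMap₂ α⟩ : InducedBicategory.Hom₂ (rightNicheMap F) (rightNicheMap G))
      map₂_id := fun F => InducedBicategory.hom₂_ext (Niche.Hom₂.ext' rfl (by rintro (_ | _) <;> rfl))
      map₂_comp := fun α β => InducedBicategory.hom₂_ext (Niche.Hom₂.ext' rfl (by
        rintro (_ | _)
        · exact (Category.comp_id _).symm
        · rfl))
      map_id := fun X => InducedBicategory.hom_ext (nicheMap_id X)
      map_comp := fun F G => InducedBicategory.hom_ext (nicheMap_comp F G)
      map₂_whisker_left := fun {X _ Z} F G H α =>
        _root_.eq_conj_eqToHom (C := rightNiche X ⟶ rightNiche Z) _ _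
        (heq_induced (InducedBicategory.hom_ext (nicheMap_comp F G))
          (InducedBicategory.hom_ext (nicheMap_comp F H)) _ _ (nicheMap₂_whiskerLeft F α))
      map₂_whisker_right := fun {X _ Z F G} α H =>
        _root_.eq_conj_eqToHom (C := rightNiche X ⟶ rightNiche Z) _ _
        (heq_induced (InducedBicategory.hom_ext (nicheMap_comp F H))
          (InducedBicategory.hom_ext (nicheMap_comp G H)) _ _ (nicheMap₂_whiskerRight α H)) }

end PtdDbl

section cartesian

universe w v w' v' u' w'' v'' u''
variable {B : Type u} [Bicategory.{w, v} B] {C : Type u'} [Bicategory.{w', v'} C]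

/-- The functor given by composition with a pair of 1-cells with the same source. -/
def pairing {P X Y : B} (p : P ⟶ X) (q : P ⟶ Y) (Z : B) : (Z ⟶ P) ⥤ (Z ⟶ X) × (Z ⟶ Y) :=
  (postcomp Z p).prod' (postcomp Z q)

/-- A functor that is an isomorphism of categories. -/
def IsCatIso {A A' : Type*} [Category* A] [Category* A'] (F : A ⥤ A') : Prop :=
  F.Full ∧ F.Faithful ∧ F.obj.Bijective

/-- `P`, with the projections `p` and `q`, is a product enriched in categories. -/
def Is2Product {P X Y : B} (p : P ⟶ X) (q : P ⟶ Y) : Prop :=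
  ∀ Z : B, IsCatIso (pairing p q Z)

/-- `T` is a terminal object enriched in categories. -/
def Is2Terminal (T : B) : Prop :=
  ∀ Z : B, Nonempty (Unique (Z ⟶ T)) ∧ ∀ f g : Z ⟶ T, Nonempty (Unique (f ⟶ g))

/-- `P`, with the projections `p` and `q`, is a product up to equivalence of categories. -/
def IsBiproduct {P X Y : B} (p : P ⟶ X) (q : P ⟶ Y) : Prop :=
  ∀ Z : B, (pairing p q Z).IsEquivalence

/-- `T` is a terminal object up to equivalence of categories. -/
def IsBiterminal (T : B) : Prop :=
  ∀ Z : B, Nonempty (Z ⟶ T) ∧ ∀ f g : Z ⟶ T, Nonempty (Unique (f ⟶ g))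

variable (B) in
/-- A cartesian 2-category: a strict 2-category with finite products enriched in categories. -/
def IsCartesian2Category : Prop :=
  Strict B ∧ (∃ T : B, Is2Terminal T) ∧
    ∀ X Y : B, ∃ (P : B) (p : P ⟶ X) (q : P ⟶ Y), Is2Product p q

/-- A cartesian 2-functor: one that preserves finite products enriched in categories. -/
def IsCartesian2Functor (F : StrictPseudofunctor B C) : Prop :=
  (∀ T : B, Is2Terminal T → Is2Terminal (F.obj T)) ∧
    ∀ {P X Y : B} (p : P ⟶ X) (q : P ⟶ Y), Is2Product p q → Is2Product (F.map p) (F.map q)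

/-- A cartesian pseudofunctor: one that preserves finite products, up to equivalence. -/
def IsCartesianPseudofunctor (F : B ⥤ᵖ C) : Prop :=
  (∀ T : B, Is2Terminal T → IsBiterminal (F.obj T)) ∧
    ∀ {P X Y : B} (p : P ⟶ X) (q : P ⟶ Y), Is2Product p q → IsBiproduct (F.map p) (F.map q)

/-- A strict 2-natural isomorphism: its components are isomorphisms and its naturality cells are
identities. -/
def IsStrictIso {F G : B ⥤ᵖ C} (θ : F.StrongTrans G) : Prop :=
  (∀ X, ∃ g : G.obj X ⟶ F.obj X, θ.app X ≫ g = 𝟙 _ ∧ g ≫ θ.app X = 𝟙 _) ∧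
    ∀ {X Y : B} (f : X ⟶ Y), ∃ h : F.map f ≫ θ.app Y = θ.app X ≫ G.map f,
      θ.naturality f = eqToIso h

/-- The pseudofunctor underlying a 2-functor. -/
abbrev CategoryTheory.StrictPseudofunctor.pseudo (F : StrictPseudofunctor B C) : B ⥤ᵖ C :=
  F.toStrictlyUnitaryPseudofunctor.toPseudofunctor

/-- A doctrine of systems theories: a cartesian 2-functor `π` and cartesian pseudofunctors `S` and
`I` into loose right modules and double categories, such that the target of `S` is `I` after `π`. -/
def IsDoctrine (π : StrictPseudofunctor B C) (S : B ⥤ᵖ LooseRightMod.{u''})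
    (I : C ⥤ᵖ DblCat.{u''}) (θ : (π.pseudo.comp I).StrongTrans (S.comp LooseRightMod.target.pseudo)) :
    Prop :=
  IsCartesian2Category B ∧ IsCartesian2Category C ∧ IsCartesian2Functor π ∧
    IsCartesianPseudofunctor S ∧ IsCartesianPseudofunctor I ∧ IsStrictIso θ

end cartesian

theorem DblFunctor.ext_heq {D E : DblCat.{u}} {F G : DblFunctor D E} (h₁ : F.tight = G.tight)
    (h₂ : HEq (@DblFunctor.lo _ _ F) (@DblFunctor.lo _ _ G))
    (h₃ : HEq (@DblFunctor.sq _ _ F) (@DblFunctor.sq _ _ G))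
    (h₄ : HEq F.unitIso G.unitIso) (h₅ : HEq (@DblFunctor.compIso _ _ F) (@DblFunctor.compIso _ _ G)) :
    F = G := by
  cases F
  cases G
  dsimp only at h₁ h₂ h₃ h₄ h₅
  subst h₁
  cases h₂
  cases h₃
  cases h₄
  cases h₅
  rfl

namespace Niche

theorem inc_proj (N : Niche.{u}) (i : Side.{u}) :
    N.inc i ≫ LooseBimod.fiberMap N.proj i = N.F i := by
  cases i
  · refine DblFunctor.ext_heq rfl HEq.rfl HEq.rfl (heq_of_eq ?_) (heq_of_eq ?_)
    · funext x
      refine Iso.ext (Eq.trans (congrArg (_ ≫ ·) ?_) (Category.comp_id _))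
      exact DblFunctor.sq_id (N.F .zero) _
    · funext x y z m n
      refine Iso.ext (Eq.trans (congrArg (_ ≫ ·) ?_) (Category.comp_id _))
      exact DblFunctor.sq_id (N.F .zero) _
  · refine DblFunctor.ext_heq rfl HEq.rfl HEq.rfl (heq_of_eq ?_) (heq_of_eq ?_)
    · funext x
      refine Iso.ext (Eq.trans (congrArg (_ ≫ ·) ?_) (Category.comp_id _))
      exact DblFunctor.sq_id (N.F .one) _
    · funext x y z m n
      refine Iso.ext (Eq.trans (congrArg (_ ≫ ·) ?_) (Category.comp_id _))
      exact DblFunctor.sq_id (N.F .one) _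

end Niche

/-- For loose `m` and tight `f`, `g` out of its ends, with a conjoint of `f` and a companion of `g`:
the square from `m` with sides `f` and `g` to the composite of the conjoint, `m` and the
companion. -/
def DblCat.extend {D : DblCat.{u}} {x y x' y' : D.Obj} (m : D.Lo x y) {f : x ⟶ x'} {g : y ⟶ y'}
    (C : DblCat.Conjoint f) (K : DblCat.Companion g) :
    LoArr.mk m ⟶ LoArr.mk (D.comp (D.comp C.lo m) K.lo) :=
  (D.rightUnitor m).inv ≫ D.compSq
    ((D.leftUnitor m).inv ≫ D.compSq C.eta (𝟙 (LoArr.mk m)) (by simp)) K.eta (by simp)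

/-- The restriction of loose bimodules, as a pseudofunctor on niches with the restrictions as values
on objects. A map of niches, consisting of a map `a` of bimodules, double functors `f₀` and `f₁` on
ends, a colaxator `a F₀ ⟶ F₀' f₀` with conjoints and a colaxator `a F₁ ⟶ F₁' f₁` with companions,
goes to the map that is `f₀` and `f₁` on ends and sends a heteromorphism `m` from `e` to `e'` to the
composite of the conjoint of the first colaxator at `e`, the loose arrow `a m` and the companion of
the second colaxator at `e'`. The colaxators and the squares from `a m` to these composites form the
2-cell `cell a`; the constraints of the pseudofunctor are identities on ends and compatible with
these 2-cells, which determines them. -/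
structure Restriction : Type (u + 1) where
  map {M N : Niche.{u}} (a : M ⟶ N) : M.restrict ⟶ N.restrict
  map₂ {M N : Niche.{u}} {a b : M ⟶ N} (β : a ⟶ b) : map a ⟶ map b
  map₂_id {M N : Niche.{u}} (a : M ⟶ N) : map₂ (𝟙 a) = 𝟙 (map a)
  map₂_comp {M N : Niche.{u}} {a b c : M ⟶ N} (β : a ⟶ b) (γ : b ⟶ c) :
    map₂ (β ≫ γ) = map₂ β ≫ map₂ γ
  mapId (N : Niche.{u}) : map (𝟙 N) ≅ 𝟙 N.restrict
  mapComp {M N P : Niche.{u}} (a : M ⟶ N) (b : N ⟶ P) : map (a ≫ b) ≅ map a ≫ map b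
  map₂_whisker_left {M N P : Niche.{u}} (a : M ⟶ N) {b c : N ⟶ P} (β : b ⟶ c) :
    map₂ (a ◁ β) = (mapComp a b).hom ≫ map a ◁ map₂ β ≫ (mapComp a c).inv
  map₂_whisker_right {M N P : Niche.{u}} {a b : M ⟶ N} (β : a ⟶ b) (c : N ⟶ P) :
    map₂ (β ▷ c) = (mapComp a c).hom ≫ map₂ β ▷ map c ≫ (mapComp b c).inv
  map₂_associator {M N P Q : Niche.{u}} (a : M ⟶ N) (b : N ⟶ P) (c : P ⟶ Q) :
    map₂ (α_ a b c).hom = (mapComp (a ≫ b) c).hom ≫ (mapComp a b).hom ▷ map c ≫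
      (α_ (map a) (map b) (map c)).hom ≫ map a ◁ (mapComp b c).inv ≫ (mapComp a (b ≫ c)).inv
  map₂_left_unitor {M N : Niche.{u}} (a : M ⟶ N) :
    map₂ (λ_ a).hom = (mapComp (𝟙 M) a).hom ≫ (mapId M).hom ▷ map a ≫ (λ_ (map a)).hom
  map₂_right_unitor {M N : Niche.{u}} (a : M ⟶ N) :
    map₂ (ρ_ a).hom = (mapComp a (𝟙 N)).hom ≫ map a ◁ (mapId N).hom ≫ (ρ_ (map a)).hom
  cell {M N : Niche.{u}} (a : M ⟶ N) : M.proj ≫ a.bimod ⟶ map a ≫ N.proj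
  cell_naturality {M N : Niche.{u}} {a b : M ⟶ N} (β : a ⟶ b) :
    M.proj ◁ Niche.Hom₂.bimod β ≫ cell b = cell a ≫ map₂ β ▷ N.proj
  cell_id (N : Niche.{u}) :
    cell (𝟙 N) ≫ (mapId N).hom ▷ N.proj = (ρ_ N.proj).hom ≫ (λ_ N.proj).inv
  cell_comp {M N P : Niche.{u}} (a : M ⟶ N) (b : N ⟶ P) :
    cell (a ≫ b) ≫ (mapComp a b).hom ▷ P.proj =
      (α_ M.proj a.bimod b.bimod).inv ≫ cell a ▷ b.bimod ≫ (α_ (map a) N.proj b.bimod).hom ≫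
        map a ◁ cell b ≫ (α_ (map a) (map b) P.proj).inv
  map_ends {M N : Niche.{u}} (a : M ⟶ N) (i : Side.{u}) :
    M.inc i ≫ LooseBimod.fiberMap (map a) i = a.f i ≫ N.inc i
  map₂_ends {M N : Niche.{u}} {a b : M ⟶ N} (β : a ⟶ b) (i : Side.{u}) :
    ∃ h h', M.inc i ◁ LooseBimod.fiberMap₂ (map₂ β) i =
      eqToHom h ≫ Niche.Hom₂.f β i ▷ N.inc i ≫ eqToHom h'
  mapId_ends (N : Niche.{u}) (i : Side.{u}) :
    ∃ h, N.inc i ◁ LooseBimod.fiberMap₂ (mapId N).hom i = eqToHom h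
  mapComp_ends {M N P : Niche.{u}} (a : M ⟶ N) (b : N ⟶ P) (i : Side.{u}) :
    ∃ h, M.inc i ◁ LooseBimod.fiberMap₂ (mapComp a b).hom i = eqToHom h
  cell_ends {M N : Niche.{u}} (a : M ⟶ N) (i : Side.{u}) :
    ∃ h h', M.inc i ◁ LooseBimod.fiberMap₂ (cell a) i = eqToHom h ≫ a.colax i ≫ eqToHom h'
  cell_het {M N : Niche.{u}} (a : M ⟶ N) :
    ∃ (C : ∀ e, DblCat.Conjoint (DblTrans.app (LooseBimod.Hom₂.trans (cell a)) (Sum.inl e)))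
      (K : ∀ e, DblCat.Companion (DblTrans.app (LooseBimod.Hom₂.trans (cell a)) (Sum.inr e))),
      ∀ {e e'} (m : M.bimod.collage.Lo (DblFunctor.tight (M.leg .zero) |>.obj e)
          (DblFunctor.tight (M.leg .one) |>.obj e')),
        ∃ h, DblTrans.sq (LooseBimod.Hom₂.trans (cell a)) (Cograph.Lo.het m) ≫ eqToHom h =
          DblCat.extend (D := N.bimod.collage) (DblFunctor.lo a.bimod.functor m) (C e) (K e')

namespace Restriction

/-- The pseudofunctor on niches. -/
def toPseudofunctor (R : Restriction.{u}) : Niche.{u} ⥤ᵖ LooseBimod.{u} where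
  obj N := N.restrict
  map := R.map
  map₂ := R.map₂
  map₂_id := R.map₂_id
  map₂_comp := R.map₂_comp
  mapId := R.mapId
  mapComp := R.mapComp
  map₂_whisker_left := R.map₂_whisker_left
  map₂_whisker_right := R.map₂_whisker_right
  map₂_associator := R.map₂_associator
  map₂_left_unitor := R.map₂_left_unitor
  map₂_right_unitor := R.map₂_right_unitor

/-- Restriction of right niches to loose right modules. -/
def right (R : Restriction.{u}) : RightNiche.{u} ⥤ᵖ LooseRightMod.{u} where
  obj N := RightNicheData.restrict N
  map a := InducedBicategory.mkHom (R.map a.hom)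
  map₂ β := ⟨R.map₂ (InducedBicategory.Hom₂.hom β)⟩
  map₂_id _ := InducedBicategory.hom₂_ext (R.map₂_id _)
  map₂_comp _ _ := InducedBicategory.hom₂_ext (R.map₂_comp _ _)
  mapId N := InducedBicategory.isoMk (R.mapId (RightNicheData.toNiche N))
  mapComp a b := InducedBicategory.isoMk (R.mapComp a.hom b.hom)
  map₂_whisker_left _ _ _ _ := InducedBicategory.hom₂_ext (R.map₂_whisker_left _ _)
  map₂_whisker_right _ _ := InducedBicategory.hom₂_ext (R.map₂_whisker_right _ _)
  map₂_associator _ _ _ := InducedBicategory.hom₂_ext (R.map₂_associator _ _ _)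
  map₂_left_unitor _ := InducedBicategory.hom₂_ext (R.map₂_left_unitor _)
  map₂_right_unitor _ := InducedBicategory.hom₂_ext (R.map₂_right_unitor _)

end Restriction

/-- The property of being a heteromorphism: a loose arrow of the collage from the source to the
target. -/
def LooseBimod.isHet (M : LooseBimod.{u}) : ObjectProperty (LoArr M.collage.Lo) :=
  fun m => M.Over .zero m.src ∧ M.Over .one m.tgt

/-- The carrier of a loose bimodule: the category of heteromorphisms and squares between them. -/
abbrev LooseBimod.Carrier (M : LooseBimod.{u}) : Type u := M.isHet.FullSubcategory

namespace PtdDbl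

/-- The object picked out by the point. -/
def point (X : PtdDbl.{u}) : X.dbl.Obj := DblFunctor.tight X.pt |>.obj PUnit.unit

/-- A loose arrow out of the point. -/
structure LooseOut (X : PtdDbl.{u}) : Type u where
  tgt : X.dbl.Obj
  lo : X.dbl.Lo X.point tgt

namespace LooseOut

variable {X : PtdDbl.{u}}

/-- A square between loose arrows out of the point, with identity domain. -/
@[ext]
structure Hom (p q : X.LooseOut) : Type u where
  sq : LoArr.mk p.lo ⟶ LoArr.mk q.lo
  dom : X.dbl.dom sq = 𝟙 X.point

instance : Category.{u} X.LooseOut where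
  Hom p q := Hom p q
  id p := ⟨𝟙 (LoArr.mk p.lo), X.dbl.dom_id _⟩
  comp α β := ⟨α.sq ≫ β.sq, by rw [X.dbl.dom_comp, α.dom, β.dom]; exact Category.comp_id _⟩
  id_comp _ := Hom.ext (Category.id_comp _)
  comp_id _ := Hom.ext (Category.comp_id _)
  assoc _ _ _ := Hom.ext (Category.assoc _ _ _)

/-- Composition with a loose arrow. -/
def act (p : X.LooseOut) {y : X.dbl.Obj} (l : X.dbl.Lo p.tgt y) : X.LooseOut :=
  ⟨y, X.dbl.comp p.lo l⟩

/-- Composition with a square. -/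
def actSq {p q : X.LooseOut} (α : p ⟶ q) {y z : X.dbl.Obj} {l : X.dbl.Lo p.tgt y}
    {k : X.dbl.Lo q.tgt z} (β : LoArr.mk l ⟶ LoArr.mk k)
    (h : X.dbl.cod (Hom.sq α) = X.dbl.dom β) : p.act l ⟶ q.act k :=
  Hom.mk (p := p.act l) (q := q.act k) (X.dbl.compSq (Hom.sq α) β h)
    ((X.dbl.dom_compSq _ _ _).trans (Hom.dom α))

/-- A loose arrow out of the point, as a heteromorphism of the restricted loose Hom bimodule. -/
def toHet (p : X.LooseOut) : X.niche.toNiche.restrict.collage.Lo (Sum.inl PUnit.unit) (Sum.inr p.tgt) :=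
  Cograph.Lo.het (p.lo, ⟨⟨Or.inr ⟨rfl, rfl⟩⟩⟩)

theorem map_pt {x y : DblCat.Pt.{u}.Obj} (f : x ⟶ y) :
    (DblFunctor.tight X.pt).map f = 𝟙 X.point := by
  rcases f with ⟨⟨⟨⟩⟩⟩
  exact (DblFunctor.tight X.pt).map_id x

/-- A square out of the point, as a square of the restricted loose Hom bimodule. -/
def toSq {p q : X.LooseOut} (α : p ⟶ q) :
    @LoArr.mk _ X.niche.toNiche.restrict.collage.Lo _ _ p.toHet ⟶ LoArr.mk q.toHet :=
  Cograph.Sq.het ⟨⟨⟨rfl⟩⟩, X.dbl.cod (Hom.sq α),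
    (Hom.sq α, ⟨⟨rfl, rfl⟩⟩), Prod.ext ((Hom.dom α).trans (map_pt _).symm) rfl, rfl⟩

end LooseOut

/-- The comparison of loose arrows out of the point with the carrier of the restricted loose Hom
bimodule. -/
def systems (X : PtdDbl.{u}) : X.LooseOut ⥤ X.niche.restrict.bimod.Carrier where
  obj p := ⟨@LoArr.mk _ X.niche.toNiche.restrict.collage.Lo _ _ p.toHet, rfl, rfl⟩
  map α := ObjectProperty.homMk (LooseOut.toSq α)
  map_id p := by
    refine ObjectProperty.hom_ext _ ?_
    refine congrArg (fun α => Cograph.Sq.het α) ?_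
    exact Cograph.Het.ext' rfl (X.dbl.cod_id _) rfl
  map_comp α β := by
    refine ObjectProperty.hom_ext _ ?_
    refine congrArg (fun α => Cograph.Sq.het α) ?_
    exact Cograph.Het.ext' rfl (X.dbl.cod_comp _ _) rfl

end PtdDbl

section cartesian_lemmas

universe w v w' v' u'
variable {B : Type u} [Bicategory.{w, v} B] {C : Type u'} [Bicategory.{w', v'} C]

theorem IsCatIso.isEquivalence {A A' : Type*} [Category* A] [Category* A'] {F : A ⥤ A'}
    (h : IsCatIso F) : F.IsEquivalence where
  full := h.1
  faithful := h.2.1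
  essSurj := ⟨fun Y => by
    obtain ⟨X, rfl⟩ := h.2.2.2 Y
    exact ⟨X, ⟨Iso.refl _⟩⟩⟩

/-- Postcomposition with two composable 1-cells. -/
def postcompComp {X Y Z : B} (W : B) (f : X ⟶ Y) (g : Y ⟶ Z) :
    postcomp W f ⋙ postcomp W g ≅ postcomp W (f ≫ g) :=
  NatIso.ofComponents (fun h => α_ h f g) (fun η => associator_naturality_left η f g)

/-- Postcomposition with isomorphic 1-cells. -/
def postcompIso {X Y : B} (W : B) {f g : X ⟶ Y} (e : f ≅ g) : postcomp W f ≅ postcomp W g :=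
  NatIso.ofComponents (fun h => whiskerLeftIso h e) (fun η => (whisker_exchange η e.hom).symm)

/-- Postcomposition with an identity. -/
def postcompId (W X : B) : postcomp W (𝟙 X) ≅ 𝟭 (W ⟶ X) :=
  NatIso.ofComponents (fun h => ρ_ h) (fun η => rightUnitor_naturality η)

theorem isEquivalence_postcomp {X Y : B} (W : B) {f : X ⟶ Y} {g : Y ⟶ X} (e : f ≫ g ≅ 𝟙 X)
    (e' : g ≫ f ≅ 𝟙 Y) : (postcomp W f).IsEquivalence :=
  (CategoryTheory.Equivalence.mk (postcomp W f) (postcomp W g)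
    ((postcompId W X).symm ≪≫ (postcompIso W e).symm ≪≫ (postcompComp W f g).symm)
    (postcompComp W g f ≪≫ postcompIso W e' ≪≫ postcompId W Y)).isEquivalence_functor

/-- The pairing with a pair of 1-cells precomposed with a 1-cell. -/
def pairingComp {P P' X Y : B} (u : P ⟶ P') (p : P' ⟶ X) (q : P' ⟶ Y) (Z : B) :
    postcomp Z u ⋙ pairing p q Z ≅ pairing (u ≫ p) (u ≫ q) Z :=
  NatIso.ofComponents (fun h => Iso.prod (α_ h u p) (α_ h u q))
    (fun η => Prod.ext (associator_naturality_left η u p) (associator_naturality_left η u q))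

/-- The pairings with isomorphic pairs of 1-cells. -/
def pairingIso {P X Y : B} {p p' : P ⟶ X} {q q' : P ⟶ Y} (e : p ≅ p') (e' : q ≅ q') (Z : B) :
    pairing p q Z ≅ pairing p' q' Z :=
  NatIso.ofComponents (fun h => Iso.prod (whiskerLeftIso h e) (whiskerLeftIso h e'))
    (fun η => Prod.ext (whisker_exchange η e.hom).symm (whisker_exchange η e'.hom).symm)

theorem IsBiproduct.of_iso {P X Y : B} {p p' : P ⟶ X} {q q' : P ⟶ Y} (h : IsBiproduct p q)
    (e : p ≅ p') (e' : q ≅ q') : IsBiproduct p' q' := fun Z =>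
  have := h Z
  Functor.isEquivalence_of_iso (pairingIso e e' Z)

theorem IsBiproduct.comp {P P' X Y : B} {p : P' ⟶ X} {q : P' ⟶ Y} (h : IsBiproduct p q)
    {u : P ⟶ P'} {v : P' ⟶ P} (e : u ≫ v ≅ 𝟙 P) (e' : v ≫ u ≅ 𝟙 P') :
    IsBiproduct (u ≫ p) (u ≫ q) := fun Z =>
  have := h Z
  have := isEquivalence_postcomp Z e e'
  Functor.isEquivalence_of_iso (pairingComp u p q Z)

theorem Is2Product.isBiproduct {P X Y : B} {p : P ⟶ X} {q : P ⟶ Y} (h : Is2Product p q) :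
    IsBiproduct p q := fun Z => (h Z).isEquivalence

theorem Is2Product.exists_lift {P X Y : B} {p : P ⟶ X} {q : P ⟶ Y} (h : Is2Product p q) {Z : B}
    (f : Z ⟶ X) (g : Z ⟶ Y) : ∃ u : Z ⟶ P, u ≫ p = f ∧ u ≫ q = g := by
  obtain ⟨u, hu⟩ := (h Z).2.2.2 (f, g)
  exact ⟨u, congrArg Prod.fst hu, congrArg Prod.snd hu⟩

theorem Is2Product.hom_ext {P X Y : B} {p : P ⟶ X} {q : P ⟶ Y} (h : Is2Product p q) {Z : B}
    {f g : Z ⟶ P} (e : f ≫ p = g ≫ p) (e' : f ≫ q = g ≫ q) : f = g :=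
  (h Z).2.2.1 (Prod.ext e e')

theorem Is2Product.exists_lift₂ {P X Y : B} {p : P ⟶ X} {q : P ⟶ Y} (h : Is2Product p q) {Z : B}
    {f g : Z ⟶ P} (α : f ≫ p ⟶ g ≫ p) (β : f ≫ q ⟶ g ≫ q) :
    ∃ γ : f ⟶ g, γ ▷ p = α ∧ γ ▷ q = β := by
  obtain ⟨γ, hγ⟩ := (h Z).1.map_surjective (X := f) (Y := g) ((α, β) : _ ⟶ _)
  exact ⟨γ, congrArg Prod.fst hγ, congrArg Prod.snd hγ⟩

theorem Is2Product.hom_ext₂ {P X Y : B} {p : P ⟶ X} {q : P ⟶ Y} (h : Is2Product p q) {Z : B}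
    {f g : Z ⟶ P} {α β : f ⟶ g} (e : α ▷ p = β ▷ p) (e' : α ▷ q = β ▷ q) : α = β :=
  (h Z).2.1.map_injective (Prod.ext e e')

theorem is2Product_of {P X Y : B} {p : P ⟶ X} {q : P ⟶ Y}
    (lift : ∀ {Z : B} (f : Z ⟶ X) (g : Z ⟶ Y), ∃ u : Z ⟶ P, u ≫ p = f ∧ u ≫ q = g)
    (hom_ext : ∀ {Z : B} {f g : Z ⟶ P}, f ≫ p = g ≫ p → f ≫ q = g ≫ q → f = g)
    (lift₂ : ∀ {Z : B} {f g : Z ⟶ P} (α : f ≫ p ⟶ g ≫ p) (β : f ≫ q ⟶ g ≫ q),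
      ∃ γ : f ⟶ g, γ ▷ p = α ∧ γ ▷ q = β)
    (hom_ext₂ : ∀ {Z : B} {f g : Z ⟶ P} {α β : f ⟶ g}, α ▷ p = β ▷ p → α ▷ q = β ▷ q → α = β) :
    Is2Product p q := fun Z =>
  ⟨⟨fun {f g} φ => by
      obtain ⟨γ, h, h'⟩ := lift₂ φ.1 φ.2
      exact ⟨γ, Prod.ext h h'⟩⟩,
    ⟨fun {f g} α β e => hom_ext₂ (congrArg Prod.fst e) (congrArg Prod.snd e)⟩,
    fun f g e => hom_ext (congrArg Prod.fst e) (congrArg Prod.snd e),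
    fun φ => by
      obtain ⟨u, h, h'⟩ := lift φ.1 φ.2
      exact ⟨u, Prod.ext h h'⟩⟩

/-- Strict invertibility of a 1-cell. -/
def IsInv {X Y : B} (f : X ⟶ Y) : Prop := ∃ g : Y ⟶ X, f ≫ g = 𝟙 X ∧ g ≫ f = 𝟙 Y

theorem Is2Product.comp [Strict C] {P P' X Y : C} {p : P' ⟶ X} {q : P' ⟶ Y} (h : Is2Product p q)
    {u : P ⟶ P'} (hu : IsInv u) : Is2Product (u ≫ p) (u ≫ q) := fun Z => by
  obtain ⟨v, e, e'⟩ := hu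
  have := isEquivalence_postcomp Z (eqToIso e) (eqToIso e')
  have := (h Z).1
  have := (h Z).2.1
  refine ⟨Functor.Full.of_iso (pairingComp u p q Z), Functor.Faithful.of_iso (pairingComp u p q Z),
    fun f g hfg => ?_, fun φ => ?_⟩
  · have h1 : f ≫ u = g ≫ u := h.hom_ext
      ((Strict.assoc _ _ _).trans ((congrArg Prod.fst hfg).trans (Strict.assoc _ _ _).symm))
      ((Strict.assoc _ _ _).trans ((congrArg Prod.snd hfg).trans (Strict.assoc _ _ _).symm))
    have h2 := congrArg (· ≫ v) h1
    simpa [Strict.assoc, e, Strict.comp_id] using h2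
  · obtain ⟨t, h1, h2⟩ := h.exists_lift φ.1 φ.2
    have h3 : (t ≫ v) ≫ u = t := by rw [Strict.assoc, e', Strict.comp_id]
    exact ⟨t ≫ v, Prod.ext (show (t ≫ v) ≫ u ≫ p = _ by rw [← Strict.assoc, h3, h1])
      (show (t ≫ v) ≫ u ≫ q = _ by rw [← Strict.assoc, h3, h2])⟩

theorem Is2Product.unique [Strict B] {P P' X Y : B} {p : P ⟶ X} {q : P ⟶ Y} {p' : P' ⟶ X}
    {q' : P' ⟶ Y} (h : Is2Product p q) (h' : Is2Product p' q') :
    ∃ (f : P ⟶ P') (g : P' ⟶ P), f ≫ g = 𝟙 P ∧ g ≫ f = 𝟙 P' ∧ f ≫ p' = p ∧ f ≫ q' = q := by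
  obtain ⟨f, h1, h2⟩ := h'.exists_lift p q
  obtain ⟨g, h3, h4⟩ := h.exists_lift p' q'
  refine ⟨f, g, h.hom_ext ?_ ?_, h'.hom_ext ?_ ?_, h1, h2⟩ <;>
    simp [Strict.assoc, Strict.id_comp, h1, h2, h3, h4]

theorem Is2Terminal.unique [Strict B] {T T' : B} (h : Is2Terminal T) (h' : Is2Terminal T') :
    ∃ (f : T ⟶ T') (g : T' ⟶ T), f ≫ g = 𝟙 T ∧ g ≫ f = 𝟙 T' := by
  obtain ⟨⟨⟨⟨f⟩, hf⟩⟩, -⟩ := h' T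
  obtain ⟨⟨⟨⟨g⟩, hg⟩⟩, -⟩ := h T'
  obtain ⟨⟨i⟩, -⟩ := h T
  obtain ⟨⟨j⟩, -⟩ := h' T'
  exact ⟨f, g, (i.uniq _).trans (i.uniq _).symm, (j.uniq _).trans (j.uniq _).symm⟩

theorem IsBiterminal.of_equiv {T T' : B} (h : IsBiterminal T') {u : T ⟶ T'} {v : T' ⟶ T}
    (e : u ≫ v ≅ 𝟙 T) (e' : v ≫ u ≅ 𝟙 T') : IsBiterminal T := fun Z => by
  have := isEquivalence_postcomp Z e e'
  obtain ⟨⟨t⟩, ht⟩ := h Z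
  refine ⟨⟨t ≫ v⟩, fun f g => ?_⟩
  obtain ⟨i⟩ := ht (f ≫ u) (g ≫ u)
  exact ⟨⟨⟨(postcomp Z u).preimage i.default⟩,
    fun a => (postcomp Z u).map_injective ((i.uniq _).trans (i.uniq _).symm)⟩⟩

theorem Is2Terminal.isBiterminal {T : B} (h : Is2Terminal T) : IsBiterminal T := fun Z =>
  ⟨(h Z).1.map fun i => i.default, (h Z).2⟩

theorem Is2Terminal.of_inv [Strict B] {T T' : B} (h : Is2Terminal T') {u : T ⟶ T'} {v : T' ⟶ T}
    (e : u ≫ v = 𝟙 T) (e' : v ≫ u = 𝟙 T') : Is2Terminal T := fun Z => by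
  refine ⟨?_, (h.isBiterminal.of_equiv (eqToIso e) (eqToIso e') Z).2⟩
  obtain ⟨⟨i⟩, -⟩ := h Z
  refine ⟨⟨⟨i.default ≫ v⟩, fun f => ?_⟩⟩
  change f = i.default ≫ v
  rw [← i.uniq (f ≫ u), Strict.assoc, e, Strict.comp_id]

theorem isCartesian2Functor_of [Strict B] [Strict C] (F : StrictPseudofunctor B C)
    (ht : ∃ T : B, Is2Terminal T ∧ Is2Terminal (F.obj T))
    (hp : ∀ X Y : B, ∃ (P : B) (p : P ⟶ X) (q : P ⟶ Y), Is2Product p q ∧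
      Is2Product (F.map p) (F.map q)) : IsCartesian2Functor F := by
  refine ⟨fun T hT => ?_, fun {P X Y} p q h => ?_⟩
  · obtain ⟨T', h1, h2⟩ := ht
    obtain ⟨f, g, e, e'⟩ := hT.unique h1
    refine h2.of_inv (u := F.map f) (v := F.map g) ?_ ?_
    · rw [← F.map_comp, e, F.map_id]
    · rw [← F.map_comp, e', F.map_id]
  · obtain ⟨P', p', q', h1, h2⟩ := hp X Y
    obtain ⟨f, g, e, e', rfl, rfl⟩ := h.unique h1
    rw [F.map_comp, F.map_comp]
    refine h2.comp ⟨F.map g, ?_, ?_⟩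
    · rw [← F.map_comp, e, F.map_id]
    · rw [← F.map_comp, e', F.map_id]

theorem isCartesianPseudofunctor_of [Strict B] (F : B ⥤ᵖ C)
    (ht : ∃ T : B, Is2Terminal T ∧ IsBiterminal (F.obj T))
    (hp : ∀ X Y : B, ∃ (P : B) (p : P ⟶ X) (q : P ⟶ Y), Is2Product p q ∧
      IsBiproduct (F.map p) (F.map q)) : IsCartesianPseudofunctor F := by
  have key : ∀ {X Y : B} {f : X ⟶ Y} {g : Y ⟶ X}, f ≫ g = 𝟙 X →
      Nonempty (F.map f ≫ F.map g ≅ 𝟙 _) := fun e =>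
    ⟨(F.mapComp _ _).symm ≪≫ F.map₂Iso (eqToIso e) ≪≫ F.mapId _⟩
  refine ⟨fun T hT => ?_, fun {P X Y} p q h => ?_⟩
  · obtain ⟨T', h1, h2⟩ := ht
    obtain ⟨f, g, e, e'⟩ := hT.unique h1
    exact h2.of_equiv (key e).some (key e').some
  · obtain ⟨P', p', q', h1, h2⟩ := hp X Y
    obtain ⟨f, g, e, e', rfl, rfl⟩ := h.unique h1
    exact (h2.comp (key e).some (key e').some).of_iso (F.mapComp f p').symm (F.mapComp f q').symm

theorem isCartesianPseudofunctor_id : IsCartesianPseudofunctor (Pseudofunctor.id B) :=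
  ⟨fun T hT => hT.isBiterminal, fun p q hpq => hpq.isBiproduct⟩

theorem IsCartesian2Functor.comp_pseudo {D : Type*} [Bicategory D] {F : StrictPseudofunctor B C}
    (h : IsCartesian2Functor F) {G : C ⥤ᵖ D} (k : IsCartesianPseudofunctor G) :
    IsCartesianPseudofunctor (F.pseudo.comp G) :=
  ⟨fun T hT => k.1 _ (h.1 T hT), fun p q hpq => k.2 _ _ (h.2 p q hpq)⟩

section induced

variable {I : Type*} {i : I → C}

theorem InducedBicategory.is2Terminal {T : InducedBicategory C i} (h : Is2Terminal (i T)) :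
    Is2Terminal T := fun Z => by
  obtain ⟨⟨a⟩, b⟩ := h (i Z)
  refine ⟨⟨⟨⟨InducedBicategory.mkHom a.default⟩, fun f => InducedBicategory.hom_ext (a.uniq _)⟩⟩,
    fun f g => ?_⟩
  obtain ⟨c⟩ := b f.hom g.hom
  exact ⟨⟨⟨⟨c.default⟩⟩, fun t => InducedBicategory.hom₂_ext (c.uniq _)⟩⟩

theorem InducedBicategory.is2Product {P X Y : InducedBicategory C i} {p : P ⟶ X} {q : P ⟶ Y}
    (h : Is2Product p.hom q.hom) : Is2Product p q := by
  refine is2Product_of (fun {Z} f g => ?_) (fun {Z f g} e e' => ?_) (fun {Z f g} α β => ?_)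
    (fun {Z f g α β} e e' => ?_)
  · obtain ⟨t, h1, h2⟩ := h.exists_lift f.hom g.hom
    exact ⟨InducedBicategory.mkHom t, InducedBicategory.hom_ext h1, InducedBicategory.hom_ext h2⟩
  · exact InducedBicategory.hom_ext (h.hom_ext (congrArg (·.hom) e) (congrArg (·.hom) e'))
  · obtain ⟨t, h1, h2⟩ := h.exists_lift₂ (f := f.hom) (g := g.hom) α.hom β.hom
    exact ⟨⟨t⟩, InducedBicategory.hom₂_ext h1, InducedBicategory.hom₂_ext h2⟩
  · exact InducedBicategory.hom₂_ext (h.hom_ext₂ (congrArg (fun t => InducedBicategory.Hom₂.hom t) e)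
      (congrArg (fun t => InducedBicategory.Hom₂.hom t) e'))

theorem InducedBicategory.isBiproduct {P X Y : InducedBicategory C i} {p : P ⟶ X} {q : P ⟶ Y}
    (h : IsBiproduct p.hom q.hom) : IsBiproduct p q := fun Z => by
  have := h (i Z)
  refine { faithful := ⟨fun {f g} α β e => ?_⟩, full := ⟨fun {f g} φ => ?_⟩, essSurj := ⟨fun φ => ?_⟩ }
  · refine InducedBicategory.hom₂_ext ((pairing p.hom q.hom (i Z)).map_injective (Prod.ext ?_ ?_))
    · exact congrArg (fun t => InducedBicategory.Hom₂.hom (Prod.fst t)) e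
    · exact congrArg (fun t => InducedBicategory.Hom₂.hom (Prod.snd t)) e
  · obtain ⟨t, ht⟩ := (pairing p.hom q.hom (i Z)).map_surjective (X := f.hom) (Y := g.hom)
      ((φ.1.hom, φ.2.hom) : _ ⟶ _)
    exact ⟨⟨t⟩, Prod.ext (InducedBicategory.hom₂_ext (congrArg Prod.fst ht))
      (InducedBicategory.hom₂_ext (congrArg Prod.snd ht))⟩
  · obtain ⟨t, ⟨e⟩⟩ := Functor.EssSurj.mem_essImage (F := pairing p.hom q.hom (i Z)) (φ.1.hom, φ.2.hom)
    refine ⟨InducedBicategory.mkHom t, ⟨Iso.prod ?_ ?_⟩⟩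
    · exact InducedBicategory.isoMk ((CategoryTheory.Prod.fst _ _).mapIso e)
    · exact InducedBicategory.isoMk ((CategoryTheory.Prod.snd _ _).mapIso e)

end induced

end cartesian_lemmas

namespace DblFunctor

variable {P D E Z : DblCat.{u}}

theorem sq_unitSq (p : DblFunctor P D) {x y : P.Obj} (f : x ⟶ y) :
    p.sq (P.unitSq f) = (p.unitIso x).inv ≫ D.unitSq (p.tight.map f) ≫ (p.unitIso y).hom := by
  rw [Iso.eq_inv_comp, p.unitIso_naturality]

theorem sq_compSq (p : DblFunctor P D) {x y z x' y' z' : P.Obj} {m : P.Lo x y} {n : P.Lo y z}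
    {m' : P.Lo x' y'} {n' : P.Lo y' z'}
    (α : LoArr.mk m ⟶ LoArr.mk m') (β : LoArr.mk n ⟶ LoArr.mk n') (h : P.cod α = P.dom β) :
    p.sq (P.compSq α β h) = (p.compIso m n).inv ≫
      D.compSq (p.sq α) (p.sq β) (by rw [cod_sq, dom_sq, h]) ≫ (p.compIso m' n').hom := by
  rw [Iso.eq_inv_comp, p.compIso_naturality]

section reflect

variable (p : DblFunctor P D)

theorem sq_unitSq_eq_iff {x y : P.Obj} (f : x ⟶ y) {m : P.Lo x x} {n : P.Lo y y}
    (μ : LoArr.mk (P.unit x) ⟶ LoArr.mk m) (ν : LoArr.mk (P.unit y) ⟶ LoArr.mk n)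
    (α : LoArr.mk m ⟶ LoArr.mk n) :
    p.sq (μ ≫ α) = p.sq (P.unitSq f ≫ ν) ↔
      ((p.unitIso x).hom ≫ p.sq μ) ≫ p.sq α =
        D.unitSq (p.tight.map f) ≫ (p.unitIso y).hom ≫ p.sq ν := by
  rw [← cancel_epi (p.unitIso x).hom, p.sq_comp, p.sq_comp, p.sq_unitSq]
  simp

theorem sq_compSq_eq_iff {x y z x' y' z' : P.Obj} {m : P.Lo x y} {n : P.Lo y z}
    {m' : P.Lo x' y'} {n' : P.Lo y' z'} {k : P.Lo x z} {k' : P.Lo x' z'}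
    (α : LoArr.mk m ⟶ LoArr.mk m') (β : LoArr.mk n ⟶ LoArr.mk n') (h : P.cod α = P.dom β)
    (μ : LoArr.mk (P.comp m n) ⟶ LoArr.mk k) (ν : LoArr.mk (P.comp m' n') ⟶ LoArr.mk k')
    (γ : LoArr.mk k ⟶ LoArr.mk k') :
    p.sq (μ ≫ γ) = p.sq (P.compSq α β h ≫ ν) ↔
      ((p.compIso m n).hom ≫ p.sq μ) ≫ p.sq γ =
        D.compSq (p.sq α) (p.sq β) (by rw [cod_sq, dom_sq, h]) ≫
          (p.compIso m' n').hom ≫ p.sq ν := by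
  rw [← cancel_epi (p.compIso m n).hom, p.sq_comp, p.sq_comp, p.sq_compSq]
  simp

theorem sq_assoc_eq_iff {x y z w : P.Obj} {a : P.Lo x y} {b : P.Lo y z} {c : P.Lo z w}
    {ab : P.Lo x z} {bc : P.Lo y w} {r r' : P.Lo x w} (φ : LoArr.mk (P.comp a b) ⟶ LoArr.mk ab)
    (ψ : LoArr.mk (P.comp b c) ⟶ LoArr.mk bc) (hφ : P.cod φ = 𝟙 z) (hψ : P.dom ψ = 𝟙 y)
    (χ : LoArr.mk (P.comp ab c) ⟶ LoArr.mk r) (ω : LoArr.mk (P.comp a bc) ⟶ LoArr.mk r')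
    (s : LoArr.mk r ⟶ LoArr.mk r') :
    p.sq (P.compSq φ (𝟙 (LoArr.mk c)) (hφ.trans (P.dom_id (LoArr.mk c)).symm) ≫ χ ≫ s) =
        p.sq ((P.assoc a b c).hom ≫
          P.compSq (𝟙 (LoArr.mk a)) ψ ((P.cod_id (LoArr.mk a)).trans hψ.symm) ≫ ω) ↔
      D.compSq ((p.compIso a b).hom ≫ p.sq φ) (𝟙 (LoArr.mk (p.lo c))) (by simp [hφ]) ≫
          ((p.compIso ab c).hom ≫ p.sq χ) ≫ p.sq s =
        (D.assoc (p.lo a) (p.lo b) (p.lo c)).hom ≫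
          D.compSq (𝟙 (LoArr.mk (p.lo a))) ((p.compIso b c).hom ≫ p.sq ψ) (by simp [hψ]) ≫
            (p.compIso a bc).hom ≫ p.sq ω := by
  have : IsIso (D.compSq (p.compIso a b).hom (𝟙 (LoArr.mk (p.lo c))) (by simp)) :=
    DblCat.Companion.isIso_rw' _ _ (by simp)
  rw [← cancel_epi (D.compSq (p.compIso a b).hom (𝟙 (LoArr.mk (p.lo c))) (by simp) ≫
    (p.compIso (P.comp a b) c).hom)]
  have e1 : D.compSq ((p.compIso a b).hom ≫ p.sq φ) (𝟙 (LoArr.mk (p.lo c))) (by simp [hφ]) =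
      D.compSq (p.compIso a b).hom (𝟙 (LoArr.mk (p.lo c))) (by simp) ≫
        D.compSq (p.sq φ) (p.sq (𝟙 (LoArr.mk c))) (by simp [hφ]) := by
    rw [DblCat.compSq_compSq]; exact DblCat.compSq_congr _ rfl (by simp)
  have e2 : D.compSq (𝟙 (LoArr.mk (p.lo a))) ((p.compIso b c).hom ≫ p.sq ψ) (by simp [hψ]) =
      D.compSq (𝟙 (LoArr.mk (p.lo a))) (p.compIso b c).hom (by simp) ≫
        D.compSq (p.sq (𝟙 (LoArr.mk a))) (p.sq ψ) (by simp [hψ]) := by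
    rw [DblCat.compSq_compSq]; exact DblCat.compSq_congr _ (by simp) rfl
  rw [e1, e2]
  simp only [p.sq_comp, p.sq_compSq, Category.assoc, Iso.hom_inv_id_assoc]
  rw [reassoc_of% (p.map_assoc a b c)]
  simp only [Category.assoc, Iso.hom_inv_id_assoc]

theorem sq_leftUnitor_eq_iff {x y : P.Obj} {m : P.Lo x y} {e : P.Lo x x} {r : P.Lo x y}
    (φ : LoArr.mk (P.unit x) ⟶ LoArr.mk e) (hφ : P.cod φ = 𝟙 x)
    (χ : LoArr.mk (P.comp e m) ⟶ LoArr.mk r) (s : LoArr.mk r ⟶ LoArr.mk m) :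
    p.sq (P.compSq φ (𝟙 (LoArr.mk m)) (hφ.trans (P.dom_id (LoArr.mk m)).symm) ≫ χ ≫ s) =
        p.sq (P.leftUnitor m).hom ↔
      D.compSq ((p.unitIso x).hom ≫ p.sq φ) (𝟙 (LoArr.mk (p.lo m))) (by simp [hφ]) ≫
          ((p.compIso e m).hom ≫ p.sq χ) ≫ p.sq s = (D.leftUnitor (p.lo m)).hom := by
  have : IsIso (D.compSq (p.unitIso x).hom (𝟙 (LoArr.mk (p.lo m))) (by simp)) :=
    DblCat.Companion.isIso_rw' _ _ (by simp)
  rw [← cancel_epi (D.compSq (p.unitIso x).hom (𝟙 (LoArr.mk (p.lo m))) (by simp) ≫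
    (p.compIso (P.unit x) m).hom)]
  have e1 : D.compSq ((p.unitIso x).hom ≫ p.sq φ) (𝟙 (LoArr.mk (p.lo m))) (by simp [hφ]) =
      D.compSq (p.unitIso x).hom (𝟙 (LoArr.mk (p.lo m))) (by simp) ≫
        D.compSq (p.sq φ) (p.sq (𝟙 (LoArr.mk m))) (by simp [hφ]) := by
    rw [DblCat.compSq_compSq]; exact DblCat.compSq_congr _ rfl (by simp)
  rw [e1]
  simp only [p.sq_comp, p.sq_compSq, Category.assoc, Iso.hom_inv_id_assoc]
  rw [p.map_leftUnitor m]

theorem sq_rightUnitor_eq_iff {x y : P.Obj} {m : P.Lo x y} {e : P.Lo y y} {r : P.Lo x y}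
    (φ : LoArr.mk (P.unit y) ⟶ LoArr.mk e) (hφ : P.dom φ = 𝟙 y)
    (χ : LoArr.mk (P.comp m e) ⟶ LoArr.mk r) (s : LoArr.mk r ⟶ LoArr.mk m) :
    p.sq (P.compSq (𝟙 (LoArr.mk m)) φ ((P.cod_id (LoArr.mk m)).trans hφ.symm) ≫ χ ≫ s) =
        p.sq (P.rightUnitor m).hom ↔
      D.compSq (𝟙 (LoArr.mk (p.lo m))) ((p.unitIso y).hom ≫ p.sq φ) (by simp [hφ]) ≫
          ((p.compIso m e).hom ≫ p.sq χ) ≫ p.sq s = (D.rightUnitor (p.lo m)).hom := by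
  have : IsIso (D.compSq (𝟙 (LoArr.mk (p.lo m))) (p.unitIso y).hom (by simp)) :=
    DblCat.Companion.isIso_lw _ _ (by simp)
  rw [← cancel_epi (D.compSq (𝟙 (LoArr.mk (p.lo m))) (p.unitIso y).hom (by simp) ≫
    (p.compIso m (P.unit y)).hom)]
  have e1 : D.compSq (𝟙 (LoArr.mk (p.lo m))) ((p.unitIso y).hom ≫ p.sq φ) (by simp [hφ]) =
      D.compSq (𝟙 (LoArr.mk (p.lo m))) (p.unitIso y).hom (by simp) ≫
        D.compSq (p.sq (𝟙 (LoArr.mk m))) (p.sq φ) (by simp [hφ]) := by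
    rw [DblCat.compSq_compSq]; exact DblCat.compSq_congr _ (by simp) rfl
  rw [e1]
  simp only [p.sq_comp, p.sq_compSq, Category.assoc, Iso.hom_inv_id_assoc]
  rw [p.map_rightUnitor m]

end reflect

/-- Joint bijectivity of a pair of double functors on tight arrows, loose arrows and squares, and
joint injectivity on objects. -/
structure IsJoint (p : DblFunctor P D) (q : DblFunctor P E) : Prop where
  obj_ext {x y : P.Obj} : p.tight.obj x = p.tight.obj y → q.tight.obj x = q.tight.obj y → x = y
  map {x y : P.Obj} (f : p.tight.obj x ⟶ p.tight.obj y) (g : q.tight.obj x ⟶ q.tight.obj y) :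
    ∃ h : x ⟶ y, p.tight.map h = f ∧ q.tight.map h = g
  map_ext {x y : P.Obj} {f g : x ⟶ y} :
    p.tight.map f = p.tight.map g → q.tight.map f = q.tight.map g → f = g
  lo {x y : P.Obj} (m : D.Lo (p.tight.obj x) (p.tight.obj y))
    (n : E.Lo (q.tight.obj x) (q.tight.obj y)) : ∃ l : P.Lo x y, p.lo l = m ∧ q.lo l = n
  lo_ext {x y : P.Obj} {l l' : P.Lo x y} : p.lo l = p.lo l' → q.lo l = q.lo l' → l = l'
  sq {x y x' y' : P.Obj} {m : P.Lo x y} {n : P.Lo x' y'}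
    (α : LoArr.mk (p.lo m) ⟶ LoArr.mk (p.lo n)) (β : LoArr.mk (q.lo m) ⟶ LoArr.mk (q.lo n)) :
    ∃ γ : LoArr.mk m ⟶ LoArr.mk n, p.sq γ = α ∧ q.sq γ = β
  sq_ext {x y x' y' : P.Obj} {m : P.Lo x y} {n : P.Lo x' y'} {γ δ : LoArr.mk m ⟶ LoArr.mk n} :
    p.sq γ = p.sq δ → q.sq γ = q.sq δ → γ = δ

namespace IsJoint

variable {p : DblFunctor P D} {q : DblFunctor P E}

theorem iso (h : IsJoint p q) {x y x' y' : P.Obj} {m : P.Lo x y} {n : P.Lo x' y'}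
    (e : LoArr.mk (p.lo m) ≅ LoArr.mk (p.lo n)) (e' : LoArr.mk (q.lo m) ≅ LoArr.mk (q.lo n)) :
    ∃ i : LoArr.mk m ≅ LoArr.mk n, p.sq i.hom = e.hom ∧ q.sq i.hom = e'.hom := by
  obtain ⟨f, h1, h2⟩ := h.sq e.hom e'.hom
  obtain ⟨g, h3, h4⟩ := h.sq e.inv e'.inv
  exact ⟨⟨f, g, h.sq_ext (by simp [h1, h3]) (by simp [h2, h4]),
    h.sq_ext (by simp [h1, h3]) (by simp [h2, h4])⟩, h1, h2⟩

theorem exists_lift (h : IsJoint p q) (F : DblFunctor Z D) (G : DblFunctor Z E)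
    (ho : ∀ z, ∃ x, p.tight.obj x = F.tight.obj z ∧ q.tight.obj x = G.tight.obj z) :
    ∃ H : DblFunctor Z P, H.comp p = F ∧ H.comp q = G := by
  choose X hp hq using ho
  obtain ⟨⟨Fo, Fm, Fmi, Fmc⟩, Fl, Fs, Fsi, Fsc, Fds, Fcs, Fu, Fdu, Fcu, Fun, Fc, Fdc, Fcc, Fcn,
    Fa, Flu, Fru⟩ := F
  obtain ⟨⟨Go, Gm, Gmi, Gmc⟩, Gl, Gs, Gsi, Gsc, Gds, Gcs, Gu, Gdu, Gcu, Gun, Gc, Gdc, Gcc, Gcn,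
    Ga, Glu, Gru⟩ := G
  dsimp only at *
  obtain rfl : (fun z => p.tight.obj (X z)) = Fo := funext hp
  obtain rfl : (fun z => q.tight.obj (X z)) = Go := funext hq
  dsimp only at *
  choose L hL hL' using fun (x y : Z.Obj) (m : Z.Lo x y) => h.lo (Fl m) (Gl m)
  obtain rfl : (fun {x y} m => p.lo (L x y m)) = @Fl := by funext x y m; exact hL x y m
  obtain rfl : (fun {x y} m => q.lo (L x y m)) = @Gl := by funext x y m; exact hL' x y m
  choose T hT hT' using fun (x y : Z.Obj) (f : x ⟶ y) => h.map (Fm f) (Gm f)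
  obtain rfl : (fun {x y} f => p.tight.map (T x y f)) = @Fm := by funext x y f; exact hT x y f
  obtain rfl : (fun {x y} f => q.tight.map (T x y f)) = @Gm := by funext x y f; exact hT' x y f
  choose S hS hS' using fun (x y x' y' : Z.Obj) (m : Z.Lo x y) (n : Z.Lo x' y')
    (α : LoArr.mk m ⟶ LoArr.mk n) => h.sq (Fs α) (Gs α)
  obtain rfl : (fun {x y x' y' m n} α => p.sq (S x y x' y' m n α)) = @Fs := by
    funext x y x' y' m n α; exact hS ..
  obtain rfl : (fun {x y x' y' m n} α => q.sq (S x y x' y' m n α)) = @Gs := by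
    funext x y x' y' m n α; exact hS' ..
  dsimp only at *
  choose U hU hU' using fun x : Z.Obj =>
    h.iso ((p.unitIso (X x)).symm ≪≫ Fu x) ((q.unitIso (X x)).symm ≪≫ Gu x)
  choose C hC hC' using fun (x y z : Z.Obj) (m : Z.Lo x y) (n : Z.Lo y z) =>
    h.iso ((p.compIso (L _ _ m) (L _ _ n)).symm ≪≫ Fc m n)
      ((q.compIso (L _ _ m) (L _ _ n)).symm ≪≫ Gc m n)
  have kU : ∀ x, (p.unitIso (X x)).hom ≫ p.sq (U x).hom = (Fu x).hom := fun x => by simp [hU]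
  have kU' : ∀ x, (q.unitIso (X x)).hom ≫ q.sq (U x).hom = (Gu x).hom := fun x => by simp [hU']
  have kC : ∀ {x y z : Z.Obj} (m : Z.Lo x y) (n : Z.Lo y z),
      (p.compIso _ _).hom ≫ p.sq (C x y z m n).hom = (Fc m n).hom := fun m n => by simp [hC]
  have kC' : ∀ {x y z : Z.Obj} (m : Z.Lo x y) (n : Z.Lo y z),
      (q.compIso _ _).hom ≫ q.sq (C x y z m n).hom = (Gc m n).hom := fun m n => by simp [hC']
  have dU : ∀ x, P.dom (U x).hom = 𝟙 _ := fun x => h.map_ext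
    (by rw [← p.dom_sq, hU]; simp [Fdu]) (by rw [← q.dom_sq, hU']; simp [Gdu])
  have cU : ∀ x, P.cod (U x).hom = 𝟙 _ := fun x => h.map_ext
    (by rw [← p.cod_sq, hU]; simp [Fcu]) (by rw [← q.cod_sq, hU']; simp [Gcu])
  have dC : ∀ {x y z : Z.Obj} (m : Z.Lo x y) (n : Z.Lo y z), P.dom (C x y z m n).hom = 𝟙 _ :=
    fun m n => h.map_ext
      (by rw [← p.dom_sq, hC]; simp [Fdc]) (by rw [← q.dom_sq, hC']; simp [Gdc])
  have cC : ∀ {x y z : Z.Obj} (m : Z.Lo x y) (n : Z.Lo y z), P.cod (C x y z m n).hom = 𝟙 _ :=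
    fun m n => h.map_ext
      (by rw [← p.cod_sq, hC]; simp [Fcc]) (by rw [← q.cod_sq, hC']; simp [Gcc])
  have dS : ∀ {x y x' y' : Z.Obj} {m : Z.Lo x y} {n : Z.Lo x' y'} (α : LoArr.mk m ⟶ LoArr.mk n),
      P.dom (S _ _ _ _ _ _ α) = T _ _ (Z.dom α) := fun α =>
    h.map_ext (by rw [← p.dom_sq, Fds]) (by rw [← q.dom_sq, Gds])
  have cS : ∀ {x y x' y' : Z.Obj} {m : Z.Lo x y} {n : Z.Lo x' y'} (α : LoArr.mk m ⟶ LoArr.mk n),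
      P.cod (S _ _ _ _ _ _ α) = T _ _ (Z.cod α) := fun α =>
    h.map_ext (by rw [← p.cod_sq, Fcs]) (by rw [← q.cod_sq, Gcs])
  let H : DblFunctor Z P :=
    { tight :=
        { obj := X
          map := fun f => T _ _ f
          map_id := fun x => h.map_ext (by simp [Fmi]) (by simp [Gmi])
          map_comp := fun f g => h.map_ext (by simp [Fmc]) (by simp [Gmc]) }
      lo := fun m => L _ _ m
      sq := fun α => S _ _ _ _ _ _ α
      sq_id := fun m => h.sq_ext (by simp [Fsi]) (by simp [Gsi])
      sq_comp := fun α β => h.sq_ext (by simp [Fsc]) (by simp [Gsc])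
      dom_sq := dS
      cod_sq := cS
      unitIso := U
      dom_unitIso := dU
      cod_unitIso := cU
      unitIso_naturality := fun f => h.sq_ext
        ((p.sq_unitSq_eq_iff _ _ _ _).2 (by rw [kU, kU, Fun])).symm
        ((q.sq_unitSq_eq_iff _ _ _ _).2 (by rw [kU', kU', Gun])).symm
      compIso := fun m n => C _ _ _ m n
      dom_compIso := dC
      cod_compIso := cC
      compIso_naturality := fun α β e => h.sq_ext
        ((p.sq_compSq_eq_iff _ _ _ _ _ _).2 (by rw [kC, kC, Fcn _ _ e])).symm
        ((q.sq_compSq_eq_iff _ _ _ _ _ _).2 (by rw [kC', kC', Gcn _ _ e])).symm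
      map_assoc := fun m n k => h.sq_ext
        ((p.sq_assoc_eq_iff _ _ (cC _ _) (dC _ _) _ _ _).2 (by simp only [kC, Fa]))
        ((q.sq_assoc_eq_iff _ _ (cC _ _) (dC _ _) _ _ _).2 (by simp only [kC', Ga]))
      map_leftUnitor := fun m => h.sq_ext
        ((p.sq_leftUnitor_eq_iff _ (cU _) _ _).2 (by simp only [kC, kU, Flu]))
        ((q.sq_leftUnitor_eq_iff _ (cU _) _ _).2 (by simp only [kC', kU', Glu]))
      map_rightUnitor := fun m => h.sq_ext
        ((p.sq_rightUnitor_eq_iff _ (dU _) _ _).2 (by simp only [kC, kU, Fru]))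
        ((q.sq_rightUnitor_eq_iff _ (dU _) _ _).2 (by simp only [kC', kU', Gru])) }
  refine ⟨H, ?_, ?_⟩
  · refine DblFunctor.ext_heq rfl HEq.rfl HEq.rfl (heq_of_eq ?_) (heq_of_eq ?_)
    · funext x
      exact Iso.ext (kU x)
    · funext x y z m n
      exact Iso.ext (kC m n)
  · refine DblFunctor.ext_heq rfl HEq.rfl HEq.rfl (heq_of_eq ?_) (heq_of_eq ?_)
    · funext x
      exact Iso.ext (kU' x)
    · funext x y z m n
      exact Iso.ext (kC' m n)

theorem hom_ext (h : IsJoint p q) {F G : DblFunctor Z P} (e : F.comp p = G.comp p)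
    (e' : F.comp q = G.comp q) : F = G := by
  obtain ⟨⟨Fo, Fm, Fmi, Fmc⟩, Fl, Fs, Fsi, Fsc, Fds, Fcs, Fu, Fdu, Fcu, Fun, Fc, Fdc, Fcc, Fcn,
    Fa, Flu, Fru⟩ := F
  obtain ⟨⟨Go, Gm, Gmi, Gmc⟩, Gl, Gs, Gsi, Gsc, Gds, Gcs, Gu, Gdu, Gcu, Gun, Gc, Gdc, Gcc, Gcn,
    Ga, Glu, Gru⟩ := G
  obtain rfl : Fo = Go := funext fun z => h.obj_ext
    (congrArg (fun K => K.tight.obj z) e) (congrArg (fun K => K.tight.obj z) e')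
  simp only [comp, DblFunctor.mk.injEq, Functor.comp, Functor.mk.injEq, heq_eq_eq, true_and] at e e'
  obtain ⟨e1, e2, e3, e4, e5⟩ := e
  obtain ⟨e1', e2', e3', e4', e5'⟩ := e'
  obtain rfl : @Fm = @Gm := by
    funext x y f
    exact h.map_ext (congrFun (congrFun (congrFun e1 x) y) f)
      (congrFun (congrFun (congrFun e1' x) y) f)
  obtain rfl : @Fl = @Gl := by
    funext x y f
    exact h.lo_ext (congrFun (congrFun (congrFun e2 x) y) f)
      (congrFun (congrFun (congrFun e2' x) y) f)
  have e3 := eq_of_heq e3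
  have e3' := eq_of_heq e3'
  obtain rfl : @Fs = @Gs := by
    funext x y x' y' m n α
    exact h.sq_ext (congrFun (congrFun (congrFun (congrFun (congrFun (congrFun (congrFun e3 x) y)
      x') y') m) n) α) (congrFun (congrFun (congrFun (congrFun (congrFun (congrFun (congrFun e3' x)
      y) x') y') m) n) α)
  obtain rfl : Fu = Gu := by
    funext x
    refine Iso.ext (h.sq_ext ?_ ?_)
    · have := congrArg Iso.hom (congrFun (eq_of_heq e4) x)
      simpa [sqIso] using this
    · have := congrArg Iso.hom (congrFun (eq_of_heq e4') x)
      simpa [sqIso] using this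
  obtain rfl : @Fc = @Gc := by
    funext x y z m n
    refine Iso.ext (h.sq_ext ?_ ?_)
    · have := congrArg Iso.hom (congrFun (congrFun (congrFun (congrFun (congrFun
        (eq_of_heq e5) x) y) z) m) n)
      simpa [sqIso] using this
    · have := congrArg Iso.hom (congrFun (congrFun (congrFun (congrFun (congrFun
        (eq_of_heq e5') x) y) z) m) n)
      simpa [sqIso] using this
  rfl

theorem exists_lift₂ (h : IsJoint p q) {F G : DblFunctor Z P} (α : DblTrans (F.comp p) (G.comp p))
    (β : DblTrans (F.comp q) (G.comp q)) : ∃ γ : DblTrans F G,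
      γ.whiskerRight p = α ∧ γ.whiskerRight q = β := by
  choose T hT hT' using fun x => h.map (α.app x) (β.app x)
  choose S hS hS' using fun (x y : Z.Obj) (m : Z.Lo x y) => h.sq (α.sq m) (β.sq m)
  have aα := fun x => α.unit x
  have aβ := fun x => β.unit x
  have cα := fun {x y z : Z.Obj} (m : Z.Lo x y) (n : Z.Lo y z) => α.comp m n
  have cβ := fun {x y z : Z.Obj} (m : Z.Lo x y) (n : Z.Lo y z) => β.comp m n
  simp only [DblFunctor.comp, sqIso, Iso.trans_hom] at aα aβ cα cβ
  have dS : ∀ {x y : Z.Obj} (m : Z.Lo x y), P.dom (S x y m) = T x := fun m => h.map_ext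
    (by rw [← p.dom_sq, hS, hT]; exact α.dom_sq m) (by rw [← q.dom_sq, hS', hT']; exact β.dom_sq m)
  have cS : ∀ {x y : Z.Obj} (m : Z.Lo x y), P.cod (S x y m) = T y := fun m => h.map_ext
    (by rw [← p.cod_sq, hS, hT]; exact α.cod_sq m) (by rw [← q.cod_sq, hS', hT']; exact β.cod_sq m)
  refine ⟨⟨T, fun m => S _ _ m, fun f => h.map_ext ?_ ?_, dS, cS, fun s => h.sq_ext ?_ ?_,
    fun x => h.sq_ext ?_ ?_, fun m n => h.sq_ext ?_ ?_⟩, ?_, ?_⟩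
  · simp only [Functor.map_comp, hT]; exact α.naturality f
  · simp only [Functor.map_comp, hT']; exact β.naturality f
  · simp only [sq_comp, hS]; exact α.sq_naturality s
  · simp only [sq_comp, hS']; exact β.sq_naturality s
  · rw [p.sq_unitSq_eq_iff, hS, hT, aα]
  · rw [q.sq_unitSq_eq_iff, hS', hT', aβ]
  · rw [p.sq_compSq_eq_iff]; simp only [hS]; exact cα m n
  · rw [q.sq_compSq_eq_iff]; simp only [hS']; exact cβ m n
  · exact DblTrans.ext (funext hT) (by funext x y m; exact hS x y m)
  · exact DblTrans.ext (funext hT') (by funext x y m; exact hS' x y m)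

theorem hom_ext₂ (h : IsJoint p q) {F G : DblFunctor Z P} {α β : DblTrans F G}
    (e : α.whiskerRight p = β.whiskerRight p) (e' : α.whiskerRight q = β.whiskerRight q) :
    α = β :=
  DblTrans.ext (funext fun x => h.map_ext (congrArg (fun t => DblTrans.app t x) e)
    (congrArg (fun t => DblTrans.app t x) e')) (by
      funext x y m
      exact h.sq_ext (congrArg (fun t => DblTrans.sq t m) e) (congrArg (fun t => DblTrans.sq t m) e'))

theorem full (h : IsJoint p q) {R : P.Obj → Prop} {S : D.Obj → Prop} {T : E.Obj → Prop}
    (k : ∀ x, R x → S (p.tight.obj x)) (l : ∀ x, R x → T (q.tight.obj x)) :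
    IsJoint (DblCat.fullMap p k) (DblCat.fullMap q l) where
  obj_ext e e' := Subtype.ext (h.obj_ext (congrArg Subtype.val e) (congrArg Subtype.val e'))
  map f g := h.map f g
  map_ext e e' := h.map_ext e e'
  lo m n := h.lo m n
  lo_ext e e' := h.lo_ext e e'
  sq α β := h.sq α β
  sq_ext e e' := h.sq_ext e e'

theorem is2Product {P D E : DblCat.{u}} {p : P ⟶ D} {q : P ⟶ E} (h : IsJoint p q)
    (ho : ∀ x y, ∃ z, (DblFunctor.tight p).obj z = x ∧ (DblFunctor.tight q).obj z = y) :
    Is2Product p q :=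
  is2Product_of (fun f g => h.exists_lift f g fun _ => ho _ _) (fun e e' => h.hom_ext e e')
    (fun α β => h.exists_lift₂ α β) (fun e e' => h.hom_ext₂ e e')

end IsJoint

end DblFunctor

namespace LooseBimod

theorem is2Product {P M N : LooseBimod.{u}} {p : P ⟶ M} {q : P ⟶ N}
    (h : DblFunctor.IsJoint p.functor q.functor)
    (ho : ∀ x y, (DblFunctor.tight M.label).obj x = (DblFunctor.tight N.label).obj y →
      ∃ z, (DblFunctor.tight p.functor).obj z = x ∧ (DblFunctor.tight q.functor).obj z = y) :
    Is2Product p q := by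
  refine is2Product_of (fun {Z} f g => ?_) (fun {Z f g} e e' => ?_) (fun {Z f g} α β => ?_)
    (fun {Z f g α β} e e' => ?_)
  · obtain ⟨H, h1, h2⟩ := h.exists_lift f.functor g.functor fun z =>
      ho _ _ ((f.label_obj z).trans (g.label_obj z).symm)
    have hw : ∀ z, (DblFunctor.tight P.label).obj ((DblFunctor.tight H).obj z) =
        (DblFunctor.tight Z.label).obj z := fun z => by
      rw [← p.label_obj, ← f.label_obj, ← h1]; rfl
    exact ⟨⟨H, DblCat.loose_ext hw⟩, hom_ext h1, hom_ext h2⟩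
  · exact hom_ext (h.hom_ext (congrArg Hom.functor e) (congrArg Hom.functor e'))
  · obtain ⟨γ, h1, h2⟩ := h.exists_lift₂ (Hom₂.trans α) (Hom₂.trans β)
    exact ⟨mkHom₂ γ, Hom₂.ext' h1, Hom₂.ext' h2⟩
  · exact Hom₂.ext' (h.hom_ext₂ (congrArg Hom₂.trans e) (congrArg Hom₂.trans e'))

theorem fiber_is2Product {P M N : LooseBimod.{u}} {p : P ⟶ M} {q : P ⟶ N}
    (h : DblFunctor.IsJoint p.functor q.functor)
    (ho : ∀ x y, (DblFunctor.tight M.label).obj x = (DblFunctor.tight N.label).obj y →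
      ∃ z, (DblFunctor.tight p.functor).obj z = x ∧ (DblFunctor.tight q.functor).obj z = y)
    (i : Side.{u}) : Is2Product (fiberMap p i) (fiberMap q i) :=
  (h.full _ _).is2Product fun x y => by
    obtain ⟨z, h1, h2⟩ := ho x.1 y.1 (x.2.trans y.2.symm)
    exact ⟨⟨z, ((p.label_obj z).symm.trans (congrArg (DblFunctor.tight M.label).obj h1)).trans x.2⟩,
      Subtype.ext h1, Subtype.ext h2⟩

end LooseBimod

namespace DblCat

/-- The first projection. -/
def prodFst (D E : DblCat.{u}) : DblFunctor (D.prod E) D where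
  tight :=
    { obj := fun x => x.1
      map := fun f => f.1
      map_id := fun _ => rfl
      map_comp := fun _ _ => rfl }
  lo m := m.1
  sq α := α.1
  sq_id _ := rfl
  sq_comp _ _ := rfl
  dom_sq _ := rfl
  cod_sq _ := rfl
  unitIso _ := Iso.refl _
  dom_unitIso _ := D.dom_id _
  cod_unitIso _ := D.cod_id _
  unitIso_naturality f := (Category.comp_id _).trans (Category.id_comp _).symm
  compIso _ _ := Iso.refl _
  dom_compIso _ _ := D.dom_id _
  cod_compIso _ _ := D.cod_id _
  compIso_naturality α β h := (Category.comp_id _).trans (Category.id_comp _).symm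
  map_assoc m n p := (DblFunctor.id D).map_assoc m.1 n.1 p.1
  map_leftUnitor m := (DblFunctor.id D).map_leftUnitor m.1
  map_rightUnitor m := (DblFunctor.id D).map_rightUnitor m.1

theorem prod_isJoint (D E : DblCat.{u}) : DblFunctor.IsJoint (D.prodFst E) (D.prodSnd E) where
  obj_ext e e' := Prod.ext e e'
  map f g := ⟨(f, g), rfl, rfl⟩
  map_ext e e' := Prod.ext e e'
  lo m n := ⟨(m, n), rfl, rfl⟩
  lo_ext e e' := Prod.ext e e'
  sq α β := ⟨(α, β), rfl, rfl⟩
  sq_ext e e' := Prod.ext e e'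

/-- The inclusion of a full sub double category. -/
def fullIncl {D : DblCat.{u}} (R : D.Obj → Prop) : DblFunctor (D.full R) D :=
  fullOut (DblFunctor.id (D.full R))

theorem is2Product_prod (D E : DblCat.{u}) :
    Is2Product (P := D.prod E) (X := D) (Y := E) (D.prodFst E) (D.prodSnd E) :=
  (D.prod_isJoint E).is2Product fun x y => ⟨(x, y), rfl, rfl⟩

/-- The inclusion of the point in the walking loose arrow. -/
def ptToLoose : DblFunctor Pt.{u} Loose.{u} :=
  toLoose Pt (fun _ => .zero) (fun _ => rfl) (fun _ => ⟨⟨Or.inl rfl⟩⟩)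

theorem ptToLoose_isJoint : DblFunctor.IsJoint ptToLoose.{u} ptToLoose.{u} where
  obj_ext _ _ := rfl
  map _ _ := ⟨⟨⟨rfl⟩⟩, Subsingleton.elim _ _, Subsingleton.elim _ _⟩
  map_ext := fun {x y} ⟨⟨_⟩⟩ ⟨⟨_⟩⟩ _ _ => rfl
  lo _ _ := ⟨⟨⟨trivial⟩⟩, Subsingleton.elim _ _, Subsingleton.elim _ _⟩
  lo_ext := fun {x y} ⟨⟨_⟩⟩ ⟨⟨_⟩⟩ _ _ => rfl
  sq _ _ := ⟨⟨⟨rfl, rfl⟩⟩, Subsingleton.elim _ _, Subsingleton.elim _ _⟩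
  sq_ext := fun {x y x' y' m n} ⟨⟨_⟩⟩ ⟨⟨_⟩⟩ _ _ => rfl

theorem pt_ext {D : DblCat.{u}} (F G : D ⟶ Pt.{u}) : F = G :=
  ptToLoose_isJoint.hom_ext (loose_ext fun _ => rfl) (loose_ext fun _ => rfl)

theorem pt_ext₂ {D : DblCat.{u}} {F G : D ⟶ Pt.{u}} (α β : F ⟶ G) : α = β :=
  ptToLoose_isJoint.hom_ext₂
    (Subsingleton.elim (α := (F ≫ ptToLoose : D ⟶ Loose) ⟶ (G ≫ ptToLoose : D ⟶ Loose)) _ _)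
    (Subsingleton.elim (α := (F ≫ ptToLoose : D ⟶ Loose) ⟶ (G ≫ ptToLoose : D ⟶ Loose)) _ _)

theorem exists_toPt (D : DblCat.{u}) : Nonempty (D ⟶ Pt.{u}) := by
  let F : DblFunctor D Loose := toLoose D (fun _ => .zero) (fun _ => rfl) fun _ => ⟨⟨Or.inl rfl⟩⟩
  obtain ⟨H, _⟩ := ptToLoose_isJoint.exists_lift F F fun _ => ⟨PUnit.unit, rfl, rfl⟩
  exact ⟨H⟩

theorem pt_is2Terminal : Is2Terminal DblCat.Pt.{u} := fun D => by
  obtain ⟨F⟩ := exists_toPt D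
  exact ⟨⟨⟨⟨F⟩, fun G => pt_ext _ _⟩⟩,
    fun f g => ⟨⟨⟨eqToHom (pt_ext f g)⟩, fun _ => pt_ext₂ _ _⟩⟩⟩

end DblCat

namespace LooseBimod

/-- The terminal loose bimodule. -/
def terminal : LooseBimod.{u} := ⟨DblCat.Loose, 𝟙 _⟩

theorem terminal_is2Terminal : Is2Terminal terminal.{u} := fun M => by
  have key : ∀ F : M ⟶ terminal, F.functor = M.label := fun F =>
    (DblCat.strict.comp_id F.functor).symm.trans F.w
  refine ⟨⟨⟨⟨⟨M.label, DblCat.strict.comp_id _⟩⟩, fun F => hom_ext (key F)⟩⟩, fun f g =>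
    ⟨⟨⟨eqToHom (hom_ext ((key f).trans (key g).symm))⟩, fun _ => Hom₂.ext' ?_⟩⟩⟩
  have h : ∀ F G : M.collage ⟶ DblCat.Loose.{u}, Subsingleton (F ⟶ G) := fun F G => inferInstance
  exact (h f.functor g.functor).elim _ _

/-- The product of two loose bimodules. -/
def prod (M N : LooseBimod.{u}) : LooseBimod.{u} where
  collage := (M.collage.prod N.collage).full fun x =>
    (DblFunctor.tight M.label).obj x.1 = (DblFunctor.tight N.label).obj x.2
  label := ((DblCat.fullIncl _).comp (DblCat.prodFst _ _)).comp M.label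

variable (M N : LooseBimod.{u})

/-- The first projection. -/
def prodFst : M.prod N ⟶ M := (⟨(DblCat.fullIncl _).comp (DblCat.prodFst _ _), rfl⟩ : Hom (M.prod N) M)

/-- The second projection. -/
def prodSnd : M.prod N ⟶ N :=
  (⟨(DblCat.fullIncl _).comp (DblCat.prodSnd _ _), DblCat.loose_ext fun x => Eq.symm (Subtype.property x)⟩ :
    Hom (M.prod N) N)

theorem prod_isJoint : DblFunctor.IsJoint (M.prodFst N).functor (M.prodSnd N).functor where
  obj_ext e e' := Subtype.ext (Prod.ext e e')
  map f g := ⟨(f, g), rfl, rfl⟩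
  map_ext e e' := Prod.ext e e'
  lo m n := ⟨(m, n), rfl, rfl⟩
  lo_ext e e' := Prod.ext e e'
  sq α β := ⟨(α, β), rfl, rfl⟩
  sq_ext e e' := Prod.ext e e'

theorem prod_obj (x : M.collage.Obj) (y : N.collage.Obj)
    (h : (DblFunctor.tight M.label).obj x = (DblFunctor.tight N.label).obj y) :
    ∃ z, (DblFunctor.tight (M.prodFst N).functor).obj z = x ∧
      (DblFunctor.tight (M.prodSnd N).functor).obj z = y := ⟨⟨(x, y), h⟩, rfl, rfl⟩

theorem is2Product_prod : Is2Product (M.prodFst N) (M.prodSnd N) :=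
  is2Product (M.prod_isJoint N) (M.prod_obj N)

theorem fiber_is2Product_prod (i : Side.{u}) :
    Is2Product (fiberMap (M.prodFst N) i) (fiberMap (M.prodSnd N) i) :=
  fiber_is2Product (M.prod_isJoint N) (M.prod_obj N) i

end LooseBimod

namespace DblCat

variable {D E : DblCat.{u}} {x y x' y' x'' y'' z z' : D.Obj}

/-- An opcartesian square: a square through which every square out of its domain with suitable
sides factors uniquely. -/
structure IsCocart {m : D.Lo x y} {n : D.Lo x' y'} (c : LoArr.mk m ⟶ LoArr.mk n) : Prop where
  factor {a b : D.Obj} {p : D.Lo a b} (β : LoArr.mk m ⟶ LoArr.mk p) (s : x' ⟶ a) (t : y' ⟶ b) :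
    D.dom β = D.dom c ≫ s → D.cod β = D.cod c ≫ t →
      ∃! γ : LoArr.mk n ⟶ LoArr.mk p, D.dom γ = s ∧ D.cod γ = t ∧ c ≫ γ = β

namespace IsCocart

variable {m : D.Lo x y} {n : D.Lo x' y'} {k : D.Lo x'' y''} {c : LoArr.mk m ⟶ LoArr.mk n}

theorem hom_ext (h : IsCocart c) {a b : D.Obj} {p : D.Lo a b} {γ δ : LoArr.mk n ⟶ LoArr.mk p}
    (e₀ : D.dom γ = D.dom δ) (e₁ : D.cod γ = D.cod δ) (e : c ≫ γ = c ≫ δ) : γ = δ :=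
  (h.factor (c ≫ δ) (D.dom δ) (D.cod δ) (D.dom_comp _ _) (D.cod_comp _ _)).unique ⟨e₀, e₁, e⟩
    ⟨rfl, rfl, rfl⟩

theorem of_isIso (c : LoArr.mk m ⟶ LoArr.mk n) [IsIso c] : IsCocart c := by
  refine ⟨fun {a b p} β s t hs ht => ?_⟩
  refine ⟨inv c ≫ β, ⟨?_, ?_, by simp⟩, fun γ hγ => by simp [← hγ.2.2]⟩
  · rw [D.dom_comp, hs, ← Category.assoc, ← D.dom_comp]; simp
  · rw [D.cod_comp, ht, ← Category.assoc, ← D.cod_comp]; simp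

theorem comp (h : IsCocart c) {d : LoArr.mk n ⟶ LoArr.mk k} (h' : IsCocart d) :
    IsCocart (c ≫ d) := by
  refine ⟨fun {a b p} β s t hs ht => ?_⟩
  obtain ⟨γ, ⟨h1, h2, h3⟩, -⟩   := h.factor β (D.dom d ≫ s) (D.cod d ≫ t) (by rw [hs]; simp)
    (by rw [ht]; simp)
  obtain ⟨δ, ⟨k1, k2, k3⟩, -⟩ := h'.factor γ s t h1 h2
  refine ⟨δ, ⟨k1, k2, by rw [Category.assoc, k3, h3]⟩, fun δ' ⟨l1, l2, l3⟩ => ?_⟩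
  refine h'.hom_ext (l1.trans k1.symm) (l2.trans k2.symm) (h.hom_ext ?_ ?_ ?_)
  · simp [l1, k1]
  · simp [l2, k2]
  · rw [← Category.assoc, l3, k3, h3]

theorem comp_isIso (h : IsCocart c) (d : LoArr.mk n ⟶ LoArr.mk k) [IsIso d] : IsCocart (c ≫ d) :=
  h.comp (of_isIso d)

theorem exists_iso (h : IsCocart c) {n' : D.Lo x' y'} {c' : LoArr.mk m ⟶ LoArr.mk n'}
    (h' : IsCocart c') (e₀ : D.dom c = D.dom c') (e₁ : D.cod c = D.cod c') :
    ∃ i : LoArr.mk n ≅ LoArr.mk n', D.dom i.hom = 𝟙 _ ∧ D.cod i.hom = 𝟙 _ ∧ c ≫ i.hom = c' := by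
  obtain ⟨γ, ⟨h1, h2, h3⟩, -⟩ := h.factor c' (𝟙 _) (𝟙 _) (by simp [e₀]) (by simp [e₁])
  obtain ⟨δ, ⟨k1, k2, k3⟩, -⟩ := h'.factor c (𝟙 _) (𝟙 _) (by simp [e₀]) (by simp [e₁])
  exact ⟨⟨γ, δ, h.hom_ext (by simp [h1, k1]) (by simp [h2, k2]) (by rw [← Category.assoc, h3, k3,
    Category.comp_id]), h'.hom_ext (by simp [h1, k1]) (by simp [h2, k2]) (by
    rw [← Category.assoc, k3, h3, Category.comp_id])⟩, h1, h2, h3⟩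

theorem hop_iff (c : LoArr.mk m ⟶ LoArr.mk n) :
    IsCocart (D := D.hop) (x := y) (y := x) (x' := y') (y' := x') (hopSq c) ↔ IsCocart c := by
  constructor
  · intro h
    refine ⟨fun {a b p} β s t hs ht => ?_⟩
    obtain ⟨γ, ⟨h1, h2, h3⟩, hu⟩ := h.factor (a := b) (b := a) (p := p) (hopSq β) t s ht hs
    exact ⟨γ, ⟨h2, h1, h3⟩, fun δ hδ => hu δ ⟨hδ.2.1, hδ.1, hδ.2.2⟩⟩
  · intro h
    refine ⟨fun {a b p} β s t hs ht => ?_⟩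
    obtain ⟨γ, ⟨h1, h2, h3⟩, hu⟩ := h.factor (a := b) (b := a) (p := p) β t s ht hs
    exact ⟨γ, ⟨h2, h1, h3⟩, fun δ hδ => hu δ ⟨hδ.2.1, hδ.1, hδ.2.2⟩⟩

end IsCocart

theorem Companion.isCocart_χ {g : y ⟶ z} (C : Companion g) (m : D.Lo x y) : IsCocart (C.χ m) := by
  refine ⟨fun {a b p} β s t hs ht => ?_⟩
  rw [C.dom_χ, Category.id_comp] at hs
  rw [C.cod_χ] at ht
  refine ⟨D.compSq β (C.eps ≫ D.unitSq t) (by simp [ht]) ≫ (D.rightUnitor p).hom,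
    ⟨by simp [hs], by simp, ?_⟩, fun γ hγ => C.χ_epi m _ _ (by simp [hγ.2.1]) ?_⟩
  · unfold χ lw
    rw [Category.assoc, Iso.inv_comp_eq, ← D.rightUnitor_naturality, ← Category.assoc,
      compSq_compSq]
    congr 1
    refine compSq_congr _ (Category.id_comp _) ?_
    rw [← Category.assoc, C.eta_eps, ← D.unitSq_comp, ht]
  · rw [hγ.2.2]
    unfold χ lw
    rw [Category.assoc, eq_comm, Iso.inv_comp_eq, ← D.rightUnitor_naturality, ← Category.assoc,
      compSq_compSq]
    congr 1
    refine compSq_congr _ (Category.id_comp _) ?_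
    rw [← Category.assoc, C.eta_eps, ← D.unitSq_comp, ht]

theorem Companion.lw_χ {w : D.Obj} {g : y ⟶ z} (C : Companion g) (n : D.Lo w x) (m : D.Lo x y) :
    lw n (C.χ m) (by simp) = C.χ (D.comp n m) ≫ (D.assoc n m C.lo).hom := by
  have h := rightUnitor_inv_assoc n m
  unfold χ
  rw [Category.assoc, lw_lw, reassoc_of% h, ← lw_comp]

/-- The square from a loose arrow to its composite with a conjoint of a tight arrow out of its
source. -/
def Conjoint.χ {f : x ⟶ z} (C : Conjoint f) (m : D.Lo x y) :
    LoArr.mk m ⟶ LoArr.mk (D.comp C.lo m) :=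
  (D.leftUnitor m).inv ≫ rw' C.eta m C.cod_eta

namespace Conjoint

@[simp] theorem dom_χ {f : x ⟶ z} (C : Conjoint f) (m : D.Lo x y) : D.dom (C.χ m) = f := by
  simp [χ]

@[simp] theorem cod_χ {f : x ⟶ z} (C : Conjoint f) (m : D.Lo x y) : D.cod (C.χ m) = 𝟙 _ := by
  simp [χ]

theorem isCocart_χ {f : x ⟶ z} (C : Conjoint f) (m : D.Lo x y) : IsCocart (C.χ m) :=
  (IsCocart.hop_iff _).1 (Companion.isCocart_χ (D := D.hop) (x := y) (y := x) C.toHop m)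

theorem rw'_χ {w : D.Obj} {f : x ⟶ z} (C : Conjoint f) (m : D.Lo x y) (n : D.Lo y w) :
    rw' (C.χ m) n (by simp) = C.χ (D.comp m n) ≫ (D.assoc C.lo m n).inv :=
  Companion.lw_χ (D := D.hop) (w := w) (x := y) (y := x) C.toHop n m

theorem map_χ (F : DblFunctor D E) {f : x ⟶ z} (C : Conjoint f) (m : D.Lo x y) :
    ∃ C' : Conjoint (F.tight.map f), ∃ i : LoArr.mk (E.comp C'.lo (F.lo m)) ≅
      LoArr.mk (F.lo (D.comp C.lo m)), C'.χ (F.lo m) ≫ i.hom = F.sq (C.χ m) :=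
  ⟨Conjoint.ofHop (Companion.map (D := D.hop) (E := E.hop) (hopFunctor F) C.toHop),
    F.compIso C.lo m, Companion.map_χ (D := D.hop) (E := E.hop) (x := y) (y := x) (hopFunctor F)
      C.toHop m⟩

end Conjoint

theorem extend_eq (m : D.Lo x y) {f : x ⟶ x'} {g : y ⟶ y'} (C : Conjoint f) (K : Companion g) :
    extend m C K = C.χ m ≫ K.χ (D.comp C.lo m) := by
  have h := D.rightUnitor_naturality (C.χ m)
  have h' : C.χ m ≫ (D.rightUnitor _).inv = (D.rightUnitor m).inv ≫
      D.compSq (C.χ m) (𝟙 (LoArr.mk (D.unit y))) (by simp) := by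
    rw [Iso.comp_inv_eq, Category.assoc, Iso.eq_inv_comp, ← h]
    congr 1
    exact compSq_congr _ rfl (by simp)
  unfold Companion.χ
  rw [reassoc_of% h']
  unfold lw
  rw [compSq_compSq]
  unfold extend
  congr 1
  exact compSq_congr _ (by simp [Conjoint.χ, rw']) (by simp)

theorem isCocart_extend (m : D.Lo x y) {f : x ⟶ x'} {g : y ⟶ y'} (C : Conjoint f)
    (K : Companion g) : IsCocart (extend m C K) := by
  rw [extend_eq]
  exact (C.isCocart_χ m).comp (K.isCocart_χ _)

@[simp] theorem dom_extend (m : D.Lo x y) {f : x ⟶ x'} {g : y ⟶ y'} (C : Conjoint f)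
    (K : Companion g) : D.dom (extend m C K) = f := by simp [extend_eq]

@[simp] theorem cod_extend (m : D.Lo x y) {f : x ⟶ x'} {g : y ⟶ y'} (C : Conjoint f)
    (K : Companion g) : D.cod (extend m C K) = g := by simp [extend_eq]

theorem IsCocart.map (F : DblFunctor D E) {m : D.Lo x y} {n : D.Lo x' y'}
    {c : LoArr.mk m ⟶ LoArr.mk n} (h : IsCocart c) (hC : Nonempty (Conjoint (D.dom c)))
    (hK : Nonempty (Companion (D.cod c))) : IsCocart (F.sq c) := by
  obtain ⟨f, hf⟩ : ∃ f : x ⟶ x', D.dom c = f := ⟨_, rfl⟩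
  obtain ⟨g, hg⟩ : ∃ g : y ⟶ y', D.cod c = g := ⟨_, rfl⟩
  rw [hf] at hC
  rw [hg] at hK
  obtain ⟨C⟩ := hC
  obtain ⟨K⟩ := hK
  obtain ⟨i, -, -, hi⟩ := (isCocart_extend m C K).exists_iso h (by simp [hf]) (by simp [hg])
  obtain ⟨C', j, hj⟩ := C.map_χ F m
  rw [← hi, extend_eq, F.sq_comp, F.sq_comp, ← hj, ← K.map_χ]
  have : IsIso (F.sq i.hom) := (F.sqIso i).isIso_hom
  exact (((C'.isCocart_χ _).comp_isIso j.hom).comp (((K.map F).isCocart_χ _).comp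
    (IsCocart.of_isIso (F.compIso (D.comp C.lo m) K.lo).hom))).comp_isIso _

theorem Companion.χ_transpose {m : D.Lo x y} {n : D.Lo x' y'} (α : LoArr.mk m ⟶ LoArr.mk n)
    {f : x ⟶ x'} {g : y ⟶ y'} (C₀ : Companion f) (C₁ : Companion g) (hf : D.dom α = f)
    (hg : D.cod α = g) : C₁.χ m ≫ transpose α C₀ C₁ hf hg =
      (D.leftUnitor m).inv ≫ D.compSq C₀.eta α (by simp [hf]) := by
  refine (C₀.eq_of_κ n (C₁.χ m ≫ transpose α C₀ C₁ hf hg)).trans ?_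
  congr 1
  exact compSq_congr _ (by simp) (by rw [Category.assoc, χ_transpose_κ])

theorem rw'_rightUnitor_inv (m : D.Lo x y) (p : D.Lo y z) :
    rw' (D.rightUnitor m).inv p (by simp) ≫ (D.assoc m (D.unit y) p).hom =
      lw m (D.leftUnitor p).inv (by simp) := by
  have h : (D.assoc m (D.unit y) p).hom ≫ lw m (D.leftUnitor p).hom (by simp) =
    rw' (D.rightUnitor m).hom p (by simp) := D.triangle m p
  have h1 : lw m (D.leftUnitor p).hom (by simp) ≫ lw m (D.leftUnitor p).inv (by simp) = 𝟙 _ := by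
    rw [← lw_comp, ← lw_id]; unfold lw; exact compSq_congr _ rfl (Iso.hom_inv_id _)
  have h2 : rw' (D.rightUnitor m).inv p (by simp) ≫ rw' (D.rightUnitor m).hom p (by simp) =
      𝟙 _ := by
    rw [← comp_rw', ← id_rw']; unfold rw'; exact compSq_congr _ (Iso.inv_hom_id _) rfl
  rw [← Category.comp_id (D.assoc m (D.unit y) p).hom, ← h1, reassoc_of% h, reassoc_of% h2]

theorem IsCocart.compSq {m : D.Lo x y} {n : D.Lo x' y'} {p : D.Lo y z} {q : D.Lo y' z'}
    {c : LoArr.mk m ⟶ LoArr.mk n} {s : LoArr.mk p ⟶ LoArr.mk q} (hc : IsCocart c)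
    (hs : IsCompanionCommuter s) (h : D.cod c = D.dom s) (hC : Nonempty (Conjoint (D.dom c))) :
    IsCocart (D.compSq c s h) := by
  obtain ⟨C⟩ := hC
  obtain ⟨K, K₁, ht⟩ := hs
  obtain ⟨i, hi₀, hi₁, hi⟩ :=
    ((K.isCocart_χ m).comp (C.isCocart_χ (D.comp m K.lo))).exists_iso hc (by simp) (by simp [h])
  have e : D.compSq c s h = D.compSq (K.χ m) s (by simp) ≫
      rw' (C.χ (D.comp m K.lo)) q (by simp) ≫ rw' i.hom q hi₁ := by
    unfold rw'
    rw [compSq_compSq, compSq_compSq]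
    exact compSq_congr _ (hi.symm.trans (Category.assoc _ _ _)) (by simp)
  have e' : D.compSq (K.χ m) s (by simp) = (K₁.χ (D.comp m p) ≫ (D.assoc m p K₁.lo).hom) ≫
      lw m (Companion.transpose s K K₁ rfl rfl) (by simp) ≫ (D.assoc m K.lo q).inv := by
    rw [← Companion.lw_χ, ← Category.assoc, Iso.eq_comp_inv, ← lw_comp]
    have hn := D.assoc_naturality (𝟙 (LoArr.mk m)) K.eta s (by simp) (by simp)
    have ht := rw'_rightUnitor_inv m p
    have e1 : D.compSq (K.χ m) s (by simp) = rw' (D.rightUnitor m).inv p (by simp) ≫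
        D.compSq (D.compSq (𝟙 (LoArr.mk m)) K.eta (by simp)) s (by simp) := by
      unfold rw'
      rw [compSq_compSq]
      exact compSq_congr _ rfl (by simp)
    rw [e1, Category.assoc, hn, reassoc_of% ht]
    unfold lw
    rw [compSq_compSq]
    exact compSq_congr _ (by simp) (Companion.χ_transpose s K K₁ rfl rfl).symm
  rw [e, e']
  have := Companion.isIso_lw m (Companion.transpose s K K₁ rfl rfl) (by simp)
  have := Companion.isIso_rw' i.hom q hi₁
  rw [Conjoint.rw'_χ]
  exact ((((K₁.isCocart_χ _).comp_isIso _).comp ((IsCocart.of_isIso _).comp_isIso _))).comp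
    (((C.isCocart_χ _).comp_isIso _).comp_isIso _)

theorem IsCocart.compSq' {m : D.Lo x y} {n : D.Lo x' y'} {p : D.Lo y z} {q : D.Lo y' z'}
    {s : LoArr.mk m ⟶ LoArr.mk n} {c : LoArr.mk p ⟶ LoArr.mk q} (hc : IsCocart c)
    (hs : IsConjointCommuter s) (h : D.cod s = D.dom c) (hK : Nonempty (Companion (D.cod c))) :
    IsCocart (D.compSq s c h) := by
  obtain ⟨K⟩ := hK
  let K' : Conjoint (D := D.hop) (x := z) (y := z') (D.hop.dom (hopSq c)) :=
    ⟨K.lo, K.eta, K.eps, K.cod_eta, K.dom_eta, K.cod_eps, K.dom_eps, K.eta_eps, K.zigzag⟩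
  exact (IsCocart.hop_iff _).1 (IsCocart.compSq (D := D.hop) (x := z) (y := y) (z := x) (x' := z')
    (y' := y') (z' := x') ((IsCocart.hop_iff _).2 hc) ((isConjointCommuter_iff _).1 hs) h.symm ⟨K'⟩)

end DblCat

namespace DblCat

variable {D : DblCat.{u}}

section transfer

variable {x y z w x' y' z' w' : D.Obj} {a : D.Lo x y} {b : D.Lo y z} {c : D.Lo z w}
  {ab : D.Lo x z} {bc : D.Lo y w} {l r : D.Lo x w} {a' : D.Lo x' y'} {b' : D.Lo y' z'}
  {c' : D.Lo z' w'} {ab' : D.Lo x' z'} {bc' : D.Lo y' w'} {l' r' : D.Lo x' w'}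

theorem IsCocart.assoc_transfer {σa : LoArr.mk a ⟶ LoArr.mk a'} {σb : LoArr.mk b ⟶ LoArr.mk b'}
    {σc : LoArr.mk c ⟶ LoArr.mk c'} {σab : LoArr.mk ab ⟶ LoArr.mk ab'}
    {σbc : LoArr.mk bc ⟶ LoArr.mk bc'} {σl : LoArr.mk l ⟶ LoArr.mk l'}
    {σr : LoArr.mk r ⟶ LoArr.mk r'} {φ : LoArr.mk (D.comp a b) ⟶ LoArr.mk ab}
    {φ' : LoArr.mk (D.comp a' b') ⟶ LoArr.mk ab'} {ψ : LoArr.mk (D.comp b c) ⟶ LoArr.mk bc}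
    {ψ' : LoArr.mk (D.comp b' c') ⟶ LoArr.mk bc'} {χ : LoArr.mk (D.comp ab c) ⟶ LoArr.mk l}
    {χ' : LoArr.mk (D.comp ab' c') ⟶ LoArr.mk l'} {ω : LoArr.mk (D.comp a bc) ⟶ LoArr.mk r}
    {ω' : LoArr.mk (D.comp a' bc') ⟶ LoArr.mk r'} {s : LoArr.mk l ⟶ LoArr.mk r}
    {s' : LoArr.mk l' ⟶ LoArr.mk r'} {hab : D.cod σa = D.dom σb} {hbc : D.cod σb = D.dom σc}
    {hab' : D.cod (D.compSq σa σb hab) = D.dom σc}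
    (hc : IsCocart (D.compSq (D.compSq σa σb hab) σc hab'))
    {habc : D.cod σab = D.dom σc} {habc' : D.cod σa = D.dom σbc}
    {hφ : D.cod φ = D.dom (𝟙 (LoArr.mk c))} {hψ : D.cod (𝟙 (LoArr.mk a)) = D.dom ψ}
    {hφ' : D.cod φ' = D.dom (𝟙 (LoArr.mk c'))} {hψ' : D.cod (𝟙 (LoArr.mk a')) = D.dom ψ'}
    (eφ : φ ≫ σab = D.compSq σa σb hab ≫ φ') (eψ : ψ ≫ σbc = D.compSq σb σc hbc ≫ ψ')
    (eχ : χ ≫ σl = D.compSq σab σc habc ≫ χ') (eω : ω ≫ σr = D.compSq σa σbc habc' ≫ ω')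
    (es : s ≫ σr = σl ≫ s')
    (H : D.compSq φ (𝟙 (LoArr.mk c)) hφ ≫ χ ≫ s =
      (D.assoc a b c).hom ≫ D.compSq (𝟙 (LoArr.mk a)) ψ hψ ≫ ω)
    (hd : D.dom (D.compSq φ' (𝟙 (LoArr.mk c')) hφ' ≫ χ' ≫ s') =
      D.dom ((D.assoc a' b' c').hom ≫ D.compSq (𝟙 (LoArr.mk a')) ψ' hψ' ≫ ω'))
    (hd' : D.cod (D.compSq φ' (𝟙 (LoArr.mk c')) hφ' ≫ χ' ≫ s') =
      D.cod ((D.assoc a' b' c').hom ≫ D.compSq (𝟙 (LoArr.mk a')) ψ' hψ' ≫ ω')) :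
    D.compSq φ' (𝟙 (LoArr.mk c')) hφ' ≫ χ' ≫ s' =
      (D.assoc a' b' c').hom ≫ D.compSq (𝟙 (LoArr.mk a')) ψ' hψ' ≫ ω' := by
  refine hc.hom_ext hd hd' ?_
  have h1 : D.compSq (D.compSq σa σb hab) σc hab' ≫ D.compSq φ' (𝟙 (LoArr.mk c')) hφ' =
      D.compSq φ (𝟙 (LoArr.mk c)) hφ ≫ D.compSq σab σc habc := by
    rw [compSq_compSq, compSq_compSq]
    exact compSq_congr _ eφ.symm (by simp)
  have h2 : D.compSq σa (D.compSq σb σc hbc) (by simp [hab]) ≫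
      D.compSq (𝟙 (LoArr.mk a')) ψ' hψ' =
      D.compSq (𝟙 (LoArr.mk a)) ψ hψ ≫ D.compSq σa σbc habc' := by
    rw [compSq_compSq, compSq_compSq]
    exact compSq_congr _ (by simp) eψ.symm
  rw [reassoc_of% h1, ← reassoc_of% eχ, ← es, reassoc_of% H,
    reassoc_of% (D.assoc_naturality σa σb σc hab hbc), reassoc_of% h2, eω]

variable {e : D.Lo x x} {ea : D.Lo x y} {e' : D.Lo x' x'} {ea' : D.Lo x' y'}

theorem IsCocart.leftUnitor_transfer {σa : LoArr.mk a ⟶ LoArr.mk a'} (hc : IsCocart σa)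
    {σe : LoArr.mk e ⟶ LoArr.mk e'} {σl : LoArr.mk ea ⟶ LoArr.mk ea'}
    {φ : LoArr.mk (D.unit x) ⟶ LoArr.mk e} {φ' : LoArr.mk (D.unit x') ⟶ LoArr.mk e'}
    {χ : LoArr.mk (D.comp e a) ⟶ LoArr.mk ea} {χ' : LoArr.mk (D.comp e' a') ⟶ LoArr.mk ea'}
    {s : LoArr.mk ea ⟶ LoArr.mk a} {s' : LoArr.mk ea' ⟶ LoArr.mk a'}
    {he : D.cod σe = D.dom σa} {hφ : D.cod φ = D.dom (𝟙 (LoArr.mk a))}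
    {hφ' : D.cod φ' = D.dom (𝟙 (LoArr.mk a'))}
    (eφ : φ ≫ σe = D.unitSq (D.dom σa) ≫ φ') (eχ : χ ≫ σl = D.compSq σe σa he ≫ χ')
    (es : s ≫ σa = σl ≫ s')
    (H : D.compSq φ (𝟙 (LoArr.mk a)) hφ ≫ χ ≫ s = (D.leftUnitor a).hom)
    (hd : D.dom (D.compSq φ' (𝟙 (LoArr.mk a')) hφ' ≫ χ' ≫ s') = 𝟙 _)
    (hd' : D.cod (D.compSq φ' (𝟙 (LoArr.mk a')) hφ' ≫ χ' ≫ s') = 𝟙 _) :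
    D.compSq φ' (𝟙 (LoArr.mk a')) hφ' ≫ χ' ≫ s' = (D.leftUnitor a').hom := by
  have hc' : IsCocart (D.compSq (D.unitSq (D.dom σa)) σa (by simp)) := by
    have : D.compSq (D.unitSq (D.dom σa)) σa (by simp) =
        (D.leftUnitor a).hom ≫ σa ≫ (D.leftUnitor a').inv := by
      rw [← Category.assoc, Iso.eq_comp_inv, D.leftUnitor_naturality]
    rw [this]
    exact (IsCocart.of_isIso _).comp (hc.comp_isIso _)
  refine hc'.hom_ext (hd.trans (by simp)) (hd'.trans (by simp)) ?_
  have h1 : D.compSq (D.unitSq (D.dom σa)) σa (by simp) ≫ D.compSq φ' (𝟙 (LoArr.mk a')) hφ' =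
      D.compSq φ (𝟙 (LoArr.mk a)) hφ ≫ D.compSq σe σa he := by
    rw [compSq_compSq, compSq_compSq]
    exact compSq_congr _ eφ.symm (by simp)
  rw [reassoc_of% h1, ← reassoc_of% eχ, ← es, reassoc_of% H, D.leftUnitor_naturality]

variable {u : D.Lo y y} {au : D.Lo x y} {u' : D.Lo y' y'} {au' : D.Lo x' y'}

theorem IsCocart.rightUnitor_transfer {σa : LoArr.mk a ⟶ LoArr.mk a'} (hc : IsCocart σa)
    {σe : LoArr.mk u ⟶ LoArr.mk u'} {σl : LoArr.mk au ⟶ LoArr.mk au'}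
    {φ : LoArr.mk (D.unit y) ⟶ LoArr.mk u} {φ' : LoArr.mk (D.unit y') ⟶ LoArr.mk u'}
    {χ : LoArr.mk (D.comp a u) ⟶ LoArr.mk au} {χ' : LoArr.mk (D.comp a' u') ⟶ LoArr.mk au'}
    {s : LoArr.mk au ⟶ LoArr.mk a} {s' : LoArr.mk au' ⟶ LoArr.mk a'}
    {he : D.cod σa = D.dom σe} {hφ : D.cod (𝟙 (LoArr.mk a)) = D.dom φ}
    {hφ' : D.cod (𝟙 (LoArr.mk a')) = D.dom φ'}
    (eφ : φ ≫ σe = D.unitSq (D.cod σa) ≫ φ') (eχ : χ ≫ σl = D.compSq σa σe he ≫ χ')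
    (es : s ≫ σa = σl ≫ s')
    (H : D.compSq (𝟙 (LoArr.mk a)) φ hφ ≫ χ ≫ s = (D.rightUnitor a).hom)
    (hd : D.dom (D.compSq (𝟙 (LoArr.mk a')) φ' hφ' ≫ χ' ≫ s') = 𝟙 _)
    (hd' : D.cod (D.compSq (𝟙 (LoArr.mk a')) φ' hφ' ≫ χ' ≫ s') = 𝟙 _) :
    D.compSq (𝟙 (LoArr.mk a')) φ' hφ' ≫ χ' ≫ s' = (D.rightUnitor a').hom := by
  have hc' : IsCocart (D.compSq σa (D.unitSq (D.cod σa)) (by simp)) := by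
    have : D.compSq σa (D.unitSq (D.cod σa)) (by simp) =
        (D.rightUnitor a).hom ≫ σa ≫ (D.rightUnitor a').inv := by
      rw [← Category.assoc, Iso.eq_comp_inv, D.rightUnitor_naturality]
    rw [this]
    exact (IsCocart.of_isIso _).comp (hc.comp_isIso _)
  refine hc'.hom_ext (hd.trans (by simp)) (hd'.trans (by simp)) ?_
  have h1 : D.compSq σa (D.unitSq (D.cod σa)) (by simp) ≫ D.compSq (𝟙 (LoArr.mk a')) φ' hφ' =
      D.compSq (𝟙 (LoArr.mk a)) φ hφ ≫ D.compSq σa σe he := by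
    rw [compSq_compSq, compSq_compSq]
    exact compSq_congr _ (by simp) eφ.symm
  rw [reassoc_of% h1, ← reassoc_of% eχ, ← es, reassoc_of% H, D.rightUnitor_naturality]

end transfer

end DblCat

namespace Cograph

variable {A B M A' B' M' : DblCat.{u}}

/-- The data of a double functor between restrictions: double functors between the ends, a double
functor between the restricted double categories, colaxators, and an action on heteromorphisms given
by opcartesian squares. -/
structure LiftData (P : DblFunctor A M) (Q : DblFunctor B M) (P' : DblFunctor A' M')
    (Q' : DblFunctor B' M') where
  f : DblFunctor A A'
  g : DblFunctor B B'
  a : DblFunctor M M'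
  s : DblTrans (P.comp a) (f.comp P')
  t : DblTrans (Q.comp a) (g.comp Q')
  conj : s.IsConjointCommuter
  comp : t.IsCompanionCommuter
  het {x : A.Obj} {y : B.Obj} (m : M.Lo (P.tight.obj x) (Q.tight.obj y)) :
    M'.Lo (P'.tight.obj (f.tight.obj x)) (Q'.tight.obj (g.tight.obj y))
  c {x : A.Obj} {y : B.Obj} (m : M.Lo (P.tight.obj x) (Q.tight.obj y)) :
    LoArr.mk (a.lo m) ⟶ LoArr.mk (het m)
  dom_c {x : A.Obj} {y : B.Obj} (m : M.Lo (P.tight.obj x) (Q.tight.obj y)) :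
    M'.dom (c m) = s.app x
  cod_c {x : A.Obj} {y : B.Obj} (m : M.Lo (P.tight.obj x) (Q.tight.obj y)) :
    M'.cod (c m) = t.app y
  cocart {x : A.Obj} {y : B.Obj} (m : M.Lo (P.tight.obj x) (Q.tight.obj y)) :
    DblCat.IsCocart (c m)

namespace LiftData

variable {P : DblFunctor A M} {Q : DblFunctor B M} {P' : DblFunctor A' M'} {Q' : DblFunctor B' M'}
  (L : LiftData P Q P' Q')

/-- The action on objects. -/
def obj : A.Obj ⊕ B.Obj → A'.Obj ⊕ B'.Obj
  | .inl x => .inl (L.f.tight.obj x)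
  | .inr x => .inr (L.g.tight.obj x)

/-- The action on tight arrows. -/
def ti : ∀ {x y : A.Obj ⊕ B.Obj}, Ti x y → Ti (L.obj x) (L.obj y)
  | _, _, .left h => .left (L.f.tight.map h)
  | _, _, .right h => .right (L.g.tight.map h)

/-- The action on loose arrows. -/
def lo : ∀ {x y : A.Obj ⊕ B.Obj}, Lo P Q x y → Lo P' Q' (L.obj x) (L.obj y)
  | _, _, .left m => .left (L.f.lo m)
  | _, _, .het m => .het (L.het m)
  | _, _, .right m => .right (L.g.lo m)

/-- The components of the colaxators at objects. -/
def app : ∀ x : A.Obj ⊕ B.Obj, L.a.tight.obj (projObj P Q x) ⟶ projObj P' Q' (L.obj x)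
  | .inl x => L.s.app x
  | .inr x => L.t.app x

/-- The components of the colaxators at loose arrows. -/
def cell : ∀ {x y : A.Obj ⊕ B.Obj} (m : Lo P Q x y),
    LoArr.mk (L.a.lo (projLo m)) ⟶ LoArr.mk (projLo (L.lo m))
  | _, _, .left m => L.s.sq m
  | _, _, .het m => L.c m
  | _, _, .right m => L.t.sq m

@[simp] theorem dom_cell {x y : A.Obj ⊕ B.Obj} (m : Lo P Q x y) :
    M'.dom (L.cell m) = L.app x := by
  rcases m with m | m | m
  · exact L.s.dom_sq m
  · exact L.dom_c m
  · exact L.t.dom_sq m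

@[simp] theorem cod_cell {x y : A.Obj ⊕ B.Obj} (m : Lo P Q x y) :
    M'.cod (L.cell m) = L.app y := by
  rcases m with m | m | m
  · exact L.s.cod_sq m
  · exact L.cod_c m
  · exact L.t.cod_sq m

theorem app_naturality {x y : A.Obj ⊕ B.Obj} (f : Ti x y) :
    L.a.tight.map (projTi (P := P) (Q := Q) f) ≫ L.app y = L.app x ≫ projTi (L.ti f) := by
  rcases f with f | f
  · exact L.s.naturality f
  · exact L.t.naturality f

theorem exists_het {x x' : A.Obj} {y y' : B.Obj} {m : M.Lo (P.tight.obj x) (Q.tight.obj y)}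
    {n : M.Lo (P.tight.obj x') (Q.tight.obj y')} (α : Het P Q m n) :
    ∃ β : Het P' Q' (L.het m) (L.het n), β.f = L.f.tight.map α.f ∧ β.g = L.g.tight.map α.g ∧
      L.a.sq α.sq ≫ L.c n = L.c m ≫ β.sq := by
  obtain ⟨γ, ⟨h1, h2, h3⟩, -⟩ := (L.cocart m).factor (L.a.sq α.sq ≫ L.c n)
    (P'.tight.map (L.f.tight.map α.f)) (Q'.tight.map (L.g.tight.map α.g))
    (by rw [M'.dom_comp, L.a.dom_sq, α.dom, L.dom_c, L.dom_c]; exact L.s.naturality α.f)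
    (by rw [M'.cod_comp, L.a.cod_sq, α.cod, L.cod_c, L.cod_c]; exact L.t.naturality α.g)
  exact ⟨⟨_, _, γ, h1, h2⟩, rfl, rfl, h3.symm⟩

/-- The action on squares. -/
noncomputable def sq : ∀ {m n : LoArr (Lo P Q)}, Sq P Q m n → Sq P' Q' ⟨L.lo m.arr⟩ ⟨L.lo n.arr⟩
  | _, _, .left α => .left (L.f.sq α)
  | _, _, .het α => .het (L.exists_het α).choose
  | _, _, .right α => .right (L.g.sq α)

theorem sq_naturality {m n : LoArr (Lo P Q)} (α : Sq P Q m n) :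
    L.a.sq (projSq α) ≫ L.cell n.arr = L.cell m.arr ≫ projSq (L.sq α) := by
  rcases α with α | α | α
  · exact L.s.sq_naturality α
  · exact (L.exists_het α).choose_spec.2.2
  · exact L.t.sq_naturality α

theorem dom_sq {m n : LoArr (Lo P Q)} (α : Sq P Q m n) : Sq.dom (L.sq α) = L.ti (Sq.dom α) := by
  rcases α with α | α | α
  · exact congrArg Ti.left (L.f.dom_sq α)
  · exact congrArg Ti.left (L.exists_het α).choose_spec.1
  · exact congrArg Ti.right (L.g.dom_sq α)

theorem cod_sq {m n : LoArr (Lo P Q)} (α : Sq P Q m n) : Sq.cod (L.sq α) = L.ti (Sq.cod α) := by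
  rcases α with α | α | α
  · exact congrArg Ti.left (L.f.cod_sq α)
  · exact congrArg Ti.right (L.exists_het α).choose_spec.2.1
  · exact congrArg Ti.right (L.g.cod_sq α)

theorem isCocart_cell {x : A.Obj} {y : B.Obj} (m : Lo P Q (.inl x) (.inr y)) :
    DblCat.IsCocart (L.cell m) := by
  rcases m with m | m | m
  exact L.cocart m

theorem isCocart_compSq_cell {x : A.Obj} {y : A.Obj ⊕ B.Obj} {z : B.Obj}
    (m : Lo P Q (.inl x) y) (n : Lo P Q y (.inr z)) :
    DblCat.IsCocart (M'.compSq (L.cell m) (L.cell n) (by simp)) := by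
  rcases m with m | m | m <;> rcases n with n | n | n
  · exact (L.cocart n).compSq' (L.conj.2 m) _ (by rw [L.cod_c]; exact L.comp.1 z)
  · exact (L.cocart m).compSq (L.comp.2 n) _ (by rw [L.dom_c]; exact L.conj.1 x)

theorem isCocart_compSq_compSq_cell {x : A.Obj} {y z : A.Obj ⊕ B.Obj} {w : B.Obj}
    (m : Lo P Q (.inl x) y) (n : Lo P Q y z) (p : Lo P Q z (.inr w)) :
    DblCat.IsCocart (M'.compSq (M'.compSq (L.cell m) (L.cell n) (by simp)) (L.cell p)
      (by simp)) := by
  rcases z with z | z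
  · rcases m with m | m | m
    swap
    · nomatch n
    have h := M'.assoc_naturality (L.cell (.left m)) (L.cell n) (L.cell p) (by simp) (by simp)
    rw [← Iso.eq_comp_inv, Category.assoc] at h
    rw [h]
    refine (DblCat.IsCocart.of_isIso _).comp (DblCat.IsCocart.comp_isIso ?_ _)
    exact (L.isCocart_compSq_cell n p).compSq' (L.conj.2 m) _
      (by rw [M'.cod_compSq, L.cod_cell]; exact L.comp.1 w)
  · rcases p with p | p | p
    exact (L.isCocart_compSq_cell m n).compSq (L.comp.2 p) _
      (by rw [M'.dom_compSq, L.dom_cell]; exact L.conj.1 x)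

theorem exists_compIso {x : A.Obj} {y : A.Obj ⊕ B.Obj} {z : B.Obj}
    (m : Lo P Q (.inl x) y) (n : Lo P Q y (.inr z)) :
    ∃ i : LoArr.mk (projLo (Cograph.comp (L.lo m) (L.lo n))) ≅
        LoArr.mk (projLo (L.lo (Cograph.comp m n))),
      M'.dom i.hom = 𝟙 _ ∧ M'.cod i.hom = 𝟙 _ ∧
      M'.compSq (L.cell m) (L.cell n) (by simp) ≫ (projComp (L.lo m) (L.lo n)).hom ≫ i.hom =
        (L.a.compIso (projLo m) (projLo n)).hom ≫ L.a.sq (projComp m n).hom ≫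
          L.cell (Cograph.comp m n) := by
  have h1 : M'.dom (projComp (L.lo m) (L.lo n)).hom = 𝟙 _ :=
    (proj P' Q').dom_compIso (L.lo m) (L.lo n)
  have h2 : M'.cod (projComp (L.lo m) (L.lo n)).hom = 𝟙 _ :=
    (proj P' Q').cod_compIso (L.lo m) (L.lo n)
  have h3 : M.dom (projComp m n).hom = 𝟙 _ := (proj P Q).dom_compIso m n
  have h4 : M.cod (projComp m n).hom = 𝟙 _ := (proj P Q).cod_compIso m n
  have : IsIso (L.a.sq (projComp m n).hom) :=
    inferInstanceAs (IsIso (L.a.sqIso (projComp m n)).hom)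
  obtain ⟨i, hi, hi', e⟩ := ((L.isCocart_compSq_cell m n).comp_isIso
    (projComp (L.lo m) (L.lo n)).hom).exists_iso
      ((DblCat.IsCocart.of_isIso (L.a.compIso (projLo m) (projLo n)).hom).comp
        ((DblCat.IsCocart.of_isIso (L.a.sq (projComp m n).hom)).comp
          (L.isCocart_cell (Cograph.comp m n))))
      (by simp [h1, h3]) (by simp [h2, h4])
  exact ⟨i, hi, hi', (Category.assoc _ _ _).symm.trans e⟩

/-- The comparison of composites. -/
noncomputable def compIso : ∀ {x y z : A.Obj ⊕ B.Obj} (m : Lo P Q x y) (n : Lo P Q y z),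
    @Iso _ (sqCat P' Q') ⟨Cograph.comp (L.lo m) (L.lo n)⟩ ⟨L.lo (Cograph.comp m n)⟩
  | _, _, _, .left m, .left n => leftIso P' Q' (L.f.compIso m n)
  | _, _, _, .left m, .het n => hetIso (L.exists_compIso (.left m) (.het n)).choose
      (L.exists_compIso (.left m) (.het n)).choose_spec.1
      (L.exists_compIso (.left m) (.het n)).choose_spec.2.1
  | _, _, _, .het m, .right n => hetIso (L.exists_compIso (.het m) (.right n)).choose
      (L.exists_compIso (.het m) (.right n)).choose_spec.1
      (L.exists_compIso (.het m) (.right n)).choose_spec.2.1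
  | _, _, _, .right m, .right n => rightIso P' Q' (L.g.compIso m n)

theorem cell_compIso {x y z : A.Obj ⊕ B.Obj} (m : Lo P Q x y) (n : Lo P Q y z) :
    ((L.a.compIso (projLo m) (projLo n)).hom ≫ L.a.sq (projComp m n).hom) ≫
        L.cell (Cograph.comp m n) =
      M'.compSq (L.cell m) (L.cell n) (by simp) ≫ (projComp (L.lo m) (L.lo n)).hom ≫
        projSq (@Iso.hom _ (sqCat P' Q') _ _ (L.compIso m n)) := by
  rcases m with m | m | m <;> rcases n with n | n | n
  · exact L.s.comp m n
  · exact (Category.assoc _ _ _).trans (L.exists_compIso (.left m) (.het n)).choose_spec.2.2.symm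
  · exact (Category.assoc _ _ _).trans (L.exists_compIso (.het m) (.right n)).choose_spec.2.2.symm
  · exact L.t.comp m n

theorem dom_compIso {x y z : A.Obj ⊕ B.Obj} (m : Lo P Q x y) (n : Lo P Q y z) :
    Sq.dom (@Iso.hom _ (sqCat P' Q') _ _ (L.compIso m n)) = Ti.id (L.obj x) := by
  rcases m with m | m | m <;> rcases n with n | n | n
  · exact congrArg Ti.left (L.f.dom_compIso m n)
  · rfl
  · rfl
  · exact congrArg Ti.right (L.g.dom_compIso m n)

theorem cod_compIso {x y z : A.Obj ⊕ B.Obj} (m : Lo P Q x y) (n : Lo P Q y z) :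
    Sq.cod (@Iso.hom _ (sqCat P' Q') _ _ (L.compIso m n)) = Ti.id (L.obj z) := by
  rcases m with m | m | m <;> rcases n with n | n | n
  · exact congrArg Ti.left (L.f.cod_compIso m n)
  · rfl
  · rfl
  · exact congrArg Ti.right (L.g.cod_compIso m n)

/-- The comparison of units. -/
def unitIso : ∀ x : A.Obj ⊕ B.Obj,
    @Iso _ (sqCat P' Q') ⟨unit P' Q' (L.obj x)⟩ ⟨L.lo (unit P Q x)⟩
  | .inl x => leftIso P' Q' (L.f.unitIso x)
  | .inr x => rightIso P' Q' (L.g.unitIso x)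

theorem cell_unitIso (x : A.Obj ⊕ B.Obj) :
    ((L.a.unitIso (projObj P Q x)).hom ≫ L.a.sq (projUnit x).hom) ≫ L.cell (unit P Q x) =
      M'.unitSq (L.app x) ≫ (projUnit (L.obj x)).hom ≫
        projSq (@Iso.hom _ (sqCat P' Q') _ _ (L.unitIso x)) := by
  rcases x with x | x
  · exact L.s.unit x
  · exact L.t.unit x

theorem dom_unitIso (x : A.Obj ⊕ B.Obj) :
    Sq.dom (@Iso.hom _ (sqCat P' Q') _ _ (L.unitIso x)) = Ti.id (L.obj x) := by
  rcases x with x | x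
  · exact congrArg Ti.left (L.f.dom_unitIso x)
  · exact congrArg Ti.right (L.g.dom_unitIso x)

theorem cod_unitIso (x : A.Obj ⊕ B.Obj) :
    Sq.cod (@Iso.hom _ (sqCat P' Q') _ _ (L.unitIso x)) = Ti.id (L.obj x) := by
  rcases x with x | x
  · exact congrArg Ti.left (L.f.cod_unitIso x)
  · exact congrArg Ti.right (L.g.cod_unitIso x)

end LiftData

end Cograph

namespace DblCat

variable {D : DblCat.{u}} {x y z w : D.Obj} {a : D.Lo x y} {b : D.Lo y z} {c : D.Lo z w}

theorem dom_cod_assoc_law {ab : D.Lo x z} {bc : D.Lo y w} {l r : D.Lo x w}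
    {φ : LoArr.mk (D.comp a b) ⟶ LoArr.mk ab} {ψ : LoArr.mk (D.comp b c) ⟶ LoArr.mk bc}
    {χ : LoArr.mk (D.comp ab c) ⟶ LoArr.mk l} {ω : LoArr.mk (D.comp a bc) ⟶ LoArr.mk r}
    {s : LoArr.mk l ⟶ LoArr.mk r} (hφ : D.cod φ = D.dom (𝟙 (LoArr.mk c)))
    (hψ : D.cod (𝟙 (LoArr.mk a)) = D.dom ψ) (h1 : D.dom φ = 𝟙 x) (h2 : D.cod ψ = 𝟙 w)
    (h3 : D.dom χ = 𝟙 x) (h4 : D.cod χ = 𝟙 w) (h5 : D.dom ω = 𝟙 x) (h6 : D.cod ω = 𝟙 w)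
    (h7 : D.dom s = 𝟙 x) (h8 : D.cod s = 𝟙 w) :
    D.dom (D.compSq φ (𝟙 (LoArr.mk c)) hφ ≫ χ ≫ s) =
        D.dom ((D.assoc a b c).hom ≫ D.compSq (𝟙 (LoArr.mk a)) ψ hψ ≫ ω) ∧
      D.cod (D.compSq φ (𝟙 (LoArr.mk c)) hφ ≫ χ ≫ s) =
        D.cod ((D.assoc a b c).hom ≫ D.compSq (𝟙 (LoArr.mk a)) ψ hψ ≫ ω) :=
  ⟨by simp [*], by simp [*]⟩

theorem dom_cod_leftUnitor_law {e : D.Lo x x} {r : D.Lo x y}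
    {φ : LoArr.mk (D.unit x) ⟶ LoArr.mk e} {χ : LoArr.mk (D.comp e a) ⟶ LoArr.mk r}
    {s : LoArr.mk r ⟶ LoArr.mk a} (hφ : D.cod φ = D.dom (𝟙 (LoArr.mk a))) (h1 : D.dom φ = 𝟙 x)
    (h3 : D.dom χ = 𝟙 x) (h4 : D.cod χ = 𝟙 y) (h5 : D.dom s = 𝟙 x) (h6 : D.cod s = 𝟙 y) :
    D.dom (D.compSq φ (𝟙 (LoArr.mk a)) hφ ≫ χ ≫ s) = 𝟙 x ∧
      D.cod (D.compSq φ (𝟙 (LoArr.mk a)) hφ ≫ χ ≫ s) = 𝟙 y :=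
  ⟨by simp [*], by simp [*]⟩

theorem dom_cod_rightUnitor_law {e : D.Lo y y} {r : D.Lo x y}
    {φ : LoArr.mk (D.unit y) ⟶ LoArr.mk e} {χ : LoArr.mk (D.comp a e) ⟶ LoArr.mk r}
    {s : LoArr.mk r ⟶ LoArr.mk a} (hφ : D.cod (𝟙 (LoArr.mk a)) = D.dom φ) (h1 : D.cod φ = 𝟙 y)
    (h3 : D.dom χ = 𝟙 x) (h4 : D.cod χ = 𝟙 y) (h5 : D.dom s = 𝟙 x) (h6 : D.cod s = 𝟙 y) :
    D.dom (D.compSq (𝟙 (LoArr.mk a)) φ hφ ≫ χ ≫ s) = 𝟙 x ∧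
      D.cod (D.compSq (𝟙 (LoArr.mk a)) φ hφ ≫ χ ≫ s) = 𝟙 y :=
  ⟨by simp [*], by simp [*]⟩

theorem IsCocart.compSq_transfer {x' y' z' p q r p' q' r' : D.Obj} {m : D.Lo x y} {n : D.Lo y z}
    {mn : D.Lo x z} {m' : D.Lo x' y'} {n' : D.Lo y' z'} {mn' : D.Lo x' z'}
    {k : D.Lo p q} {l : D.Lo q r} {kl : D.Lo p r} {k' : D.Lo p' q'} {l' : D.Lo q' r'}
    {kl' : D.Lo p' r'} {σm : LoArr.mk m ⟶ LoArr.mk m'} {σn : LoArr.mk n ⟶ LoArr.mk n'}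
    {σmn : LoArr.mk mn ⟶ LoArr.mk mn'} {σk : LoArr.mk k ⟶ LoArr.mk k'}
    {σl : LoArr.mk l ⟶ LoArr.mk l'} {σkl : LoArr.mk kl ⟶ LoArr.mk kl'}
    {φ : LoArr.mk (D.comp m n) ⟶ LoArr.mk mn} {φ' : LoArr.mk (D.comp m' n') ⟶ LoArr.mk mn'}
    {ψ : LoArr.mk (D.comp k l) ⟶ LoArr.mk kl} {ψ' : LoArr.mk (D.comp k' l') ⟶ LoArr.mk kl'}
    {α : LoArr.mk m ⟶ LoArr.mk k} {β : LoArr.mk n ⟶ LoArr.mk l} {γ : LoArr.mk mn ⟶ LoArr.mk kl}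
    {α' : LoArr.mk m' ⟶ LoArr.mk k'} {β' : LoArr.mk n' ⟶ LoArr.mk l'}
    {γ' : LoArr.mk mn' ⟶ LoArr.mk kl'} {h : D.cod σm = D.dom σn} (hc : IsCocart (D.compSq σm σn h))
    {h' : D.cod σk = D.dom σl} {hα : D.cod α = D.dom β} {hα' : D.cod α' = D.dom β'}
    (eφ : φ ≫ σmn = D.compSq σm σn h ≫ φ') (eψ : ψ ≫ σkl = D.compSq σk σl h' ≫ ψ')
    (eα : α ≫ σk = σm ≫ α') (eβ : β ≫ σl = σn ≫ β') (eγ : γ ≫ σkl = σmn ≫ γ')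
    (H : D.compSq α β hα ≫ ψ = φ ≫ γ)
    (hd : D.dom (φ' ≫ γ') = D.dom (D.compSq α' β' hα' ≫ ψ'))
    (hd' : D.cod (φ' ≫ γ') = D.cod (D.compSq α' β' hα' ≫ ψ')) :
    φ' ≫ γ' = D.compSq α' β' hα' ≫ ψ' := by
  refine hc.hom_ext hd hd' ?_
  have h1 : D.compSq σm σn h ≫ D.compSq α' β' hα' = D.compSq α β hα ≫ D.compSq σk σl h' := by
    rw [compSq_compSq, compSq_compSq]
    exact compSq_congr _ eα.symm eβ.symm
  rw [reassoc_of% h1, ← eψ, reassoc_of% H, eγ, reassoc_of% eφ]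

theorem dom_comp_eq_id {m n k : D.Lo x y} {φ : LoArr.mk m ⟶ LoArr.mk n}
    {ψ : LoArr.mk n ⟶ LoArr.mk k} (h : D.dom φ = 𝟙 x) (h' : D.dom ψ = 𝟙 x) :
    D.dom (φ ≫ ψ) = 𝟙 x := by simp [*]

theorem cod_comp_eq_id {m n k : D.Lo x y} {φ : LoArr.mk m ⟶ LoArr.mk n}
    {ψ : LoArr.mk n ⟶ LoArr.mk k} (h : D.cod φ = 𝟙 y) (h' : D.cod ψ = 𝟙 y) :
    D.cod (φ ≫ ψ) = 𝟙 y := by simp [*]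

end DblCat

namespace Cograph

variable {A B M A' B' M' : DblCat.{u}}

theorem Sq.ext_of_het {P : DblFunctor A M} {Q : DblFunctor B M} {x : A.Obj} {y : B.Obj}
    {m : Lo P Q (.inl x) (.inr y)} {n : LoArr (Lo P Q)} {α β : Sq P Q ⟨m⟩ n}
    (h : Sq.dom α = Sq.dom β) (k : Sq.cod α = Sq.cod β) (e : projSq α = projSq β) : α = β := by
  cases m
  cases α
  cases β
  exact Sq.het_congr (Ti.left_inj h) (Ti.right_inj k) e

theorem dom_projSq {P : DblFunctor A M} {Q : DblFunctor B M} {m n : LoArr (Lo P Q)}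
    (α : Sq P Q m n) : M.dom (projSq α) = projTi (Sq.dom α) := (proj P Q).dom_sq α

theorem cod_projSq {P : DblFunctor A M} {Q : DblFunctor B M} {m n : LoArr (Lo P Q)}
    (α : Sq P Q m n) : M.cod (projSq α) = projTi (Sq.cod α) := (proj P Q).cod_sq α

theorem projTi_id {P : DblFunctor A M} {Q : DblFunctor B M} (x : A.Obj ⊕ B.Obj) :
    projTi (P := P) (Q := Q) (Ti.id x) = 𝟙 _ := (proj P Q).tight.map_id x

namespace LiftData

variable {P : DblFunctor A M} {Q : DblFunctor B M} {P' : DblFunctor A' M'} {Q' : DblFunctor B' M'}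
  (L : LiftData P Q P' Q')

theorem ti_id (x : A.Obj ⊕ B.Obj) : L.ti (Ti.id x) = Ti.id (L.obj x) := by
  rcases x with x | x
  · exact congrArg Ti.left (L.f.tight.map_id x)
  · exact congrArg Ti.right (L.g.tight.map_id x)

theorem ti_comp {x y z : A.Obj ⊕ B.Obj} (f : Ti x y) (g : Ti y z) :
    L.ti (f.comp g) = (L.ti f).comp (L.ti g) := by
  rcases f with f | f <;> rcases g with g | g
  · exact congrArg Ti.left (L.f.tight.map_comp f g)
  · exact congrArg Ti.right (L.g.tight.map_comp f g)

theorem sq_ext {x : A.Obj} {y : B.Obj} {m : Lo P Q (.inl x) (.inr y)} {n : LoArr (Lo P' Q')}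
    {α β : Sq P' Q' ⟨L.lo m⟩ n} (h : Sq.dom α = Sq.dom β) (k : Sq.cod α = Sq.cod β)
    (e : L.cell m ≫ projSq α = L.cell m ≫ projSq β) : α = β :=
  Sq.ext_of_het h k ((L.isCocart_cell m).hom_ext
    ((dom_projSq _).trans ((congrArg projTi h).trans (dom_projSq _).symm))
    ((cod_projSq _).trans ((congrArg projTi k).trans (cod_projSq _).symm)) e)

theorem sq_id {x y : A.Obj ⊕ B.Obj} (m : Lo P Q x y) :
    L.sq (Sq.id P Q ⟨m⟩) = Sq.id P' Q' ⟨L.lo m⟩ := by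
  rcases m with m | m | m
  · exact Sq.left_congr (L.f.sq_id m)
  · refine L.sq_ext (m := .het m) ((L.dom_sq _).trans (L.ti_id _))
      ((L.cod_sq _).trans (L.ti_id _)) ((L.sq_naturality (Sq.id P Q ⟨.het m⟩)).symm.trans ?_)
    exact (congrArg (· ≫ _) (L.a.sq_id m)).trans
      ((Category.id_comp _).trans (Category.comp_id _).symm)
  · exact Sq.right_congr (L.g.sq_id m)

theorem sq_comp {m n p : LoArr (Lo P Q)} (α : Sq P Q m n) (β : Sq P Q n p) :
    L.sq (α.comp β) = (L.sq α).comp (L.sq β) := by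
  rcases α with α | α | α <;> rcases β with β | β | β
  · exact Sq.left_congr (L.f.sq_comp α β)
  · rename_i m n m' n' m'' n'' p p' p''
    refine L.sq_ext (m := .het _) ?_ ?_ ?_
    · exact (L.dom_sq (Sq.comp (.het α) (.het β))).trans ((L.ti_comp _ _).trans
        ((Cograph.dom_comp _ _).trans (congrArg₂ Ti.comp (L.dom_sq (.het α))
          (L.dom_sq (.het β)))).symm)
    · exact (L.cod_sq (Sq.comp (.het α) (.het β))).trans ((L.ti_comp _ _).trans
        ((Cograph.cod_comp _ _).trans (congrArg₂ Ti.comp (L.cod_sq (.het α))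
          (L.cod_sq (.het β)))).symm)
    · refine (L.sq_naturality (Sq.comp (.het α) (.het β))).symm.trans ?_
      refine (congrArg (· ≫ _) (L.a.sq_comp α.sq β.sq)).trans ((Category.assoc _ _ _).trans ?_)
      refine (congrArg (_ ≫ ·) (L.sq_naturality (.het β))).trans
        ((Category.assoc _ _ _).symm.trans ?_)
      refine (congrArg (· ≫ _) (L.sq_naturality (.het α))).trans (Category.assoc _ _ _)
  · exact Sq.right_congr (L.g.sq_comp α β)

theorem dom_sq_eq_id {x y : A.Obj ⊕ B.Obj} {m n : Lo P Q x y} {α : Sq P Q ⟨m⟩ ⟨n⟩}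
    (h : Sq.dom α = Ti.id x) : Sq.dom (L.sq α) = Ti.id _ :=
  (L.dom_sq α).trans ((congrArg L.ti h).trans (L.ti_id x))

theorem cod_sq_eq_id {x y : A.Obj ⊕ B.Obj} {m n : Lo P Q x y} {α : Sq P Q ⟨m⟩ ⟨n⟩}
    (h : Sq.cod α = Ti.id y) : Sq.cod (L.sq α) = Ti.id _ :=
  (L.cod_sq α).trans ((congrArg L.ti h).trans (L.ti_id y))

theorem dom_projSq_eq_id {x y : A.Obj ⊕ B.Obj} {m n : Lo P Q x y} {α : Sq P Q ⟨m⟩ ⟨n⟩}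
    (h : Sq.dom α = Ti.id x) : M.dom (projSq α) = 𝟙 _ :=
  (dom_projSq α).trans ((congrArg projTi h).trans (projTi_id x))

theorem cod_projSq_eq_id {x y : A.Obj ⊕ B.Obj} {m n : Lo P Q x y} {α : Sq P Q ⟨m⟩ ⟨n⟩}
    (h : Sq.cod α = Ti.id y) : M.cod (projSq α) = 𝟙 _ :=
  (cod_projSq α).trans ((congrArg projTi h).trans (projTi_id y))

theorem dom_projCompIso {x y z : A.Obj ⊕ B.Obj} (m : Lo P Q x y) (n : Lo P Q y z) :
    M'.dom ((projComp (L.lo m) (L.lo n)).hom ≫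
      projSq (@Iso.hom _ (sqCat P' Q') _ _ (L.compIso m n))) = 𝟙 _ :=
  DblCat.dom_comp_eq_id ((proj P' Q').dom_compIso (L.lo m) (L.lo n))
    (dom_projSq_eq_id (L.dom_compIso m n))

theorem cod_projCompIso {x y z : A.Obj ⊕ B.Obj} (m : Lo P Q x y) (n : Lo P Q y z) :
    M'.cod ((projComp (L.lo m) (L.lo n)).hom ≫
      projSq (@Iso.hom _ (sqCat P' Q') _ _ (L.compIso m n))) = 𝟙 _ :=
  DblCat.cod_comp_eq_id ((proj P' Q').cod_compIso (L.lo m) (L.lo n))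
    (cod_projSq_eq_id (L.cod_compIso m n))

theorem dom_projUnitIso (x : A.Obj ⊕ B.Obj) :
    M'.dom ((projUnit (L.obj x)).hom ≫
      projSq (@Iso.hom _ (sqCat P' Q') _ _ (L.unitIso x))) = 𝟙 _ :=
  DblCat.dom_comp_eq_id ((proj P' Q').dom_unitIso (L.obj x))
    (dom_projSq_eq_id (L.dom_unitIso x))

theorem cod_projUnitIso (x : A.Obj ⊕ B.Obj) :
    M'.cod ((projUnit (L.obj x)).hom ≫
      projSq (@Iso.hom _ (sqCat P' Q') _ _ (L.unitIso x))) = 𝟙 _ :=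
  DblCat.cod_comp_eq_id ((proj P' Q').cod_unitIso (L.obj x))
    (cod_projSq_eq_id (L.cod_unitIso x))

theorem cod_compIso_eq {x y z w : A.Obj ⊕ B.Obj} (m : Lo P Q x y) (n : Lo P Q y z)
    (p : Lo P Q z w) : Sq.cod (@Iso.hom _ (sqCat P' Q') _ _ (L.compIso m n)) =
      Sq.dom (Sq.id P' Q' ⟨L.lo p⟩) :=
  (L.cod_compIso m n).trans ((cograph P' Q').dom_id ⟨L.lo p⟩).symm

theorem dom_compIso_eq {x y z w : A.Obj ⊕ B.Obj} (m : Lo P Q x y) (n : Lo P Q y z)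
    (p : Lo P Q z w) : Sq.cod (Sq.id P' Q' ⟨L.lo m⟩) =
      Sq.dom (@Iso.hom _ (sqCat P' Q') _ _ (L.compIso n p)) :=
  ((cograph P' Q').cod_id ⟨L.lo m⟩).trans (L.dom_compIso n p).symm

theorem map_assoc_het {x : A.Obj} {y z : A.Obj ⊕ B.Obj} {w : B.Obj} (m : Lo P Q (.inl x) y)
    (n : Lo P Q y z) (p : Lo P Q z (.inr w))
    (h : Sq.cod (@Iso.hom _ (sqCat P' Q') _ _ (L.compIso m n)) = Sq.dom (Sq.id P' Q' ⟨L.lo p⟩))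
    (h' : Sq.cod (Sq.id P' Q' ⟨L.lo m⟩) = Sq.dom (@Iso.hom _ (sqCat P' Q') _ _ (L.compIso n p))) :
    Sq.comp (Cograph.compSq (@Iso.hom _ (sqCat P' Q') _ _ (L.compIso m n)) (Sq.id P' Q' ⟨L.lo p⟩) h)
        (Sq.comp (@Iso.hom _ (sqCat P' Q') _ _ (L.compIso (Cograph.comp m n) p))
          (L.sq (@Iso.hom _ (sqCat P Q) _ _ (Cograph.assoc m n p)))) =
      Sq.comp (@Iso.hom _ (sqCat P' Q') _ _ (Cograph.assoc (L.lo m) (L.lo n) (L.lo p)))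
        (Sq.comp (Cograph.compSq (Sq.id P' Q' ⟨L.lo m⟩)
            (@Iso.hom _ (sqCat P' Q') _ _ (L.compIso n p)) h')
          (@Iso.hom _ (sqCat P' Q') _ _ (L.compIso m (Cograph.comp n p)))) := by
  have hs := L.dom_sq_eq_id ((cograph P Q).dom_assoc m n p)
  have hs' := L.cod_sq_eq_id ((cograph P Q).cod_assoc m n p)
  have hd := DblCat.dom_cod_assoc_law (D := cograph P' Q') (a := L.lo m) (b := L.lo n)
    (c := L.lo p) h h' (L.dom_compIso m n)
    (L.cod_compIso n p) (L.dom_compIso (Cograph.comp m n) p) (L.cod_compIso (Cograph.comp m n) p)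
    (L.dom_compIso m (Cograph.comp n p)) (L.cod_compIso m (Cograph.comp n p)) hs hs'
  refine Sq.ext_of_het hd.1 hd.2 ?_
  refine ((proj P' Q').sq_assoc_eq_iff (@Iso.hom _ (sqCat P' Q') _ _ (L.compIso m n))
    (@Iso.hom _ (sqCat P' Q') _ _ (L.compIso n p)) (L.cod_compIso m n) (L.dom_compIso n p)
    (@Iso.hom _ (sqCat P' Q') _ _ (L.compIso (Cograph.comp m n) p))
    (@Iso.hom _ (sqCat P' Q') _ _ (L.compIso m (Cograph.comp n p)))
    (L.sq (@Iso.hom _ (sqCat P Q) _ _ (Cograph.assoc m n p)))).2 ?_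
  have hd' := DblCat.dom_cod_assoc_law ((L.cod_projCompIso m n).trans (M'.dom_id (LoArr.mk (projLo (L.lo p)))).symm)
    ((M'.cod_id (LoArr.mk (projLo (L.lo m)))).trans (L.dom_projCompIso n p).symm) (L.dom_projCompIso m n)
    (L.cod_projCompIso n p) (L.dom_projCompIso (Cograph.comp m n) p)
    (L.cod_projCompIso (Cograph.comp m n) p)
    (L.dom_projCompIso m (Cograph.comp n p)) (L.cod_projCompIso m (Cograph.comp n p))
    (dom_projSq_eq_id hs) (cod_projSq_eq_id hs')
  exact (L.isCocart_compSq_compSq_cell m n p).assoc_transfer (L.cell_compIso m n)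
    (L.cell_compIso n p) (L.cell_compIso (Cograph.comp m n) p)
    (L.cell_compIso m (Cograph.comp n p))
    (L.sq_naturality (@Iso.hom _ (sqCat P Q) _ _ (Cograph.assoc m n p)))
    (((proj P Q).comp L.a).map_assoc m n p) hd'.1 hd'.2

theorem map_leftUnitor_het {x : A.Obj} {y : B.Obj} (m : Lo P Q (.inl x) (.inr y))
    (h : Sq.cod (@Iso.hom _ (sqCat P' Q') _ _ (L.unitIso (.inl x))) =
      Sq.dom (Sq.id P' Q' ⟨L.lo m⟩)) :
    Sq.comp (Cograph.compSq (@Iso.hom _ (sqCat P' Q') _ _ (L.unitIso (.inl x)))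
          (Sq.id P' Q' ⟨L.lo m⟩) h)
        (Sq.comp (@Iso.hom _ (sqCat P' Q') _ _ (L.compIso (unit P Q (.inl x)) m))
          (L.sq (@Iso.hom _ (sqCat P Q) _ _ (Cograph.leftUnitor m)))) =
      @Iso.hom _ (sqCat P' Q') _ _ (Cograph.leftUnitor (L.lo m)) := by
  have hs := L.dom_sq_eq_id ((cograph P Q).dom_leftUnitor m)
  have hs' := L.cod_sq_eq_id ((cograph P Q).cod_leftUnitor m)
  have hd := DblCat.dom_cod_leftUnitor_law (D := cograph P' Q') (a := L.lo m)
    (φ := @Iso.hom _ (sqCat P' Q') _ _ (L.unitIso (.inl x))) h (L.dom_unitIso (.inl x)) (L.dom_compIso (unit P Q (.inl x)) m) (L.cod_compIso (unit P Q (.inl x)) m)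
    hs hs'
  refine Sq.ext_of_het (hd.1.trans ((cograph P' Q').dom_leftUnitor (L.lo m)).symm)
    (hd.2.trans ((cograph P' Q').cod_leftUnitor (L.lo m)).symm) ?_
  refine ((proj P' Q').sq_leftUnitor_eq_iff (@Iso.hom _ (sqCat P' Q') _ _ (L.unitIso (.inl x)))
    (L.cod_unitIso (.inl x)) (@Iso.hom _ (sqCat P' Q') _ _ (L.compIso (unit P Q (.inl x)) m))
    (L.sq (@Iso.hom _ (sqCat P Q) _ _ (Cograph.leftUnitor m)))).2 ?_
  have hd' := DblCat.dom_cod_leftUnitor_law ((L.cod_projUnitIso (.inl x)).trans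
    (M'.dom_id (LoArr.mk (projLo (L.lo m)))).symm) (L.dom_projUnitIso _)
    (L.dom_projCompIso (unit P Q (.inl x)) m)
    (L.cod_projCompIso (unit P Q (.inl x)) m) (dom_projSq_eq_id hs) (cod_projSq_eq_id hs')
  refine (L.isCocart_cell m).leftUnitor_transfer
    ((L.cell_unitIso _).trans (congrArg (M'.unitSq · ≫ _) (L.dom_cell m).symm))
    (L.cell_compIso (unit P Q (.inl x)) m)
    (L.sq_naturality (@Iso.hom _ (sqCat P Q) _ _ (Cograph.leftUnitor m)))
    (((proj P Q).comp L.a).map_leftUnitor m) hd'.1 hd'.2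

theorem map_rightUnitor_het {x : A.Obj} {y : B.Obj} (m : Lo P Q (.inl x) (.inr y))
    (h : Sq.cod (Sq.id P' Q' ⟨L.lo m⟩) =
      Sq.dom (@Iso.hom _ (sqCat P' Q') _ _ (L.unitIso (.inr y)))) :
    Sq.comp (Cograph.compSq (Sq.id P' Q' ⟨L.lo m⟩)
          (@Iso.hom _ (sqCat P' Q') _ _ (L.unitIso (.inr y))) h)
        (Sq.comp (@Iso.hom _ (sqCat P' Q') _ _ (L.compIso m (unit P Q (.inr y))))
          (L.sq (@Iso.hom _ (sqCat P Q) _ _ (Cograph.rightUnitor m)))) =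
      @Iso.hom _ (sqCat P' Q') _ _ (Cograph.rightUnitor (L.lo m)) := by
  have hs := L.dom_sq_eq_id ((cograph P Q).dom_rightUnitor m)
  have hs' := L.cod_sq_eq_id ((cograph P Q).cod_rightUnitor m)
  have hd := DblCat.dom_cod_rightUnitor_law (D := cograph P' Q') (a := L.lo m)
    (φ := @Iso.hom _ (sqCat P' Q') _ _ (L.unitIso (.inr y))) h (L.cod_unitIso (.inr y)) (L.dom_compIso m (unit P Q (.inr y))) (L.cod_compIso m (unit P Q (.inr y)))
    hs hs'
  refine Sq.ext_of_het (hd.1.trans ((cograph P' Q').dom_rightUnitor (L.lo m)).symm)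
    (hd.2.trans ((cograph P' Q').cod_rightUnitor (L.lo m)).symm) ?_
  refine ((proj P' Q').sq_rightUnitor_eq_iff (@Iso.hom _ (sqCat P' Q') _ _ (L.unitIso (.inr y)))
    (L.dom_unitIso (.inr y)) (@Iso.hom _ (sqCat P' Q') _ _ (L.compIso m (unit P Q (.inr y))))
    (L.sq (@Iso.hom _ (sqCat P Q) _ _ (Cograph.rightUnitor m)))).2 ?_
  have hd' := DblCat.dom_cod_rightUnitor_law ((M'.cod_id (LoArr.mk (projLo (L.lo m)))).trans
    (L.dom_projUnitIso (.inr y)).symm) (L.cod_projUnitIso _)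
    (L.dom_projCompIso m (unit P Q (.inr y)))
    (L.cod_projCompIso m (unit P Q (.inr y))) (dom_projSq_eq_id hs) (cod_projSq_eq_id hs')
  refine (L.isCocart_cell m).rightUnitor_transfer
    ((L.cell_unitIso _).trans (congrArg (M'.unitSq · ≫ _) (L.cod_cell m).symm))
    (L.cell_compIso m (unit P Q (.inr y)))
    (L.sq_naturality (@Iso.hom _ (sqCat P Q) _ _ (Cograph.rightUnitor m)))
    (((proj P Q).comp L.a).map_rightUnitor m) hd'.1 hd'.2

theorem cod_sq_eq_dom_sq {x y z x' y' z' : A.Obj ⊕ B.Obj} {m : Lo P Q x y} {n : Lo P Q y z}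
    {m' : Lo P Q x' y'} {n' : Lo P Q y' z'} {α : Sq P Q ⟨m⟩ ⟨m'⟩} {β : Sq P Q ⟨n⟩ ⟨n'⟩}
    (h : Sq.cod α = Sq.dom β) : Sq.cod (L.sq α) = Sq.dom (L.sq β) :=
  (L.cod_sq α).trans ((congrArg L.ti h).trans (L.dom_sq β).symm)

theorem compIso_naturality_het {x : A.Obj} {y x' y' z' : A.Obj ⊕ B.Obj} {z : B.Obj}
    {m : Lo P Q (.inl x) y} {n : Lo P Q y (.inr z)}
    {m' : Lo P Q x' y'} {n' : Lo P Q y' z'} (α : Sq P Q ⟨m⟩ ⟨m'⟩) (β : Sq P Q ⟨n⟩ ⟨n'⟩)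
    (h : Sq.cod α = Sq.dom β) (h' : Sq.cod (L.sq α) = Sq.dom (L.sq β)) :
    Sq.comp (Cograph.compSq (L.sq α) (L.sq β) h')
        (@Iso.hom _ (sqCat P' Q') _ _ (L.compIso m' n')) =
      Sq.comp (@Iso.hom _ (sqCat P' Q') _ _ (L.compIso m n)) (L.sq (Cograph.compSq α β h)) := by
  have hd : Sq.dom (Sq.comp (@Iso.hom _ (sqCat P' Q') _ _ (L.compIso m n))
      (L.sq (Cograph.compSq α β h))) = Sq.dom (Sq.comp (Cograph.compSq (L.sq α) (L.sq β) h')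
        (@Iso.hom _ (sqCat P' Q') _ _ (L.compIso m' n'))) := by
    refine (Cograph.dom_comp _ _).trans (Eq.trans ?_ (Cograph.dom_comp _ _).symm)
    refine (congrArg₂ Ti.comp (L.dom_compIso m n) (L.dom_sq _)).trans
      (Eq.trans ?_ (congrArg₂ Ti.comp (Cograph.dom_compSq _ _ _) (L.dom_compIso m' n')).symm)
    refine (@Category.id_comp _ (tiCat (A := A') (B := B')) _ _ _).trans
      (Eq.trans ?_ (@Category.comp_id _ (tiCat (A := A') (B := B')) _ _ _).symm)
    exact (congrArg L.ti (Cograph.dom_compSq _ _ _)).trans (L.dom_sq α).symm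
  have hd' : Sq.cod (Sq.comp (@Iso.hom _ (sqCat P' Q') _ _ (L.compIso m n))
      (L.sq (Cograph.compSq α β h))) = Sq.cod (Sq.comp (Cograph.compSq (L.sq α) (L.sq β) h')
        (@Iso.hom _ (sqCat P' Q') _ _ (L.compIso m' n'))) := by
    refine (Cograph.cod_comp _ _).trans (Eq.trans ?_ (Cograph.cod_comp _ _).symm)
    refine (congrArg₂ Ti.comp (L.cod_compIso m n) (L.cod_sq _)).trans
      (Eq.trans ?_ (congrArg₂ Ti.comp (Cograph.cod_compSq _ _ _) (L.cod_compIso m' n')).symm)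
    refine (@Category.id_comp _ (tiCat (A := A') (B := B')) _ _ _).trans
      (Eq.trans ?_ (@Category.comp_id _ (tiCat (A := A') (B := B')) _ _ _).symm)
    exact (congrArg L.ti (Cograph.cod_compSq _ _ _)).trans (L.cod_sq β).symm
  refine (Sq.ext_of_het hd hd' ?_).symm
  refine ((proj P' Q').sq_compSq_eq_iff (L.sq α) (L.sq β) h'
    (@Iso.hom _ (sqCat P' Q') _ _ (L.compIso m n)) (@Iso.hom _ (sqCat P' Q') _ _ (L.compIso m' n'))
    (L.sq (Cograph.compSq α β h))).2 ?_
  refine (L.isCocart_compSq_cell m n).compSq_transfer (L.cell_compIso m n) (L.cell_compIso m' n')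
    (L.sq_naturality α) (L.sq_naturality β) (L.sq_naturality (Cograph.compSq α β h))
    (((proj P Q).comp L.a).compIso_naturality α β h) ?_ ?_
  · refine (M'.dom_comp _ _).trans ((congrArg₂ (· ≫ ·) (L.dom_projCompIso m n) (dom_projSq
      (L.sq (Cograph.compSq α β h)))).trans ?_)
    refine Eq.trans ?_ ((M'.dom_comp _ _).trans (congrArg₂ (· ≫ ·) ((M'.dom_compSq _ _ _).trans
      (dom_projSq (L.sq α))) (L.dom_projCompIso m' n'))).symm
    refine (Category.id_comp _).trans (Eq.trans ?_ (Category.comp_id _).symm)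
    exact congrArg projTi ((L.dom_sq _).trans
      ((congrArg L.ti (Cograph.dom_compSq _ _ _)).trans (L.dom_sq α).symm))
  · refine (M'.cod_comp _ _).trans ((congrArg₂ (· ≫ ·) (L.cod_projCompIso m n) (cod_projSq
      (L.sq (Cograph.compSq α β h)))).trans ?_)
    refine Eq.trans ?_ ((M'.cod_comp _ _).trans (congrArg₂ (· ≫ ·) ((M'.cod_compSq _ _ _).trans
      (cod_projSq (L.sq β))) (L.cod_projCompIso m' n'))).symm
    refine (Category.id_comp _).trans (Eq.trans ?_ (Category.comp_id _).symm)
    exact congrArg projTi ((L.cod_sq _).trans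
      ((congrArg L.ti (Cograph.cod_compSq _ _ _)).trans (L.cod_sq β).symm))

/-- The double functor between restrictions. -/
noncomputable def functor : DblFunctor (cograph P Q) (cograph P' Q') where
  tight :=
    { obj := L.obj
      map := L.ti
      map_id := L.ti_id
      map_comp := L.ti_comp }
  lo m := L.lo m
  sq α := L.sq α
  sq_id m := L.sq_id m
  sq_comp α β := L.sq_comp α β
  dom_sq α := L.dom_sq α
  cod_sq α := L.cod_sq α
  unitIso x := L.unitIso x
  dom_unitIso x := L.dom_unitIso x
  cod_unitIso x := L.cod_unitIso x
  unitIso_naturality f := by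
    rcases f with f | f
    · exact Sq.left_congr (L.f.unitIso_naturality f)
    · exact Sq.right_congr (L.g.unitIso_naturality f)
  compIso m n := L.compIso m n
  dom_compIso m n := L.dom_compIso m n
  cod_compIso m n := L.cod_compIso m n
  compIso_naturality {x y z x' y' z' m n m' n'} α β h := by
    rcases α with α | α | α <;> rcases β with β | β | β
    · exact Sq.left_congr (L.f.compIso_naturality α β (Ti.left_inj h))
    · exact L.compIso_naturality_het (.left α) (.het β) h (L.cod_sq_eq_dom_sq h)
    · exact L.compIso_naturality_het (.het α) (.right β) h (L.cod_sq_eq_dom_sq h)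
    · exact Sq.right_congr (L.g.compIso_naturality α β (Ti.right_inj h))
  map_assoc m n p := by
    rcases m with m | m | m <;> rcases n with n | n | n <;> rcases p with p | p | p
    · exact Sq.left_congr (L.f.map_assoc m n p)
    · exact L.map_assoc_het (.left m) (.left n) (.het p) (L.cod_compIso_eq (.left m) (.left n) (.het p))
        (L.dom_compIso_eq (.left m) (.left n) (.het p))
    · exact L.map_assoc_het (.left m) (.het n) (.right p) (L.cod_compIso_eq (.left m) (.het n) (.right p))
        (L.dom_compIso_eq (.left m) (.het n) (.right p))
    · exact L.map_assoc_het (.het m) (.right n) (.right p) (L.cod_compIso_eq (.het m) (.right n) (.right p))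
        (L.dom_compIso_eq (.het m) (.right n) (.right p))
    · exact Sq.right_congr (L.g.map_assoc m n p)
  map_leftUnitor m := by
    rcases m with m | m | m
    · exact Sq.left_congr (L.f.map_leftUnitor m)
    · exact L.map_leftUnitor_het (.het m)
        ((L.cod_unitIso (.inl _)).trans ((cograph P' Q').dom_id ⟨L.lo (.het m)⟩).symm)
    · exact Sq.right_congr (L.g.map_leftUnitor m)
  map_rightUnitor m := by
    rcases m with m | m | m
    · exact Sq.left_congr (L.f.map_rightUnitor m)
    · exact L.map_rightUnitor_het (.het m)
        (((cograph P' Q').cod_id ⟨L.lo (.het m)⟩).trans (L.dom_unitIso (.inr _)).symm)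
    · exact Sq.right_congr (L.g.map_rightUnitor m)

/-- The tight transformation formed by the colaxators and the opcartesian squares. -/
def trans : DblTrans ((proj P Q).comp L.a) (L.functor.comp (proj P' Q')) where
  app := L.app
  sq m := L.cell m
  naturality f := L.app_naturality f
  dom_sq m := L.dom_cell m
  cod_sq m := L.cod_cell m
  sq_naturality α := L.sq_naturality α
  unit x := L.cell_unitIso x
  comp m n := L.cell_compIso m n

end LiftData
end Cograph

namespace DblTrans

theorem sq_transfer {X : Type*} [Category* X] {a a' b b' e e' g g' : X} {cm : a ⟶ b} {kα : b ⟶ b'}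
    {sn : b' ⟶ e'} {sm : b ⟶ e} {lα : e ⟶ e'} {cn : a' ⟶ b'} {Fα : a ⟶ a'} {bm : a ⟶ g}
    {dm : g ⟶ e} {bn : a' ⟶ g'} {dn : g' ⟶ e'} {Gα : g ⟶ g'} (h1 : Fα ≫ cn = cm ≫ kα)
    (h2 : Fα ≫ bn = bm ≫ Gα) (h3 : Gα ≫ dn = dm ≫ lα) (h4 : cm ≫ sm = bm ≫ dm)
    (h5 : cn ≫ sn = bn ≫ dn) : cm ≫ kα ≫ sn = cm ≫ sm ≫ lα := by
  rw [← reassoc_of% h1, h5, reassoc_of% h2, h3, reassoc_of% h4]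

theorem comp_transfer_aux {C C' E : DblCat.{u}} (p : DblFunctor C' E) {K L : DblFunctor C C'}
    {F G : DblFunctor C E} (β : DblTrans F G) {x y z : C.Obj} {m : C.Lo x y} {n : C.Lo y z}
    (cm : LoArr.mk (F.lo m) ⟶ LoArr.mk (p.lo (K.lo m)))
    (cn : LoArr.mk (F.lo n) ⟶ LoArr.mk (p.lo (K.lo n)))
    (cmn : LoArr.mk (F.lo (C.comp m n)) ⟶ LoArr.mk (p.lo (K.lo (C.comp m n))))
    (dm : LoArr.mk (G.lo m) ⟶ LoArr.mk (p.lo (L.lo m)))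
    (dn : LoArr.mk (G.lo n) ⟶ LoArr.mk (p.lo (L.lo n)))
    (dmn : LoArr.mk (G.lo (C.comp m n)) ⟶ LoArr.mk (p.lo (L.lo (C.comp m n))))
    (σ : LoArr.mk (K.lo m) ⟶ LoArr.mk (L.lo m)) (τ : LoArr.mk (K.lo n) ⟶ LoArr.mk (L.lo n))
    (h : C'.cod σ = C'.dom τ) (e1 : E.cod cm = E.dom cn) (e2 : E.cod dm = E.dom dn)
    (h1 : (F.compIso m n).hom ≫ cmn =
      E.compSq cm cn e1 ≫ (p.compIso (K.lo m) (K.lo n)).hom ≫ p.sq (K.compIso m n).hom)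
    (h2 : (G.compIso m n).hom ≫ dmn =
      E.compSq dm dn e2 ≫ (p.compIso (L.lo m) (L.lo n)).hom ≫ p.sq (L.compIso m n).hom)
    (hσ : cm ≫ p.sq σ = β.sq m ≫ dm) (hτ : cn ≫ p.sq τ = β.sq n ≫ dn) :
    cmn ≫ p.sq ((K.compIso m n).inv ≫ C'.compSq σ τ h ≫ (L.compIso m n).hom) =
      β.sq (C.comp m n) ≫ dmn := by
  rw [← cancel_epi (F.compIso m n).hom]
  have h3 : p.sq (K.compIso m n).hom ≫ p.sq (K.compIso m n).inv = 𝟙 _ := by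
    rw [← p.sq_comp, Iso.hom_inv_id, p.sq_id]
  have h4 : E.cod (p.sq σ) = E.dom (p.sq τ) := by simp [h]
  have h5 : E.compSq cm cn e1 ≫ E.compSq (p.sq σ) (p.sq τ) h4 =
      E.compSq (β.sq m) (β.sq n) (by simp) ≫ E.compSq dm dn e2 := by
    rw [DblCat.compSq_compSq, DblCat.compSq_compSq]
    exact DblCat.compSq_congr _ hσ hτ
  rw [reassoc_of% h1, p.sq_comp, reassoc_of% h3, p.sq_comp,
    ← reassoc_of% (p.compIso_naturality σ τ h), reassoc_of% h5, reassoc_of% (β.comp m n), h2]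

theorem comp_transfer {C C' E : DblCat.{u}} (p : DblFunctor C' E) {K L : DblFunctor C C'}
    {F G : DblFunctor C E} (c : DblTrans F (K.comp p)) (d : DblTrans G (L.comp p))
    (β : DblTrans F G) {x y z : C.Obj} {m : C.Lo x y} {n : C.Lo y z}
    (σ : LoArr.mk (K.lo m) ⟶ LoArr.mk (L.lo m)) (τ : LoArr.mk (K.lo n) ⟶ LoArr.mk (L.lo n))
    (h : C'.cod σ = C'.dom τ) (hσ : c.sq m ≫ p.sq σ = β.sq m ≫ d.sq m)
    (hτ : c.sq n ≫ p.sq τ = β.sq n ≫ d.sq n) :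
    c.sq (C.comp m n) ≫ p.sq ((K.compIso m n).inv ≫ C'.compSq σ τ h ≫ (L.compIso m n).hom) =
      β.sq (C.comp m n) ≫ d.sq (C.comp m n) :=
  comp_transfer_aux p β (c.sq m) (c.sq n) _ (d.sq m) (d.sq n) _ σ τ h
    ((c.cod_sq m).trans (c.dom_sq n).symm) ((d.cod_sq m).trans (d.dom_sq n).symm)
    (c.comp m n) (d.comp m n) hσ hτ

end DblTrans

namespace Cograph

variable {A B M A' B' M' : DblCat.{u}} {P : DblFunctor A M} {Q : DblFunctor B M}
  {P' : DblFunctor A' M'} {Q' : DblFunctor B' M'}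

theorem Sq.exists_of_side {x y x' y' : A.Obj ⊕ B.Obj} (k : Lo P Q x y) (l : Lo P Q x' y')
    (hx : side x = Side.zero) (hy : side y = Side.one) (s : Ti x x') (t : Ti y y')
    (σ : LoArr.mk (projLo k) ⟶ LoArr.mk (projLo l)) (hs : M.dom σ = projTi s)
    (ht : M.cod σ = projTi t) :
    ∃ α : Sq P Q ⟨k⟩ ⟨l⟩, Sq.dom α = s ∧ Sq.cod α = t ∧ projSq α = σ := by
  rcases k with k | k | k
  · nomatch hy
  · cases s
    cases t
    cases l
    exact ⟨.het ⟨_, _, σ, hs, ht⟩, rfl, rfl, rfl⟩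
  · nomatch hx

theorem Sq.ext_of_side {x y x' y' : A.Obj ⊕ B.Obj} {k : Lo P Q x y} {l : Lo P Q x' y'}
    (hx : side x = Side.zero) (hy : side y = Side.one) {α β : Sq P Q ⟨k⟩ ⟨l⟩}
    (h : Sq.dom α = Sq.dom β) (h' : Sq.cod α = Sq.cod β) (e : projSq α = projSq β) : α = β := by
  rcases k with k | k | k
  · nomatch hy
  · exact Sq.ext_of_het h h' e
  · nomatch hx

section cell

variable {F G : DblFunctor (cograph P Q) M'} {K L : DblFunctor (cograph P Q) (cograph P' Q')}

theorem sq_ext_of_cocart (c : DblTrans F (K.comp (proj P' Q')))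
    (hK : ∀ x, side (K.tight.obj x) = side x)
    (hc : ∀ {x y} (m : M.Lo (P.tight.obj x) (Q.tight.obj y)), DblCat.IsCocart (c.sq (.het m)))
    {x : A.Obj} {y : B.Obj} {x' y' : A'.Obj ⊕ B'.Obj} {m : Lo P Q (.inl x) (.inr y)}
    {n : Lo P' Q' x' y'} {σ τ : Sq P' Q' ⟨K.lo m⟩ ⟨n⟩} (h : Sq.dom σ = Sq.dom τ)
    (h' : Sq.cod σ = Sq.cod τ) (e : c.sq m ≫ projSq σ = c.sq m ≫ projSq τ) : σ = τ := by
  rcases m with m | m | m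
  refine Sq.ext_of_side (hK (.inl x)) (hK (.inr y)) h h' ((hc m).hom_ext ?_ ?_ e)
  · exact (dom_projSq σ).trans ((congrArg projTi h).trans (dom_projSq τ).symm)
  · exact (cod_projSq σ).trans ((congrArg projTi h').trans (cod_projSq τ).symm)

theorem trans_ext (c : DblTrans F (K.comp (proj P' Q')))
    (hK : ∀ x, side (K.tight.obj x) = side x)
    (hc : ∀ {x y} (m : M.Lo (P.tight.obj x) (Q.tight.obj y)), DblCat.IsCocart (c.sq (.het m)))
    {θ θ' : DblTrans K L}
    (h₀ : ∀ {x y} (m : A.Lo x y), θ.sq (.left m) = θ'.sq (.left m))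
    (h₁ : ∀ {x y} (m : B.Lo x y), θ.sq (.right m) = θ'.sq (.right m))
    (h : ∀ {x y} (m : M.Lo (P.tight.obj x) (Q.tight.obj y)),
      c.sq (.het m) ≫ projSq (θ.sq (.het m)) = c.sq (.het m) ≫ projSq (θ'.sq (.het m))) :
    θ = θ' := by
  have happ : ∀ x, θ.app x = θ'.app x := by
    intro x
    refine (θ.dom_sq ((cograph P Q).unit x)).symm.trans
      (Eq.trans ?_ (θ'.dom_sq ((cograph P Q).unit x)))
    rcases x with x | x
    · exact congrArg Sq.dom (h₀ _)
    · exact congrArg Sq.dom (h₁ _)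
  refine DblTrans.hom_ext (α := θ) (β := θ') happ ?_
  rintro x y (m | m | m)
  · exact h₀ m
  · exact sq_ext_of_cocart c hK hc (m := .het m) ((θ.dom_sq _).trans ((happ _).trans (θ'.dom_sq _).symm))
      ((θ.cod_sq _).trans ((happ _).trans (θ'.cod_sq _).symm)) (h m)
  · exact h₁ m

theorem exists_trans (c : DblTrans F (K.comp (proj P' Q')))
    (hK : ∀ x, side (K.tight.obj x) = side x)
    (hc : ∀ {x y} (m : M.Lo (P.tight.obj x) (Q.tight.obj y)), DblCat.IsCocart (c.sq (.het m)))
    (hL : ∀ x, side (L.tight.obj x) = side x)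
    (d : DblTrans G (L.comp (proj P' Q'))) (β : DblTrans F G)
    (θ₀ : DblTrans ((inl P Q).comp K) ((inl P Q).comp L))
    (θ₁ : DblTrans ((inr P Q).comp K) ((inr P Q).comp L))
    (h₀ : ∀ {x y} (m : A.Lo x y),
      c.sq (.left m) ≫ projSq (θ₀.sq m) = β.sq (.left m) ≫ d.sq (.left m))
    (h₁ : ∀ {x y} (m : B.Lo x y),
      c.sq (.right m) ≫ projSq (θ₁.sq m) = β.sq (.right m) ≫ d.sq (.right m)) :
    ∃ θ : DblTrans K L, (∀ {x y} (m : A.Lo x y), θ.sq (.left m) = θ₀.sq m) ∧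
      (∀ {x y} (m : B.Lo x y), θ.sq (.right m) = θ₁.sq m) ∧
      ∀ {x y} (m : Lo P Q x y), c.sq m ≫ projSq (θ.sq m) = β.sq m ≫ d.sq m := by
  let app : ∀ x, K.tight.obj x ⟶ L.tight.obj x := fun
    | .inl x => θ₀.app x
    | .inr x => θ₁.app x
  have happ : ∀ x, c.app x ≫ projTi (app x) = β.app x ≫ d.app x := by
    rintro (x | x)
    · have h := congrArg M'.dom (h₀ (A.unit x))
      refine Eq.trans ?_ (h.trans ?_)
      · refine ((M'.dom_comp _ _).trans (congrArg₂ (· ≫ ·) (c.dom_sq _) ((dom_projSq _).trans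
          (congrArg projTi (θ₀.dom_sq _))))).symm
      · exact (M'.dom_comp _ _).trans (congrArg₂ (· ≫ ·) (β.dom_sq _) (d.dom_sq _))
    · have h := congrArg M'.dom (h₁ (B.unit x))
      refine Eq.trans ?_ (h.trans ?_)
      · refine ((M'.dom_comp _ _).trans (congrArg₂ (· ≫ ·) (c.dom_sq _) ((dom_projSq _).trans
          (congrArg projTi (θ₁.dom_sq _))))).symm
      · exact (M'.dom_comp _ _).trans (congrArg₂ (· ≫ ·) (β.dom_sq _) (d.dom_sq _))
  have hhet : ∀ x y (m : M.Lo (P.tight.obj x) (Q.tight.obj y)),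
      ∃ α : Sq P' Q' ⟨K.lo (.het m)⟩ ⟨L.lo (.het m)⟩, Sq.dom α = app (.inl x) ∧
        Sq.cod α = app (.inr y) ∧ c.sq (.het m) ≫ projSq α = β.sq (.het m) ≫ d.sq (.het m) := by
    intro x y m
    obtain ⟨γ, ⟨e1, e2, e3⟩, -⟩ := (hc m).factor (β.sq (.het m) ≫ d.sq (.het m))
      (projTi (app (.inl x))) (projTi (app (.inr y)))
      ((M'.dom_comp _ _).trans ((congrArg₂ (· ≫ ·) (β.dom_sq _) (d.dom_sq _)).trans
        ((happ (.inl x)).symm.trans (congrArg (· ≫ _) (c.dom_sq (.het m)).symm))))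
      ((M'.cod_comp _ _).trans ((congrArg₂ (· ≫ ·) (β.cod_sq _) (d.cod_sq _)).trans
        ((happ (.inr y)).symm.trans (congrArg (· ≫ _) (c.cod_sq (.het m)).symm))))
    obtain ⟨α, k1, k2, k3⟩ := Sq.exists_of_side (K.lo (.het m)) (L.lo (.het m)) (hK _) (hK _) _ _ γ
      e1 e2
    exact ⟨α, k1, k2, (congrArg (c.sq (.het m) ≫ ·) k3).trans e3⟩
  choose H hH hH' hH'' using hhet
  let sq : ∀ {x y : A.Obj ⊕ B.Obj} (m : Lo P Q x y), Sq P' Q' ⟨K.lo m⟩ ⟨L.lo m⟩ := fun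
    | .left m => θ₀.sq m
    | .het m => H _ _ m
    | .right m => θ₁.sq m
  have hd : ∀ {x y} (m : Lo P Q x y), Sq.dom (sq m) = app x := by
    rintro x y (m | m | m)
    · exact θ₀.dom_sq m
    · exact hH _ _ m
    · exact θ₁.dom_sq m
  have hcd : ∀ {x y} (m : Lo P Q x y), Sq.cod (sq m) = app y := by
    rintro x y (m | m | m)
    · exact θ₀.cod_sq m
    · exact hH' _ _ m
    · exact θ₁.cod_sq m
  have hsq : ∀ {x y} (m : Lo P Q x y), c.sq m ≫ projSq (sq m) = β.sq m ≫ d.sq m := by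
    rintro x y (m | m | m)
    · exact h₀ m
    · exact hH'' _ _ m
    · exact h₁ m
  have hnat : ∀ {x y : A.Obj ⊕ B.Obj} (f : Ti x y),
      (Ti.comp (K.tight.map f) (app y)) = Ti.comp (app x) (L.tight.map f) := by
    rintro x y (f | f)
    · exact θ₀.naturality f
    · exact θ₁.naturality f
  have hcomp : ∀ {x : A.Obj} {y : A.Obj ⊕ B.Obj} {z : B.Obj} (m : Lo P Q (.inl x) y)
      (n : Lo P Q y (.inr z)) (h : (cograph P' Q').cod (sq m) = (cograph P' Q').dom (sq n)),
      (K.compIso m n).hom ≫ (sq (Cograph.comp m n) : LoArr.mk (K.lo _) ⟶ LoArr.mk (L.lo _)) =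
        (cograph P' Q').compSq (sq m) (sq n) h ≫ (L.compIso m n).hom := by
    intro x y z m n h
    refine (Iso.eq_inv_comp _).1 ?_
    have hi := dom_compIso_inv K m n
    have hi' := cod_compIso_inv K m n
    refine sq_ext_of_cocart c hK hc (m := Cograph.comp m n) ?_ ?_ ?_
    · refine (hd _).trans (Eq.symm ?_)
      refine ((cograph P' Q').dom_comp _ _).trans ((congrArg₂ (· ≫ ·) hi
        ((cograph P' Q').dom_comp _ _)).trans ((Category.id_comp _).trans ?_))
      exact (congrArg₂ (· ≫ ·) (((cograph P' Q').dom_compSq _ _ _).trans (hd m))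
        (L.dom_compIso m n)).trans (Category.comp_id _)
    · refine (hcd _).trans (Eq.symm ?_)
      refine ((cograph P' Q').cod_comp _ _).trans ((congrArg₂ (· ≫ ·) hi'
        ((cograph P' Q').cod_comp _ _)).trans ((Category.id_comp _).trans ?_))
      exact (congrArg₂ (· ≫ ·) (((cograph P' Q').cod_compSq _ _ _).trans (hcd n))
        (L.cod_compIso m n)).trans (Category.comp_id _)
    · exact (hsq (Cograph.comp m n)).trans
        (DblTrans.comp_transfer (proj P' Q') c d β (sq m) (sq n) h (hsq m) (hsq n)).symm
  refine ⟨⟨app, sq, hnat, hd, hcd, ?_, ?_, ?_⟩, fun m => rfl, fun m => rfl, hsq⟩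
  · rintro x y x' y' m n (α | α | α)
    · exact θ₀.sq_naturality α
    · rename_i m n
      refine sq_ext_of_cocart c hK hc (m := .het m) ?_ ?_ ?_
      · refine ((cograph P' Q').dom_comp _ _).trans (Eq.trans ?_ ((cograph P' Q').dom_comp _ _).symm)
        exact (congrArg₂ (· ≫ ·) (K.dom_sq _) (hd _)).trans ((hnat (Ti.left α.f)).trans
          (congrArg₂ (· ≫ ·) (hd (.het m)) (L.dom_sq (.het α))).symm)
      · refine ((cograph P' Q').cod_comp _ _).trans (Eq.trans ?_ ((cograph P' Q').cod_comp _ _).symm)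
        exact (congrArg₂ (· ≫ ·) (K.cod_sq _) (hcd _)).trans ((hnat (Ti.right α.g)).trans
          (congrArg₂ (· ≫ ·) (hcd (.het m)) (L.cod_sq (.het α))).symm)
      · refine (congrArg (_ ≫ ·) ((proj P' Q').sq_comp (K.sq (.het α)) (sq (.het n)))).trans
          (Eq.trans ?_ (congrArg (_ ≫ ·) ((proj P' Q').sq_comp (sq (.het m)) (L.sq (.het α)))).symm)
        exact DblTrans.sq_transfer (c.sq_naturality (.het α)) (β.sq_naturality (.het α))
          (d.sq_naturality (.het α)) (hsq (.het m)) (hsq (.het n))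
    · exact θ₁.sq_naturality α
  · rintro (x | x)
    · exact (congrArg (· ≫ _) ((congrArg (_ ≫ ·) (K.sq_id _)).trans (Category.comp_id _)).symm).trans
        ((θ₀.unit x).trans (congrArg (_ ≫ ·) ((congrArg (_ ≫ ·) (L.sq_id _)).trans
          (Category.comp_id _))))
    · exact (congrArg (· ≫ _) ((congrArg (_ ≫ ·) (K.sq_id _)).trans (Category.comp_id _)).symm).trans
        ((θ₁.unit x).trans (congrArg (_ ≫ ·) ((congrArg (_ ≫ ·) (L.sq_id _)).trans
          (Category.comp_id _))))
  · rintro x y z (m | m | m) (n | n | n)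
    · exact (congrArg (· ≫ _) ((congrArg (_ ≫ ·) (K.sq_id _)).trans (Category.comp_id _)).symm).trans
        ((θ₀.comp m n).trans (congrArg (_ ≫ ·) ((congrArg (_ ≫ ·) (L.sq_id _)).trans
          (Category.comp_id _))))
    · exact hcomp (.left m) (.het n) _
    · exact hcomp (.het m) (.right n) _
    · exact (congrArg (· ≫ _) ((congrArg (_ ≫ ·) (K.sq_id _)).trans (Category.comp_id _)).symm).trans
        ((θ₁.comp m n).trans (congrArg (_ ≫ ·) ((congrArg (_ ≫ ·) (L.sq_id _)).trans
          (Category.comp_id _))))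

end cell

end Cograph

namespace DblTrans

variable {A B D E : DblCat.{u}}

theorem heq_sq {F F' G G' : D ⟶ E} {α : F ⟶ G} {β : F' ⟶ G'} (h : F = F') (k : G = G')
    (e : HEq α β) {x y : D.Obj} (m : D.Lo x y) : HEq (DblTrans.sq α m) (DblTrans.sq β m) := by
  subst h k
  cases e
  rfl

theorem lo_congr {F F' : D ⟶ E} (h : F = F') {x y : D.Obj} (m : D.Lo x y) :
    LoArr.mk (DblFunctor.lo F m) = LoArr.mk (DblFunctor.lo F' m) := by
  subst h; rfl

theorem isConjointCommuter_of_heq {F F' G G' : D ⟶ E} {α : F ⟶ G} {β : F' ⟶ G'} (h : F = F')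
    (k : G = G') (e : HEq α β) (hβ : DblTrans.IsConjointCommuter β) :
    DblTrans.IsConjointCommuter α := by
  subst h k
  cases e
  exact hβ

theorem isCompanionCommuter_of_heq {F F' G G' : D ⟶ E} {α : F ⟶ G} {β : F' ⟶ G'} (h : F = F')
    (k : G = G') (e : HEq α β) (hβ : DblTrans.IsCompanionCommuter β) :
    DblTrans.IsCompanionCommuter α := by
  subst h k
  cases e
  exact hβ

theorem sq_heq_sq (p : DblFunctor D E) {x y x' y' z w z' w' : D.Obj} {k : D.Lo x y}
    {k' : D.Lo x' y'} {l : D.Lo z w} {l' : D.Lo z' w'} (h : LoArr.mk k = LoArr.mk k')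
    (h' : LoArr.mk l = LoArr.mk l') {θ : LoArr.mk k ⟶ LoArr.mk l} {ψ : LoArr.mk k' ⟶ LoArr.mk l'}
    (e : HEq θ ψ) : HEq (p.sq θ) (p.sq ψ) := by
  cases h
  cases h'
  cases e
  rfl

theorem sq_comp_eq_of_heq (p : DblFunctor D E) {x y x' y' z w z' w' : D.Obj} {k : D.Lo x y}
    {k' : D.Lo x' y'} {l : D.Lo z w} {l' : D.Lo z' w'} {t t' : LoArr E.Lo}
    (h : LoArr.mk k = LoArr.mk k') (h' : LoArr.mk l = LoArr.mk l')
    {θ : LoArr.mk k ⟶ LoArr.mk l} {ψ : LoArr.mk k' ⟶ LoArr.mk l'} {γ : t ⟶ LoArr.mk (p.lo k)}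
    {s : t ⟶ LoArr.mk (p.lo k')} {γ' : t' ⟶ LoArr.mk (p.lo l)} {s' : t' ⟶ LoArr.mk (p.lo l')}
    {β : t ⟶ t'} (e : HEq θ ψ) (hγ : HEq γ s) (hγ' : HEq γ' s') (w : β ≫ s' = s ≫ p.sq ψ) :
    γ ≫ p.sq θ = β ≫ γ' := by
  cases h
  cases h'
  cases e
  cases hγ
  cases hγ'
  exact w.symm

end DblTrans

namespace Niche

open LooseBimod

/-- A map `K` between restrictions with a 2-cell `c` is an extension of a map `a` of niches if it is
`a` on the ends and its values on heteromorphisms are opcartesian. -/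
structure Ext {M N : Niche.{u}} (a : M ⟶ N) (K : M.restrict ⟶ N.restrict)
    (c : M.proj ≫ a.bimod ⟶ K ≫ N.proj) : Prop where
  ends (i : Side.{u}) : M.inc i ≫ fiberMap K i = a.f i ≫ N.inc i
  cell (i : Side.{u}) : HEq (M.inc i ◁ fiberMap₂ c i) (a.colax i)
  het {e e'} (m : M.bimod.collage.Lo (DblFunctor.tight (M.leg .zero) |>.obj e)
    (DblFunctor.tight (M.leg .one) |>.obj e')) :
    DblCat.IsCocart (D := N.bimod.collage) (DblTrans.sq (Hom₂.trans c) (Cograph.Lo.het m))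

theorem side_obj {M N : Niche.{u}} (K : M.restrict ⟶ N.restrict) (x : M.restrict.collage.Obj) :
    Cograph.side (DblFunctor.tight K.functor |>.obj x) = Cograph.side x := K.label_obj x

theorem source_eq {M N : Niche.{u}} (a : M ⟶ N) (i : Side.{u}) :
    M.inc i ≫ fiberMap (M.proj ≫ a.bimod) i = M.F i ≫ fiberMap a.bimod i :=
  (DblCat.strict.assoc (M.inc i) (fiberMap M.proj i) (fiberMap a.bimod i)).symm.trans
    (congrArg (· ≫ fiberMap a.bimod i) (M.inc_proj i))

/-- A tight transformation on the source of a restriction, as a transformation of collages. -/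
def overZero {M N : Niche.{u}} {K L : M.restrict ⟶ N.restrict}
    (t : M.inc .zero ≫ fiberMap K .zero ⟶ M.inc .zero ≫ fiberMap L .zero) :
    DblTrans ((Cograph.inl (M.leg .zero) (M.leg .one)).comp K.functor)
      ((Cograph.inl (M.leg .zero) (M.leg .one)).comp L.functor) where
  app x := DblTrans.app t x
  sq m := DblTrans.sq t m
  naturality f := DblTrans.naturality t f
  dom_sq m := DblTrans.dom_sq t m
  cod_sq m := DblTrans.cod_sq t m
  sq_naturality α := DblTrans.sq_naturality t α
  unit x := DblTrans.unit t x
  comp m n := DblTrans.comp t m n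

/-- A tight transformation on the target of a restriction, as a transformation of collages. -/
def overOne {M N : Niche.{u}} {K L : M.restrict ⟶ N.restrict}
    (t : M.inc .one ≫ fiberMap K .one ⟶ M.inc .one ≫ fiberMap L .one) :
    DblTrans ((Cograph.inr (M.leg .zero) (M.leg .one)).comp K.functor)
      ((Cograph.inr (M.leg .zero) (M.leg .one)).comp L.functor) where
  app x := DblTrans.app t x
  sq m := DblTrans.sq t m
  naturality f := DblTrans.naturality t f
  dom_sq m := DblTrans.dom_sq t m
  cod_sq m := DblTrans.cod_sq t m
  sq_naturality α := DblTrans.sq_naturality t α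
  unit x := DblTrans.unit t x
  comp m n := DblTrans.comp t m n

namespace Ext

variable {M N : Niche.{u}} {a b : M ⟶ N} {K L : M.restrict ⟶ N.restrict}
  {c : M.proj ≫ a.bimod ⟶ K ≫ N.proj} {d : M.proj ≫ b.bimod ⟶ L ≫ N.proj}

theorem target_eq_of_ends (i : Side.{u}) (h : M.inc i ≫ fiberMap K i = a.f i ≫ N.inc i) :
    M.inc i ≫ fiberMap (K ≫ N.proj) i = a.f i ≫ N.F i :=
  (DblCat.strict.assoc (M.inc i) (fiberMap K i) (fiberMap N.proj i)).symm.trans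
    ((congrArg (· ≫ fiberMap N.proj i) h).trans
      ((DblCat.strict.assoc (a.f i) (N.inc i) (fiberMap N.proj i)).trans
        (congrArg (a.f i ≫ ·) (N.inc_proj i))))

theorem target_eq (h : Ext a K c) (i : Side.{u}) :
    M.inc i ≫ fiberMap (K ≫ N.proj) i = a.f i ≫ N.F i := target_eq_of_ends i (h.ends i)

theorem sq_heq (h : Ext a K c) (i : Side.{u}) {x y : (M.E i).Obj} (m : (M.E i).Lo x y) :
    HEq (DblTrans.sq (M.inc i ◁ fiberMap₂ c i) m) (DblTrans.sq (a.colax i) m) :=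
  DblTrans.heq_sq (source_eq a i) (h.target_eq i) (h.cell i) m

theorem lo_eq (h : Ext a K c) (i : Side.{u}) {x y : (M.E i).Obj} (m : (M.E i).Lo x y) :
    LoArr.mk (DblFunctor.lo (M.inc i ≫ fiberMap K i) m) =
      LoArr.mk (DblFunctor.lo (a.f i ≫ N.inc i) m) := DblTrans.lo_congr (h.ends i) m

theorem hom_ext (h : Ext a K c) {θ θ' : K ⟶ L}
    (e : ∀ i, M.inc i ◁ fiberMap₂ θ i = M.inc i ◁ fiberMap₂ θ' i)
    (e' : c ≫ θ ▷ N.proj = c ≫ θ' ▷ N.proj) : θ = θ' := by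
  refine LooseBimod.Hom₂.ext' (Cograph.trans_ext (Hom₂.trans c) (side_obj K) h.het ?_ ?_ ?_)
  · intro x y m
    exact congrArg (fun t => DblTrans.sq t m) (e .zero)
  · intro x y m
    exact congrArg (fun t => DblTrans.sq t m) (e .one)
  · intro x y m
    exact congrArg (fun t => DblTrans.sq (Hom₂.trans t) (Cograph.Lo.het m)) e'

theorem exists_hom (h : Ext a K c) (h' : Ext b L d) (β : a ⟶ b) :
    ∃ θ : K ⟶ L, (∀ i, HEq (M.inc i ◁ fiberMap₂ θ i) (Hom₂.f β i ▷ N.inc i)) ∧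
      c ≫ θ ▷ N.proj = M.proj ◁ Hom₂.bimod β ≫ d := by
  let t : ∀ i, M.inc i ≫ fiberMap K i ⟶ M.inc i ≫ fiberMap L i := fun i =>
    eqToHom (h.ends i) ≫ Hom₂.f β i ▷ N.inc i ≫ eqToHom (h'.ends i).symm
  have ht : ∀ i, HEq (t i) (Hom₂.f β i ▷ N.inc i) := fun i => by simp [t]
  have ht' : ∀ i {x y} (m : (M.E i).Lo x y), HEq (DblTrans.sq (t i) m)
      (DblTrans.sq (Hom₂.f β i ▷ N.inc i) m) := fun i x y m =>
    DblTrans.heq_sq (h.ends i) (h'.ends i) (ht i) m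
  have hw : ∀ i {x y} (m : (M.E i).Lo x y), DblTrans.sq (M.F i ◁ fiberMap₂ (Hom₂.bimod β) i) m ≫
      DblTrans.sq (b.colax i) m = DblTrans.sq (a.colax i) m ≫
        DblTrans.sq (Hom₂.f β i ▷ N.F i) m := fun i x y m =>
    congrArg (fun s => DblTrans.sq s m) (Hom₂.w β i)
  obtain ⟨θ, h0, h1, h2⟩ := Cograph.exists_trans (Hom₂.trans c) (side_obj K) h.het (side_obj L)
    (Hom₂.trans d) (Hom₂.trans (M.proj ◁ Hom₂.bimod β)) (overZero (t .zero))
    (overOne (t .one))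
    (fun m => DblTrans.sq_comp_eq_of_heq (fiberMap N.proj .zero) (h.lo_eq .zero m)
      (h'.lo_eq .zero m) (ht' .zero m) (h.sq_heq .zero m) (h'.sq_heq .zero m) (hw .zero m))
    (fun m => DblTrans.sq_comp_eq_of_heq (fiberMap N.proj .one) (h.lo_eq .one m)
      (h'.lo_eq .one m) (ht' .one m) (h.sq_heq .one m) (h'.sq_heq .one m) (hw .one m))
  refine ⟨mkHom₂ θ, ?_, ?_⟩
  · rintro (_ | _)
    · exact (heq_of_eq (DblTrans.hom_ext_sq fun m => h0 m)).trans (ht .zero)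
    · exact (heq_of_eq (DblTrans.hom_ext_sq fun m => h1 m)).trans (ht .one)
  · exact LooseBimod.Hom₂.ext' (DblTrans.hom_ext_sq fun m => h2 m)

end Ext

end Niche

namespace DblTrans

variable {D E : DblCat.{u}}

theorem sq_heq_of_lo {F G : D ⟶ E} (α : F ⟶ G) {x y x' y' : D.Obj} {m : D.Lo x y}
    {m' : D.Lo x' y'} (h : LoArr.mk m = LoArr.mk m') :
    HEq (DblTrans.sq α m) (DblTrans.sq α m') := by
  cases h
  rfl

theorem nonempty_conjoint_of_eq {x y : D.Obj} {f g : x ⟶ y} (e : f = g)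
    (h : Nonempty (DblCat.Conjoint g)) : Nonempty (DblCat.Conjoint f) := e ▸ h

theorem nonempty_companion_of_eq {x y : D.Obj} {f g : x ⟶ y} (e : f = g)
    (h : Nonempty (DblCat.Companion g)) : Nonempty (DblCat.Companion f) := e ▸ h

theorem comp_heq {X : Type*} [Category* X] {a b c a' b' c' : X} (ha : a = a') (hb : b = b')
    (hc : c = c') {f : a ⟶ b} {g : b ⟶ c} {f' : a' ⟶ b'} {g' : b' ⟶ c'} (hf : HEq f f')
    (hg : HEq g g') : HEq (f ≫ g) (f' ≫ g') := by
  subst ha hb hc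
  cases hf
  cases hg
  rfl

end DblTrans

namespace Niche

open LooseBimod

namespace Ext

variable {M N : Niche.{u}} {a b : M ⟶ N} {K L : M.restrict ⟶ N.restrict}
  {c : M.proj ≫ a.bimod ⟶ K ≫ N.proj} {d : M.proj ≫ b.bimod ⟶ L ≫ N.proj}

theorem cocart_of_side (h : Ext a K c) {x y : M.restrict.collage.Obj}
    (k : M.restrict.collage.Lo x y) (hx : Cograph.side x = Side.zero)
    (hy : Cograph.side y = Side.one) :
    DblCat.IsCocart (D := N.bimod.collage) (DblTrans.sq (Hom₂.trans c) k) := by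
  rcases k with k | k | k
  · nomatch hy
  · exact h.het k
  · nomatch hx

theorem conjoint (h : Ext a K c) (e : (M.E .zero).Obj) : Nonempty (DblCat.Conjoint
    (D := N.bimod.collage) (DblTrans.app (Hom₂.trans c) (Sum.inl e))) := by
  obtain ⟨C⟩ := (DblTrans.isConjointCommuter_of_heq (source_eq a .zero) (h.target_eq .zero)
    (h.cell .zero) a.conj).1 e
  exact ⟨⟨C.lo, C.eta, C.eps, C.dom_eta, C.cod_eta, C.dom_eps, C.cod_eps, C.eta_eps, C.zigzag⟩⟩

theorem companion (h : Ext a K c) (e : (M.E .one).Obj) : Nonempty (DblCat.Companion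
    (D := N.bimod.collage) (DblTrans.app (Hom₂.trans c) (Sum.inr e))) := by
  obtain ⟨C⟩ := (DblTrans.isCompanionCommuter_of_heq (source_eq a .one) (h.target_eq .one)
    (h.cell .one) a.comp).1 e
  exact ⟨⟨C.lo, C.eta, C.eps, C.dom_eta, C.cod_eta, C.dom_eps, C.cod_eps, C.eta_eps, C.zigzag⟩⟩

/-- The identity is an extension of the identity. -/
theorem id (N : Niche.{u}) : Ext (𝟙 N) (𝟙 N.restrict) ((ρ_ N.proj).hom ≫ (λ_ N.proj).inv) where
  ends i := (DblCat.strict.comp_id _).trans (DblCat.strict.id_comp _).symm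
  cell i := by
    refine DblTrans.heq_of_sq (source_eq (𝟙 N) i) ?_ ?_
    · exact (congrArg (N.inc i ≫ ·) (congrArg (fiberMap · i) (LooseBimod.strict.id_comp N.proj))).trans
        ((N.inc_proj i).trans (DblCat.strict.id_comp _).symm)
    · intro x y m
      refine HEq.trans ?_ (heq_of_eq (DblTrans.idColax_sq (N.F i) m).symm)
      cases i
      · exact heq_of_eq (DblTrans.idColax_sq N.proj.functor (Cograph.Lo.left m))
      · exact heq_of_eq (DblTrans.idColax_sq N.proj.functor (Cograph.Lo.right m))
  het m := by
    have h := DblTrans.idColax_sq N.proj.functor (Cograph.Lo.het m)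
    exact h ▸ @DblCat.IsCocart.of_isIso _ _ _ _ _ _ _ _ (IsIso.id _)

theorem comp_ends {P : Niche.{u}} {f : N ⟶ P} {L : N.restrict ⟶ P.restrict} (i : Side.{u})
    (h : M.inc i ≫ fiberMap K i = a.f i ≫ N.inc i) (h' : N.inc i ≫ fiberMap L i = f.f i ≫ P.inc i) :
    M.inc i ≫ fiberMap (K ≫ L) i = (a ≫ f).f i ≫ P.inc i :=
  (DblCat.strict.assoc (M.inc i) (fiberMap K i) (fiberMap L i)).symm.trans
    ((congrArg (· ≫ fiberMap L i) h).trans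
      ((DblCat.strict.assoc (a.f i) (N.inc i) (fiberMap L i)).trans
        ((congrArg (a.f i ≫ ·) h').trans (DblCat.strict.assoc (a.f i) (f.f i) (P.inc i)).symm)))

/-- Extensions compose. -/
theorem comp {P : Niche.{u}} {f : N ⟶ P} {L : N.restrict ⟶ P.restrict}
    {d : N.proj ≫ f.bimod ⟶ L ≫ P.proj} (h : Ext a K c) (h' : Ext f L d) :
    Ext (a ≫ f) (K ≫ L) ((α_ M.proj a.bimod f.bimod).inv ≫ c ▷ f.bimod ≫
      (α_ K N.proj f.bimod).hom ≫ K ◁ d ≫ (α_ K L P.proj).inv) where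
  ends i := comp_ends i (h.ends i) (h'.ends i)
  cell i := by
    have hT := target_eq_of_ends (a := a ≫ f) i (comp_ends i (h.ends i) (h'.ends i))
    refine DblTrans.heq_of_sq (source_eq (a ≫ f) i) hT ?_
    intro x y m
    refine HEq.trans ?_ (heq_of_eq (DblTrans.paste_sq (a.colax i) (f.colax i) m).symm)
    refine HEq.trans (b := DblFunctor.sq (fiberMap f.bimod i)
      (DblTrans.sq (M.inc i ◁ fiberMap₂ c i) m) ≫ DblTrans.sq (fiberMap₂ d i)
        (DblFunctor.lo (M.inc i ≫ fiberMap K i) m)) ?_ ?_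
    · cases i
      · exact heq_of_eq (DblTrans.paste_sq (Hom₂.trans c) (Hom₂.trans d) (Cograph.Lo.left m))
      · exact heq_of_eq (DblTrans.paste_sq (Hom₂.trans c) (Hom₂.trans d) (Cograph.Lo.right m))
    · refine DblTrans.comp_heq (DblTrans.lo_congr (source_eq (a ≫ f) i) m)
        (congrArg (fun l => LoArr.mk (DblFunctor.lo (fiberMap f.bimod i) l.arr))
          (DblTrans.lo_congr (h.target_eq i) m)) (DblTrans.lo_congr hT m) ?_ ?_
      · exact DblTrans.sq_heq_sq (fiberMap f.bimod i) (DblTrans.lo_congr (source_eq a i) m)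
          (DblTrans.lo_congr (h.target_eq i) m) (h.sq_heq i m)
      · exact (DblTrans.sq_heq_of_lo (fiberMap₂ d i) (h.lo_eq i m)).trans
          (h'.sq_heq i (DblFunctor.lo (a.f i) m))
  het m := by
    have e := DblTrans.paste_sq (Hom₂.trans c) (Hom₂.trans d) (Cograph.Lo.het m)
    refine e ▸ DblCat.IsCocart.comp (DblCat.IsCocart.map f.bimod.functor (h.het m) ?_ ?_)
      (h'.cocart_of_side _ (side_obj K (.inl _)) (side_obj K (.inr _)))
    · exact DblTrans.nonempty_conjoint_of_eq (DblTrans.dom_sq (Hom₂.trans c) (Cograph.Lo.het m))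
        (h.conjoint _)
    · exact DblTrans.nonempty_companion_of_eq (DblTrans.cod_sq (Hom₂.trans c) (Cograph.Lo.het m))
        (h.companion _)

end Ext

end Niche

namespace Niche

open LooseBimod

section

variable {M N : Niche.{u}} (a : M ⟶ N)

/-- The colaxator of a map of niches, as a transformation into the collage. -/
def legTrans (i : Side.{u}) :
    DblTrans ((M.leg i).comp a.bimod.functor) (DblFunctor.comp (a.f i) (N.leg i)) where
  app x := DblTrans.app (a.colax i) x
  sq m := DblTrans.sq (a.colax i) m
  naturality f := DblTrans.naturality (a.colax i) f
  dom_sq m := DblTrans.dom_sq (a.colax i) m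
  cod_sq m := DblTrans.cod_sq (a.colax i) m
  sq_naturality α := DblTrans.sq_naturality (a.colax i) α
  unit x := DblTrans.unit (a.colax i) x
  comp m n := DblTrans.comp (a.colax i) m n

theorem legTrans_isConjointCommuter : (legTrans a .zero).IsConjointCommuter :=
  DblTrans.isConjointCommuter_of_sq _ fun m =>
    DblCat.IsConjointCommuter.map (DblCat.fullIncl (N.bimod.Over .zero)) (a.conj.2 m)

theorem legTrans_isCompanionCommuter : (legTrans a .one).IsCompanionCommuter :=
  DblTrans.isCompanionCommuter_of_sq _ fun m =>
    DblCat.IsCompanionCommuter.map (DblCat.fullIncl (N.bimod.Over .one)) (a.comp.2 m)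

/-- The data of an extension of a map of niches on heteromorphisms. -/
structure HetData where
  het {e e'} (m : M.bimod.collage.Lo ((M.leg .zero).tight.obj e) ((M.leg .one).tight.obj e')) :
    N.bimod.collage.Lo ((N.leg .zero).tight.obj ((a.f .zero).tight.obj e))
      ((N.leg .one).tight.obj ((a.f .one).tight.obj e'))
  c {e e'} (m : M.bimod.collage.Lo ((M.leg .zero).tight.obj e) ((M.leg .one).tight.obj e')) :
    LoArr.mk (a.bimod.functor.lo m) ⟶ LoArr.mk (het m)
  dom_c {e e'} (m : M.bimod.collage.Lo ((M.leg .zero).tight.obj e) ((M.leg .one).tight.obj e')) :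
    N.bimod.collage.dom (c m) = (legTrans a .zero).app e
  cod_c {e e'} (m : M.bimod.collage.Lo ((M.leg .zero).tight.obj e) ((M.leg .one).tight.obj e')) :
    N.bimod.collage.cod (c m) = (legTrans a .one).app e'
  cocart {e e'} (m : M.bimod.collage.Lo ((M.leg .zero).tight.obj e) ((M.leg .one).tight.obj e')) :
    DblCat.IsCocart (c m)

namespace HetData

variable {a} (H : HetData a)

/-- The data of the extension on the collages. -/
def liftData : Cograph.LiftData (M.leg .zero) (M.leg .one) (N.leg .zero) (N.leg .one) where
  f := a.f .zero
  g := a.f .one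
  a := a.bimod.functor
  s := legTrans a .zero
  t := legTrans a .one
  conj := legTrans_isConjointCommuter a
  comp := legTrans_isCompanionCommuter a
  het := H.het
  c := H.c
  dom_c := H.dom_c
  cod_c := H.cod_c
  cocart := H.cocart

/-- The extension. -/
noncomputable def map : M.restrict ⟶ N.restrict :=
  LooseBimod.Hom.mk (M := M.restrict) (N := N.restrict) H.liftData.functor (by
    refine DblCat.loose_ext ?_
    rintro (x | x) <;> rfl)

/-- The 2-cell of the extension. -/
noncomputable def cell : M.proj ≫ a.bimod ⟶ H.map ≫ N.proj :=
  mkHom₂ (F := M.proj ≫ a.bimod) (G := H.map ≫ N.proj) H.liftData.trans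

theorem map_ends (i : Side.{u}) : M.inc i ≫ fiberMap H.map i = a.f i ≫ N.inc i := by
  rcases i with _ | _
  · refine DblFunctor.ext_heq rfl HEq.rfl HEq.rfl (heq_of_eq ?_) (heq_of_eq ?_)
    · funext x
      refine Iso.ext ((Eq.trans (congrArg (_ ≫ ·) ?_) (Category.comp_id _)).trans
        (Category.id_comp _).symm)
      exact DblFunctor.sq_id (fiberMap H.map .zero)
        ((M.restrict.fiberObj .zero).unit ((M.inc .zero).tight.obj x))
    · funext x y z m n
      refine Iso.ext ((Eq.trans (congrArg (_ ≫ ·) ?_) (Category.comp_id _)).trans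
        (Category.id_comp _).symm)
      exact DblFunctor.sq_id (fiberMap H.map .zero)
        ((M.restrict.fiberObj .zero).comp ((M.inc .zero).lo m) ((M.inc .zero).lo n))
  · refine DblFunctor.ext_heq rfl HEq.rfl HEq.rfl (heq_of_eq ?_) (heq_of_eq ?_)
    · funext x
      refine Iso.ext ((Eq.trans (congrArg (_ ≫ ·) ?_) (Category.comp_id _)).trans
        (Category.id_comp _).symm)
      exact DblFunctor.sq_id (fiberMap H.map .one)
        ((M.restrict.fiberObj .one).unit ((M.inc .one).tight.obj x))
    · funext x y z m n
      refine Iso.ext ((Eq.trans (congrArg (_ ≫ ·) ?_) (Category.comp_id _)).trans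
        (Category.id_comp _).symm)
      exact DblFunctor.sq_id (fiberMap H.map .one)
        ((M.restrict.fiberObj .one).comp ((M.inc .one).lo m) ((M.inc .one).lo n))

theorem ext : Ext a H.map H.cell where
  ends := H.map_ends
  cell i := by
    refine DblTrans.heq_of_sq (source_eq a i) (Ext.target_eq_of_ends i (H.map_ends i)) ?_
    intro x y m
    cases i <;> rfl
  het m := H.cocart m

end HetData

/-- Conjoints and companions of the components of the colaxators of a map of niches. -/
structure Transposes where
  conj (e : (M.E .zero).Obj) : DblCat.Conjoint (D := N.bimod.collage) ((legTrans a .zero).app e)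
  comp (e : (M.E .one).Obj) : DblCat.Companion (D := N.bimod.collage) ((legTrans a .one).app e)

/-- A choice of conjoints and companions. -/
noncomputable def transposes : Transposes a where
  conj e := ((legTrans_isConjointCommuter a).1 e).some
  comp e := ((legTrans_isCompanionCommuter a).1 e).some

/-- Composition with conjoints and companions. -/
def Transposes.hetData {a : M ⟶ N} (T : Transposes a) : HetData a where
  het m := N.bimod.collage.comp (N.bimod.collage.comp (T.conj _).lo (a.bimod.functor.lo m))
    (T.comp _).lo
  c m := DblCat.extend (D := N.bimod.collage) (a.bimod.functor.lo m) (T.conj _) (T.comp _)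
  dom_c m := DblCat.dom_extend _ _ _
  cod_c m := DblCat.cod_extend _ _ _
  cocart m := DblCat.isCocart_extend _ _ _

end

/-- The value of the restriction at a map of niches. -/
noncomputable def restrictMap {M N : Niche.{u}} (a : M ⟶ N) : M.restrict ⟶ N.restrict :=
  (transposes a).hetData.map

/-- The 2-cell of the restriction at a map of niches. -/
noncomputable def restrictCell {M N : Niche.{u}} (a : M ⟶ N) :
    M.proj ≫ a.bimod ⟶ restrictMap a ≫ N.proj :=
  (transposes a).hetData.cell

theorem restrict_ext {M N : Niche.{u}} (a : M ⟶ N) : Ext a (restrictMap a) (restrictCell a) :=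
  (transposes a).hetData.ext

end Niche

namespace CategoryTheory.Bicategory

section strict

variable {B : Type*} [Bicategory B] [Strict B] {a b c d : B}

theorem heq_comp_whiskerLeft (f : a ⟶ b) (g : b ⟶ c) {h h' : c ⟶ d} (η : h ⟶ h') :
    HEq ((f ≫ g) ◁ η) (f ◁ g ◁ η) := by
  rw [comp_whiskerLeft, Strict.associator_eqToIso, Strict.associator_eqToIso]
  simp

theorem heq_whiskerRight_comp {f f' : a ⟶ b} (η : f ⟶ f') (g : b ⟶ c) (h : c ⟶ d) :
    HEq (η ▷ (g ≫ h)) ((η ▷ g) ▷ h) := by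
  rw [whiskerRight_comp, Strict.associator_eqToIso, Strict.associator_eqToIso]
  simp

theorem heq_whisker_assoc (f : a ⟶ b) {g g' : b ⟶ c} (η : g ⟶ g') (h : c ⟶ d) :
    HEq ((f ◁ η) ▷ h) (f ◁ η ▷ h) := by
  rw [whisker_assoc, Strict.associator_eqToIso, Strict.associator_eqToIso]
  simp

end strict

variable {B : Type*} [Bicategory B] {a b c d e : B}

theorem whiskerLeft_heq (f : a ⟶ b) {g h g' h' : b ⟶ c} {η : g ⟶ h} {θ : g' ⟶ h'} (e : g = g')
    (e' : h = h') (w : HEq η θ) : HEq (f ◁ η) (f ◁ θ) := by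
  subst e e'
  cases w
  rfl

theorem whiskerRight_heq {f g f' g' : a ⟶ b} {η : f ⟶ g} {θ : f' ⟶ g'} (e : f = f')
    (e' : g = g') (w : HEq η θ) (h : b ⟶ c) : HEq (η ▷ h) (θ ▷ h) := by
  subst e e'
  cases w
  rfl

theorem whiskerLeft_heq_of_eq {f f' : a ⟶ b} (e : f = f') {g h : b ⟶ c} (η : g ⟶ h) :
    HEq (f ◁ η) (f' ◁ η) := by
  subst e; rfl

theorem eqToHom_heq {X : Type*} [Category* X] {x y x' y' : X} (h : x = y) (h' : x' = y') (e : x = x') :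
    HEq (eqToHom h) (eqToHom h') := by
  subst e h h'; rfl

theorem paste_whiskerLeft {M N P : B} {M' N' P' : B} {p : M' ⟶ M} {q : N' ⟶ N} {r : P' ⟶ P}
    {f : M ⟶ N} {g g' : N ⟶ P} {K : M' ⟶ N'} {L L' : N' ⟶ P'} (c : p ≫ f ⟶ K ≫ q)
    {d : q ≫ g ⟶ L ≫ r} {d' : q ≫ g' ⟶ L' ≫ r} {β : g ⟶ g'} {θ : L ⟶ L'}
    (h : d ≫ θ ▷ r = q ◁ β ≫ d') :
    ((α_ p f g).inv ≫ c ▷ g ≫ (α_ K q g).hom ≫ K ◁ d ≫ (α_ K L r).inv) ≫ (K ◁ θ) ▷ r =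
      p ◁ f ◁ β ≫ (α_ p f g').inv ≫ c ▷ g' ≫ (α_ K q g').hom ≫ K ◁ d' ≫ (α_ K L' r).inv := by
  calc _ = (α_ p f g).inv ≫ c ▷ g ≫ (α_ K q g).hom ≫ K ◁ (d ≫ θ ▷ r) ≫ (α_ K L' r).inv := by
        simp
    _ = (α_ p f g).inv ≫ (c ▷ g ≫ (K ≫ q) ◁ β) ≫ (α_ K q g').hom ≫ K ◁ d' ≫ (α_ K L' r).inv := by
        rw [h]; simp
    _ = _ := by rw [← whisker_exchange]; simp

theorem paste_whiskerRight {M N P : B} {M' N' P' : B} {p : M' ⟶ M} {q : N' ⟶ N} {r : P' ⟶ P}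
    {f f' : M ⟶ N} {g : N ⟶ P} {K K' : M' ⟶ N'} {L : N' ⟶ P'} {c : p ≫ f ⟶ K ≫ q}
    {c' : p ≫ f' ⟶ K' ≫ q} (d : q ≫ g ⟶ L ≫ r) {β : f ⟶ f'} {θ : K ⟶ K'}
    (h : c ≫ θ ▷ q = p ◁ β ≫ c') :
    ((α_ p f g).inv ≫ c ▷ g ≫ (α_ K q g).hom ≫ K ◁ d ≫ (α_ K L r).inv) ≫ (θ ▷ L) ▷ r =
      p ◁ β ▷ g ≫ (α_ p f' g).inv ≫ c' ▷ g ≫ (α_ K' q g).hom ≫ K' ◁ d ≫ (α_ K' L r).inv := by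
  calc _ = (α_ p f g).inv ≫ c ▷ g ≫ (α_ K q g).hom ≫ (K ◁ d ≫ θ ▷ (L ≫ r)) ≫ (α_ K' L r).inv := by
        simp
    _ = (α_ p f g).inv ≫ (c ≫ θ ▷ q) ▷ g ≫ (α_ K' q g).hom ≫ K' ◁ d ≫ (α_ K' L r).inv := by
        rw [whisker_exchange]; simp
    _ = _ := by rw [h]; simp

theorem paste_associator {M N P Q : B} {M' N' P' Q' : B} {p : M' ⟶ M} {q : N' ⟶ N} {r : P' ⟶ P}
    {s : Q' ⟶ Q} {f : M ⟶ N} {g : N ⟶ P} {h : P ⟶ Q} {K : M' ⟶ N'} {L : N' ⟶ P'} {R : P' ⟶ Q'}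
    (c : p ≫ f ⟶ K ≫ q) (d : q ≫ g ⟶ L ≫ r) (e : r ≫ h ⟶ R ≫ s) :
    ((α_ p (f ≫ g) h).inv ≫
        ((α_ p f g).inv ≫ c ▷ g ≫ (α_ K q g).hom ≫ K ◁ d ≫ (α_ K L r).inv) ▷ h ≫
        (α_ (K ≫ L) r h).hom ≫ (K ≫ L) ◁ e ≫ (α_ (K ≫ L) R s).inv) ≫ (α_ K L R).hom ▷ s =
      p ◁ (α_ f g h).hom ≫ (α_ p f (g ≫ h)).inv ≫ c ▷ (g ≫ h) ≫ (α_ K q (g ≫ h)).hom ≫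
        K ◁ ((α_ q g h).inv ≫ d ▷ h ≫ (α_ L r h).hom ≫ L ◁ e ≫ (α_ L R s).inv) ≫
          (α_ K (L ≫ R) s).inv := by
  simp only [comp_whiskerRight, whisker_assoc, whiskerLeft_comp, comp_whiskerLeft,
    whiskerRight_comp, Category.assoc]
  bicategory

theorem paste_leftUnitor {M N : B} {M' N' : B} {p : M' ⟶ M} {q : N' ⟶ N} {f : M ⟶ N}
    {K : M' ⟶ N'} (c : p ≫ f ⟶ K ≫ q) :
    ((α_ p (𝟙 M) f).inv ≫ ((ρ_ p).hom ≫ (λ_ p).inv) ▷ f ≫ (α_ (𝟙 M') p f).hom ≫ 𝟙 M' ◁ c ≫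
      (α_ (𝟙 M') K q).inv) ≫ (λ_ K).hom ▷ q = p ◁ (λ_ f).hom ≫ c := by
  simp

theorem paste_rightUnitor {M N : B} {M' N' : B} {p : M' ⟶ M} {q : N' ⟶ N} {f : M ⟶ N}
    {K : M' ⟶ N'} (c : p ≫ f ⟶ K ≫ q) :
    ((α_ p f (𝟙 N)).inv ≫ c ▷ 𝟙 N ≫ (α_ K q (𝟙 N)).hom ≫ K ◁ ((ρ_ q).hom ≫ (λ_ q).inv) ≫
      (α_ K (𝟙 N') q).inv) ≫ (ρ_ K).hom ▷ q = p ◁ (ρ_ f).hom ≫ c := by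
  simp

end CategoryTheory.Bicategory

namespace Niche

open LooseBimod

theorem fiberMap₂_eqToHom {M N : LooseBimod.{u}} {F G : M ⟶ N} (h : F = G) (i : Side.{u}) :
    fiberMap₂ (eqToHom h) i = eqToHom (congrArg (fiberMap · i) h) := by
  subst h; rfl

theorem whiskerLeft_eqToHom' {A B C : DblCat.{u}} (f : A ⟶ B) {g h : B ⟶ C} (e : g = h) :
    f ◁ eqToHom e = eqToHom (congrArg (f ≫ ·) e) := by
  subst e; exact whiskerLeft_id _ _

theorem eqToHom_whiskerRight' {A B C : DblCat.{u}} {f g : A ⟶ B} (e : f = g) (h : B ⟶ C) :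
    eqToHom e ▷ h = eqToHom (congrArg (· ≫ h) e) := by
  subst e; exact id_whiskerRight _ _

/-- A 2-cell between extensions lifts a 2-cell of niches. -/
structure IsLift {M N : Niche.{u}} {a b : M ⟶ N} {K L : M.restrict ⟶ N.restrict}
    (c : M.proj ≫ a.bimod ⟶ K ≫ N.proj) (d : M.proj ≫ b.bimod ⟶ L ≫ N.proj) (β : a ⟶ b)
    (θ : K ⟶ L) : Prop where
  ends (i : Side.{u}) : HEq (M.inc i ◁ fiberMap₂ θ i) (Hom₂.f β i ▷ N.inc i)
  cell : c ≫ θ ▷ N.proj = M.proj ◁ Hom₂.bimod β ≫ d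

namespace IsLift

variable {M N P Q : Niche.{u}} {a b e : M ⟶ N} {K L J : M.restrict ⟶ N.restrict}
  {c : M.proj ≫ a.bimod ⟶ K ≫ N.proj} {d : M.proj ≫ b.bimod ⟶ L ≫ N.proj}
  {j : M.proj ≫ e.bimod ⟶ J ≫ N.proj}

theorem unique (h : Ext a K c) {β : a ⟶ b} {θ θ' : K ⟶ L} (l : IsLift c d β θ)
    (l' : IsLift c d β θ') : θ = θ' :=
  h.hom_ext (fun i => eq_of_heq ((l.ends i).trans (l'.ends i).symm)) (l.cell.trans l'.cell.symm)

theorem id (h : Ext a K c) : IsLift c c (𝟙 a) (𝟙 K) where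
  ends i := by
    have e : M.inc i ◁ fiberMap₂ (𝟙 K) i = 𝟙 _ := whiskerLeft_id _ _
    have e' : Hom₂.f (𝟙 a) i ▷ N.inc i = 𝟙 _ := id_whiskerRight _ _
    rw [e, e', h.ends i]
  cell := by
    have e : Hom₂.bimod (𝟙 a) = 𝟙 a.bimod := rfl
    rw [e]
    simp

theorem comp (h : Ext a K c) (h' : Ext b L d) (h'' : Ext e J j) {β : a ⟶ b} {γ : b ⟶ e}
    {θ : K ⟶ L} {ψ : L ⟶ J}
    (l : IsLift c d β θ) (l' : IsLift d j γ ψ) : IsLift c j (β ≫ γ) (θ ≫ ψ) where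
  ends i := by
    have e : M.inc i ◁ fiberMap₂ (θ ≫ ψ) i = M.inc i ◁ fiberMap₂ θ i ≫ M.inc i ◁ fiberMap₂ ψ i :=
      whiskerLeft_comp (M.inc i) (fiberMap₂ θ i) (fiberMap₂ ψ i)
    have e' : Hom₂.f (β ≫ γ) i ▷ N.inc i = Hom₂.f β i ▷ N.inc i ≫ Hom₂.f γ i ▷ N.inc i :=
      comp_whiskerRight _ _ _
    rw [e, e']
    exact DblTrans.comp_heq (h.ends i) (h'.ends i) (h''.ends i) (l.ends i) (l'.ends i)
  cell := by
    have e : Hom₂.bimod (β ≫ γ) = Hom₂.bimod β ≫ Hom₂.bimod γ := rfl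
    rw [e, comp_whiskerRight, ← Category.assoc, l.cell, Category.assoc, l'.cell]
    simp

theorem of_eqToHom (h : Ext a K c) (p : a = b) (q : K = L)
    (w : c ≫ eqToHom q ▷ N.proj = M.proj ◁ Hom₂.bimod (eqToHom p) ≫ d) :
    IsLift c d (eqToHom p) (eqToHom q) where
  ends i := by
    rw [fiberMap₂_eqToHom, whiskerLeft_eqToHom', eqToHom_f, eqToHom_whiskerRight']
    exact eqToHom_heq _ _ (h.ends i)
  cell := w

variable {f f' : N ⟶ P} {R R' : N.restrict ⟶ P.restrict}
  {k : N.proj ≫ f.bimod ⟶ R ≫ P.proj} {k' : N.proj ≫ f'.bimod ⟶ R' ≫ P.proj}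

/-- The composite of 2-cells of extensions. -/
abbrev _root_.Niche.pasteCell (c : M.proj ≫ a.bimod ⟶ K ≫ N.proj)
    (k : N.proj ≫ f.bimod ⟶ R ≫ P.proj) : M.proj ≫ (a ≫ f).bimod ⟶ (K ≫ R) ≫ P.proj :=
  (α_ M.proj a.bimod f.bimod).inv ≫ c ▷ f.bimod ≫ (α_ K N.proj f.bimod).hom ≫ K ◁ k ≫
    (α_ K R P.proj).inv

theorem whiskerLeft (h : Ext a K c) (m : Ext f R k) (m' : Ext f' R' k') {β : f ⟶ f'} {θ : R ⟶ R'}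
    (l : IsLift k k' β θ) : IsLift (pasteCell c k) (pasteCell c k') (a ◁ β) (K ◁ θ) where
  ends i := by
    have := DblCat.strict.{u}
    refine (heq_comp_whiskerLeft (M.inc i) (fiberMap K i) (fiberMap₂ θ i)).symm.trans ?_
    refine (whiskerLeft_heq_of_eq (h.ends i) _).trans ?_
    refine (heq_comp_whiskerLeft (a.f i) (N.inc i) (fiberMap₂ θ i)).trans ?_
    refine (whiskerLeft_heq (a.f i) (m.ends i) (m'.ends i) (l.ends i)).trans ?_
    exact (heq_whisker_assoc (a.f i) (Hom₂.f β i) (P.inc i)).symm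
  cell := paste_whiskerLeft c l.cell

theorem whiskerRight (h : Ext a K c) (h' : Ext b L d) (m : Ext f R k) {β : a ⟶ b} {θ : K ⟶ L}
    (l : IsLift c d β θ) : IsLift (pasteCell c k) (pasteCell d k) (β ▷ f) (θ ▷ R) where
  ends i := by
    have := DblCat.strict.{u}
    refine (heq_whisker_assoc (M.inc i) (fiberMap₂ θ i) (fiberMap R i)).symm.trans ?_
    refine (whiskerRight_heq (h.ends i) (h'.ends i) (l.ends i) (fiberMap R i)).trans ?_
    refine (heq_whiskerRight_comp (Hom₂.f β i) (N.inc i) (fiberMap R i)).symm.trans ?_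
    rw [m.ends i]
    exact heq_whiskerRight_comp (Hom₂.f β i) (f.f i) (P.inc i)
  cell := paste_whiskerRight k l.cell

theorem associator {g : P ⟶ Q} {S : P.restrict ⟶ Q.restrict} {s : P.proj ≫ g.bimod ⟶ S ≫ Q.proj}
    (h : Ext a K c) (m : Ext f R k) (n : Ext g S s) :
    IsLift (pasteCell (pasteCell c k) s) (pasteCell c (pasteCell k s)) (α_ a f g).hom
      (α_ K R S).hom := by
  have e : (α_ a f g).hom = eqToHom (Niche.strict.assoc a f g) :=
    congrArg Iso.hom (Niche.strict.associator_eqToIso a f g)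
  have e' : (α_ K R S).hom = eqToHom (LooseBimod.strict.assoc K R S) :=
    congrArg Iso.hom (LooseBimod.strict.associator_eqToIso K R S)
  have w := paste_associator c k s
  rw [e, e']
  refine of_eqToHom ((h.comp m).comp n) _ _ ?_
  rw [← e, ← e']
  exact w

theorem leftUnitor (h : Ext a K c) :
    IsLift (pasteCell ((ρ_ M.proj).hom ≫ (λ_ M.proj).inv) c) c (a := 𝟙 M ≫ a) (K := 𝟙 M.restrict ≫ K)
      (λ_ a).hom (λ_ K).hom := by
  have e : (λ_ a).hom = eqToHom (Niche.strict.id_comp a) :=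
    congrArg Iso.hom (Niche.strict.leftUnitor_eqToIso a)
  have e' : (λ_ K).hom = eqToHom (LooseBimod.strict.id_comp K) :=
    congrArg Iso.hom (LooseBimod.strict.leftUnitor_eqToIso K)
  have w := paste_leftUnitor c
  rw [e, e']
  refine of_eqToHom ((Ext.id M).comp h) _ _ ?_
  rw [← e, ← e']
  exact w

theorem rightUnitor (h : Ext a K c) :
    IsLift (pasteCell c ((ρ_ N.proj).hom ≫ (λ_ N.proj).inv)) c (a := a ≫ 𝟙 N) (K := K ≫ 𝟙 N.restrict)
      (ρ_ a).hom (ρ_ K).hom := by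
  have e : (ρ_ a).hom = eqToHom (Niche.strict.comp_id a) :=
    congrArg Iso.hom (Niche.strict.rightUnitor_eqToIso a)
  have e' : (ρ_ K).hom = eqToHom (LooseBimod.strict.comp_id K) :=
    congrArg Iso.hom (LooseBimod.strict.rightUnitor_eqToIso K)
  have w := paste_rightUnitor c
  rw [e, e']
  refine of_eqToHom (h.comp (Ext.id N)) _ _ ?_
  rw [← e, ← e']
  exact w

end IsLift

namespace Ext

variable {M N : Niche.{u}} {a b : M ⟶ N} {K L : M.restrict ⟶ N.restrict}
  {c : M.proj ≫ a.bimod ⟶ K ≫ N.proj} {d : M.proj ≫ b.bimod ⟶ L ≫ N.proj}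

theorem exists_isLift (h : Ext a K c) (h' : Ext b L d) (β : a ⟶ b) :
    ∃ θ : K ⟶ L, IsLift c d β θ :=
  let ⟨θ, e, w⟩ := h.exists_hom h' β
  ⟨θ, e, w⟩

/-- The 2-cell between extensions that lifts a 2-cell of niches. -/
noncomputable def lift (h : Ext a K c) (h' : Ext b L d) (β : a ⟶ b) : K ⟶ L :=
  (h.exists_isLift h' β).choose

theorem isLift (h : Ext a K c) (h' : Ext b L d) (β : a ⟶ b) : IsLift c d β (h.lift h' β) :=
  (h.exists_isLift h' β).choose_spec

theorem eq_lift (h : Ext a K c) (h' : Ext b L d) {β : a ⟶ b} {θ : K ⟶ L} (l : IsLift c d β θ) :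
    θ = h.lift h' β := l.unique h (h.isLift h' β)

theorem lift_comp {e : M ⟶ N} {J : M.restrict ⟶ N.restrict} {j : M.proj ≫ e.bimod ⟶ J ≫ N.proj}
    (h : Ext a K c) (h' : Ext b L d) (h'' : Ext e J j) (β : a ⟶ b) (γ : b ⟶ e) :
    h.lift h' β ≫ h'.lift h'' γ = h.lift h'' (β ≫ γ) :=
  h.eq_lift h'' (IsLift.comp h h' h'' (h.isLift h' β) (h'.isLift h'' γ))

theorem lift_id (h : Ext a K c) : h.lift h (𝟙 a) = 𝟙 K := (h.eq_lift h (IsLift.id h)).symm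

/-- Extensions of a map of niches are isomorphic. -/
@[simps]
noncomputable def iso {d : M.proj ≫ a.bimod ⟶ L ≫ N.proj} (h : Ext a K c) (h' : Ext a L d) :
    K ≅ L where
  hom := h.lift h' (𝟙 a)
  inv := h'.lift h (𝟙 a)
  hom_inv_id := by rw [lift_comp, Category.id_comp, lift_id]
  inv_hom_id := by rw [lift_comp, Category.id_comp, lift_id]

end Ext

end Niche

namespace Niche

open LooseBimod

theorem restrictId_ext (N : Niche.{u}) :
    Ext (𝟙 N) (𝟙 N.restrict) ((ρ_ N.proj).hom ≫ (λ_ N.proj).inv) := Ext.id N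

theorem restrictComp_ext {M N P : Niche.{u}} (a : M ⟶ N) (b : N ⟶ P) :
    Ext (a ≫ b) (restrictMap a ≫ restrictMap b) (pasteCell (restrictCell a) (restrictCell b)) :=
  (restrict_ext a).comp (restrict_ext b)

theorem exists_eq_conj {X : Type*} [Category* X] {x y x' y' : X} {f : x ⟶ y} {g : x' ⟶ y'}
    (e : x = x') (e' : y = y') (h : HEq f g) :
    ∃ (p : x = x') (q : y' = y), f = eqToHom p ≫ g ≫ eqToHom q := by
  subst e e'
  cases h
  exact ⟨rfl, rfl, by simp⟩

theorem exists_eq_eqToHom {X : Type*} [Category* X] {x y x' : X} {f : x ⟶ y}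
    (e : x = x') (e' : y = x') (h : HEq f (𝟙 x')) : ∃ p : x = y, f = eqToHom p := by
  subst e' 
  subst e
  exact ⟨rfl, by simpa using eq_of_heq h⟩

theorem lift_id_ends {M N : Niche.{u}} {a : M ⟶ N} {K L : M.restrict ⟶ N.restrict}
    {c : M.proj ≫ a.bimod ⟶ K ≫ N.proj} {d : M.proj ≫ a.bimod ⟶ L ≫ N.proj} (h : Ext a K c)
    (h' : Ext a L d) (i : Side.{u}) :
    ∃ p, M.inc i ◁ fiberMap₂ (h.lift h' (𝟙 a)) i = eqToHom p := by
  refine exists_eq_eqToHom (h.ends i) (h'.ends i) (((h.isLift h' (𝟙 a)).ends i).trans ?_)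
  exact heq_of_eq (id_whiskerRight _ _)

theorem lift_id_cell {M N : Niche.{u}} {a : M ⟶ N} {K L : M.restrict ⟶ N.restrict}
    {c : M.proj ≫ a.bimod ⟶ K ≫ N.proj} {d : M.proj ≫ a.bimod ⟶ L ≫ N.proj} (h : Ext a K c)
    (h' : Ext a L d) : c ≫ h.lift h' (𝟙 a) ▷ N.proj = d := by
  refine (h.isLift h' (𝟙 a)).cell.trans ?_
  have e : Hom₂.bimod (𝟙 a) = 𝟙 a.bimod := rfl
  rw [e, whiskerLeft_id, Category.id_comp]

theorem whiskerLeft_lift {M N P : Niche.{u}} {a : M ⟶ N} {f f' : N ⟶ P}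
    {K : M.restrict ⟶ N.restrict} {R R' : N.restrict ⟶ P.restrict}
    {c : M.proj ≫ a.bimod ⟶ K ≫ N.proj} {k : N.proj ≫ f.bimod ⟶ R ≫ P.proj}
    {k' : N.proj ≫ f'.bimod ⟶ R' ≫ P.proj} (h : Ext a K c) (m : Ext f R k) (m' : Ext f' R' k')
    (β : f ⟶ f') : K ◁ m.lift m' β = (h.comp m).lift (h.comp m') (a ◁ β) :=
  (h.comp m).eq_lift (h.comp m') (IsLift.whiskerLeft h m m' (m.isLift m' β))

theorem lift_whiskerRight {M N P : Niche.{u}} {a b : M ⟶ N} {f : N ⟶ P}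
    {K L : M.restrict ⟶ N.restrict} {R : N.restrict ⟶ P.restrict}
    {c : M.proj ≫ a.bimod ⟶ K ≫ N.proj} {d : M.proj ≫ b.bimod ⟶ L ≫ N.proj}
    {k : N.proj ≫ f.bimod ⟶ R ≫ P.proj} (h : Ext a K c) (h' : Ext b L d) (m : Ext f R k)
    (β : a ⟶ b) : h.lift h' β ▷ R = (h.comp m).lift (h'.comp m) (β ▷ f) :=
  (h.comp m).eq_lift (h'.comp m) (IsLift.whiskerRight h h' m (h.isLift h' β))

theorem lift_comp₃ {M N : Niche.{u}} {a₀ a₁ a₂ a₃ : M ⟶ N} {K₀ K₁ K₂ K₃ : M.restrict ⟶ N.restrict}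
    {c₀ : M.proj ≫ a₀.bimod ⟶ K₀ ≫ N.proj} {c₁ : M.proj ≫ a₁.bimod ⟶ K₁ ≫ N.proj}
    {c₂ : M.proj ≫ a₂.bimod ⟶ K₂ ≫ N.proj} {c₃ : M.proj ≫ a₃.bimod ⟶ K₃ ≫ N.proj}
    (h₀ : Ext a₀ K₀ c₀) (h₁ : Ext a₁ K₁ c₁) (h₂ : Ext a₂ K₂ c₂) (h₃ : Ext a₃ K₃ c₃) {β₀ : a₀ ⟶ a₁}
    {β₁ : a₁ ⟶ a₂} {β₂ : a₂ ⟶ a₃} {β : a₀ ⟶ a₃} (w : β₀ ≫ β₁ ≫ β₂ = β) :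
    h₀.lift h₁ β₀ ≫ h₁.lift h₂ β₁ ≫ h₂.lift h₃ β₂ = h₀.lift h₃ β := by
  rw [h₁.lift_comp h₂ h₃, h₀.lift_comp h₁ h₃, w]

/-- Restriction along chosen conjoints and companions. -/
noncomputable def restriction : Restriction.{u} where
  map a := restrictMap a
  map₂ {M N a b} β := (restrict_ext a).lift (restrict_ext b) β
  map₂_id a := (restrict_ext a).lift_id
  map₂_comp {M N a b c} β γ :=
    ((restrict_ext a).lift_comp (restrict_ext b) (restrict_ext c) β γ).symm
  mapId N := (restrict_ext (𝟙 N)).iso (restrictId_ext N)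
  mapComp a b := (restrict_ext (a ≫ b)).iso (restrictComp_ext a b)
  map₂_whisker_left {M N P} a {b c} β := by
    rw [whiskerLeft_lift (restrict_ext a)]
    exact (lift_comp₃ (restrict_ext (a ≫ b)) (restrictComp_ext a b) (restrictComp_ext a c)
      (restrict_ext (a ≫ c)) (by simp)).symm
  map₂_whisker_right {M N P a b} β c := by
    rw [lift_whiskerRight (restrict_ext a) (restrict_ext b) (restrict_ext c)]
    exact (lift_comp₃ (restrict_ext (a ≫ c)) (restrictComp_ext a c) (restrictComp_ext b c)
      (restrict_ext (b ≫ c)) (by simp)).symm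
  map₂_associator {M N P Q} a b c := by
    have e := ((restrict_ext a).comp (restrict_ext b)).comp (restrict_ext c) |>.eq_lift
      ((restrict_ext a).comp ((restrict_ext b).comp (restrict_ext c)))
      (IsLift.associator (restrict_ext a) (restrict_ext b) (restrict_ext c))
    have e1 := lift_whiskerRight (restrict_ext (a ≫ b)) (restrictComp_ext a b) (restrict_ext c)
      (𝟙 (a ≫ b))
    have e2 := whiskerLeft_lift (restrict_ext a) (restrictComp_ext b c) (restrict_ext (b ≫ c))
      (𝟙 (b ≫ c))
    simp only [Ext.iso_hom, Ext.iso_inv]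
    rw [e, e1, e2]
    refine Eq.symm ((congrArg (fun t => _ ≫ _ ≫ t) (lift_comp₃ (restrictComp_ext a b |>.comp (restrict_ext c)) ((restrict_ext a).comp (restrictComp_ext b c)) ((restrict_ext a).comp (restrict_ext (b ≫ c)))
      (restrict_ext (a ≫ b ≫ c)) (β := (α_ a b c).hom) (by simp))).trans ?_)
    exact lift_comp₃ (restrict_ext ((a ≫ b) ≫ c)) (restrictComp_ext (a ≫ b) c)
      (restrictComp_ext a b |>.comp (restrict_ext c)) (restrict_ext (a ≫ b ≫ c)) (by simp)
  map₂_left_unitor {M N} a := by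
    have e := ((Ext.id M).comp (restrict_ext a)).eq_lift (restrict_ext a)
      (IsLift.leftUnitor (restrict_ext a))
    have e1 := lift_whiskerRight (restrict_ext (𝟙 M)) (restrictId_ext M) (restrict_ext a) (𝟙 (𝟙 M))
    simp only [Ext.iso_hom, Ext.iso_inv]
    rw [e, e1]
    exact (lift_comp₃ (restrict_ext (𝟙 M ≫ a)) (restrictComp_ext (𝟙 M) a)
      ((restrictId_ext M).comp (restrict_ext a)) (restrict_ext a) (by simp)).symm
  map₂_right_unitor {M N} a := by
    have e := ((restrict_ext a).comp (Ext.id N)).eq_lift (restrict_ext a)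
      (IsLift.rightUnitor (restrict_ext a))
    have e1 := whiskerLeft_lift (restrict_ext a) (restrict_ext (𝟙 N)) (restrictId_ext N) (𝟙 (𝟙 N))
    simp only [Ext.iso_hom, Ext.iso_inv]
    rw [e, e1]
    exact (lift_comp₃ (restrict_ext (a ≫ 𝟙 N)) (restrictComp_ext a (𝟙 N))
      ((restrict_ext a).comp (restrictId_ext N)) (restrict_ext a) (by simp)).symm
  cell a := restrictCell a
  cell_naturality {M N a b} β := ((restrict_ext a).isLift (restrict_ext b) β).cell.symm
  cell_id N := lift_id_cell (restrict_ext (𝟙 N)) (restrictId_ext N)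
  cell_comp a b := lift_id_cell (restrict_ext (a ≫ b)) (restrictComp_ext a b)
  map_ends a := (restrict_ext a).ends
  map₂_ends {M N a b} β i := exists_eq_conj ((restrict_ext a).ends i) ((restrict_ext b).ends i)
    (((restrict_ext a).isLift (restrict_ext b) β).ends i)
  mapId_ends N i := lift_id_ends (restrict_ext (𝟙 N)) (restrictId_ext N) i
  mapComp_ends a b i := lift_id_ends (restrict_ext (a ≫ b)) (restrictComp_ext a b) i
  cell_ends a i := exists_eq_conj (source_eq a i) ((restrict_ext a).target_eq i)
    ((restrict_ext a).cell i)
  cell_het a := ⟨(transposes a).conj, (transposes a).comp, fun m => ⟨rfl, Category.comp_id _⟩⟩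

end Niche

namespace DblCat

variable {P D E : DblCat.{u}}

theorem sq_zigzag (F : DblFunctor P D) {x y : P.Obj} {l : P.Lo x y}
    (eta : LoArr.mk (P.unit x) ⟶ LoArr.mk l) (eps : LoArr.mk l ⟶ LoArr.mk (P.unit y))
    (h : P.cod eta = P.dom eps) (hd : P.dom eta = 𝟙 x) (hc : P.cod eps = 𝟙 y)
    (h' : D.cod ((F.unitIso x).hom ≫ F.sq eta) = D.dom (F.sq eps ≫ (F.unitIso y).inv)) :
    F.sq ((P.leftUnitor l).inv ≫ P.compSq eta eps h ≫ (P.rightUnitor l).hom) =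
      (D.leftUnitor (F.lo l)).inv ≫ D.compSq ((F.unitIso x).hom ≫ F.sq eta)
        (F.sq eps ≫ (F.unitIso y).inv) h' ≫ (D.rightUnitor (F.lo l)).hom := by
  have hd : D.dom (F.unitIso y).inv = 𝟙 _ := dom_inv _ _ (by simp)
  have e : D.compSq ((F.unitIso x).hom ≫ F.sq eta) (F.sq eps ≫ (F.unitIso y).inv) h' =
      rw' (F.unitIso x).hom (F.lo l) (by simp) ≫ D.compSq (F.sq eta) (F.sq eps) (by simp [h]) ≫
        lw (F.lo l) (F.unitIso y).inv hd := by
    unfold lw rw'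
    rw [compSq_compSq, compSq_compSq]
    exact compSq_congr _ (by simp) (by simp)
  have h1 := F.map_leftUnitor l
  have h2 := F.map_rightUnitor l
  have h3 := F.compIso_naturality eta eps h
  have h6 : lw (F.lo l) (F.unitIso y).inv hd ≫ lw (F.lo l) (F.unitIso y).hom (by simp) =
      𝟙 _ := by
    rw [← lw_comp, ← lw_id]; unfold lw; exact compSq_congr _ rfl (Iso.inv_hom_id _)
  change rw' (F.unitIso x).hom (F.lo l) (by simp) ≫ _ = _ at h1
  change lw (F.lo l) (F.unitIso y).hom (by simp) ≫ _ = _ at h2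
  rw [e, ← h2, Category.assoc, Category.assoc, reassoc_of% h6, reassoc_of% h3, Iso.eq_inv_comp, ← h1,
    Category.assoc, Category.assoc, ← F.sq_comp, ← F.sq_comp, Iso.hom_inv_id_assoc]

end DblCat

namespace DblFunctor.IsJoint

open DblCat

variable {P D E : DblCat.{u}} {p : DblFunctor P D} {q : DblFunctor P E}

theorem exists_companion (h : IsJoint p q) {x y : P.Obj} {f : x ⟶ y}
    (C : Companion (p.tight.map f)) (C' : Companion (q.tight.map f)) :
    ∃ K : Companion f, K.map p = C ∧ K.map q = C' := by
  obtain ⟨l, eta, eps, c1, c2, c3, c4, c5, c6⟩ := C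
  obtain ⟨l', eta', eps', c1', c2', c3', c4', c5', c6'⟩ := C'
  obtain ⟨k, rfl, rfl⟩ := h.lo l l'
  obtain ⟨η, hη, hη'⟩ := h.sq ((p.unitIso x).inv ≫ eta) ((q.unitIso x).inv ≫ eta')
  obtain ⟨δ, hδ, hδ'⟩ := h.sq (eps ≫ (p.unitIso y).hom) (eps' ≫ (q.unitIso y).hom)
  have e1 : (p.unitIso x).hom ≫ p.sq η = eta := by rw [hη]; simp
  have e1' : (q.unitIso x).hom ≫ q.sq η = eta' := by rw [hη']; simp
  have e2 : p.sq δ ≫ (p.unitIso y).inv = eps := by rw [hδ]; simp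
  have e2' : q.sq δ ≫ (q.unitIso y).inv = eps' := by rw [hδ']; simp
  have hd : D.dom (p.unitIso y).inv = 𝟙 _ := dom_inv _ _ (by simp)
  have hc : D.cod (p.unitIso y).inv = 𝟙 _ := cod_inv _ _ (by simp)
  have hd' : E.dom (q.unitIso y).inv = 𝟙 _ := dom_inv _ _ (by simp)
  have hc' : E.cod (q.unitIso y).inv = 𝟙 _ := cod_inv _ _ (by simp)
  subst e1 e1' e2 e2'
  have k1 : P.dom η = 𝟙 x := h.map_ext (by rw [← p.dom_sq]; simpa using c1)
    (by rw [← q.dom_sq]; simpa using c1')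
  have k2 : P.cod η = f := h.map_ext (by rw [← p.cod_sq]; simpa using c2)
    (by rw [← q.cod_sq]; simpa using c2')
  have k3 : P.dom δ = f := h.map_ext (by rw [← p.dom_sq]; simpa [hd] using c3)
    (by rw [← q.dom_sq]; simpa [hd'] using c3')
  have k4 : P.cod δ = 𝟙 y := h.map_ext (by rw [← p.cod_sq]; simpa [hc] using c4)
    (by rw [← q.cod_sq]; simpa [hc'] using c4')
  refine ⟨⟨k, η, δ, k1, k2, k3, k4, h.sq_ext ?_ ?_, h.sq_ext ?_ ?_⟩, rfl, rfl⟩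
  · rw [p.sq_unitSq, ← c5, p.sq_comp]; simp
  · rw [q.sq_unitSq, ← c5', q.sq_comp]; simp
  · exact (sq_zigzag p η δ _ k1 k4 _).trans (c6.trans (p.sq_id _).symm)
  · exact (sq_zigzag q η δ _ k1 k4 _).trans (c6'.trans (q.sq_id _).symm)

theorem isIso (h : IsJoint p q) {x y x' y' : P.Obj} {m : P.Lo x y} {n : P.Lo x' y'}
    (α : LoArr.mk m ⟶ LoArr.mk n) (hp : IsIso (p.sq α)) (hq : IsIso (q.sq α)) : IsIso α := by
  obtain ⟨i, h1, h2⟩ := h.iso (asIso (p.sq α)) (asIso (q.sq α))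
  have : α = i.hom := h.sq_ext h1.symm h2.symm
  rw [this]
  infer_instance

theorem _root_.DblCat.IsCompanionCommuter.exists_of_eq {x y x' y' : D.Obj} {m : D.Lo x y}
    {n : D.Lo x' y'} {α : LoArr.mk m ⟶ LoArr.mk n} {f : x ⟶ x'} {g : y ⟶ y'}
    (hf : D.dom α = f) (hg : D.cod α = g) (h : IsCompanionCommuter α) :
    ∃ (C₀ : Companion f) (C₁ : Companion g), IsIso (Companion.transpose α C₀ C₁ hf hg) := by
  subst hf hg
  exact h

theorem _root_.DblCat.Companion.transpose_map (F : DblFunctor P D) {x y x' y' : P.Obj} {m : P.Lo x y}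
    {n : P.Lo x' y'} (α : LoArr.mk m ⟶ LoArr.mk n) {f : x ⟶ x'} {g : y ⟶ y'}
    (C₀ : Companion f) (C₁ : Companion g) (hf : P.dom α = f) (hg : P.cod α = g) :
    Companion.transpose (F.sq α) (C₀.map F) (C₁.map F) ((F.dom_sq α).trans (congrArg _ hf))
      ((F.cod_sq α).trans (congrArg _ hg)) =
      (F.compIso m C₁.lo).hom ≫ F.sq (Companion.transpose α C₀ C₁ hf hg) ≫
        (F.compIso C₀.lo n).inv := by
  have e := Companion.χ_transpose_κ α C₀ C₁ hf hg
  have hd := Companion.dom_transpose α C₀ C₁ hf hg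
  have hc := Companion.cod_transpose α C₀ C₁ hf hg
  generalize Companion.transpose α C₀ C₁ hf hg = s at e hd hc
  have hd1 : D.dom (F.compIso C₀.lo n).inv = 𝟙 _ := dom_inv _ _ (by simp)
  have hc1 : D.cod (F.compIso C₀.lo n).inv = 𝟙 _ := cod_inv _ _ (by simp)
  have k1 := C₁.map_χ F m
  have k2 := C₀.map_κ F n
  have vd : D.dom ((F.compIso m C₁.lo).hom ≫ F.sq s ≫ (F.compIso C₀.lo n).inv) = 𝟙 _ := by
    simp [hd, hd1]
  have vc : D.cod ((F.compIso m C₁.lo).hom ≫ F.sq s ≫ (F.compIso C₀.lo n).inv) = 𝟙 _ := by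
    simp [hc, hc1]
  refine Companion.transpose_unique (F.sq α) (C₀.map F) (C₁.map F) _ _ _ vd vc ?_
  · refine Eq.trans ?_ (congrArg F.sq e)
    rw [F.sq_comp, F.sq_comp, ← k1, ← k2]
    generalize (Companion.map F C₁).χ (F.lo m) = a
    generalize (Companion.map F C₀).κ (F.lo n) = b
    change LoArr.mk (D.comp (F.lo C₀.lo) (F.lo n)) ⟶ _ at b
    change _ ⟶ LoArr.mk (D.comp (F.lo m) (F.lo C₁.lo)) at a
    exact (congrArg (a ≫ ·) ((Category.assoc _ _ _).trans
      (congrArg _ (Category.assoc _ _ _)))).trans (Category.assoc _ _ _).symm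

theorem isIso_of_conj {X : Type*} [Category* X] {a b c d : X} (i : a ≅ b) {f : b ⟶ c} (j : d ≅ c)
    (h : IsIso (i.hom ≫ f ≫ j.inv)) : IsIso f := by
  have : f = i.inv ≫ (i.hom ≫ f ≫ j.inv) ≫ j.hom := by simp
  rw [this]
  infer_instance

theorem isCompanionCommuter (h : IsJoint p q) {x y x' y' : P.Obj} {m : P.Lo x y} {n : P.Lo x' y'}
    (α : LoArr.mk m ⟶ LoArr.mk n) (hp : IsCompanionCommuter (p.sq α))
    (hq : IsCompanionCommuter (q.sq α)) : IsCompanionCommuter α := by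
  obtain ⟨C₀, C₁, hC⟩ := hp.exists_of_eq (p.dom_sq α) (p.cod_sq α)
  obtain ⟨K₀, K₁, hK⟩ := hq.exists_of_eq (q.dom_sq α) (q.cod_sq α)
  obtain ⟨L₀, rfl, rfl⟩ := h.exists_companion C₀ K₀
  obtain ⟨L₁, rfl, rfl⟩ := h.exists_companion C₁ K₁
  have e1 := Companion.transpose_map p α L₀ L₁ rfl rfl
  have e2 := Companion.transpose_map q α L₀ L₁ rfl rfl
  rw [e1] at hC
  rw [e2] at hK
  exact ⟨L₀, L₁, h.isIso _ (isIso_of_conj (p.compIso m L₁.lo) (p.compIso L₀.lo n) hC)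
    (isIso_of_conj (q.compIso m L₁.lo) (q.compIso L₀.lo n) hK)⟩

theorem hop (h : IsJoint p q) : IsJoint (hopFunctor p) (hopFunctor q) where
  obj_ext e e' := h.obj_ext e e'
  map f g := h.map f g
  map_ext e e' := h.map_ext e e'
  lo m n := h.lo m n
  lo_ext e e' := h.lo_ext e e'
  sq α β := h.sq α β
  sq_ext e e' := h.sq_ext e e'

theorem isConjointCommuter (h : IsJoint p q) {x y x' y' : P.Obj} {m : P.Lo x y} {n : P.Lo x' y'}
    (α : LoArr.mk m ⟶ LoArr.mk n) (hp : IsConjointCommuter (p.sq α))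
    (hq : IsConjointCommuter (q.sq α)) : IsConjointCommuter α :=
  (isConjointCommuter_iff _).2 (h.hop.isCompanionCommuter (x := y) (y := x) (x' := y') (y' := x')
    (hopSq α) ((isConjointCommuter_iff _).1 hp) ((isConjointCommuter_iff _).1 hq))

end DblFunctor.IsJoint

namespace DblTrans

variable {D E : DblCat.{u}}

theorem eqToHom_isCompanionCommuter {F G : D ⟶ E} (h : F = G) :
    DblTrans.IsCompanionCommuter (eqToHom h) := by
  subst h
  exact isCompanionCommuter_of_sq _ fun m => DblCat.IsCompanionCommuter.id _

theorem eqToHom_isConjointCommuter {F G : D ⟶ E} (h : F = G) :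
    DblTrans.IsConjointCommuter (eqToHom h) := by
  subst h
  exact isConjointCommuter_of_sq _ fun m => DblCat.IsConjointCommuter.id _

theorem isCompanionCommuter_of_isJoint {Z P D E : DblCat.{u}} {p : P ⟶ D} {q : P ⟶ E}
    (h : DblFunctor.IsJoint p q) {F G : Z ⟶ P} (α : F ⟶ G)
    (hp : DblTrans.IsCompanionCommuter (α ▷ p)) (hq : DblTrans.IsCompanionCommuter (α ▷ q)) :
    DblTrans.IsCompanionCommuter α :=
  isCompanionCommuter_of_sq _ fun m => h.isCompanionCommuter _ (hp.2 m) (hq.2 m)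

theorem isConjointCommuter_of_isJoint {Z P D E : DblCat.{u}} {p : P ⟶ D} {q : P ⟶ E}
    (h : DblFunctor.IsJoint p q) {F G : Z ⟶ P} (α : F ⟶ G)
    (hp : DblTrans.IsConjointCommuter (α ▷ p)) (hq : DblTrans.IsConjointCommuter (α ▷ q)) :
    DblTrans.IsConjointCommuter α :=
  isConjointCommuter_of_sq _ fun m => h.isConjointCommuter _ (hp.2 m) (hq.2 m)

end DblTrans

theorem DblFunctor.IsJoint.sq_hext {P D E : DblCat.{u}} {p : DblFunctor P D} {q : DblFunctor P E}
    (h : DblFunctor.IsJoint p q) {x y z w x' y' z' w' : P.Obj} {m : P.Lo x y} {n : P.Lo z w}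
    {m' : P.Lo x' y'} {n' : P.Lo z' w'} (e : LoArr.mk m = LoArr.mk m') (e' : LoArr.mk n = LoArr.mk n')
    {γ : LoArr.mk m ⟶ LoArr.mk n} {δ : LoArr.mk m' ⟶ LoArr.mk n'} (hp : HEq (p.sq γ) (p.sq δ))
    (hq : HEq (q.sq γ) (q.sq δ)) : HEq γ δ := by
  cases e
  cases e'
  exact heq_of_eq (h.sq_ext (eq_of_heq hp) (eq_of_heq hq))

namespace DblTrans

variable {A B C D E G : DblCat.{u}}

theorem comp_eqToHom_sq_heq {t : LoArr E.Lo} {F G : D ⟶ E} (h : F = G) {x y : D.Obj} (m : D.Lo x y)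
    (s : t ⟶ LoArr.mk (DblFunctor.lo F m)) : HEq (s ≫ DblTrans.sq (eqToHom h) m) s := by
  rw [eqToHom_sq]
  exact comp_eqToHom_heq s _

theorem paste_eqToHom_sq {F : A ⟶ B} {a : B ⟶ D} {f : A ⟶ C} {F' : C ⟶ D} {b : D ⟶ E}
    {g : C ⟶ G} {F'' : G ⟶ E} (s : F ≫ a ⟶ f ≫ F') {t : F' ≫ b ⟶ g ≫ F''}
    (ht : ∃ h, t = eqToHom h) {x y : A.Obj} (m : A.Lo x y) :
    HEq (DblTrans.sq (paste s t) m) (DblTrans.sq (s ▷ b) m) := by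
  obtain ⟨h, rfl⟩ := ht
  rw [paste_sq]
  exact comp_eqToHom_sq_heq h (DblFunctor.lo f m) _

theorem under_eqToHom_sq {p : A ⟶ B} {q : A ⟶ C} {r : A ⟶ D} {F : B ⟶ C} {G : C ⟶ D}
    (s : p ≫ F ⟶ q) {t : q ≫ G ⟶ r} (ht : ∃ h, t = eqToHom h) {x y : A.Obj} (m : A.Lo x y) :
    HEq (DblTrans.sq (under s t) m) (DblTrans.sq (s ▷ G) m) := by
  obtain ⟨h, rfl⟩ := ht
  rw [under_sq]
  exact comp_eqToHom_sq_heq h m _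

theorem sq_compat_of_paste {F : A ⟶ B} {a a' : B ⟶ D} {f f' : A ⟶ C} {F' : C ⟶ D} {b : D ⟶ E}
    {g : C ⟶ G} {F'' : G ⟶ E} {s : F ≫ a ⟶ f ≫ F'} {s' : F ≫ a' ⟶ f' ≫ F'} {t : F' ≫ b ⟶ g ≫ F''}
    (ht : ∃ h, t = eqToHom h) {α : a ⟶ a'} {φ : f ⟶ f'}
    (h : Compat (paste s t) (paste s' t) (α ▷ b) (φ ▷ g)) {x y : A.Obj} (m : A.Lo x y) :
    DblFunctor.sq b (DblTrans.sq α (DblFunctor.lo F m) ≫ DblTrans.sq s' m) =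
      DblFunctor.sq b (DblTrans.sq s m ≫ DblFunctor.sq F' (DblTrans.sq φ m)) := by
  have e := compat_iff.1 h m
  have n := DblTrans.sq_naturality t (DblTrans.sq φ m)
  have i : Mono (DblTrans.sq t (DblFunctor.lo f' m)) := by
    obtain ⟨h, rfl⟩ := ht
    rw [eqToHom_sq]
    infer_instance
  rw [paste_sq, paste_sq] at e
  refine i.right_cancellation _ _ ?_
  refine (congrArg (· ≫ _) (DblFunctor.sq_comp b _ _)).trans ?_
  refine ((Category.assoc _ _ _).trans e).trans ?_
  refine (Category.assoc _ _ _).trans ?_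
  refine (congrArg (_ ≫ ·) n.symm).trans ?_
  refine (Category.assoc _ _ _).symm.trans ?_
  exact (congrArg (· ≫ _) (DblFunctor.sq_comp b _ _)).symm

theorem sq_compat_of_under {p : A ⟶ B} {q : A ⟶ C} {r : A ⟶ D} {F F' : B ⟶ C} {G : C ⟶ D}
    {s : p ≫ F ⟶ q} {s' : p ≫ F' ⟶ q} {t : q ≫ G ⟶ r} (ht : ∃ h, t = eqToHom h) {α : F ⟶ F'}
    (h : p ◁ (α ▷ G) ≫ under s' t = under s t) {x y : A.Obj} (m : A.Lo x y) :
    DblFunctor.sq G (DblTrans.sq (p ◁ α ≫ s') m) = DblFunctor.sq G (DblTrans.sq s m) := by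
  have e : DblTrans.sq (p ◁ (α ▷ G)) m ≫ DblTrans.sq (under s' t) m = DblTrans.sq (under s t) m :=
    congrArg (fun k : p ≫ F ≫ G ⟶ r => DblTrans.sq k m) h
  have i : Mono (DblTrans.sq t m) := by
    obtain ⟨h, rfl⟩ := ht
    rw [eqToHom_sq]
    infer_instance
  rw [under_sq, under_sq] at e
  refine i.right_cancellation _ _ (Eq.trans ?_ e)
  refine (congrArg (· ≫ _) (DblFunctor.sq_comp G _ _)).trans ?_
  exact Category.assoc _ _ _

theorem sq_heq_of_is2Terminal {X : DblCat.{u}} (hX : Is2Terminal X) {F F' G G' : D ⟶ X} (h : F = F')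
    (k : G = G') (α : F ⟶ G) (β : F' ⟶ G') {x y : D.Obj} (m : D.Lo x y) :
    HEq (DblTrans.sq α m) (DblTrans.sq β m) := by
  subst h k
  obtain ⟨i⟩ := (hX D).2 F G
  rw [i.uniq α, i.uniq β]

end DblTrans

theorem Is2Terminal.hom_eq {B : Type*} [Bicategory B] {T : B} (h : Is2Terminal T) {Z : B}
    (f g : Z ⟶ T) : f = g := by
  obtain ⟨⟨i⟩, -⟩ := h Z
  exact (i.uniq f).trans (i.uniq g).symm

theorem Is2Terminal.hom₂_eq {B : Type*} [Bicategory B] {T : B} (h : Is2Terminal T) {Z : B}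
    {f g : Z ⟶ T} (α β : f ⟶ g) : α = β := by
  obtain ⟨i⟩ := (h Z).2 f g
  exact (i.uniq α).trans (i.uniq β).symm

theorem Is2Terminal.nonempty {B : Type*} [Bicategory B] {T : B} (h : Is2Terminal T) (Z : B) :
    Nonempty (Z ⟶ T) := by
  obtain ⟨⟨i⟩, -⟩ := h Z
  exact ⟨i.default⟩

theorem is2Terminal_of {B : Type*} [Bicategory B] {T : B} (h : ∀ Z : B, Nonempty (Z ⟶ T))
    (e : ∀ {Z : B} (f g : Z ⟶ T), f = g) (e' : ∀ {Z : B} {f g : Z ⟶ T} (α β : f ⟶ g), α = β) :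
    Is2Terminal T := fun Z =>
  ⟨⟨⟨⟨(h Z).some⟩, fun _ => e _ _⟩⟩, fun f g => ⟨⟨⟨eqToHom (e f g)⟩, fun _ => e' _ _⟩⟩⟩

namespace Niche

open LooseBimod

/-- A map of niches whose colaxators are identities. -/
def IsStrict {M N : Niche.{u}} (a : M ⟶ N) : Prop := ∀ i, ∃ h, a.colax i = eqToHom h

theorem sq_colax_heq {M N : Niche.{u}} {f g : M ⟶ N} (h : f = g) (i : Side.{u}) {x y : (M.E i).Obj}
    (m : (M.E i).Lo x y) : HEq (DblTrans.sq (f.colax i) m) (DblTrans.sq (g.colax i) m) := by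
  subst h; rfl

section

variable {P M N : Niche.{u}} {p : P ⟶ M} {q : P ⟶ N}

theorem exists_lift_colax (hp : IsStrict p) {Z : Niche.{u}} {f : Z ⟶ M} {u : Z.bimod ⟶ P.bimod}
    {v : ∀ i, Z.E i ⟶ P.E i} (hu : u ≫ p.bimod = f.bimod) (hv : ∀ i, v i ≫ p.f i = f.f i)
    (i : Side.{u}) :
    (Z.F i ≫ fiberMap u i) ≫ fiberMap p.bimod i = Z.F i ≫ fiberMap f.bimod i ∧
      (v i ≫ P.F i) ≫ fiberMap p.bimod i = f.f i ≫ M.F i := by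
  obtain ⟨h, -⟩ := hp i
  constructor
  · refine (DblCat.strict.assoc _ _ _).trans ?_
    exact congrArg (fun k => Z.F i ≫ fiberMap k i) hu
  · refine (DblCat.strict.assoc _ _ _).trans ?_
    rw [h, ← DblCat.strict.assoc, hv]

theorem is2Product_of_isJoint (hb : DblFunctor.IsJoint p.bimod.functor q.bimod.functor)
    (ho : ∀ x y, (DblFunctor.tight M.bimod.label).obj x = (DblFunctor.tight N.bimod.label).obj y →
      ∃ z, (DblFunctor.tight p.bimod.functor).obj z = x ∧
        (DblFunctor.tight q.bimod.functor).obj z = y)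
    (hf : ∀ i, Is2Product (p.f i) (q.f i)) (hp : IsStrict p) (hq : IsStrict q) :
    Is2Product p q := by
  have hb' := LooseBimod.is2Product hb ho
  have hF := LooseBimod.fiber_is2Product hb ho
  have hJ : ∀ i, DblFunctor.IsJoint (fiberMap p.bimod i) (fiberMap q.bimod i) := fun i =>
    hb.full _ _
  refine is2Product_of (fun {Z} f g => ?_) (fun {Z f g} e e' => ?_) (fun {Z f g} α β => ?_)
    (fun {Z f g α β} e e' => ?_)
  · obtain ⟨u, hu, hu'⟩ := hb'.exists_lift f.bimod g.bimod
    choose v hv hv' using fun i => (hf i).exists_lift (f.f i) (g.f i)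
    have k := exists_lift_colax hp hu hv
    have k' := exists_lift_colax hq hu' hv'
    choose c hc hc' using fun i => (hF i).exists_lift₂ (f := Z.F i ≫ fiberMap u i)
      (g := v i ≫ P.F i) (eqToHom (k i).1 ≫ f.colax i ≫ eqToHom (k i).2.symm)
      (eqToHom (k' i).1 ≫ g.colax i ≫ eqToHom (k' i).2.symm)
    have l : ∀ i, HEq (c i ▷ fiberMap p.bimod i) (f.colax i) := fun i => by rw [hc]; simp
    have l' : ∀ i, HEq (c i ▷ fiberMap q.bimod i) (g.colax i) := fun i => by rw [hc']; simp
    refine ⟨Hom.mk (M := Z) (N := P) u v c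
      (DblTrans.isConjointCommuter_of_isJoint (hJ .zero) _
        (DblTrans.isConjointCommuter_of_heq (k .zero).1 (k .zero).2 (l .zero) f.conj)
        (DblTrans.isConjointCommuter_of_heq (k' .zero).1 (k' .zero).2 (l' .zero) g.conj))
      (DblTrans.isCompanionCommuter_of_isJoint (hJ .one) _
        (DblTrans.isCompanionCommuter_of_heq (k .one).1 (k .one).2 (l .one) f.comp)
        (DblTrans.isCompanionCommuter_of_heq (k' .one).1 (k' .one).2 (l' .one) g.comp)), ?_, ?_⟩
    · exact Hom.ext' hu hv fun i _ _ m => (DblTrans.paste_eqToHom_sq (c i) (hp i) m).trans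
        (DblTrans.heq_sq (k i).1 (k i).2 (l i) m)
    · exact Hom.ext' hu' hv' fun i _ _ m => (DblTrans.paste_eqToHom_sq (c i) (hq i) m).trans
        (DblTrans.heq_sq (k' i).1 (k' i).2 (l' i) m)
  · have h1 : f.bimod = g.bimod := hb'.hom_ext (congrArg Hom.bimod e) (congrArg Hom.bimod e')
    have h2 : ∀ i, f.f i = g.f i := fun i =>
      (hf i).hom_ext (congrArg (fun k => Hom.f k i) e) (congrArg (fun k => Hom.f k i) e')
    refine Hom.ext' h1 h2 fun i _ _ m => (hJ i).sq_hext ?_ ?_ ?_ ?_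
    · exact DblTrans.lo_congr (congrArg (fun k => Z.F i ≫ fiberMap k i) h1) m
    · exact DblTrans.lo_congr (congrArg (· ≫ P.F i) (h2 i)) m
    · exact ((DblTrans.paste_eqToHom_sq (f.colax i) (hp i) m).symm.trans
        (sq_colax_heq e i m)).trans (DblTrans.paste_eqToHom_sq (g.colax i) (hp i) m)
    · exact ((DblTrans.paste_eqToHom_sq (f.colax i) (hq i) m).symm.trans
        (sq_colax_heq e' i m)).trans (DblTrans.paste_eqToHom_sq (g.colax i) (hq i) m)
  · obtain ⟨γ, h1, h2⟩ := hb'.exists_lift₂ (f := f.bimod) (g := g.bimod) (Hom₂.bimod α)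
      (Hom₂.bimod β)
    choose φ h3 h4 using fun i => (hf i).exists_lift₂ (f := f.f i) (g := g.f i) (Hom₂.f α i)
      (Hom₂.f β i)
    refine ⟨Hom₂.mk (F := f) (G := g) γ φ fun i => ?_, Niche.Hom₂.ext' h1 h3, Niche.Hom₂.ext' h2 h4⟩
    refine DblTrans.hom_ext_sq fun m => (hJ i).sq_ext ?_ ?_
    · refine DblTrans.sq_compat_of_paste (hp i) (α := fiberMap₂ γ i) (φ := φ i) ?_ m
      have w := Hom₂.w α i
      rw [← h1, ← h3 i] at w
      exact w
    · refine DblTrans.sq_compat_of_paste (hq i) (α := fiberMap₂ γ i) (φ := φ i) ?_ m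
      have w := Hom₂.w β i
      rw [← h2, ← h4 i] at w
      exact w
  · refine Niche.Hom₂.ext' ?_ fun i => ?_
    · exact hb'.hom_ext₂ (congrArg Hom₂.bimod e) (congrArg Hom₂.bimod e')
    · exact (hf i).hom_ext₂ (congrArg (fun k => Hom₂.f k i) e) (congrArg (fun k => Hom₂.f k i) e')

end

theorem is2Terminal_of {T : Niche.{u}} (hb : Is2Terminal T.bimod) (hE : ∀ i, Is2Terminal (T.E i))
    (hF : ∀ i, Is2Terminal (T.bimod.fiberObj i)) : Is2Terminal T := by
  refine _root_.is2Terminal_of (fun Z => ?_) (fun {Z} f g => ?_) (fun {Z f g} α β => ?_)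
  · obtain ⟨u⟩ := hb.nonempty Z.bimod
    have v : ∀ i, Z.E i ⟶ T.E i := fun i => ((hE i).nonempty (Z.E i)).some
    exact ⟨Hom.mk (M := Z) (N := T) u v (fun i => eqToHom ((hF i).hom_eq _ _))
      (DblTrans.eqToHom_isConjointCommuter _) (DblTrans.eqToHom_isCompanionCommuter _)⟩
  · have h1 : f.bimod = g.bimod := hb.hom_eq _ _
    have h2 : ∀ i, f.f i = g.f i := fun i => (hE i).hom_eq _ _
    exact Hom.ext' h1 h2 fun i _ _ m => DblTrans.sq_heq_of_is2Terminal (hF i)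
      ((hF i).hom_eq _ _) ((hF i).hom_eq _ _) _ _ m
  · exact Niche.Hom₂.ext' (hb.hom₂_eq _ _) fun i => (hE i).hom₂_eq _ _

end Niche

namespace PtdDbl

/-- A map of pointed double categories whose colaxator is an identity. -/
def IsStrict {X Y : PtdDbl.{u}} (F : X ⟶ Y) : Prop := ∃ h, F.colax = eqToHom h

theorem sq_colax_heq {X Y : PtdDbl.{u}} {f g : X ⟶ Y} (h : f = g) {x y : DblCat.Pt.{u}.Obj}
    (m : DblCat.Pt.{u}.Lo x y) : HEq (DblTrans.sq f.colax m) (DblTrans.sq g.colax m) := by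
  subst h; rfl

variable {P X Y : PtdDbl.{u}} {p : P ⟶ X} {q : P ⟶ Y}

theorem exists_lift_colax (hp : IsStrict p) {Z : PtdDbl.{u}} {f : Z ⟶ X} {u : Z.dbl ⟶ P.dbl}
    (hu : u ≫ p.functor = f.functor) :
    (Z.pt ≫ u) ≫ p.functor = Z.pt ≫ f.functor ∧ P.pt ≫ p.functor = X.pt := by
  obtain ⟨h, -⟩ := hp
  exact ⟨(DblCat.strict.assoc _ _ _).trans (congrArg (Z.pt ≫ ·) hu), h⟩

theorem is2Product_of_isJoint (hJ : DblFunctor.IsJoint p.functor q.functor)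
    (hF : Is2Product p.functor q.functor) (hp : IsStrict p) (hq : IsStrict q) : Is2Product p q := by
  refine is2Product_of (fun {Z} f g => ?_) (fun {Z f g} e e' => ?_) (fun {Z f g} α β => ?_)
    (fun {Z f g α β} e e' => ?_)
  · obtain ⟨u, hu, hu'⟩ := hF.exists_lift f.functor g.functor
    have k := exists_lift_colax hp hu
    have k' := exists_lift_colax hq hu'
    obtain ⟨c, hc, hc'⟩ := hF.exists_lift₂ (f := Z.pt ≫ u)
      (g := P.pt) (eqToHom k.1 ≫ f.colax ≫ eqToHom k.2.symm)
      (eqToHom k'.1 ≫ g.colax ≫ eqToHom k'.2.symm)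
    have l : HEq (c ▷ p.functor) f.colax := by rw [hc]; simp
    have l' : HEq (c ▷ q.functor) g.colax := by rw [hc']; simp
    refine ⟨Hom.mk (X := Z) (Y := P) u c (DblTrans.isConjointCommuter_of_isJoint hJ _
        (DblTrans.isConjointCommuter_of_heq k.1 k.2 l f.conj)
        (DblTrans.isConjointCommuter_of_heq k'.1 k'.2 l' g.conj)), ?_, ?_⟩
    · exact Hom.ext' hu fun m => (DblTrans.under_eqToHom_sq c hp m).trans
        (DblTrans.heq_sq k.1 k.2 l m)
    · exact Hom.ext' hu' fun m => (DblTrans.under_eqToHom_sq c hq m).trans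
        (DblTrans.heq_sq k'.1 k'.2 l' m)
  · have h1 : f.functor = g.functor :=
      hF.hom_ext (congrArg Hom.functor e) (congrArg Hom.functor e')
    refine Hom.ext' h1 fun m => hJ.sq_hext ?_ rfl ?_ ?_
    · exact DblTrans.lo_congr (congrArg (Z.pt ≫ ·) h1) m
    · exact ((DblTrans.under_eqToHom_sq f.colax hp m).symm.trans
        (sq_colax_heq e m)).trans (DblTrans.under_eqToHom_sq g.colax hp m)
    · exact ((DblTrans.under_eqToHom_sq f.colax hq m).symm.trans
        (sq_colax_heq e' m)).trans (DblTrans.under_eqToHom_sq g.colax hq m)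
  · obtain ⟨γ, h1, h2⟩ := hF.exists_lift₂ (f := f.functor) (g := g.functor) (Hom₂.trans α)
      (Hom₂.trans β)
    refine ⟨Hom₂.mk (F := f) (G := g) γ ?_, Hom₂.ext' h1, Hom₂.ext' h2⟩
    refine DblTrans.hom_ext_sq fun m => hJ.sq_ext ?_ ?_
    · refine DblTrans.sq_compat_of_under hp ?_ m
      have w := Hom₂.w α
      rw [← h1] at w
      exact w
    · refine DblTrans.sq_compat_of_under hq ?_ m
      have w := Hom₂.w β
      rw [← h2] at w
      exact w
  · exact Hom₂.ext' (hF.hom_ext₂ (congrArg Hom₂.trans e) (congrArg Hom₂.trans e'))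

theorem is2Terminal_of {T : PtdDbl.{u}} (h : Is2Terminal T.dbl) : Is2Terminal T := by
  refine _root_.is2Terminal_of (fun Z => ?_) (fun {Z} f g => ?_) (fun {Z f g} α β => ?_)
  · obtain ⟨u⟩ := h.nonempty Z.dbl
    exact ⟨Hom.mk (X := Z) (Y := T) u (eqToHom (h.hom_eq _ _))
      (DblTrans.eqToHom_isConjointCommuter _)⟩
  · exact Hom.ext' (h.hom_eq _ _) fun m => DblTrans.sq_heq_of_is2Terminal h
      (h.hom_eq _ _) (h.hom_eq _ _) _ _ m
  · exact Hom₂.ext' (h.hom₂_eq _ _)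

end PtdDbl

namespace Cograph

theorem Ti.left_eq {A B : DblCat.{u}} {x y : A.Obj} (f : Ti (B := B) (.inl x) (.inl y)) :
    ∃ g, f = .left g := by
  cases f with
  | left g => exact ⟨g, rfl⟩

theorem Ti.right_eq {A B : DblCat.{u}} {x y : B.Obj} (f : Ti (A := A) (.inr x) (.inr y)) :
    ∃ g, f = .right g := by
  cases f with
  | right g => exact ⟨g, rfl⟩

variable {A B M : DblCat.{u}} {P : DblFunctor A M} {Q : DblFunctor B M}

theorem Lo.left_eq {x y : A.Obj} (m : Lo P Q (.inl x) (.inl y)) : ∃ n, m = .left n := by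
  cases m with
  | left n => exact ⟨n, rfl⟩

theorem Lo.het_eq {x : A.Obj} {y : B.Obj} (m : Lo P Q (.inl x) (.inr y)) : ∃ n, m = .het n := by
  cases m with
  | het n => exact ⟨n, rfl⟩

theorem Lo.right_eq {x y : B.Obj} (m : Lo P Q (.inr x) (.inr y)) : ∃ n, m = .right n := by
  cases m with
  | right n => exact ⟨n, rfl⟩

theorem Sq.left_eq {a b a' b' : A.Obj} {m : A.Lo a b} {n : A.Lo a' b'}
    (α : Sq P Q ⟨.left m⟩ ⟨.left n⟩) : ∃ β : LoArr.mk m ⟶ LoArr.mk n, α = .left β := by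
  cases α with
  | left β => exact ⟨β, rfl⟩

theorem Sq.right_eq {a b a' b' : B.Obj} {m : B.Lo a b} {n : B.Lo a' b'}
    (α : Sq P Q ⟨.right m⟩ ⟨.right n⟩) : ∃ β : LoArr.mk m ⟶ LoArr.mk n, α = .right β := by
  cases α with
  | right β => exact ⟨β, rfl⟩

theorem Sq.het_eq {a a' : A.Obj} {b b' : B.Obj} {m : M.Lo (P.tight.obj a) (Q.tight.obj b)}
    {n : M.Lo (P.tight.obj a') (Q.tight.obj b')} (α : Sq P Q ⟨.het m⟩ ⟨.het n⟩) :
    ∃ β : Het P Q m n, α = .het β := by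
  cases α with
  | het β => exact ⟨β, rfl⟩

theorem mono_of_comp_id {C : Type*} [Category C] {x y : C} {f : x ⟶ y} {g : y ⟶ x}
    (h : f ≫ g = 𝟙 x) : Mono f :=
  ⟨fun a b k => by simpa [h] using congrArg (· ≫ g) k⟩

namespace LiftData

variable {A' B' M' A'' B'' M'' : DblCat.{u}} {P' : DblFunctor A' M'} {Q' : DblFunctor B' M'} {P'' : DblFunctor A'' M''}
  {Q'' : DblFunctor B'' M''} {L : LiftData P Q P' Q'} {L' : LiftData P Q P'' Q''}

theorem dom_eq_of_isIso (hc : ∀ {x y} (m : M.Lo (P.tight.obj x) (Q.tight.obj y)), IsIso (L.c m))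
    {x x' : A.Obj} {y y' : B.Obj} {m : M.Lo (P.tight.obj x) (Q.tight.obj y)}
    {n : M.Lo (P.tight.obj x') (Q.tight.obj y')} {s : LoArr.mk m ⟶ LoArr.mk n}
    {β : Het P' Q' (L.het m) (L.het n)} (e : L.a.sq s ≫ L.c n = L.c m ≫ β.sq) {f : x ⟶ x'}
    {g : y ⟶ y'} (hf : L.f.tight.map f = β.f) (hg : L.g.tight.map g = β.g) :
    L.a.tight.map (M.dom s) = L.a.tight.map (P.tight.map f) ∧
      L.a.tight.map (M.cod s) = L.a.tight.map (Q.tight.map g) := by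
  have := hc n
  obtain ⟨d, hd, hd'⟩ := this.out
  have i1 : Mono (L.s.app x') := mono_of_comp_id (g := M'.dom d) (by
    rw [← L.dom_c n]; exact ((M'.dom_comp _ _).symm.trans (congrArg M'.dom hd)).trans (M'.dom_id _))
  have i2 : Mono (L.t.app y') := mono_of_comp_id (g := M'.cod d) (by
    rw [← L.cod_c n]; exact ((M'.cod_comp _ _).symm.trans (congrArg M'.cod hd)).trans (M'.cod_id _))
  constructor
  · refine i1.right_cancellation _ _ ?_
    have h := congrArg M'.dom e
    rw [M'.dom_comp, M'.dom_comp, L.dom_c, L.dom_c, β.dom, L.a.dom_sq, ← hf] at h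
    exact h.trans (L.s.naturality f).symm
  · refine i2.right_cancellation _ _ ?_
    have h := congrArg M'.cod e
    rw [M'.cod_comp, M'.cod_comp, L.cod_c, L.cod_c, β.cod, L.a.cod_sq, ← hg] at h
    exact h.trans (L.t.naturality g).symm

theorem sq_het_eq (hc : ∀ {x y} (m : M.Lo (P.tight.obj x) (Q.tight.obj y)), IsIso (L.c m))
    {x x' : A.Obj} {y y' : B.Obj} {m : M.Lo (P.tight.obj x) (Q.tight.obj y)}
    {n : M.Lo (P.tight.obj x') (Q.tight.obj y')} (γ : Het P Q m n)
    (β : Het P' Q' (L.het m) (L.het n)) (hf : L.f.tight.map γ.f = β.f)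
    (hg : L.g.tight.map γ.g = β.g) (e : L.a.sq γ.sq ≫ L.c n = L.c m ≫ β.sq) :
    L.sq (.het γ) = .het β := by
  have := hc m
  refine congrArg Sq.het (Het.ext' ?_ ?_ ?_)
  · exact (L.exists_het γ).choose_spec.1.trans hf
  · exact (L.exists_het γ).choose_spec.2.1.trans hg
  · exact (cancel_epi (L.c m)).1 ((L.exists_het γ).choose_spec.2.2.symm.trans e)

theorem eq_of_sq_het_eq (hc : ∀ {x y} (m : M.Lo (P.tight.obj x) (Q.tight.obj y)), IsIso (L.c m))
    {x x' : A.Obj} {y y' : B.Obj} {m : M.Lo (P.tight.obj x) (Q.tight.obj y)}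
    {n : M.Lo (P.tight.obj x') (Q.tight.obj y')} (γ δ : Het P Q m n)
    (e : L.sq (.het γ) = L.sq (.het δ)) : L.f.tight.map γ.f = L.f.tight.map δ.f ∧
      L.g.tight.map γ.g = L.g.tight.map δ.g ∧ L.a.sq γ.sq = L.a.sq δ.sq := by
  have := hc n
  have k : (L.exists_het γ).choose = (L.exists_het δ).choose := Sq.het.inj e
  obtain ⟨h1, h2, h3⟩ := (L.exists_het γ).choose_spec
  obtain ⟨h1', h2', h3'⟩ := (L.exists_het δ).choose_spec
  refine ⟨h1.symm.trans ((congrArg Het.f k).trans h1'),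
    h2.symm.trans ((congrArg Het.g k).trans h2'), ?_⟩
  exact (cancel_mono (L.c n)).1 (h3.trans ((congrArg (fun z => L.c m ≫ Het.sq z) k).trans h3'.symm))

theorem isJoint (hf : DblFunctor.IsJoint L.f L'.f) (hg : DblFunctor.IsJoint L.g L'.g)
    (ha : DblFunctor.IsJoint L.a L'.a)
    (hc : ∀ {x y} (m : M.Lo (P.tight.obj x) (Q.tight.obj y)), IsIso (L.c m))
    (hc' : ∀ {x y} (m : M.Lo (P.tight.obj x) (Q.tight.obj y)), IsIso (L'.c m))
    (hl : ∀ {x y} (m : M'.Lo (P'.tight.obj (L.f.tight.obj x)) (Q'.tight.obj (L.g.tight.obj y)))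
      (n : M''.Lo (P''.tight.obj (L'.f.tight.obj x)) (Q''.tight.obj (L'.g.tight.obj y))),
      ∃ k, L.het k = m ∧ L'.het k = n)
    (hl' : ∀ {x y} (k k' : M.Lo (P.tight.obj x) (Q.tight.obj y)), L.het k = L.het k' →
      L'.het k = L'.het k' → k = k') : DblFunctor.IsJoint L.functor L'.functor where
  obj_ext {x y} e e' := by
    rcases x with x | x <;> rcases y with y | y
    · exact congrArg Sum.inl (hf.obj_ext (Sum.inl.inj e) (Sum.inl.inj e'))
    · nomatch (show (Sum.inl _ : A'.Obj ⊕ B'.Obj) = Sum.inr _ from e)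
    · nomatch (show (Sum.inr _ : A'.Obj ⊕ B'.Obj) = Sum.inl _ from e)
    · exact congrArg Sum.inr (hg.obj_ext (Sum.inr.inj e) (Sum.inr.inj e'))
  map {x y} f g := by
    rcases x with x | x <;> rcases y with y | y
    · obtain ⟨f, rfl⟩ := Ti.left_eq f
      obtain ⟨g, rfl⟩ := Ti.left_eq g
      obtain ⟨h, rfl, rfl⟩ := hf.map f g
      exact ⟨.left h, rfl, rfl⟩
    · nomatch f
    · nomatch f
    · obtain ⟨f, rfl⟩ := Ti.right_eq f
      obtain ⟨g, rfl⟩ := Ti.right_eq g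
      obtain ⟨h, rfl, rfl⟩ := hg.map f g
      exact ⟨.right h, rfl, rfl⟩
  map_ext {x y f g} e e' := by
    rcases f with f | f
    · obtain ⟨g, rfl⟩ := Ti.left_eq g
      exact congrArg Ti.left (hf.map_ext (Ti.left.inj e) (Ti.left.inj e'))
    · obtain ⟨g, rfl⟩ := Ti.right_eq g
      exact congrArg Ti.right (hg.map_ext (Ti.right.inj e) (Ti.right.inj e'))
  lo {x y} m n := by
    rcases x with x | x <;> rcases y with y | y
    · obtain ⟨m, rfl⟩ := Lo.left_eq m
      obtain ⟨n, rfl⟩ := Lo.left_eq n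
      obtain ⟨h, rfl, rfl⟩ := hf.lo m n
      exact ⟨.left h, rfl, rfl⟩
    · obtain ⟨m, rfl⟩ := Lo.het_eq m
      obtain ⟨n, rfl⟩ := Lo.het_eq n
      obtain ⟨h, rfl, rfl⟩ := hl m n
      exact ⟨.het h, rfl, rfl⟩
    · nomatch m
    · obtain ⟨m, rfl⟩ := Lo.right_eq m
      obtain ⟨n, rfl⟩ := Lo.right_eq n
      obtain ⟨h, rfl, rfl⟩ := hg.lo m n
      exact ⟨.right h, rfl, rfl⟩
  lo_ext {x y m n} e e' := by
    rcases m with m | m | m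
    · obtain ⟨n, rfl⟩ := Lo.left_eq n
      exact congrArg Lo.left (hf.lo_ext (Lo.left.inj e) (Lo.left.inj e'))
    · obtain ⟨n, rfl⟩ := Lo.het_eq n
      exact congrArg Lo.het (hl' _ _ (Lo.het.inj e) (Lo.het.inj e'))
    · obtain ⟨n, rfl⟩ := Lo.right_eq n
      exact congrArg Lo.right (hg.lo_ext (Lo.right.inj e) (Lo.right.inj e'))
  sq {x y x' y' m n} α β := by
    rcases m with m | m | m <;> rcases n with n | n | n
    · obtain ⟨α, rfl⟩ := Sq.left_eq α
      obtain ⟨β, rfl⟩ := Sq.left_eq β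
      obtain ⟨h, rfl, rfl⟩ := hf.sq α β
      exact ⟨.left h, rfl, rfl⟩
    · nomatch (show Sq P' Q' ⟨.left (L.f.lo m)⟩ ⟨.het (L.het n)⟩ from α)
    · nomatch (show Sq P' Q' ⟨.left (L.f.lo m)⟩ ⟨.right (L.g.lo n)⟩ from α)
    · nomatch (show Sq P' Q' ⟨.het (L.het m)⟩ ⟨.left (L.f.lo n)⟩ from α)
    · obtain ⟨α, rfl⟩ := Sq.het_eq α
      obtain ⟨β, rfl⟩ := Sq.het_eq β
      obtain ⟨f, h1, h2⟩ := hf.map α.f β.f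
      obtain ⟨g, h3, h4⟩ := hg.map α.g β.g
      have i := hc n
      have i' := hc' n
      obtain ⟨s, h5, h6⟩ := ha.sq (L.c m ≫ α.sq ≫ inv (L.c n)) (L'.c m ≫ β.sq ≫ inv (L'.c n))
      have e : L.a.sq s ≫ L.c n = L.c m ≫ α.sq := by rw [h5]; simp
      have e' : L'.a.sq s ≫ L'.c n = L'.c m ≫ β.sq := by rw [h6]; simp
      obtain ⟨k1, k2⟩ := dom_eq_of_isIso hc e h1 h3
      obtain ⟨k3, k4⟩ := dom_eq_of_isIso hc' e' h2 h4
      let γ : Het P Q m n := ⟨f, g, s, ha.map_ext k1 k3, ha.map_ext k2 k4⟩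
      exact ⟨.het γ, sq_het_eq hc γ α h1 h3 e, sq_het_eq hc' γ β h2 h4 e'⟩
    · nomatch (show Sq P' Q' ⟨.het (L.het m)⟩ ⟨.right (L.g.lo n)⟩ from α)
    · nomatch (show Sq P' Q' ⟨.right (L.g.lo m)⟩ ⟨.left (L.f.lo n)⟩ from α)
    · nomatch (show Sq P' Q' ⟨.right (L.g.lo m)⟩ ⟨.het (L.het n)⟩ from α)
    · obtain ⟨α, rfl⟩ := Sq.right_eq α
      obtain ⟨β, rfl⟩ := Sq.right_eq β
      obtain ⟨h, rfl, rfl⟩ := hg.sq α β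
      exact ⟨.right h, rfl, rfl⟩
  sq_ext {x y x' y' m n γ δ} e e' := by
    rcases γ with γ | γ | γ
    · obtain ⟨δ, rfl⟩ := Sq.left_eq δ
      exact congrArg Sq.left (hf.sq_ext (Sq.left.inj e) (Sq.left.inj e'))
    · obtain ⟨δ, rfl⟩ := Sq.het_eq δ
      obtain ⟨h1, h2, h3⟩ := eq_of_sq_het_eq hc γ δ e
      obtain ⟨h1', h2', h3'⟩ := eq_of_sq_het_eq hc' γ δ e'
      exact congrArg Sq.het (Het.ext' (hf.map_ext h1 h1') (hg.map_ext h2 h2') (ha.sq_ext h3 h3'))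
    · obtain ⟨δ, rfl⟩ := Sq.right_eq δ
      exact congrArg Sq.right (hg.sq_ext (Sq.right.inj e) (Sq.right.inj e'))

end LiftData

end Cograph

namespace DblCat

variable {D : DblCat.{u}} {x x' y y' : D.Obj}

/-- Transport of a loose arrow along equalities of its ends. -/
def castLo (h : x = x') (k : y = y') (m : D.Lo x y) : D.Lo x' y' := h ▸ k ▸ m

theorem mk_castLo (h : x = x') (k : y = y') (m : D.Lo x y) :
    LoArr.mk m = LoArr.mk (castLo h k m) := by
  subst h k; rfl

theorem exists_castLo (h : x = x') (k : y = y') (m : D.Lo x' y') : ∃ n, castLo h k n = m := by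
  subst h k; exact ⟨m, rfl⟩

theorem castLo_injective (h : x = x') (k : y = y') {m n : D.Lo x y}
    (e : castLo h k m = castLo h k n) : m = n := by
  subst h k; exact e

theorem dom_eqToHom_mk (h : x = x') {m : D.Lo x y} {n : D.Lo x' y'}
    (e : LoArr.mk m = LoArr.mk n) : D.dom (eqToHom e) = eqToHom h := by
  cases e; exact D.dom_id _

theorem cod_eqToHom_mk (h : y = y') {m : D.Lo x y} {n : D.Lo x' y'}
    (e : LoArr.mk m = LoArr.mk n) : D.cod (eqToHom e) = eqToHom h := by
  cases e; exact D.cod_id _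

end DblCat

namespace Niche

open LooseBimod

section

variable {M N : Niche.{u}} {a : M ⟶ N}

theorem IsStrict.obj_eq (ha : IsStrict a) (i : Side.{u}) (x : (M.E i).Obj) :
    a.bimod.functor.tight.obj ((M.leg i).tight.obj x) =
      (N.leg i).tight.obj ((a.f i).tight.obj x) := by
  obtain ⟨h, -⟩ := ha i
  exact congrArg (DblCat.fullIncl (N.bimod.Over i)).tight.obj
    (congrArg (fun k : M.E i ⟶ N.bimod.fiberObj i => (DblFunctor.tight k).obj x) h)

theorem IsStrict.legTrans_app (ha : IsStrict a) (i : Side.{u}) (x : (M.E i).Obj) :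
    (legTrans a i).app x = eqToHom (ha.obj_eq i x) := by
  obtain ⟨h, k⟩ := ha i
  have e : DblTrans.app (a.colax i) x = eqToHom _ :=
    (congrArg (fun t => DblTrans.app t x) k).trans (DblTrans.eqToHom_app h x)
  refine (congrArg (DblCat.fullIncl (N.bimod.Over i)).tight.map e).trans ?_
  exact eqToHom_map _ _

/-- The extension of a strict map of niches that transports heteromorphisms. -/
def IsStrict.hetData (ha : IsStrict a) : HetData a where
  het m := DblCat.castLo (ha.obj_eq .zero _) (ha.obj_eq .one _) (a.bimod.functor.lo m)
  c m := eqToHom (DblCat.mk_castLo _ _ _)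
  dom_c m := (DblCat.dom_eqToHom_mk (ha.obj_eq .zero _) _).trans (ha.legTrans_app .zero _).symm
  cod_c m := (DblCat.cod_eqToHom_mk (ha.obj_eq .one _) _).trans (ha.legTrans_app .one _).symm
  cocart m := DblCat.IsCocart.of_isIso _

end

theorem IsStrict.is2Product {P M N : Niche.{u}} {p : P ⟶ M} {q : P ⟶ N} (hp : IsStrict p)
    (hq : IsStrict q) (hb : DblFunctor.IsJoint p.bimod.functor q.bimod.functor)
    (hf : ∀ i, DblFunctor.IsJoint (p.f i) (q.f i))
    (hs : ∀ i x y, ∃ z, (p.f i).tight.obj z = x ∧ (q.f i).tight.obj z = y) :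
    Is2Product hp.hetData.map hq.hetData.map := by
  refine LooseBimod.is2Product (Cograph.LiftData.isJoint (L := hp.hetData.liftData)
    (L' := hq.hetData.liftData) (hf .zero) (hf .one) hb (fun m => ?_) (fun m => ?_) (fun m n => ?_)
    (fun k k' e e' => ?_)) ?_
  · exact inferInstanceAs (IsIso (eqToHom (DblCat.mk_castLo _ _ _)))
  · exact inferInstanceAs (IsIso (eqToHom (DblCat.mk_castLo _ _ _)))
  · obtain ⟨m, rfl⟩ := DblCat.exists_castLo (hp.obj_eq .zero _) (hp.obj_eq .one _) m
    obtain ⟨n, rfl⟩ := DblCat.exists_castLo (hq.obj_eq .zero _) (hq.obj_eq .one _) n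
    obtain ⟨k, rfl, rfl⟩ := hb.lo m n
    exact ⟨k, rfl, rfl⟩
  · exact hb.lo_ext (DblCat.castLo_injective _ _ e) (DblCat.castLo_injective _ _ e')
  · rintro (x | x) (y | y) h
    · obtain ⟨z, rfl, rfl⟩ := hs .zero x y
      exact ⟨.inl z, rfl, rfl⟩
    · nomatch h
    · nomatch h
    · obtain ⟨z, rfl, rfl⟩ := hs .one x y
      exact ⟨.inr z, rfl, rfl⟩

end Niche

theorem CategoryTheory.heq_of_eq_eqToHom_comp {C : Type*} [Category C] {x y x' y' : C} {f : x ⟶ y}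
    {g : x' ⟶ y'} {h : x = x'} {k : y' = y} (e : f = eqToHom h ≫ g ≫ eqToHom k) : HEq f g := by
  subst h k e
  simp

theorem DblCat.IsCocart.of_comp_eqToHom {D : DblCat.{u}} {x y x' y' x'' y'' : D.Obj} {m : D.Lo x y}
    {n : D.Lo x' y'} {k : D.Lo x'' y''} {c : LoArr.mk m ⟶ LoArr.mk n} {h : LoArr.mk n = LoArr.mk k}
    {d : LoArr.mk m ⟶ LoArr.mk k} (e : c ≫ eqToHom h = d) (hd : DblCat.IsCocart d) :
    DblCat.IsCocart c := by
  cases h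
  have : c = d := by simpa using e
  exact this ▸ hd

/-- A double functor whose projections are isomorphisms onto points has a point as source. -/
theorem DblFunctor.IsJoint.isPoint {P D E : DblCat.{u}} {p : DblFunctor P D} {q : DblFunctor P E}
    (h : DblFunctor.IsJoint p q) (hs : ∀ x y, ∃ z, p.tight.obj z = x ∧ q.tight.obj z = y)
    (hD : D.IsPoint) (hE : E.IsPoint) : P.IsPoint := by
  obtain ⟨⟨d0⟩, d1, d2, d3⟩ := hD
  obtain ⟨⟨e0⟩, e1, e2, e3⟩ := hE
  obtain ⟨z, -, -⟩ := hs d0.default e0.default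
  refine ⟨⟨⟨⟨z⟩, fun y => h.obj_ext ?_ ?_⟩⟩, fun x y => ?_, fun x y => ?_, fun m n => ?_⟩
  · exact (d0.uniq _).trans (d0.uniq _).symm
  · exact (e0.uniq _).trans (e0.uniq _).symm
  · obtain ⟨d⟩ := d1 (p.tight.obj x) (p.tight.obj y)
    obtain ⟨e⟩ := e1 (q.tight.obj x) (q.tight.obj y)
    obtain ⟨f, -, -⟩ := h.map d.default e.default
    exact ⟨⟨⟨f⟩, fun g => h.map_ext ((d.uniq _).trans (d.uniq _).symm)
      ((e.uniq _).trans (e.uniq _).symm)⟩⟩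
  · obtain ⟨d⟩ := d2 (p.tight.obj x) (p.tight.obj y)
    obtain ⟨e⟩ := e2 (q.tight.obj x) (q.tight.obj y)
    obtain ⟨f, -, -⟩ := h.lo d.default e.default
    exact ⟨⟨⟨f⟩, fun g => h.lo_ext ((d.uniq _).trans (d.uniq _).symm)
      ((e.uniq _).trans (e.uniq _).symm)⟩⟩
  · obtain ⟨d⟩ := d3 (LoArr.mk (p.lo m.arr)) (LoArr.mk (p.lo n.arr))
    obtain ⟨e⟩ := e3 (LoArr.mk (q.lo m.arr)) (LoArr.mk (q.lo n.arr))
    obtain ⟨f, -, -⟩ := h.sq (m := m.arr) (n := n.arr) d.default e.default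
    exact ⟨⟨⟨f⟩, fun g => h.sq_ext ((d.uniq _).trans (d.uniq _).symm)
      ((e.uniq _).trans (e.uniq _).symm)⟩⟩

theorem DblCat.pt_isJoint :
    DblFunctor.IsJoint (𝟙 DblCat.Pt.{u} : DblCat.Pt.{u} ⟶ DblCat.Pt.{u}) (𝟙 DblCat.Pt.{u}) where
  obj_ext e _ := e
  map f g := ⟨f, rfl, Subsingleton.elim (α := ULift (PLift _)) _ _⟩
  map_ext e _ := e
  lo m n := ⟨m, rfl, Subsingleton.elim (α := ULift (PLift _)) _ _⟩
  lo_ext e _ := e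
  sq α β := ⟨α, rfl, Subsingleton.elim (α := ULift (PLift _)) _ _⟩
  sq_ext e _ := e

theorem LooseBimod.fiber_surjective_prod (M N : LooseBimod.{u}) (i : Side.{u})
    (x : (M.fiberObj i).Obj) (y : (N.fiberObj i).Obj) :
    ∃ z, (DblFunctor.tight (fiberMap (M.prodFst N) i)).obj z = x ∧
      (DblFunctor.tight (fiberMap (M.prodSnd N) i)).obj z = y :=
  ⟨⟨⟨(x.1, y.1), Eq.trans (b := i) x.2 (Eq.symm y.2)⟩, x.2⟩, rfl, rfl⟩

/-- The product of two loose right modules. -/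
def RightModule.prod (M N : RightModule.{u}) : RightModule.{u} where
  bimod := M.bimod.prod N.bimod
  isPoint := ((M.bimod.prod_isJoint N.bimod).full _ _ : DblFunctor.IsJoint
    (LooseBimod.fiberMap (M.bimod.prodFst N.bimod) .zero) _).isPoint
    (LooseBimod.fiber_surjective_prod _ _ _) M.isPoint N.isPoint

namespace Niche

open LooseBimod

theorem _root_.Restriction.ext (R : Restriction.{u}) {M N : Niche.{u}} (a : M ⟶ N) :
    Ext a (R.map a) (R.cell a) where
  ends := R.map_ends a
  cell i := by
    obtain ⟨h, h', e⟩ := R.cell_ends a i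
    exact heq_of_eq_eqToHom_comp e
  het m := by
    obtain ⟨C, K, e⟩ := R.cell_het a
    obtain ⟨h, e⟩ := e m
    exact DblCat.IsCocart.of_comp_eqToHom e (DblCat.isCocart_extend _ _ _)

/-- Strict maps of niches jointly exhibiting their source as a product. -/
structure IsJoint {P M N : Niche.{u}} (p : P ⟶ M) (q : P ⟶ N) : Prop where
  fst : IsStrict p
  snd : IsStrict q
  bimod : DblFunctor.IsJoint p.bimod.functor q.bimod.functor
  obj x y : (DblFunctor.tight M.bimod.label).obj x = (DblFunctor.tight N.bimod.label).obj y →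
    ∃ z, (DblFunctor.tight p.bimod.functor).obj z = x ∧
      (DblFunctor.tight q.bimod.functor).obj z = y
  ends i : DblFunctor.IsJoint (p.f i) (q.f i)
  ends_obj i x y : ∃ z, (p.f i).tight.obj z = x ∧ (q.f i).tight.obj z = y

namespace IsJoint

variable {P M N : Niche.{u}} {p : P ⟶ M} {q : P ⟶ N}

theorem is2Product (h : IsJoint p q) : Is2Product p q :=
  is2Product_of_isJoint h.bimod h.obj (fun i => (h.ends i).is2Product (h.ends_obj i)) h.fst h.snd

theorem isBiproduct_restriction (h : IsJoint p q) (R : Restriction.{u}) :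
    IsBiproduct (R.map p) (R.map q) :=
  (h.fst.is2Product h.snd h.bimod h.ends h.ends_obj).isBiproduct.of_iso
    (h.fst.hetData.ext.iso (R.ext p)) (h.snd.hetData.ext.iso (R.ext q))

end IsJoint

/-- The map of niches given by strictly compatible maps. -/
def strictHom {M N : Niche.{u}} (a : M.bimod ⟶ N.bimod) (f : ∀ i, M.E i ⟶ N.E i)
    (h : ∀ i, M.F i ≫ fiberMap a i = f i ≫ N.F i) : M ⟶ N :=
  Hom.mk (M := M) (N := N) a f (fun i => eqToHom (h i))
    (DblTrans.eqToHom_isConjointCommuter _) (DblTrans.eqToHom_isCompanionCommuter _)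

theorem strictHom_isStrict {M N : Niche.{u}} (a : M.bimod ⟶ N.bimod) (f : ∀ i, M.E i ⟶ N.E i)
    (h : ∀ i, M.F i ≫ fiberMap a i = f i ≫ N.F i) : IsStrict (strictHom a f h) :=
  fun i => ⟨h i, rfl⟩

theorem exists_isJoint (M N : Niche.{u}) : ∃ (P : Niche.{u}) (p : P ⟶ M) (q : P ⟶ N), IsJoint p q := by
  choose F h h' using fun i => (M.bimod.fiber_is2Product_prod N.bimod i).exists_lift
    ((M.E i).prodFst (N.E i) ≫ M.F i) ((M.E i).prodSnd (N.E i) ≫ N.F i)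
  let P : Niche.{u} := ⟨M.bimod.prod N.bimod, fun i => (M.E i).prod (N.E i), F⟩
  exact ⟨P, strictHom (M := P) (N := M) (M.bimod.prodFst N.bimod)
    (fun i => (M.E i).prodFst (N.E i)) h, strictHom (M := P) (N := N) (M.bimod.prodSnd N.bimod)
    (fun i => (M.E i).prodSnd (N.E i)) h', strictHom_isStrict _ _ _, strictHom_isStrict _ _ _,
    M.bimod.prod_isJoint N.bimod, M.bimod.prod_obj N.bimod,
    fun i => (M.E i).prod_isJoint (N.E i), fun i x y => ⟨(x, y), rfl, rfl⟩⟩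

end Niche

theorem RightNiche.exists_isJoint (M N : RightNiche.{u}) :
    ∃ (P : RightNiche.{u}) (p : P ⟶ M) (q : P ⟶ N), Niche.IsJoint p.hom q.hom := by
  obtain ⟨F₀, h₀, h₀'⟩ := ((RightNicheData.bimod M).fiber_is2Product_prod
    (RightNicheData.bimod N) .zero).exists_lift (𝟙 _ ≫ RightNicheData.F₀ M)
      (𝟙 _ ≫ RightNicheData.F₀ N)
  obtain ⟨F₁, h₁, h₁'⟩ := ((RightNicheData.bimod M).fiber_is2Product_prod
    (RightNicheData.bimod N) .one).exists_lift
      (DblCat.prodFst (RightNicheData.dbl M) (RightNicheData.dbl N) ≫ RightNicheData.F₁ M)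
      (DblCat.prodSnd (RightNicheData.dbl M) (RightNicheData.dbl N) ≫ RightNicheData.F₁ N)
  let P : RightNicheData.{u} := ⟨(RightNicheData.bimod M).prod (RightNicheData.bimod N),
    (RightNicheData.dbl M).prod (RightNicheData.dbl N), F₀, F₁⟩
  let p : P.toNiche ⟶ RightNicheData.toNiche M := Niche.strictHom
    ((RightNicheData.bimod M).prodFst (RightNicheData.bimod N))
    (fun
      | .zero => 𝟙 DblCat.Pt
      | .one => DblCat.prodFst (RightNicheData.dbl M) (RightNicheData.dbl N))
    (fun
      | .zero => h₀
      | .one => h₁)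
  let q : P.toNiche ⟶ RightNicheData.toNiche N := Niche.strictHom
    ((RightNicheData.bimod M).prodSnd (RightNicheData.bimod N))
    (fun
      | .zero => 𝟙 DblCat.Pt
      | .one => DblCat.prodSnd (RightNicheData.dbl M) (RightNicheData.dbl N))
    (fun
      | .zero => h₀'
      | .one => h₁')
  refine ⟨P, InducedBicategory.mkHom p, InducedBicategory.mkHom q, Niche.strictHom_isStrict _ _ _,
    Niche.strictHom_isStrict _ _ _, LooseBimod.prod_isJoint _ _, LooseBimod.prod_obj _ _,
    ?_, ?_⟩
  · rintro (_ | _)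
    · exact DblCat.pt_isJoint
    · exact DblCat.prod_isJoint _ _
  · rintro (_ | _) x y
    · exact ⟨x, rfl, rfl⟩
    · exact ⟨(x, y), rfl, rfl⟩

theorem DblFunctor.sq_eqToHom {D E : DblCat.{u}} (F : DblFunctor D E) {x y x' y' : D.Obj}
    {m : D.Lo x y} {n : D.Lo x' y'} (h : LoArr.mk m = LoArr.mk n)
    (k : LoArr.mk (F.lo m) = LoArr.mk (F.lo n)) : F.sq (eqToHom h) = eqToHom k := by
  cases h; exact F.sq_id _

namespace LooseBimod

theorem homEnd_naturality {D E : DblCat.{u}} (F : D ⟶ E) (i : Side.{u}) :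
    homEnd D i ≫ fiberMap (homMap F) i = F ≫ homEnd E i := by
  refine DblFunctor.ext_heq rfl HEq.rfl HEq.rfl (heq_of_eq ?_) (heq_of_eq ?_)
  · funext x
    refine Iso.ext (((Category.comp_id _).symm.trans (DblTrans.unit (homNat F i) x)).trans ?_)
    exact (congrArg (· ≫ _) (DblCat.unitSq_id _ _)).trans (Category.id_comp _)
  · funext x y z m n
    refine Iso.ext (((Category.comp_id _).symm.trans (DblTrans.comp (homNat F i) m n)).trans ?_)
    exact (congrArg (· ≫ _) (DblCat.compSq_id _ _ _ _)).trans (Category.id_comp _)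

theorem homNat_eq_eqToHom {D E : DblCat.{u}} (F : D ⟶ E) (i : Side.{u}) :
    ∃ h, homNat F i = eqToHom h :=
  ⟨homEnd_naturality F i, DblTrans.hom_ext_sq fun m =>
    (DblTrans.eqToHom_sq (homEnd_naturality F i) m).symm⟩

end LooseBimod

namespace PtdDbl

/-- Strict maps of pointed double categories jointly exhibiting their source as a product. -/
structure IsJoint {P X Y : PtdDbl.{u}} (p : P ⟶ X) (q : P ⟶ Y) : Prop where
  fst : IsStrict p
  snd : IsStrict q
  functor : DblFunctor.IsJoint p.functor q.functor
  obj x y : ∃ z, (DblFunctor.tight p.functor).obj z = x ∧ (DblFunctor.tight q.functor).obj z = y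

variable {P X Y : PtdDbl.{u}} {p : P ⟶ X} {q : P ⟶ Y}

theorem IsJoint.forget_is2Product (h : IsJoint p q) : Is2Product p.functor q.functor :=
  h.functor.is2Product h.obj

theorem IsJoint.is2Product (h : IsJoint p q) : Is2Product p q :=
  is2Product_of_isJoint h.functor h.forget_is2Product h.fst h.snd

theorem IsStrict.nicheMap (h : IsStrict p) : Niche.IsStrict (nicheMap p) := by
  obtain ⟨h, k⟩ := h
  rintro (_ | _)
  · have e : (P.pt ≫ LooseBimod.homEnd P.dbl .zero) ≫
        LooseBimod.fiberMap (LooseBimod.homMap p.functor) .zero =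
        𝟙 DblCat.Pt.{u} ≫ (X.pt ≫ LooseBimod.homEnd X.dbl .zero) :=
      (DblCat.strict.assoc _ _ _).trans ((congrArg (P.pt ≫ ·)
        (LooseBimod.homEnd_naturality p.functor .zero)).trans
        ((DblCat.strict.assoc _ _ _).symm.trans ((congrArg (· ≫ _) h).trans
          (DblCat.strict.id_comp _).symm)))
    refine ⟨e, DblTrans.hom_ext_sq fun m => (nicheColax_sq p m).trans ?_⟩
    refine Eq.trans ?_ (DblTrans.eqToHom_sq e m).symm
    refine (congrArg (DblFunctor.sq (LooseBimod.homEnd X.dbl .zero))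
      ((congrArg (fun t => DblTrans.sq t m) k).trans (DblTrans.eqToHom_sq h m))).trans ?_
    exact DblFunctor.sq_eqToHom _ _ _
  · exact LooseBimod.homNat_eq_eqToHom p.functor .one

theorem IsJoint.nicheMap (h : IsJoint p q) : Niche.IsJoint (nicheMap p) (nicheMap q) where
  fst := h.fst.nicheMap
  snd := h.snd.nicheMap
  bimod :=
    { obj_ext := fun e e' => Prod.ext (h.functor.obj_ext (congrArg Prod.fst e)
        (congrArg Prod.fst e')) (Prod.mk.inj e).2
      map := fun f g => by
        obtain ⟨t, h1, h2⟩ := h.functor.map f.1 g.1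
        exact ⟨(t, f.2), Prod.ext h1 rfl, Prod.ext h2 (Subsingleton.elim (α := ULift (PLift _)) _ _)⟩
      map_ext := fun e e' => Prod.ext (h.functor.map_ext (congrArg Prod.fst e)
        (congrArg Prod.fst e')) (Prod.mk.inj e).2
      lo := fun f g => by
        obtain ⟨t, h1, h2⟩ := h.functor.lo f.1 g.1
        exact ⟨(t, f.2), Prod.ext h1 rfl, Prod.ext h2 (Subsingleton.elim (α := ULift (PLift _)) _ _)⟩
      lo_ext := fun e e' => Prod.ext (h.functor.lo_ext (congrArg Prod.fst e)
        (congrArg Prod.fst e')) (Prod.mk.inj e).2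
      sq := fun f g => by
        obtain ⟨t, h1, h2⟩ := h.functor.sq f.1 g.1
        exact ⟨(t, f.2), Prod.ext h1 rfl, Prod.ext h2 (Subsingleton.elim (α := ULift (PLift _)) _ _)⟩
      sq_ext := fun e e' => Prod.ext (h.functor.sq_ext (congrArg Prod.fst e)
        (congrArg Prod.fst e')) (Prod.mk.inj e).2 }
  obj x y e := by
    obtain ⟨z, h1, h2⟩ := h.obj x.1 y.1
    exact ⟨(z, x.2), Prod.ext h1 rfl, Prod.ext h2 e⟩
  ends := by
    rintro (_ | _)
    · exact DblCat.pt_isJoint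
    · exact h.functor
  ends_obj := by
    rintro (_ | _) x y
    · exact ⟨x, rfl, rfl⟩
    · exact h.obj x y

theorem exists_isJoint (X Y : PtdDbl.{u}) :
    ∃ (P : PtdDbl.{u}) (p : P ⟶ X) (q : P ⟶ Y), IsJoint p q := by
  obtain ⟨d, h, h'⟩ := (DblCat.is2Product_prod X.dbl Y.dbl).exists_lift X.pt Y.pt
  let P : PtdDbl.{u} := ⟨X.dbl.prod Y.dbl, d⟩
  exact ⟨P, Hom.mk (X := P) (Y := X) (X.dbl.prodFst Y.dbl) (eqToHom h)
    (DblTrans.eqToHom_isConjointCommuter _), Hom.mk (X := P) (Y := Y) (X.dbl.prodSnd Y.dbl)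
    (eqToHom h') (DblTrans.eqToHom_isConjointCommuter _), ⟨h, rfl⟩, ⟨h', rfl⟩,
    DblCat.prod_isJoint _ _, fun x y => ⟨(x, y), rfl, rfl⟩⟩

end PtdDbl

/-- A double functor to the walking loose arrow is an isomorphism onto its image. -/
theorem DblFunctor.IsJoint.of_loose {D : DblCat.{u}} (F : DblFunctor D DblCat.Loose.{u})
    (obj_ext : ∀ {x y : D.Obj}, F.tight.obj x = F.tight.obj y → x = y)
    (tight : ∀ x : D.Obj, Subsingleton (x ⟶ x)) (lo : ∀ {x y : D.Obj}, (F.tight.obj x = F.tight.obj y ∨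
      F.tight.obj x = .zero ∧ F.tight.obj y = .one) → Nonempty (D.Lo x y))
    (lo_ext : ∀ {x y : D.Obj}, Subsingleton (D.Lo x y))
    (sq_ext : ∀ {m : LoArr D.Lo}, Subsingleton (m ⟶ m)) : DblFunctor.IsJoint F F where
  obj_ext e _ := obj_ext e
  map {x y} f g := by
    obtain rfl := obj_ext f.down.down
    exact ⟨𝟙 _, Subsingleton.elim _ _, Subsingleton.elim _ _⟩
  map_ext {x y f g} _ _ := by
    obtain rfl := obj_ext (F.tight.map f).down.down
    exact (tight x).elim _ _
  lo m n := by
    obtain ⟨l⟩ := lo m.down.down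
    exact ⟨l, Subsingleton.elim (α := ULift (PLift _)) _ _,
      Subsingleton.elim (α := ULift (PLift _)) _ _⟩
  lo_ext _ _ := lo_ext.elim _ _
  sq {x y x' y' m n} α β := by
    obtain rfl := obj_ext (DblCat.Loose.dom α).down.down
    obtain rfl := obj_ext (DblCat.Loose.cod α).down.down
    obtain rfl := lo_ext.elim m n
    exact ⟨𝟙 _, Subsingleton.elim (α := ULift (PLift _)) _ _,
      Subsingleton.elim (α := ULift (PLift _)) _ _⟩
  sq_ext {x y x' y' m n γ δ} _ _ := by
    obtain rfl := obj_ext (DblCat.Loose.dom (F.sq γ)).down.down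
    obtain rfl := obj_ext (DblCat.Loose.cod (F.sq γ)).down.down
    obtain rfl := lo_ext.elim m n
    exact sq_ext.elim _ _

theorem DblCat.IsPoint.is2Terminal {D : DblCat.{u}} (h : D.IsPoint) : Is2Terminal D := by
  obtain ⟨⟨i⟩, h1, h2, h3⟩ := h
  have t : ∀ x y : D.Obj, Subsingleton (x ⟶ y) := fun x y =>
    ⟨fun f g => by obtain ⟨d⟩ := h1 x y; exact (d.uniq _).trans (d.uniq _).symm⟩
  have l : ∀ x y : D.Obj, Subsingleton (D.Lo x y) := fun x y =>
    ⟨fun f g => by obtain ⟨d⟩ := h2 x y; exact (d.uniq _).trans (d.uniq _).symm⟩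
  have s : ∀ m n : LoArr D.Lo, Subsingleton (m ⟶ n) := fun m n =>
    ⟨fun f g => by obtain ⟨d⟩ := h3 m n; exact (d.uniq _).trans (d.uniq _).symm⟩
  obtain ⟨u⟩ := DblCat.exists_toPt D
  have hu : DblFunctor.IsJoint u u :=
    { obj_ext := fun {x y} _ _ => (i.uniq x).trans (i.uniq y).symm
      map := fun {x y} _ _ => by
        obtain ⟨d⟩ := h1 x y
        exact ⟨d.default, Subsingleton.elim (α := ULift (PLift _)) _ _,
          Subsingleton.elim (α := ULift (PLift _)) _ _⟩
      map_ext := fun _ _ => (t _ _).elim _ _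
      lo := fun {x y} _ _ => by
        obtain ⟨d⟩ := h2 x y
        exact ⟨d.default, Subsingleton.elim (α := ULift (PLift _)) _ _,
          Subsingleton.elim (α := ULift (PLift _)) _ _⟩
      lo_ext := fun _ _ => (l _ _).elim _ _
      sq := fun {x y x' y' m n} _ _ => by
        obtain ⟨d⟩ := h3 (LoArr.mk m) (LoArr.mk n)
        exact ⟨d.default, Subsingleton.elim (α := ULift (PLift _)) _ _,
          Subsingleton.elim (α := ULift (PLift _)) _ _⟩
      sq_ext := fun _ _ => (s _ _).elim _ _ }
  refine is2Terminal_of (fun Z => ?_) (fun f g => hu.hom_ext (DblCat.pt_ext _ _) (DblCat.pt_ext _ _))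
    (fun α β => hu.hom_ext₂ (DblCat.pt_ext₂ (F := _ ≫ u) (G := _ ≫ u) _ _)
      (DblCat.pt_ext₂ (F := _ ≫ u) (G := _ ≫ u) _ _))
  obtain ⟨v⟩ := DblCat.exists_toPt Z
  obtain ⟨w, -⟩ := hu.exists_lift v v fun x => ⟨i.default, rfl, rfl⟩
  exact ⟨w⟩

namespace LooseBimod

theorem is2Terminal_of_isJoint {T : LooseBimod.{u}} (h : DblFunctor.IsJoint T.label T.label)
    (hs : ∀ i, ∃ x, (DblFunctor.tight T.label).obj x = i) : Is2Terminal T := by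
  refine is2Terminal_of (fun Z => ?_) (fun f g => hom_ext (h.hom_ext (f.w.trans g.w.symm)
    (f.w.trans g.w.symm))) (fun {Z f g} α β => Hom₂.ext' (h.hom_ext₂
      (Subsingleton.elim (α := (f.functor ≫ T.label) ⟶ (g.functor ≫ T.label)) _ _)
      (Subsingleton.elim (α := (f.functor ≫ T.label) ⟶ (g.functor ≫ T.label)) _ _)))
  obtain ⟨w, hw, -⟩ := h.exists_lift Z.label Z.label fun x =>
    (hs _).imp fun z hz => ⟨hz, hz⟩
  exact ⟨⟨w, hw⟩⟩

theorem fiber_is2Terminal_of_isJoint {T : LooseBimod.{u}} (h : DblFunctor.IsJoint T.label T.label)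
    (hs : ∀ i, ∃ x, (DblFunctor.tight T.label).obj x = i) (i : Side.{u}) :
    (T.fiberObj i).IsPoint := by
  obtain ⟨x, hx⟩ := hs i
  refine ⟨⟨⟨⟨⟨x, hx⟩⟩, fun y => Subtype.ext (h.obj_ext (y.2.trans hx.symm) (y.2.trans hx.symm))⟩⟩,
    fun x y => ?_, fun x y => ?_, fun m n => ?_⟩
  · obtain ⟨t, -⟩ := h.map (x := x.1) (y := y.1) ⟨⟨x.2.trans y.2.symm⟩⟩ ⟨⟨x.2.trans y.2.symm⟩⟩
    exact ⟨⟨⟨t⟩, fun s => h.map_ext (Subsingleton.elim _ _) (Subsingleton.elim _ _)⟩⟩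
  · obtain ⟨t, -⟩ := h.lo (x := x.1) (y := y.1) ⟨⟨Or.inl (x.2.trans y.2.symm)⟩⟩
      ⟨⟨Or.inl (x.2.trans y.2.symm)⟩⟩
    exact ⟨⟨⟨t⟩, fun s => h.lo_ext (Subsingleton.elim (α := ULift (PLift _)) _ _)
      (Subsingleton.elim (α := ULift (PLift _)) _ _)⟩⟩
  · obtain ⟨t, -⟩ := h.sq (m := m.arr) (n := n.arr)
      ⟨⟨m.src.2.trans n.src.2.symm, m.tgt.2.trans n.tgt.2.symm⟩⟩
      ⟨⟨m.src.2.trans n.src.2.symm, m.tgt.2.trans n.tgt.2.symm⟩⟩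
    exact ⟨⟨⟨t⟩, fun s => h.sq_ext (Subsingleton.elim (α := ULift (PLift _)) _ _)
      (Subsingleton.elim (α := ULift (PLift _)) _ _)⟩⟩

end LooseBimod

namespace PtdDbl

/-- The terminal pointed double category. -/
def terminal : PtdDbl.{u} := ⟨DblCat.Pt, 𝟙 _⟩

theorem terminal_is2Terminal : Is2Terminal terminal.{u} :=
  is2Terminal_of (T := terminal) DblCat.pt_is2Terminal

theorem terminal_bimod_isJoint :
    DblFunctor.IsJoint terminal.{u}.niche.bimod.label terminal.{u}.niche.bimod.label :=
  DblFunctor.IsJoint.of_loose _ (fun e => Prod.ext rfl e)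
    (fun _ => ⟨fun _ _ => Prod.ext (Subsingleton.elim (α := ULift (PLift _)) _ _)
      (Subsingleton.elim (α := ULift (PLift _)) _ _)⟩)
    (fun h => ⟨(⟨⟨trivial⟩⟩, ⟨⟨h⟩⟩)⟩)
    (⟨fun _ _ => Prod.ext (Subsingleton.elim (α := ULift (PLift _)) _ _)
      (Subsingleton.elim (α := ULift (PLift _)) _ _)⟩)
    (⟨fun _ _ => Prod.ext (Subsingleton.elim (α := ULift (PLift _)) _ _)
      (Subsingleton.elim (α := ULift (PLift _)) _ _)⟩)

theorem terminal_bimod_surjective (i : Side.{u}) :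
    ∃ x, (DblFunctor.tight terminal.{u}.niche.bimod.label).obj x = i := ⟨(PUnit.unit, i), rfl⟩

theorem terminal_niche_is2Terminal : Is2Terminal terminal.{u}.niche.toNiche :=
  Niche.is2Terminal_of (LooseBimod.is2Terminal_of_isJoint terminal_bimod_isJoint
    terminal_bimod_surjective) (by
      rintro (_ | _)
      · exact DblCat.pt_is2Terminal
      · exact DblCat.pt_is2Terminal)
    fun i => (LooseBimod.fiber_is2Terminal_of_isJoint terminal_bimod_isJoint
      terminal_bimod_surjective i).is2Terminal

theorem terminal_restrict_isJoint : DblFunctor.IsJoint terminal.{u}.niche.restrict.bimod.label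
    terminal.{u}.niche.restrict.bimod.label :=
  DblFunctor.IsJoint.of_loose _
    (fun {x y} e => by
      rcases x with x | x <;> rcases y with y | y
      · rfl
      · nomatch (show Side.zero = Side.one from e)
      · nomatch (show Side.one = Side.zero from e)
      · rfl)
    (fun x => ⟨fun f g => by
      rcases x with x | x
      · obtain ⟨f, rfl⟩ := Cograph.Ti.left_eq f
        obtain ⟨g, rfl⟩ := Cograph.Ti.left_eq g
        exact congrArg Cograph.Ti.left (Subsingleton.elim (α := ULift (PLift _)) _ _)
      · obtain ⟨f, rfl⟩ := Cograph.Ti.right_eq f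
        obtain ⟨g, rfl⟩ := Cograph.Ti.right_eq g
        exact congrArg Cograph.Ti.right (Subsingleton.elim (α := ULift (PLift _)) _ _)⟩)
    (fun {x y} h => by
      rcases x with x | x <;> rcases y with y | y
      · exact ⟨.left ⟨⟨trivial⟩⟩⟩
      · exact ⟨.het (⟨⟨trivial⟩⟩, ⟨⟨Or.inr ⟨rfl, rfl⟩⟩⟩)⟩
      · rcases h with h | ⟨h, -⟩
        · nomatch (show Side.one = Side.zero from h)
        · nomatch (show Side.one = Side.zero from h)
      · exact ⟨.right ⟨⟨trivial⟩⟩⟩)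
    (fun {x y} => ⟨fun m n => by
      rcases x with x | x <;> rcases y with y | y
      · obtain ⟨m, rfl⟩ := Cograph.Lo.left_eq m
        obtain ⟨n, rfl⟩ := Cograph.Lo.left_eq n
        exact congrArg Cograph.Lo.left (Subsingleton.elim (α := ULift (PLift _)) _ _)
      · obtain ⟨m, rfl⟩ := Cograph.Lo.het_eq m
        obtain ⟨n, rfl⟩ := Cograph.Lo.het_eq n
        exact congrArg Cograph.Lo.het (Prod.ext (Subsingleton.elim (α := ULift (PLift _)) _ _)
          (Subsingleton.elim (α := ULift (PLift _)) _ _))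
      · nomatch m
      · obtain ⟨m, rfl⟩ := Cograph.Lo.right_eq m
        obtain ⟨n, rfl⟩ := Cograph.Lo.right_eq n
        exact congrArg Cograph.Lo.right (Subsingleton.elim (α := ULift (PLift _)) _ _)⟩)
    (fun {m} => ⟨fun α β => by
      rcases m with ⟨m | m | m⟩
      · obtain ⟨α, rfl⟩ := Cograph.Sq.left_eq α
        obtain ⟨β, rfl⟩ := Cograph.Sq.left_eq β
        exact congrArg Cograph.Sq.left (Subsingleton.elim (α := ULift (PLift _)) _ _)
      · obtain ⟨α, rfl⟩ := Cograph.Sq.het_eq α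
        obtain ⟨β, rfl⟩ := Cograph.Sq.het_eq β
        exact congrArg Cograph.Sq.het (Cograph.Het.ext'
          (Subsingleton.elim (α := ULift (PLift _)) _ _)
          (Subsingleton.elim (α := ULift (PLift _)) _ _)
          (Prod.ext (Subsingleton.elim (α := ULift (PLift _)) _ _)
            (Subsingleton.elim (α := ULift (PLift _)) _ _)))
      · obtain ⟨α, rfl⟩ := Cograph.Sq.right_eq α
        obtain ⟨β, rfl⟩ := Cograph.Sq.right_eq β
        exact congrArg Cograph.Sq.right (Subsingleton.elim (α := ULift (PLift _)) _ _)⟩)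

theorem terminal_restrict_surjective (i : Side.{u}) :
    ∃ x, (DblFunctor.tight terminal.{u}.niche.restrict.bimod.label).obj x = i := by
  rcases i with _ | _
  · exact ⟨.inl PUnit.unit, rfl⟩
  · exact ⟨.inr PUnit.unit, rfl⟩

theorem terminal_restrict_is2Terminal : Is2Terminal terminal.{u}.niche.restrict.bimod :=
  LooseBimod.is2Terminal_of_isJoint terminal_restrict_isJoint terminal_restrict_surjective

end PtdDbl

section

universe w₁ v₁ u₁ w₂ v₂ u₂ w₃ v₃ u₃
variable {B : Type u₁} [Bicategory.{w₁, v₁} B] {C : Type u₂} [Bicategory.{w₂, v₂} C]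
  {D : Type u₃} [Bicategory.{w₃, v₃} D]

/-- A 2-cell given by an equality of 1-cells. -/
def IsEqCell {X Y : B} {f g : X ⟶ Y} (α : f ⟶ g) : Prop := ∃ h, α = eqToHom h

theorem IsEqCell.eqToHom {X Y : B} {f g : X ⟶ Y} (h : f = g) : IsEqCell (eqToHom h) := ⟨h, rfl⟩

theorem IsEqCell.comp {X Y : B} {f g h : X ⟶ Y} {α : f ⟶ g} {β : g ⟶ h} (hα : IsEqCell α)
    (hβ : IsEqCell β) : IsEqCell (α ≫ β) := by
  obtain ⟨rfl, rfl⟩ := hα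
  obtain ⟨rfl, rfl⟩ := hβ
  exact ⟨rfl, by simp⟩

theorem IsEqCell.whiskerLeft {X Y Z : B} (k : X ⟶ Y) {f g : Y ⟶ Z} {α : f ⟶ g} (h : IsEqCell α) :
    IsEqCell (k ◁ α) := by
  obtain ⟨rfl, rfl⟩ := h
  exact ⟨rfl, by simp⟩

theorem IsEqCell.whiskerRight {X Y Z : B} {f g : X ⟶ Y} {α : f ⟶ g} (h : IsEqCell α) (k : Y ⟶ Z) :
    IsEqCell (α ▷ k) := by
  obtain ⟨rfl, rfl⟩ := h
  exact ⟨rfl, by simp⟩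

theorem IsEqCell.map (F : B ⥤ᵖ C) {X Y : B} {f g : X ⟶ Y} {α : f ⟶ g} (h : IsEqCell α) :
    IsEqCell (F.map₂ α) := by
  obtain ⟨rfl, rfl⟩ := h
  exact ⟨rfl, F.map₂_id _⟩

theorem IsEqCell.of_iso {X Y : B} {f g : X ⟶ Y} {e : f ≅ g} {h : f = g} (k : e = eqToIso h) :
    IsEqCell e.hom := ⟨h, by rw [k]; rfl⟩

theorem IsEqCell.eq {X Y : B} {f g : X ⟶ Y} {α β : f ⟶ g} (h : IsEqCell α) (k : IsEqCell β) :
    α = β := by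
  obtain ⟨_, rfl⟩ := h
  obtain ⟨_, rfl⟩ := k
  rfl

theorem isEqCell_mapId (F : StrictPseudofunctor B C) (X : B) : IsEqCell (F.pseudo.mapId X).hom :=
  .of_iso (F.mapId_eq_eqToIso X)

theorem isEqCell_mapComp (F : StrictPseudofunctor B C) {X Y Z : B} (f : X ⟶ Y) (g : Y ⟶ Z) :
    IsEqCell (F.pseudo.mapComp f g).hom := .of_iso (F.mapComp_eq_eqToIso f g)

theorem IsEqCell.eqToIso_hom {X Y : B} {f g : X ⟶ Y} (h : f = g) : IsEqCell (eqToIso h).hom := ⟨h, rfl⟩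

theorem IsEqCell.eqToIso_inv {X Y : B} {f g : X ⟶ Y} (h : f = g) : IsEqCell (eqToIso h).inv :=
  ⟨h.symm, rfl⟩

theorem IsEqCell.whiskerLeft_comp {X Y Z : B} {k : X ⟶ Y} {f g h : Y ⟶ Z} {α : f ⟶ g} {β : g ⟶ h}
    (hα : IsEqCell (k ◁ α)) (hβ : IsEqCell β) : IsEqCell (k ◁ (α ≫ β)) := by
  rw [Bicategory.whiskerLeft_comp]
  exact hα.comp (hβ.whiskerLeft k)

theorem IsEqCell.whiskerLeft_map_comp (F : B ⥤ᵖ C) {X Y : B} {W : C} {k : W ⟶ F.obj X} {f g h : X ⟶ Y}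
    {α : f ⟶ g} {β : g ⟶ h} (hα : IsEqCell α) (hβ : IsEqCell (k ◁ F.map₂ β)) :
    IsEqCell (k ◁ F.map₂ (α ≫ β)) := by
  rw [F.map₂_comp, Bicategory.whiskerLeft_comp]
  exact ((hα.map F).whiskerLeft k).comp hβ

theorem isEqCell_comp_mapId (F : B ⥤ᵖ C) (G : StrictPseudofunctor C D) {X : B} {Y : D}
    {k : Y ⟶ G.obj (F.obj X)} (h : IsEqCell (k ◁ G.map₂ (F.mapId X).hom)) :
    IsEqCell (k ◁ ((F.comp G.pseudo).mapId X).hom) :=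
  h.whiskerLeft_comp (isEqCell_mapId G _)

theorem isEqCell_comp_mapComp (F : B ⥤ᵖ C) (G : StrictPseudofunctor C D) {X Y Z : B} {W : D}
    {k : W ⟶ G.obj (F.obj X)} (f : X ⟶ Y) (g : Y ⟶ Z)
    (h : IsEqCell (k ◁ G.map₂ (F.mapComp f g).hom)) :
    IsEqCell (k ◁ ((F.comp G.pseudo).mapComp f g).hom) :=
  h.whiskerLeft_comp (isEqCell_mapComp G _ _)

/-- A strictly natural transformation between pseudofunctors with constraints that are equalities on
its components. -/
def strictTrans [Strict C] {F G : B ⥤ᵖ C} (app : ∀ X, F.obj X ⟶ G.obj X)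
    (h : ∀ {X Y : B} (f : X ⟶ Y), F.map f ≫ app Y = app X ≫ G.map f)
    (h₂ : ∀ {X Y : B} {f g : X ⟶ Y} (α : f ⟶ g),
      F.map₂ α ▷ app Y ≫ eqToHom (h g) = eqToHom (h f) ≫ app X ◁ G.map₂ α)
    (hF : ∀ X, IsEqCell (F.mapId X).hom)
    (hF' : ∀ {X Y Z : B} (f : X ⟶ Y) (g : Y ⟶ Z), IsEqCell (F.mapComp f g).hom)
    (hG : ∀ X, IsEqCell (app X ◁ (G.mapId X).hom))
    (hG' : ∀ {X Y Z : B} (f : X ⟶ Y) (g : Y ⟶ Z), IsEqCell (app X ◁ (G.mapComp f g).hom)) :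
    F.StrongTrans G where
  app := app
  naturality f := eqToIso (h f)
  naturality_naturality α := h₂ α
  naturality_id X := by
    refine IsEqCell.eq ((IsEqCell.eqToIso_hom _).comp (hG X)) (((hF X).whiskerRight _).comp ?_)
    rw [Strict.leftUnitor_eqToIso, Strict.rightUnitor_eqToIso]
    exact (IsEqCell.eqToIso_hom _).comp (IsEqCell.eqToIso_inv _)
  naturality_comp f g := by
    refine IsEqCell.eq ((IsEqCell.eqToIso_hom _).comp (hG' f g))
      (((hF' f g).whiskerRight _).comp ?_)
    simp only [Strict.associator_eqToIso]
    exact (IsEqCell.eqToIso_hom _).comp (((IsEqCell.eqToIso_hom _).whiskerLeft _).comp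
      ((IsEqCell.eqToIso_inv _).comp (((IsEqCell.eqToIso_hom _).whiskerRight _).comp
        (IsEqCell.eqToIso_hom _))))

/-- Pseudofunctors with the same underlying data and equal constraints are equal. -/
theorem CategoryTheory.Pseudofunctor.ext_of_toPrelaxFunctor {F G : B ⥤ᵖ C}
    (h : F.toPrelaxFunctor = G.toPrelaxFunctor) (hId : ∀ X, HEq (F.mapId X).hom (G.mapId X).hom)
    (hComp : ∀ {X Y Z : B} (f : X ⟶ Y) (g : Y ⟶ Z),
      HEq (F.mapComp f g).hom (G.mapComp f g).hom) : F = G := by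
  rcases F with @⟨F, i, c⟩
  rcases G with @⟨G, j, d⟩
  dsimp only at h
  subst h
  have e : i = j := funext fun X => Iso.ext (eq_of_heq (hId X))
  have e' : @c = @d := by
    funext X Y Z f g
    exact Iso.ext (eq_of_heq (hComp f g))
  subst e e'
  rfl

end

theorem DblFunctor.IsJoint.isInv {P D : DblCat.{u}} {p : P ⟶ D} {q : P ⟶ DblCat.Pt.{u}}
    (h : DblFunctor.IsJoint p q) (hs : ∀ x, ∃ z, (DblFunctor.tight p).obj z = x) : IsInv p := by
  obtain ⟨u⟩ := DblCat.exists_toPt D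
  obtain ⟨g, hg, -⟩ := h.exists_lift (𝟙 D) u fun x => (hs x).imp fun z hz => ⟨hz, rfl⟩
  refine ⟨g, h.hom_ext ?_ (DblCat.pt_ext _ _), hg⟩
  refine (DblCat.strict.assoc p g p).trans ((congrArg (p ≫ ·) hg).trans ?_)
  exact (DblCat.strict.comp_id p).trans (DblCat.strict.id_comp p).symm

namespace Niche

open LooseBimod

theorem inc_isInv (N : Niche.{u}) (i : Side.{u}) : IsInv (N.inc i) := by
  obtain ⟨u⟩ := DblCat.exists_toPt (N.E i)
  rcases i with _ | _
  · refine DblFunctor.IsJoint.isInv (q := u)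
      { obj_ext := fun e _ => Sum.inl.inj (congrArg Subtype.val e)
        map := fun f _ => by
          obtain ⟨g, rfl⟩ := Cograph.Ti.left_eq f
          exact ⟨g, rfl, Subsingleton.elim (α := ULift (PLift _)) _ _⟩
        map_ext := fun e _ => Cograph.Ti.left.inj e
        lo := fun m _ => by
          obtain ⟨n, rfl⟩ := Cograph.Lo.left_eq m
          exact ⟨n, rfl, Subsingleton.elim (α := ULift (PLift _)) _ _⟩
        lo_ext := fun e _ => Cograph.Lo.left.inj e
        sq := fun α _ => by
          obtain ⟨β, rfl⟩ := Cograph.Sq.left_eq α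
          exact ⟨β, rfl, Subsingleton.elim (α := ULift (PLift _)) _ _⟩
        sq_ext := fun e _ => Cograph.Sq.left.inj e } ?_
    rintro ⟨x | x, hx⟩
    · exact ⟨x, rfl⟩
    · nomatch (show Side.one = Side.zero from hx)
  · refine DblFunctor.IsJoint.isInv (q := u)
      { obj_ext := fun e _ => Sum.inr.inj (congrArg Subtype.val e)
        map := fun f _ => by
          obtain ⟨g, rfl⟩ := Cograph.Ti.right_eq f
          exact ⟨g, rfl, Subsingleton.elim (α := ULift (PLift _)) _ _⟩
        map_ext := fun e _ => Cograph.Ti.right.inj e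
        lo := fun m _ => by
          obtain ⟨n, rfl⟩ := Cograph.Lo.right_eq m
          exact ⟨n, rfl, Subsingleton.elim (α := ULift (PLift _)) _ _⟩
        lo_ext := fun e _ => Cograph.Lo.right.inj e
        sq := fun α _ => by
          obtain ⟨β, rfl⟩ := Cograph.Sq.right_eq α
          exact ⟨β, rfl, Subsingleton.elim (α := ULift (PLift _)) _ _⟩
        sq_ext := fun e _ => Cograph.Sq.right.inj e } ?_
    rintro ⟨x | x, hx⟩
    · nomatch (show Side.zero = Side.one from hx)
    · exact ⟨x, rfl⟩

end Niche

namespace Restriction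

open LooseBimod

variable (R : Restriction.{u})

theorem map₂_ends_comp {M N : Niche.{u}} {a b : M ⟶ N} (β : a ⟶ b) (i : Side.{u}) :
    Niche.Hom₂.f β i ▷ N.inc i ≫ eqToHom (R.map_ends b i).symm =
      eqToHom (R.map_ends a i).symm ≫ M.inc i ◁ fiberMap₂ (R.map₂ β) i := by
  obtain ⟨h, h', e⟩ := R.map₂_ends β i
  rw [e]
  simp

/-- The identification of the ends of the restriction. -/
def endsTrans (i : Side.{u}) : (Niche.endpoint i).pseudo.StrongTrans
    (R.toPseudofunctor.comp (LooseBimod.fiber i).pseudo) :=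
  have := DblCat.strict.{u}
  strictTrans (F := (Niche.endpoint i).pseudo)
    (G := R.toPseudofunctor.comp (LooseBimod.fiber i).pseudo) (fun N => N.inc i)
    (fun a => (R.map_ends a i).symm) (fun β => R.map₂_ends_comp β i)
    (fun N => isEqCell_mapId (Niche.endpoint i) N)
    (fun a b => isEqCell_mapComp (Niche.endpoint i) a b)
    (fun N => isEqCell_comp_mapId R.toPseudofunctor (LooseBimod.fiber i) (R.mapId_ends N i))
    (fun a b => isEqCell_comp_mapComp R.toPseudofunctor (LooseBimod.fiber i) a b
      (R.mapComp_ends a b i))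

theorem endsTrans_isStrictIso (i : Side.{u}) : IsStrictIso (R.endsTrans i) :=
  ⟨fun N => N.inc_isInv i, fun a => ⟨(R.map_ends a i).symm, rfl⟩⟩

/-- The identification of the target of the module of initial processes. -/
def initialTrans : (PtdDbl.forget.pseudo.comp (Pseudofunctor.id DblCat.{u})).StrongTrans
    ((PtdDbl.toRightNiche.pseudo.comp R.right).comp LooseRightMod.target.pseudo) :=
  have := DblCat.strict.{u}
  strictTrans (F := PtdDbl.forget.pseudo.comp (Pseudofunctor.id DblCat.{u}))
    (G := (PtdDbl.toRightNiche.pseudo.comp R.right).comp LooseRightMod.target.pseudo)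
    (fun X => X.niche.toNiche.inc .one)
    (fun F => (R.map_ends (PtdDbl.nicheMap F) .one).symm)
    (fun α => R.map₂_ends_comp (PtdDbl.nicheMap₂ α) .one)
    (fun X => (isEqCell_mapId PtdDbl.forget X).comp (IsEqCell.eqToHom rfl))
    (fun F G => (isEqCell_mapComp PtdDbl.forget F G).comp (IsEqCell.eqToHom rfl))
    (fun X => isEqCell_comp_mapId (PtdDbl.toRightNiche.pseudo.comp R.right) LooseRightMod.target
      (IsEqCell.whiskerLeft_map_comp LooseRightMod.target.pseudo
        ((isEqCell_mapId PtdDbl.toRightNiche X).map R.right) (R.mapId_ends X.niche.toNiche .one)))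
    (fun F G => isEqCell_comp_mapComp (PtdDbl.toRightNiche.pseudo.comp R.right)
      LooseRightMod.target F G (IsEqCell.whiskerLeft_map_comp LooseRightMod.target.pseudo
        ((isEqCell_mapComp PtdDbl.toRightNiche F G).map R.right)
        (R.mapComp_ends (PtdDbl.nicheMap F) (PtdDbl.nicheMap G) .one)))

theorem initialTrans_isStrictIso : IsStrictIso R.initialTrans :=
  ⟨fun X => X.niche.toNiche.inc_isInv .one,
    fun F => ⟨(R.map_ends (PtdDbl.nicheMap F) .one).symm, rfl⟩⟩

theorem right_comp_incl : R.right.comp LooseRightMod.incl.pseudo =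
    RightNiche.incl.pseudo.comp R.toPseudofunctor := by
  refine Pseudofunctor.ext_of_toPrelaxFunctor rfl (fun X => heq_of_eq ?_)
    (fun f g => heq_of_eq ?_)
  · refine (Category.comp_id _).trans ?_
    exact ((congrArg (· ≫ _) (R.map₂_id _)).trans (Category.id_comp _)).symm
  · refine (Category.comp_id _).trans ?_
    exact ((congrArg (· ≫ _) (R.map₂_id _)).trans (Category.id_comp _)).symm

end Restriction

namespace DblCat

theorem isCartesian : IsCartesian2Category DblCat.{u} :=
  ⟨strict, ⟨Pt, pt_is2Terminal⟩, fun X Y => ⟨X.prod Y, X.prodFst Y, X.prodSnd Y, is2Product_prod X Y⟩⟩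

end DblCat

namespace LooseBimod

theorem isCartesian : IsCartesian2Category LooseBimod.{u} :=
  ⟨strict, ⟨terminal, terminal_is2Terminal⟩,
    fun M N => ⟨M.prod N, M.prodFst N, M.prodSnd N, M.is2Product_prod N⟩⟩

end LooseBimod

namespace Niche

theorem isCartesian : IsCartesian2Category Niche.{u} := by
  refine ⟨strict, ⟨_, PtdDbl.terminal_niche_is2Terminal⟩, fun M N => ?_⟩
  obtain ⟨P, p, q, h⟩ := exists_isJoint M N
  exact ⟨P, p, q, h.is2Product⟩

end Niche

namespace RightNiche

theorem terminal_is2Terminal : Is2Terminal (PtdDbl.rightNiche PtdDbl.terminal.{u}) :=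
  InducedBicategory.is2Terminal PtdDbl.terminal_niche_is2Terminal

theorem isCartesian : IsCartesian2Category RightNiche.{u} := by
  have := Niche.strict.{u}
  refine ⟨inferInstance, ⟨_, terminal_is2Terminal⟩, fun M N => ?_⟩
  obtain ⟨P, p, q, h⟩ := exists_isJoint M N
  exact ⟨P, p, q, InducedBicategory.is2Product h.is2Product⟩

theorem incl_isCartesian : IsCartesian2Functor incl.{u} := by
  have := Niche.strict.{u}
  refine isCartesian2Functor_of _ ⟨_, terminal_is2Terminal, PtdDbl.terminal_niche_is2Terminal⟩
    fun M N => ?_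
  obtain ⟨P, p, q, h⟩ := exists_isJoint M N
  exact ⟨P, p, q, InducedBicategory.is2Product h.is2Product, h.is2Product⟩

end RightNiche

namespace LooseRightMod

/-- The product of two loose right modules. -/
abbrev prod (M N : LooseRightMod.{u}) : LooseRightMod.{u} := RightModule.prod M N

/-- The first projection. -/
def prodFst (M N : LooseRightMod.{u}) : prod M N ⟶ M :=
  InducedBicategory.mkHom (LooseBimod.prodFst (RightModule.bimod M) (RightModule.bimod N))

/-- The second projection. -/
def prodSnd (M N : LooseRightMod.{u}) : prod M N ⟶ N :=
  InducedBicategory.mkHom (LooseBimod.prodSnd (RightModule.bimod M) (RightModule.bimod N))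

theorem is2Product_prod (M N : LooseRightMod.{u}) : Is2Product (prodFst M N) (prodSnd M N) :=
  InducedBicategory.is2Product (LooseBimod.is2Product_prod _ _)

/-- The terminal loose right module. -/
def terminal : LooseRightMod.{u} := RightNicheData.restrict PtdDbl.terminal.niche

theorem terminal_is2Terminal : Is2Terminal terminal.{u} :=
  InducedBicategory.is2Terminal PtdDbl.terminal_restrict_is2Terminal

theorem isCartesian : IsCartesian2Category LooseRightMod.{u} := by
  have := LooseBimod.strict.{u}
  exact ⟨inferInstance, ⟨_, terminal_is2Terminal⟩, fun M N => ⟨_, _, _, is2Product_prod M N⟩⟩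

theorem incl_isCartesian : IsCartesian2Functor incl.{u} := by
  have := LooseBimod.strict.{u}
  exact isCartesian2Functor_of _ ⟨_, terminal_is2Terminal, PtdDbl.terminal_restrict_is2Terminal⟩
    fun M N => ⟨_, _, _, is2Product_prod M N, LooseBimod.is2Product_prod _ _⟩

theorem target_isCartesian : IsCartesian2Functor target.{u} := by
  have := LooseBimod.strict.{u}
  have := DblCat.strict.{u}
  exact isCartesian2Functor_of _ ⟨_, terminal_is2Terminal,
    (LooseBimod.fiber_is2Terminal_of_isJoint PtdDbl.terminal_restrict_isJoint
      PtdDbl.terminal_restrict_surjective .one).is2Terminal⟩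
    fun M N => ⟨_, _, _, is2Product_prod M N, LooseBimod.fiber_is2Product_prod _ _ .one⟩

end LooseRightMod

namespace PtdDbl

theorem isCartesian : IsCartesian2Category PtdDbl.{u} := by
  refine ⟨strict, ⟨_, terminal_is2Terminal⟩, fun M N => ?_⟩
  obtain ⟨P, p, q, h⟩ := exists_isJoint M N
  exact ⟨P, p, q, h.is2Product⟩

theorem forget_isCartesian : IsCartesian2Functor forget.{u} := by
  have := strict.{u}
  have := DblCat.strict.{u}
  refine isCartesian2Functor_of _ ⟨_, terminal_is2Terminal, DblCat.pt_is2Terminal⟩ fun M N => ?_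
  obtain ⟨P, p, q, h⟩ := exists_isJoint M N
  exact ⟨P, p, q, h.is2Product, h.forget_is2Product⟩

theorem toRightNiche_isCartesian : IsCartesian2Functor toRightNiche.{u} := by
  have := strict.{u}
  have := Niche.strict.{u}
  refine isCartesian2Functor_of _ ⟨_, terminal_is2Terminal, RightNiche.terminal_is2Terminal⟩
    fun M N => ?_
  obtain ⟨P, p, q, h⟩ := exists_isJoint M N
  exact ⟨P, p, q, h.is2Product, InducedBicategory.is2Product h.nicheMap.is2Product⟩

end PtdDbl

namespace Restriction

variable (R : Restriction.{u})

theorem isCartesian : IsCartesianPseudofunctor R.toPseudofunctor := by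
  have := Niche.strict.{u}
  refine isCartesianPseudofunctor_of _ ⟨_, PtdDbl.terminal_niche_is2Terminal,
    PtdDbl.terminal_restrict_is2Terminal.isBiterminal⟩ fun M N => ?_
  obtain ⟨P, p, q, h⟩ := Niche.exists_isJoint M N
  exact ⟨P, p, q, h.is2Product, h.isBiproduct_restriction R⟩

theorem right_isCartesian : IsCartesianPseudofunctor R.right := by
  have := Niche.strict.{u}
  refine isCartesianPseudofunctor_of _ ⟨_, RightNiche.terminal_is2Terminal,
    LooseRightMod.terminal_is2Terminal.isBiterminal⟩ fun M N => ?_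
  obtain ⟨P, p, q, h⟩ := RightNiche.exists_isJoint M N
  exact ⟨P, p, q, InducedBicategory.is2Product h.is2Product,
    InducedBicategory.isBiproduct (h.isBiproduct_restriction R)⟩

end Restriction

namespace PtdDbl

theorem exists_toHet {X : PtdDbl.{u}} {y : X.dbl.Obj}
    (m : Cograph.Lo (X.niche.toNiche.leg .zero) (X.niche.toNiche.leg .one) (Sum.inl PUnit.unit)
      (Sum.inr y)) : ∃ p : X.dbl.Lo X.point y, m = LooseOut.toHet ⟨y, p⟩ := by
  obtain ⟨⟨m, k⟩, rfl⟩ := Cograph.Lo.het_eq m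
  exact ⟨m, congrArg Cograph.Lo.het (Prod.ext rfl (Subsingleton.elim (α := ULift (PLift _)) _ _))⟩

theorem exists_toSq {X : PtdDbl.{u}} {p q : X.LooseOut}
    (α : Cograph.Sq (X.niche.toNiche.leg .zero) (X.niche.toNiche.leg .one) ⟨p.toHet⟩ ⟨q.toHet⟩) :
    ∃ β : p ⟶ q, LooseOut.toSq β = α := by
  obtain ⟨⟨f, g, ⟨s, s'⟩, h, k⟩, rfl⟩ := Cograph.Sq.het_eq α
  refine ⟨⟨s, (congrArg Prod.fst h).trans (LooseOut.map_pt f)⟩, congrArg Cograph.Sq.het ?_⟩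
  exact Cograph.Het.ext' (Subsingleton.elim (α := ULift (PLift _)) _ _) (congrArg Prod.fst k)
    (Prod.ext rfl (Subsingleton.elim (α := ULift (PLift _)) _ _))

/-- The loose arrow out of the point underlying a heteromorphism. -/
def LooseOut.ofHet {X : PtdDbl.{u}} (d : X.LooseOut) :
    LoArr (Cograph.Lo (X.niche.toNiche.leg .zero) (X.niche.toNiche.leg .one)) → X.LooseOut
  | ⟨.het m⟩ => ⟨_, m.1⟩
  | ⟨.left _⟩ => d
  | ⟨.right _⟩ => d

theorem systems_isCatIso (X : PtdDbl.{u}) : IsCatIso X.systems := by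
  refine ⟨⟨fun {p q} α => ?_⟩, ⟨fun {p q α β} e => ?_⟩, fun p q e => ?_, ?_⟩
  · obtain ⟨β, hβ⟩ := exists_toSq α.hom
    exact ⟨β, ObjectProperty.hom_ext _ hβ⟩
  · have h : LooseOut.toSq α = LooseOut.toSq β :=
      congrArg (fun t => t.hom) e
    exact LooseOut.Hom.ext (congrArg (fun t => Prod.fst (Cograph.Het.sq t)) (Cograph.Sq.het.inj h))
  · have h : @LoArr.mk _ X.niche.toNiche.restrict.collage.Lo _ _ p.toHet = LoArr.mk q.toHet :=
      congrArg ObjectProperty.FullSubcategory.obj e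
    exact congrArg (LooseOut.ofHet p) h
  · rintro ⟨⟨m⟩, h, k⟩
    rcases m with m | @⟨a, b, m⟩ | m
    · nomatch (show Side.zero = Side.one from k)
    · obtain ⟨p, hp⟩ := exists_toHet (.het m)
      have e : @LoArr.mk _ X.niche.toNiche.restrict.collage.Lo _ _
          (LooseOut.toHet ⟨b, p⟩) = ⟨.het m⟩ :=
        congrArg (fun t : X.niche.toNiche.restrict.collage.Lo (.inl PUnit.unit) (.inr b) =>
          LoArr.mk t) hp.symm
      exact ⟨⟨b, p⟩, ObjectProperty.FullSubcategory.ext e⟩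
    · nomatch (show Side.one = Side.zero from h)

theorem LooseOut.comp_toHet {X : PtdDbl.{u}} (p : X.LooseOut) {y : X.dbl.Obj} (l : X.dbl.Lo p.tgt y) :
    X.niche.restrict.bimod.collage.comp p.toHet (DblFunctor.lo (X.niche.toNiche.inc .one) l) =
      (p.act l).toHet :=
  congrArg Cograph.Lo.het (Prod.ext rfl (Subsingleton.elim (α := ULift (PLift _)) _ _))

theorem LooseOut.compSq_toSq {X : PtdDbl.{u}} {p q : X.LooseOut} (α : p ⟶ q) {y z : X.dbl.Obj}
    (l : X.dbl.Lo p.tgt y) (k : X.dbl.Lo q.tgt z) (β : LoArr.mk l ⟶ LoArr.mk k)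
    (h : X.dbl.cod (LooseOut.Hom.sq α) = X.dbl.dom β) :
    ∃ h', X.niche.restrict.bimod.collage.compSq (LooseOut.toSq α)
        (DblFunctor.sq (X.niche.toNiche.inc .one) β) h' = LooseOut.toSq (LooseOut.actSq α β h) := by
  refine ⟨congrArg Cograph.Ti.right h, Cograph.Sq.het_congr rfl ?_ ?_⟩
  · exact (X.dbl.cod_compSq _ _ _).symm
  · exact Prod.ext rfl (Subsingleton.elim (α := ULift (PLift _)) _ _)

end PtdDbl

theorem mainTheorem9 :
    (IsCartesian2Category DblCat.{u} ∧ IsCartesian2Category LooseBimod.{u} ∧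
      IsCartesian2Category LooseRightMod.{u} ∧ IsCartesian2Category Niche.{u} ∧
      IsCartesian2Category RightNiche.{u} ∧ IsCartesian2Category PtdDbl.{u}) ∧
    IsCartesian2Functor PtdDbl.toRightNiche.{u} ∧ IsCartesian2Functor RightNiche.incl.{u} ∧
    IsCartesian2Functor LooseRightMod.incl.{u} ∧ IsCartesian2Functor LooseRightMod.target.{u} ∧
    Nonempty Restriction.{u} ∧ ∀ R : Restriction.{u},
      IsCartesianPseudofunctor R.toPseudofunctor ∧
      (∀ i : Side.{u}, ∃ θ : (Niche.endpoint i).pseudo.StrongTrans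
          (R.toPseudofunctor.comp (LooseBimod.fiber i).pseudo),
        IsStrictIso θ ∧ ∀ N, θ.app N = N.inc i) ∧
      IsCartesianPseudofunctor R.right ∧
      R.right.comp LooseRightMod.incl.pseudo = RightNiche.incl.pseudo.comp R.toPseudofunctor ∧
      (∃ θ : (PtdDbl.forget.pseudo.comp (Pseudofunctor.id DblCat.{u})).StrongTrans
          ((PtdDbl.toRightNiche.pseudo.comp R.right).comp LooseRightMod.target.pseudo),
        IsDoctrine PtdDbl.forget (PtdDbl.toRightNiche.pseudo.comp R.right)
          (Pseudofunctor.id DblCat.{u}) θ ∧ ∀ X, θ.app X = X.niche.toNiche.inc .one) ∧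
      ∀ X : PtdDbl.{u},
        ((PtdDbl.toRightNiche.pseudo.comp R.right).obj X).bimod = X.niche.restrict.bimod ∧
        IsCatIso X.systems ∧
        ∀ (p q : X.LooseOut) (α : p ⟶ q) {y z : X.dbl.Obj} (l : X.dbl.Lo p.tgt y)
          (k : X.dbl.Lo q.tgt z) (β : LoArr.mk l ⟶ LoArr.mk k)
          (h : X.dbl.cod (PtdDbl.LooseOut.Hom.sq α) = X.dbl.dom β),
          X.niche.restrict.bimod.collage.comp p.toHet
              (DblFunctor.lo (X.niche.toNiche.inc .one) l) = (p.act l).toHet ∧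
          ∃ h', X.niche.restrict.bimod.collage.compSq (PtdDbl.LooseOut.toSq α)
              (DblFunctor.sq (X.niche.toNiche.inc .one) β) h' =
            PtdDbl.LooseOut.toSq (PtdDbl.LooseOut.actSq α β h) := by
  refine ⟨⟨DblCat.isCartesian, LooseBimod.isCartesian, LooseRightMod.isCartesian,
    Niche.isCartesian, RightNiche.isCartesian, PtdDbl.isCartesian⟩,
    PtdDbl.toRightNiche_isCartesian, RightNiche.incl_isCartesian, LooseRightMod.incl_isCartesian,
    LooseRightMod.target_isCartesian, ⟨Niche.restriction⟩, fun R => ⟨R.isCartesian,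
    fun i => ⟨R.endsTrans i, R.endsTrans_isStrictIso i, fun _ => rfl⟩, R.right_isCartesian,
    R.right_comp_incl, ⟨R.initialTrans, ⟨PtdDbl.isCartesian, DblCat.isCartesian,
      PtdDbl.forget_isCartesian, PtdDbl.toRightNiche_isCartesian.comp_pseudo R.right_isCartesian,
      isCartesianPseudofunctor_id, R.initialTrans_isStrictIso⟩, fun _ => rfl⟩,
    fun X => ⟨rfl, X.systems_isCatIso, fun p q α y z l k β h => ⟨p.comp_toHet l,
      PtdDbl.LooseOut.compSq_toSq α l k β h⟩⟩⟩⟩
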